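/- **Setting.** Let $\mathcal H=L^2(\mathbb R;\mathbb C^2)$, $Q=\begin{pmatrix}0&0\\0&1\end{pmatrix}$ (projection onto the right lead), let $S$ be a unitary $2\times2$ matrix, and let $U(t)$ be the propagator of the instantaneous scattering model: $(U(t)\psi)(x)=\psi(x-t)+(S-1)\theta(0<x<t)\psi(x-t)$ for $t>0$, and $(U(t)\psi)(x)=\psi(x-t)+(S^*-1)\theta(t<x<0)\psi(x-t)$ for $t<0$. Put $Q(t)=U(t)^*QU(t)$, $I(t)=dQ(t)/dt=I_+(t)+I_-(t)$ with $$I_+(t)=\bigl(S^*QS\,\theta(-x)+Q\,\theta(x)\bigr)\delta(x+t),\qquad I_-(t)=-\bigl(Q\,\theta(-x)+SQS^*\,\theta(x)\bigr)\delta(x+t),$$ operator-valued distributions in $t$; $I_\pm(f)=\int f(t)I_\pm(t)\,dt$ is multiplication by the corresponding matrix function times $f(-x)$, and $I(f)=I_+(f)+I_-(f)$. Let $\mathrm T$ denote time ordering (later times to the left) and $$\mathrm T^*(I(t_1)\cdots I(t_k))=\partial_{t_k}\cdots\partial_{t_1}\mathrm T(Q(t_1)\cdots Q(t_k))$$ in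 the sense of distributions, while $\widetilde{\mathrm T}(I(t_1)\cdots I(t_k))$ is obtained by writing each $I=I_++I_-$, expanding multilinearly, and placing every $I_-$ to the right of every $I_+$. **(a) First quantization.** $Q(t)=Q+\int_0^tI(s)\,ds$ for all $t\in\mathbb R$, and $\mathrm T^*(I(t_1)\cdots I(t_k))=\widetilde{\mathrm T}(I(t_1)\cdots I(t_k))$ for every $k\ge0$; that is, for all $\varphi_1,\dots,\varphi_k\in C_c^\infty(\mathbb R)$ and $\psi\in\mathcal H$, $$(-1)^k\!\int_{\mathbb R^k}\prod_i\varphi_i'(t_i)\;\mathrm T(Q(t_1)\cdots Q(t_k))\psi\;d^kt=\sum_{A\subset\{1,\dots,k\}}\ \prod_{i\in A}I_+(\varphi_i)\prod_{i\notin A}I_-(\varphi_i)\,\psi ,$$ where the integrand is integrable and the order of the factors within each of the two products is arbitrary. **(b) Second quantization.** Let $\rho=\mathrm{diag}(\theta(\mu_L-p),\theta(\mu_R-p))$, $p=-i\,d/dx$, $\mu_L,\mu_R\in\mathbb R$. On the GNS (Fock) space of the quasi-free fermionic state $\rho$, built on any orthonormal basis of $\mathcal H$ whose vectors lie in $\operatorname{ran}\rho$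 or $\ker\rho$, a bounded operator $A$ with $[A,\rho]$ Hilbert–Schmidt has a second quantization $\widehat A$ with zero expectation in the state $\rho$, which maps the space $\mathcal D$ of vectors with boundedly many particle and hole excitations into itself. For every $\varphi\in C_c^\infty(\mathbb R\setminus\{0\})$ the operators $I_\pm(\varphi)$ satisfy this criterion. Since $\widehat{Q(t)}$ itself does not exist for $t\neq0$ in general (its symbol is discontinuous in $x$), $\mathrm T^*$ is understood through a regularization: let $\chi\in C_c^\infty(\mathbb R\setminus\{0\})$ be real, with $\chi=1$ on a neighbourhood of the supports of $\varphi_1,\dots,\varphi_k\in C_c^\infty(\mathbb R\setminus\{0\})$, let $G\in C^\infty(\mathbb R)$ be real with $G=0$ on $(-\infty,-1]$ and $G=1$ on $[1,\infty)$, and let $$Q_\varepsilon(t)=Q+I(f_{\varepsilon,t}),\qquad f_{\varepsilon,t}(s)=\chi(s)\bigl(G((t-s)/\varepsilon)-\theta(s<0)\bigr),$$ a smoothing of $Q(t)=Q+I(\theta(\cdot<t)-\theta(\cdot<0))$, which satisfies the criterion for all $\varepsilon>0$ and $t\in\mathbb R$. To allow for any normalization of the second quantized charge and currents, let $c_\pm$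 be continuous complex functions on $\mathbb R\setminus\{0\}$, let $C'=c_++c_-$ there, and put $\widehat Q_\varepsilon(t)=\widehat{Q_\varepsilon(t)}+C(t)$ and $\widehat I_\pm(\varphi)=\widehat{I_\pm(\varphi)}+\int\varphi\,c_\pm\,dt$. Then $\mathrm T^*(\widehat I(t_1)\cdots\widehat I(t_k))=\widetilde{\mathrm T}(\widehat I(t_1)\cdots\widehat I(t_k))$ in the following sense: for every $\Psi\in\mathcal D$, $$\lim_{\varepsilon\downarrow0}\,(-1)^k\!\int_{\mathbb R^k}\prod_i\varphi_i'(t_i)\;\mathrm T(\widehat Q_\varepsilon(t_1)\cdots\widehat Q_\varepsilon(t_k))\Psi\;d^kt=\sum_{A\subset\{1,\dots,k\}}\operatorname{Sym}\prod_{i\in A}\widehat I_+(\varphi_i)\ \operatorname{Sym}\prod_{i\notin A}\widehat I_-(\varphi_i)\,\Psi$$ in the norm of the Fock space, the integrands being integrable for each $\varepsilon>0$. Here $\operatorname{Sym}$ is the average over all orders of the factors (currents $\widehat I_+$, and likewise currents $\widehat I_-$, commute with each other up to multiples of the identity). -/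

import Mathlib

open MeasureTheory Filter Topology
open scoped ContDiff InnerProductSpace FourierTransform ENNReal

noncomputable section

namespace ScatteringModel

/-! ### The single-particle space and its multiplication operators -/

/-- Spin space `ℂ²`: component `0` is the left lead, component `1` the right lead. -/
abbrev Lead : Type := EuclideanSpace ℂ (Fin 2)

/-- The single-particle Hilbert space `L²(ℝ; ℂ²)`. -/
abbrev H : Type := Lp Lead 2 (volume : Measure ℝ)

/-- Complex `2 × 2` matrices. -/
abbrev Mat : Type := Matrix (Fin 2) (Fin 2) ℂ

/-- A matrix acting on `ℂ²`. -/
def matAct (A : Mat) : Lead →L[ℂ] Lead := Matrix.toEuclideanCLM (n := Fin 2) (𝕜 := ℂ) A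

open Classical in
/-- Multiplication by the (essentially bounded, measurable) matrix function `m`:
`(mulOp m ψ)(x) = m(x) ψ(x)`. -/
def mulOp (m : ℝ → Mat) : H →L[ℂ] H :=
  if h : MemLp (fun x => matAct (m x)) ∞ (volume : Measure ℝ) then
    (ContinuousLinearMap.id ℂ (Lead →L[ℂ] Lead)).holderL volume ∞ 2 2 h.toLp
  else 0

theorem mulOp_ae (m : ℝ → Mat) (h : MemLp (fun x => matAct (m x)) ∞ (volume : Measure ℝ)) (f : H) :
    (mulOp m f : ℝ → Lead) =ᵐ[volume] fun x => matAct (m x) (f x) := by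
  have e : mulOp m f =
      (ContinuousLinearMap.id ℂ (Lead →L[ℂ] Lead)).holder 2 h.toLp f := by
    simp only [mulOp, dif_pos h]; rfl
  rw [e]
  filter_upwards [(ContinuousLinearMap.id ℂ (Lead →L[ℂ] Lead)).coeFn_holder (r := 2) h.toLp f,
    h.coeFn_toLp] with x hx hx'
  rw [hx, hx']; rfl

/-- Free evolution `(shift t ψ)(x) = ψ(x - t)`. -/
def shift (t : ℝ) : H →L[ℂ] H :=
  (Lp.compMeasurePreservingₗᵢ ℂ (fun x : ℝ => x - t)
    (measurePreserving_sub_right volume t)).toContinuousLinearMap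

/-! ### The instantaneous scattering model -/

/-- The charge matrix: projection of `ℂ²` onto the right lead. -/
def chargeMat : Mat := !![0, 0; 0, 1]

/-- The charge operator `Q`. -/
def charge : H →L[ℂ] H := mulOp fun _ => chargeMat

open Classical in
/-- The propagator: `(U(t)ψ)(x) = ψ(x-t) + (S-1) θ(0<x<t) ψ(x-t)` for `t > 0` and
`(U(t)ψ)(x) = ψ(x-t) + (S*-1) θ(t<x<0) ψ(x-t)` for `t < 0`. -/
def propagator (S : Mat) (t : ℝ) : H →L[ℂ] H :=
  mulOp (fun x => if 0 < x ∧ x < t then S else if t < x ∧ x < 0 then star S else 1) ∘L shift t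

/-- `Q(t) = U(t)* Q U(t)`. -/
def chargeAt (S : Mat) (t : ℝ) : H →L[ℂ] H :=
  (propagator S t).adjoint ∘L charge ∘L propagator S t

open Classical in
/-- The outgoing current smeared with `f`, `∫ f(t) I₊(t) dt`, where
`I₊(t) = (S*QS θ(-x) + Q θ(x)) δ(x+t)`. -/
def currentOut (S : Mat) (f : ℝ → ℂ) : H →L[ℂ] H :=
  mulOp fun x => f (-x) • (if x < 0 then star S * chargeMat * S else chargeMat)

open Classical in
/-- The incoming current smeared with `f`, `∫ f(t) I₋(t) dt`, where
`I₋(t) = -(Q θ(-x) + SQS* θ(x)) δ(x+t)`. -/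
def currentIn (S : Mat) (f : ℝ → ℂ) : H →L[ℂ] H :=
  mulOp fun x => -(f (-x) • (if x < 0 then chargeMat else S * chargeMat * star S))

/-! ### Orderings -/

/-- The time-ordered product `T(X(t₁) ⋯ X(t_k)) v`: the factor with the earliest time acts first
(i.e. stands rightmost). Factors at equal times are equal, so ties do not matter. -/
def timeOrdered {E : Type*} {k : ℕ} (X : ℝ → E → E) (t : Fin k → ℝ) (v : E) : E :=
  (List.ofFn fun i => t (Tuple.sort t i)).foldl (fun w s => X s w) v

/-- The distribution `∂_{t_k} ⋯ ∂_{t_1} T(X(t₁) ⋯ X(t_k))`, tested with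
`φ₁(t₁) ⋯ φ_k(t_k)` and applied to the vector `v`. -/
def starIntegrand {E : Type*} [NormedAddCommGroup E] [NormedSpace ℂ E] {k : ℕ}
    (X : ℝ → E → E) (φ : Fin k → ℝ → ℂ) (v : E) (t : Fin k → ℝ) : E :=
  (∏ i, -deriv (φ i) (t i)) • timeOrdered X t v

/-- See `starIntegrand`. -/
def starOrdered {E : Type*} [NormedAddCommGroup E] [NormedSpace ℂ E] {k : ℕ}
    (X : ℝ → E → E) (φ : Fin k → ℝ → ℂ) (v : E) : E :=
  ∫ t : Fin k → ℝ, starIntegrand X φ v t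

/-- The product in which the outgoing factor `J₊ i` is taken for `i ∈ A` and the incoming factor
`J₋ i` for `i ∉ A`, all `J₋` standing to the right of all `J₊`; among factors of the same type the
one whose index comes first in the list `e 0, e 1, …` stands leftmost. -/
def inOutTerm {E : Type*} {k : ℕ} (Jout Jin : Fin k → E → E) (A : Finset (Fin k))
    (e : Equiv.Perm (Fin k)) (v : E) : E :=
  ((List.ofFn e).filter (fun i => decide (i ∈ A))).foldr (fun i w => Jout i w)
    (((List.ofFn e).filter (fun i => decide (i ∉ A))).foldr (fun i w => Jin i w) v)

/-! ### The Fermi sea -/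

open Classical in
/-- The Fourier multiplier `diag (θ(μL - p), θ(μR - p))` at momentum `p = 2πξ`. -/
def fermiSymbol (μL μR : ℝ) (ξ : ℝ) : Mat :=
  !![if 2 * Real.pi * ξ < μL then 1 else 0, 0; 0, if 2 * Real.pi * ξ < μR then 1 else 0]

/-- The single-particle density matrix `ρ = diag (θ(μL - p), θ(μR - p))`, `p = -i d/dx`. -/
def fermiSea (μL μR : ℝ) : H →L[ℂ] H :=
  (Lp.fourierTransformₗᵢ ℝ Lead).symm.toContinuousLinearEquiv.toContinuousLinearMap ∘L
    mulOp (fermiSymbol μL μR) ∘L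
    (Lp.fourierTransformₗᵢ ℝ Lead).toContinuousLinearEquiv.toContinuousLinearMap

/-! ### Second quantization

The GNS space of the pure quasi-free fermionic state with one-particle density matrix a projection
`ρ`, written in an orthonormal basis `b` of `H` each of whose vectors is occupied (`ρ b_i = b_i`)
or empty (`ρ b_i = 0`). The vector `|Δ⟩`, `Δ` a finite set of indices, carries one excitation for
every `i ∈ Δ`: a hole if `b_i` is occupied, a particle if it is empty; `|∅⟩` is the state `ρ`
itself. -/

section Fock

variable {ι : Type*}

/-- The GNS (Fock) space, with orthonormal basis `|Δ⟩`. -/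
abbrev Fock (ι : Type*) : Type _ := lp (fun _ : Finset ι => ℂ) 2

/-- `b` diagonalizes `ρ`. -/
def Adapted (ρ : H →L[ℂ] H) (b : HilbertBasis ι ℂ H) : Prop :=
  ∀ i, ρ (b i) = b i ∨ ρ (b i) = 0

/-- The criterion for `A` to admit a second quantization: `[A, ρ]` is a Hilbert-Schmidt operator. -/
def Implementable (ρ : H →L[ℂ] H) (b : HilbertBasis ι ℂ H) (A : H →L[ℂ] H) : Prop :=
  Summable fun i => ‖A (ρ (b i)) - ρ (A (b i))‖ ^ 2

/-- Vectors with a bounded number of excitations. -/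
def FiniteExcitation (Ψ : Fock ι) : Prop :=
  ∃ N : ℕ, ∀ Δ : Finset ι, N < Δ.card → Ψ Δ = 0

variable [LinearOrder ι]

/-- The Jordan-Wigner sign. -/
def jwSign (i : ι) (Δ : Finset ι) : ℂ := (-1) ^ (Δ.filter (fun j => j < i)).card

/-- Annihilation of the excitation `i`:  `|Δ⟩ ↦ ± |Δ \ {i}⟩` if `i ∈ Δ`, and `|Δ⟩ ↦ 0` otherwise
(written on coefficients). -/
def annihilateExc (i : ι) (Ψ : Finset ι → ℂ) : Finset ι → ℂ :=
  fun Δ => if i ∈ Δ then 0 else jwSign i Δ * Ψ (insert i Δ)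

/-- Creation of the excitation `i`:  `|Δ⟩ ↦ ± |Δ ∪ {i}⟩` if `i ∉ Δ`, and `|Δ⟩ ↦ 0` otherwise
(written on coefficients). -/
def createExc (i : ι) (Ψ : Finset ι → ℂ) : Finset ι → ℂ :=
  fun Δ => if i ∈ Δ then jwSign i Δ * Ψ (Δ.erase i) else 0

open Classical in
/-- The fermion annihilation operator `a_i` of the mode `b_i`; for an occupied mode it creates a
hole. -/
def annihilate (ρ : H →L[ℂ] H) (b : HilbertBasis ι ℂ H) (i : ι) (Ψ : Finset ι → ℂ) :
    Finset ι → ℂ :=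
  if ρ (b i) = b i then createExc i Ψ else annihilateExc i Ψ

open Classical in
/-- The fermion creation operator `a_i*` of the mode `b_i`; for an occupied mode it fills a
hole. -/
def create (ρ : H →L[ℂ] H) (b : HilbertBasis ι ℂ H) (i : ι) (Ψ : Finset ι → ℂ) :
    Finset ι → ℂ :=
  if ρ (b i) = b i then annihilateExc i Ψ else createExc i Ψ

open Classical in
/-- The bilinear `a_i* a_j` with its expectation value in the state `ρ` subtracted. -/
def bilinear (ρ : H →L[ℂ] H) (b : HilbertBasis ι ℂ H) (i j : ι) (Ψ : Finset ι → ℂ) :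
    Finset ι → ℂ :=
  create ρ b i (annihilate ρ b j Ψ) - (if i = j ∧ ρ (b i) = b i then (1 : ℂ) else 0) • Ψ

/-- The terms of the series `(Â Ψ)(Δ) = ∑_{i,j} ⟨b_i, A b_j⟩ (:a_i* a_j: Ψ)(Δ)`. -/
def hatTerm (ρ : H →L[ℂ] H) (b : HilbertBasis ι ℂ H) (A : H →L[ℂ] H) (Ψ : Finset ι → ℂ)
    (Δ : Finset ι) (p : ι × ι) : ℂ :=
  ⟪b p.1, A (b p.2)⟫_ℂ * bilinear ρ b p.1 p.2 Ψ Δ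

/-- The coefficients of `Â Ψ`. -/
def hatCoeff (ρ : H →L[ℂ] H) (b : HilbertBasis ι ℂ H) (A : H →L[ℂ] H) (Ψ : Finset ι → ℂ) :
    Finset ι → ℂ :=
  fun Δ => ∑' p : ι × ι, hatTerm ρ b A Ψ Δ p

open Classical in
/-- The second quantization `Â = ∑_{i,j} ⟨b_i, A b_j⟩ :a_i* a_j:` with zero expectation in the
state `ρ`. It is used for implementable `A` on vectors of finite excitation, where it is a genuine
square summable vector. -/
def hat (ρ : H →L[ℂ] H) (b : HilbertBasis ι ℂ H) (A : H →L[ℂ] H) (Ψ : Fock ι) : Fock ι :=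
  if h : Memℓp (hatCoeff ρ b A Ψ) 2 then ⟨hatCoeff ρ b A Ψ, h⟩ else 0

end Fock

/-! ### Regularized charge -/

open Classical in
/-- The indicator `θ(s < t) - θ(s < 0)` of the time interval from `0` to `t`
(so that `∫_0^t I(s) ds` is `I` smeared with it). -/
def interval (t : ℝ) (s : ℝ) : ℂ := (if s < t then 1 else 0) - (if s < 0 then 1 else 0)

open Classical in
/-- A regularization of `interval t`: the jump at `s = t` is replaced by the smooth step
`G((t - s)/ε)`, and the result is cut off by `χ`, which vanishes near `s = 0`. -/
def smoothInterval (χ G : ℝ → ℝ) (ε t : ℝ) (s : ℝ) : ℂ :=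
  χ s * (G ((t - s) / ε) - (if s < 0 then 1 else 0))

/-- The regularization `Q + ∫ f(s) I(s) ds` of `Q(t) = Q + ∫_0^t I(s) ds`,
with `f = smoothInterval χ G ε t`. -/
def regCharge (S : Mat) (χ G : ℝ → ℝ) (ε t : ℝ) : H →L[ℂ] H :=
  charge + (currentOut S (smoothInterval χ G ε t) + currentIn S (smoothInterval χ G ε t))

/-- `φ` is a test function on the real line. -/
def IsTest {F : Type*} [NormedAddCommGroup F] [NormedSpace ℝ F] (φ : ℝ → F) : Prop :=
  ContDiff ℝ ∞ φ ∧ HasCompactSupport φ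

/-- `G` is a smooth step: `0` on `(-∞, -1]`, `1` on `[1, ∞)`. -/
def IsSmoothStep (G : ℝ → ℝ) : Prop :=
  ContDiff ℝ ∞ G ∧ (∀ s ≤ -1, G s = 0) ∧ ∀ s, 1 ≤ s → G s = 1

end ScatteringModel

end

noncomputable section

namespace ScatteringModel

/-! ### Operators on a filtered space -/

/-! Write Q(t) = r + Y(t) + Z(t), where r is the charge at time zero and Y, Z are the outgoing and
incoming currents integrated from 0 to t. Seen as a function of y = -x, the operator Q(t) multiplies
by an outgoing projection where y < t and by an incoming projection where y > t. This gives three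
commutation relations for p < q. The increment Y(q) - Y(p) lives on p < y < q and commutes with Q(s)
for s later than q, because Q(s) is the outgoing projection there. The increment Z(q) - Z(p)
commutes with Q(s) for s earlier than p. The mixed charge r + Y(p) + Z(q) commutes with Q(s) for s
between p and q, because it vanishes on p < y < q and equals Q(s) elsewhere.

Fix all times but one and let D(p) be T(Q(p)...) minus Y(p) T(...) minus T(...) Z(p), which is
`orderDefect`. The first two relations make D constant between the other times, and the third
excludes a jump across any of them (`orderDefect_eq`). Differentiation in p therefore produces
I_+(p) T(...) + T(...) I_-(p). Iterating this puts outgoing currents to the left and incoming ones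
to the right (`orderedSum`). The outgoing factors come in the listed order and the incoming ones in
the opposite order. Since the left side is symmetric in the test functions, averaging over all
permutations gives the symmetrized products (`sum_orderedSum`).

With charges smeared at scale ε the relations hold only for times that are 2ε apart, so D is
constant only off windows of total length O(ε). Its integral against φ' is then O(ε) times the
supremum of D (`norm_integral_deriv_smul_le`). The second quantized charges blow up as ε tends to 0,
but more slowly than any power ε^(-δ), so the error vanishes (`tendsto_starVec`). First quantization
is the same theorem for a sharp charge that does not depend on ε.

Two facts about Fock space are needed. First, on vectors with at most N excitations a second
quantized operator is bounded by a multiple of (N + 2) times a common bound for the operator norm of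
A and the Hilbert-Schmidt norm of [A, ρ] (`Sea.Tame.opBound`). For smooth symbols the latter is an
integral of |r| |â(r)|², up to Fermi momenta (`hsSq_symbol`), and it is bounded through the L¹ norms
of the symbol and two derivatives (`exists_tame_bound`). Second, the commutation relations must
survive second quantization. For commuting A and B the commutator of the second quantizations
commutes with all field operators, hence is a scalar, the Schwinger term (`Sea.comm_eq_smul_one`,
`Sea.schwinger_eq`). For symbols a, d it is (2πi)⁻¹ ∫ tr(a d') plus a Fermi momentum term that sees
only the diagonal of [a, d] (`schwinger_symbol`). For the charges the trace reduces to a constant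
times ∫ w' (u + v) (`trace_model`). This vanishes by disjoint supports in the first two relations,
and as the integral of a total derivative in the third (`StepFamily.integral_deriv_mul_add`). -/

/-- An increasing family of ranges of bounded projections in a normed space. -/
structure Filtered (E : Type*) [NormedAddCommGroup E] [NormedSpace ℂ E] where
  space : ℕ → Submodule ℂ E
  -- The projections make every level closed. They also let an operator that is bounded on one level
  -- be extended to a bounded operator on all of `E`.
  proj : ℕ → E →L[ℂ] E
  mono : Monotone space
  proj_mem : ∀ N v, proj N v ∈ space N
  proj_eq : ∀ N, ∀ v ∈ space N, proj N v = v

namespace Filtered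

variable {E : Type*} [NormedAddCommGroup E] [NormedSpace ℂ E] (F : Filtered E)

/-- The union of the filtration. -/
def union : Submodule ℂ E := ⨆ N, F.space N

/-- Linear operators on the union of the filtration. -/
abbrev Op : Type _ := Module.End ℂ F.union

variable {F}

theorem mem_union {v : E} : v ∈ F.union ↔ ∃ N, v ∈ F.space N :=
  Submodule.mem_iSup_of_directed _ F.mono.directed_le

theorem space_le_union (N : ℕ) : F.space N ≤ F.union := le_iSup F.space N

theorem exists_mem_space (v : F.union) : ∃ N, (v : E) ∈ F.space N := mem_union.1 v.2

/-- `a` maps level `N` to level `M` with norm at most `C`. -/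
def OpBound (a : F.Op) (N M : ℕ) (C : ℝ) : Prop :=
  ∀ v : F.union, (v : E) ∈ F.space N → (a v : E) ∈ F.space M ∧ ‖(a v : E)‖ ≤ C * ‖(v : E)‖

namespace OpBound

variable {a b : F.Op} {N M K : ℕ} {C C' : ℝ}

theorem mono (h : OpBound a N M C) {M' : ℕ} (hM : M ≤ M') (hC : C ≤ C') : OpBound a N M' C' :=
  fun v hv => ⟨F.mono hM (h v hv).1, (h v hv).2.trans (by gcongr)⟩

theorem add (ha : OpBound a N M C) (hb : OpBound b N M C') : OpBound (a + b) N M (C + C') :=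
  fun v hv => ⟨add_mem (ha v hv).1 (hb v hv).1, by
    have := (norm_add_le (a v : E) (b v)).trans (add_le_add (ha v hv).2 (hb v hv).2)
    simpa [add_mul] using this⟩

theorem neg (ha : OpBound a N M C) : OpBound (-a) N M C :=
  fun v hv => ⟨by simpa using (ha v hv).1, by simpa using (ha v hv).2⟩

theorem sub (ha : OpBound a N M C) (hb : OpBound b N M C') : OpBound (a - b) N M (C + C') := by
  simpa [sub_eq_add_neg] using ha.add hb.neg

theorem smul (z : ℂ) (ha : OpBound a N M C) : OpBound (z • a) N M (‖z‖ * C) :=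
  fun v hv => ⟨by simpa using (F.space M).smul_mem z (ha v hv).1, by
    simpa [norm_smul, mul_assoc] using mul_le_mul_of_nonneg_left (ha v hv).2 (norm_nonneg z)⟩

theorem one (N : ℕ) : OpBound (1 : F.Op) N N 1 := fun v hv => ⟨by simpa using hv, by simp⟩

theorem mul (hC : 0 ≤ C) (ha : OpBound a K M C) (hb : OpBound b N K C') :
    OpBound (a * b) N M (C * C') := fun v hv => by
  obtain ⟨h1, h2⟩ := hb v hv
  obtain ⟨h3, h4⟩ := ha (b v) h1
  refine ⟨by simpa using h3, ?_⟩
  simpa [mul_assoc] using h4.trans (mul_le_mul_of_nonneg_left h2 hC)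

/-- A bounded operator on a level extends to the whole space. -/
theorem exists_clm (h : OpBound a N M C) :
    ∃ L : E →L[ℂ] E, ∀ v : F.union, (v : E) ∈ F.space N → L v = a v := by
  let p : E →ₗ[ℂ] F.union :=
    (F.proj N).toLinearMap.codRestrict F.union fun v => space_le_union N (F.proj_mem N v)
  refine ⟨LinearMap.mkContinuous (F.union.subtype ∘ₗ a ∘ₗ p) (|C| * ‖F.proj N‖) fun v => ?_,
    fun v hv => ?_⟩
  · have h1 := (h (p v) (F.proj_mem N v)).2
    have h2 : ‖((p v : F.union) : E)‖ ≤ ‖F.proj N‖ * ‖v‖ := (F.proj N).le_opNorm v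
    calc ‖((a (p v) : F.union) : E)‖ ≤ C * ‖((p v : F.union) : E)‖ := h1
      _ ≤ |C| * ‖((p v : F.union) : E)‖ := by gcongr; exact le_abs_self C
      _ ≤ |C| * (‖F.proj N‖ * ‖v‖) := by gcongr
      _ = _ := by ring
  · have : p v = v := Subtype.ext (F.proj_eq N v hv)
    change ((a (p v) : F.union) : E) = a v
    rw [this]

end OpBound

theorem isClosed_space (N : ℕ) : IsClosed (F.space N : Set E) := by
  have : (F.space N : Set E) = {v | F.proj N v = v} := by
    ext v
    exact ⟨fun h => F.proj_eq N v h, fun h => by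
      have := F.proj_mem N v
      rw [show F.proj N v = v from h] at this
      exact this⟩
  rw [this]
  exact isClosed_eq (F.proj N).continuous continuous_id

variable [CompleteSpace E] {α : Type*} [MeasurableSpace α] {μ : Measure α}

theorem integral_mem_space {N : ℕ} {g : α → E} (hg : ∀ t, g t ∈ F.space N) :
    ∫ t, g t ∂μ ∈ F.space N := by
  by_cases hi : Integrable g μ
  · have : F.proj N (∫ t, g t ∂μ) = ∫ t, g t ∂μ := by
      rw [← ContinuousLinearMap.integral_comp_comm _ hi]
      exact integral_congr_ae (Eventually.of_forall fun t => F.proj_eq N _ (hg t))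
    rw [← this]
    exact F.proj_mem N _
  · rw [integral_undef hi]
    exact zero_mem _

/-- On one level the densely defined operator agrees with a bounded operator on `E`, and bounded
operators pass through Bochner integrals. -/
theorem OpBound.integral_comm {a : F.Op} {N M : ℕ} {C : ℝ} (h : OpBound a N M C)
    {g : α → F.union} (hg : ∀ t, (g t : E) ∈ F.space N) (hi : Integrable (fun t => (g t : E)) μ)
    (w : F.union) (hw : (w : E) = ∫ t, (g t : E) ∂μ) :
    ∫ t, (a (g t) : E) ∂μ = a w := by
  obtain ⟨L, hL⟩ := h.exists_clm
  have hwN : (w : E) ∈ F.space N := hw ▸ integral_mem_space hg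
  rw [← hL w hwN, hw, ← L.integral_comp_comm hi]
  exact integral_congr_ae (Eventually.of_forall fun t => (hL _ (hg t)).symm)

end Filtered

/-! ### Time-ordered products in a ring -/

section Ring

variable {R : Type*} [Ring R]

/-- Product of `X s` over the list `l`, the head of the list standing rightmost. -/
def listProd (X : ℝ → R) (l : List ℝ) : R := ((l.map X).reverse).prod

@[simp] theorem listProd_nil (X : ℝ → R) : listProd X [] = 1 := by simp [listProd]

theorem listProd_append (X : ℝ → R) (l l' : List ℝ) :
    listProd X (l ++ l') = listProd X l' * listProd X l := by simp [listProd]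

theorem listProd_cons (X : ℝ → R) (s : ℝ) (l : List ℝ) :
    listProd X (s :: l) = listProd X l * X s := by simp [listProd]

theorem commute_listProd {X : ℝ → R} {a : R} {l : List ℝ} (h : ∀ s ∈ l, Commute a (X s)) :
    Commute a (listProd X l) := by
  refine Commute.list_prod_right _ _ fun y hy => ?_
  obtain ⟨s, hs, rfl⟩ := List.mem_map.1 (List.mem_reverse.1 hy)
  exact h s hs

/-- Time-ordered product, later times to the left. -/
def timeProd (X : ℝ → R) (l : List ℝ) : R := listProd X (l.insertionSort (· ≤ ·))

/-- The difference between the time-ordered product and its expression by outgoing and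
incoming parts of the factor at time `p`. -/
def orderDefect (X Y Z : ℝ → R) (l : List ℝ) (p : ℝ) : R :=
  timeProd X (p :: l) - (Y p * timeProd X l + timeProd X l * Z p)

theorem orderedInsert_append {l₁ l₂ : List ℝ} {p : ℝ} (h₁ : ∀ s ∈ l₁, s < p)
    (h₂ : ∀ s ∈ l₂, p < s) :
    List.orderedInsert (· ≤ ·) p (l₁ ++ l₂) = l₁ ++ p :: l₂ := by
  induction l₁ with
  | nil =>
    cases l₂ with
    | nil => rfl
    | cons a l => simp [(h₂ a (by simp)).le]
  | cons a l ih =>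
    have ha : ¬ p ≤ a := not_le.2 (h₁ a (by simp))
    simp [ha, ih fun s hs => h₁ s (by simp [hs])]

theorem exists_split {l : List ℝ} (hl : l.Pairwise (· ≤ ·)) {p ε : ℝ}
    (hp : ∀ s ∈ l, ε ≤ |p - s|) :
    ∃ l₁ l₂, l = l₁ ++ l₂ ∧ (∀ s ∈ l₁, s ≤ p - ε) ∧ ∀ s ∈ l₂, p + ε ≤ s := by
  induction l with
  | nil => exact ⟨[], [], by simp⟩
  | cons a l ih =>
    obtain ⟨h1, h2⟩ := List.pairwise_cons.1 hl
    by_cases ha : a ≤ p - ε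
    · obtain ⟨l₁, l₂, rfl, h3, h4⟩ := ih h2 fun s hs => hp s (by simp [hs])
      refine ⟨a :: l₁, l₂, by simp, ?_, h4⟩
      simp only [List.mem_cons, forall_eq_or_imp]
      exact ⟨ha, h3⟩
    · have ha' : p + ε ≤ a := by
        have := hp a (by simp)
        rcases le_abs.1 this with h | h <;> linarith
      refine ⟨[], a :: l, by simp, by simp, ?_⟩
      simp only [List.mem_cons, forall_eq_or_imp]
      exact ⟨ha', fun s hs => ha'.trans (h1 s hs)⟩

/-- The algebraic core. Moving the time from p to q changes the defect by a sum of three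
commutators, one with the product of the factors later than q, one with those earlier than p, and
one with those in between. Each vanishes by one hypothesis. -/
theorem orderDefect_eq {X Y Z : ℝ → R} {r : R} (hX : ∀ s, X s = r + Y s + Z s) {l : List ℝ}
    {p q ε : ℝ} (hε : 0 < ε) (hpq : p < q)
    (hp : ∀ s ∈ l, ε ≤ |p - s|) (hq : ∀ s ∈ l, ε ≤ |q - s|)
    (h₁ : ∀ s, q + ε ≤ s → Commute (Y q - Y p) (X s))
    (h₂ : ∀ s, s ≤ p - ε → Commute (Z q - Z p) (X s))
    (h₃ : ∀ s, p + ε ≤ s → s ≤ q - ε → Commute (r + Y p + Z q) (X s)) :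
    orderDefect X Y Z l p = orderDefect X Y Z l q := by
  have hs : (l.insertionSort (· ≤ ·)).Pairwise (· ≤ ·) := List.pairwise_insertionSort _ l
  have hmem : ∀ s, s ∈ l.insertionSort (· ≤ ·) ↔ s ∈ l :=
    fun s => (List.perm_insertionSort (· ≤ ·) l).mem_iff
  obtain ⟨l₁, l', e, hl₁, hl'⟩ := exists_split hs fun s h => hp s ((hmem s).1 h)
  have hs' : l'.Pairwise (· ≤ ·) := (List.pairwise_append.1 (e ▸ hs)).2.1
  obtain ⟨c, l₂, rfl, hc, hl₂⟩ := exists_split hs' (p := q)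
    fun s h => hq s ((hmem s).1 (e ▸ List.mem_append_right _ h))
  have hcp : ∀ s ∈ c, p + ε ≤ s := fun s h => hl' s (by simp [h])
  have ep : List.insertionSort (· ≤ ·) (p :: l) = l₁ ++ p :: (c ++ l₂) := by
    rw [List.insertionSort_cons, e]
    exact orderedInsert_append (fun s h => by linarith [hl₁ s h]) (fun s h => by linarith [hl' s h])
  have eq : List.insertionSort (· ≤ ·) (q :: l) = (l₁ ++ c) ++ q :: l₂ := by
    rw [List.insertionSort_cons, e, ← List.append_assoc]
    refine orderedInsert_append (fun s h => ?_) (fun s h => by linarith [hl₂ s h])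
    rcases List.mem_append.1 h with h | h
    · linarith [hl₁ s h]
    · linarith [hc s h]
  have c1 : Commute (Y q - Y p) (listProd X l₂) := commute_listProd fun s h => h₁ s (hl₂ s h)
  have c2 : Commute (Z q - Z p) (listProd X l₁) := commute_listProd fun s h => h₂ s (hl₁ s h)
  have c3 : Commute (r + Y p + Z q) (listProd X c) :=
    commute_listProd fun s h => h₃ s (hcp s h) (hc s h)
  simp only [orderDefect, timeProd, ep, eq, e, listProd_append, listProd_cons]
  generalize listProd X l₁ = a at *
  generalize listProd X l₂ = b at *
  generalize listProd X c = m at *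
  rw [hX p, hX q]
  rw [← sub_eq_zero]
  -- Here a, m, b are the products over times before p, between p and q, and after q. With K = r + Y
  -- p + Z q one has X p = K - (Z q - Z p) and X q = K + (Y q - Y p), which turns the difference of
  -- the defects into these commutators.
  have : b * (m * (r + Y p + Z q) - (r + Y p + Z q) * m) * a
      + ((Y q - Y p) * b - b * (Y q - Y p)) * m * a
      + b * m * (a * (Z q - Z p) - (Z q - Z p) * a) = 0 := by
    rw [c1.eq, c2.eq, c3.eq]; simp
  rw [← this]
  noncomm_ring

end Ring

/-! ### Integration against functions that are constant off small windows -/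

section Windows

/-- `p` has distance at least `r` from all points of `l`. -/
def OffWindow (l : List ℝ) (r p : ℝ) : Prop := ∀ s ∈ l, r ≤ |p - s|

theorem isOpen_not_offWindow (l : List ℝ) (r : ℝ) : IsOpen {p | ¬ OffWindow l r p} := by
  have : {p | ¬ OffWindow l r p} = ⋃ s ∈ l, {p : ℝ | |p - s| < r} := by
    ext p; simp [OffWindow]
  rw [this]
  exact isOpen_biUnion fun s _ => isOpen_lt (by fun_prop) continuous_const

theorem volume_not_offWindow_le (l : List ℝ) {r : ℝ} (hr : 0 ≤ r) :
    volume {p | ¬ OffWindow l r p} ≤ ENNReal.ofReal (l.length * (2 * r)) := by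
  induction l with
  | nil => simp [OffWindow]
  | cons a l ih =>
    have : {p | ¬ OffWindow (a :: l) r p} ⊆ Metric.ball a r ∪ {p | ¬ OffWindow l r p} := by
      intro p hp
      simp only [OffWindow, List.mem_cons, forall_eq_or_imp, Set.mem_ofPred_eq, not_and_or,
        not_le] at hp
      exact hp.imp (fun h => by simpa [Real.dist_eq] using h) fun h => h
    refine (measure_mono this).trans ((measure_union_le _ _).trans ?_)
    rw [Real.volume_ball, List.length_cons]
    refine (add_le_add_right ih _).trans (le_of_eq ?_)
    rw [← ENNReal.ofReal_add (by positivity) (by positivity)]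
    congr 1
    push_cast
    ring

/-- The windows together are shorter than the interval of radius δ around t, so they cannot cover
it. -/
theorem exists_offWindow {l : List ℝ} {r δ : ℝ} (hr : 0 ≤ r) (h : l.length * (2 * r) < 2 * δ)
    (t : ℝ) : ∃ p, |p - t| ≤ δ ∧ OffWindow l r p := by
  by_contra! hcon
  have h1 : Set.Icc (t - δ) (t + δ) ⊆ {p | ¬ OffWindow l r p} := fun p hp =>
    hcon p (abs_le.2 ⟨by linarith [hp.1], by linarith [hp.2]⟩)
  have h2 := (measure_mono h1).trans (volume_not_offWindow_le l hr)
  rw [Real.volume_Icc] at h2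
  have h3 := (ENNReal.ofReal_le_ofReal_iff (by positivity)).1 h2
  linarith

variable {E : Type*} [NormedAddCommGroup E] [NormedSpace ℂ E]

theorem IsTest.deriv {φ : ℝ → ℂ} (hφ : IsTest φ) : IsTest (deriv φ) :=
  ⟨hφ.1.iterate_deriv 1, hφ.2.deriv⟩

theorem deriv_eq_zero_of_notMem_tsupport {φ : ℝ → ℂ} {x : ℝ} (hx : x ∉ tsupport φ) :
    _root_.deriv φ x = 0 := by
  by_contra h
  exact hx (support_deriv_subset h)

/-- Near the support of φ the function g is locally constant, so φ' g is the derivative of the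
compactly supported φ g. -/
theorem integral_deriv_smul_eq_zero {φ : ℝ → ℂ} (hφ : IsTest φ) {g : ℝ → E}
    (hg : ∀ x ∈ tsupport φ, ∀ᶠ t in 𝓝 x, g t = g x) :
    Integrable (fun t => deriv φ t • g t) ∧ ∫ t, deriv φ t • g t = 0 := by
  have key : ∀ ψ : ℝ → ℂ, IsTest ψ → (∀ x ∈ tsupport ψ, x ∈ tsupport φ) →
      Integrable (fun t => ψ t • g t) := fun ψ hψ hsub => by
    refine Continuous.integrable_of_hasCompactSupport (continuous_iff_continuousAt.2 fun x => ?_)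
      (hψ.2.smul_right)
    by_cases hx : x ∈ tsupport ψ
    · refine ContinuousAt.smul hψ.1.continuous.continuousAt ?_
      exact (continuousAt_const (y := g x)).congr ((hg x (hsub x hx)).mono fun t ht => ht.symm)
    · have : (fun t => ψ t • g t) =ᶠ[𝓝 x] fun _ => 0 := by
        filter_upwards [(notMem_tsupport_iff_eventuallyEq.1 hx)] with t ht
        simp [ht]
      exact continuousAt_const.congr this.symm
  have h1 := key _ hφ.deriv fun x hx => tsupport_deriv_subset (𝕜 := ℝ) hx
  refine ⟨h1, integral_eq_zero_of_hasDerivAt_of_integrable (f := fun t => φ t • g t) (fun x => ?_)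
    h1 (key φ hφ fun _ h => h)⟩
  by_cases hx : x ∈ tsupport φ
  · have hd : HasDerivAt φ (deriv φ x) x :=
      (hφ.1.differentiable (by simp)).differentiableAt.hasDerivAt
    exact (hd.smul_const (g x)).congr_of_eventuallyEq ((hg x hx).mono fun t ht => by simp [ht])
  · rw [deriv_eq_zero_of_notMem_tsupport hx, zero_smul]
    refine (hasDerivAt_const x (0 : E)).congr_of_eventuallyEq ?_
    filter_upwards [(notMem_tsupport_iff_eventuallyEq.1 hx)] with t ht
    simp [ht]

/-- Replace g(t) by its value at a nearby point off the windows. The new function is locally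
constant near the support of φ, hence integrates to zero against φ'. It differs from g only inside
the windows, whose total length gives the factor on the right. The windows have radius 2ε because
this is the separation that the commutation relations require. -/
theorem norm_integral_deriv_smul_le {φ : ℝ → ℂ} (hφ : IsTest φ) {U : Set ℝ} {δ ε M B : ℝ}
    (hδ : 0 < δ) (hU : ∀ x ∈ tsupport φ, ∀ y, |y - x| ≤ 3 * δ → y ∈ U) {l : List ℝ}
    (hε : 0 < ε) (hεδ : ε ≤ δ) (hl : l.length * (2 * (2 * ε)) < 2 * δ)
    {g : ℝ → E} (hg : Continuous g) (hB : ∀ t, ‖g t‖ ≤ B) (hM : ∀ t, ‖deriv φ t‖ ≤ M)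
    (hc : ∀ p q, p < q → Set.Icc (p - ε) (q + ε) ⊆ U → OffWindow l (2 * ε) p →
      OffWindow l (2 * ε) q → g p = g q) :
    ‖∫ t, deriv φ t • g t‖ ≤ M * (2 * B) * (l.length * (2 * (2 * ε))) := by
  -- The point p t off the windows lies within δ of t. No regularity of p is needed, since g takes
  -- one value at all such points close to the support.
  choose p hp hpo using exists_offWindow (l := l) (by positivity) hl
  have hM0 : 0 ≤ M := (norm_nonneg _).trans (hM 0)
  have hB0 : 0 ≤ B := (norm_nonneg _).trans (hB 0)
  have heq : ∀ x ∈ tsupport φ, ∀ a b, |a - x| ≤ 2 * δ → |b - x| ≤ 2 * δ →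
      OffWindow l (2 * ε) a → OffWindow l (2 * ε) b → g a = g b := by
    intro x hx a b ha hb hoa hob
    wlog hab : a < b generalizing a b
    · rcases (not_lt.1 hab).lt_or_eq with h | h
      · exact (this b a hb ha hob hoa h).symm
      · rw [h]
    refine hc a b hab (fun y hy => hU x hx y (abs_le.2 ?_)) hoa hob
    have := abs_le.1 ha
    have := abs_le.1 hb
    constructor <;> linarith [hy.1, hy.2]
  have hloc : ∀ x ∈ tsupport φ, ∀ᶠ t in 𝓝 x, g (p t) = g (p x) := by
    intro x hx
    filter_upwards [Metric.ball_mem_nhds x hδ] with t ht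
    have ht' : |t - x| < δ := by simpa [Real.dist_eq] using ht
    refine heq x hx _ _ ?_ ((hp x).trans (by linarith)) (hpo t) (hpo x)
    have := abs_sub_le (p t) t x
    linarith [hp t]
  obtain ⟨hi, h0⟩ := integral_deriv_smul_eq_zero hφ hloc
  have hi' : Integrable (fun t => deriv φ t • g t) :=
    Continuous.integrable_of_hasCompactSupport (hφ.deriv.1.continuous.smul hg)
      hφ.deriv.2.smul_right
  have e : ∫ t, deriv φ t • g t = ∫ t, (deriv φ t • g t - deriv φ t • g (p t)) := by
    rw [integral_sub hi' hi, h0, sub_zero]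
  set W := {t | ¬ OffWindow l (2 * ε) t} with hW
  have hWm : MeasurableSet W := (isOpen_not_offWindow l _).measurableSet
  have hWv := volume_not_offWindow_le l (r := 2 * ε) (by positivity)
  have hWf : volume W ≠ ⊤ := ne_top_of_le_ne_top ENNReal.ofReal_ne_top hWv
  have hbound : ∀ t, ‖deriv φ t • g t - deriv φ t • g (p t)‖ ≤
      W.indicator (fun _ => M * (2 * B)) t := by
    intro t
    by_cases ht : t ∈ W
    · rw [Set.indicator_of_mem ht, ← smul_sub, norm_smul]
      gcongr
      · exact hM t
      · linarith [norm_sub_le (g t) (g (p t)), hB t, hB (p t)]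
    · rw [Set.indicator_of_notMem ht]
      by_cases hx : t ∈ tsupport φ
      · rw [heq t hx t (p t) (by simp [hδ.le]) ((hp t).trans (by linarith)) (not_not.1 ht) (hpo t)]
        simp
      · simp [deriv_eq_zero_of_notMem_tsupport hx]
  rw [e]
  refine (norm_integral_le_of_norm_le ?_ (Eventually.of_forall hbound)).trans ?_
  · exact (integrable_indicator_iff hWm).2 (integrableOn_const hWf)
  · rw [integral_indicator hWm, setIntegral_const, smul_eq_mul, mul_comm]
    gcongr
    exact ENNReal.toReal_le_of_le_ofReal (by positivity) hWv

end Windows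

/-! ### Regularized charges and their time-ordered products -/

section TimeOrdering

variable {E : Type*} [NormedAddCommGroup E] [NormedSpace ℂ E] {F : Filtered E}

open Filtered

theorem insertionSort_ofFn {n : ℕ} (t : Fin n → ℝ) (σ : Equiv.Perm (Fin n))
    (h : Monotone (t ∘ σ)) :
    (List.ofFn t).insertionSort (· ≤ ·) = List.ofFn (t ∘ σ) :=
  List.Perm.eq_of_pairwise' (r := (· ≤ ·)) (List.pairwise_insertionSort _ _)
    (h.sortedLE_ofFn).pairwise
    ((List.perm_insertionSort _ _).trans (σ.ofFn_comp_perm t).symm)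

theorem timeOrdered_eq {n : ℕ} {Y : ℝ → E → E} {X : ℝ → F.Op} (t : Fin n → ℝ) (v : F.union)
    (h : ∀ i, ∀ w : F.union, Y (t i) w = X (t i) w) :
    timeOrdered Y t v = timeProd X (List.ofFn t) v := by
  have key : ∀ (l : List ℝ) (w : F.union), (∀ s ∈ l, ∀ w : F.union, Y s w = X s w) →
      l.foldl (fun w s => Y s w) (w : E) = listProd X l w := by
    intro l
    induction l with
    | nil => intro w _; simp
    | cons s l ih =>
      intro w hw
      rw [List.foldl_cons, hw s (by simp) w, ih _ fun s hs => hw s (by simp [hs]), listProd_cons]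
      rfl
  have e := insertionSort_ofFn t (Tuple.sort t) (Tuple.monotone_sort t)
  rw [timeOrdered, timeProd, e]
  refine key _ v fun s hs => ?_
  obtain ⟨i, rfl⟩ := List.mem_ofFn.1 hs
  exact h _

theorem OpBound.listProd {X : ℝ → F.Op} {c : ℝ} (hc : 0 ≤ c) (K : ℕ)
    (hX : ∀ s, ∀ M ≤ K, OpBound (X s) M (M + 2) c) (l : List ℝ) :
    ∀ M, M + 2 * l.length ≤ K + 2 →
      OpBound (listProd X l) M (M + 2 * l.length) (c ^ l.length) := by
  induction l with
  | nil => intro M _; simpa using OpBound.one (F := F) M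
  | cons s l ih =>
    intro M hM
    rw [List.length_cons] at hM
    rw [listProd_cons]
    have h1 := OpBound.mul (by positivity) (ih (M + 2) (by omega)) (hX s M (by omega))
    exact h1.mono (by simp; omega) (by simp [pow_succ])

theorem OpBound.timeProd {X : ℝ → F.Op} {c : ℝ} (hc : 0 ≤ c) (K : ℕ)
    (hX : ∀ s, ∀ M ≤ K, OpBound (X s) M (M + 2) c) (l : List ℝ) (M : ℕ)
    (hM : M + 2 * l.length ≤ K + 2) :
    OpBound (timeProd X l) M (M + 2 * l.length) (c ^ l.length) := by
  have := OpBound.listProd hc K hX (l.insertionSort (· ≤ ·)) M (by simpa using hM)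
  simpa [ScatteringModel.timeProd] using this

/-- Strong continuity at the fixed vector w t₀ handles one part, and the bound uniform in time
controls the effect of w t - w t₀. -/
theorem continuous_op_apply {T : Type*} [TopologicalSpace T] {X : ℝ → F.Op}
    (hX : ∀ v : F.union, Continuous fun s => (X s v : E)) {N M : ℕ} {C : ℝ}
    (hb : ∀ s, OpBound (X s) N M C) {τ : T → ℝ} (hτ : Continuous τ) {w : T → F.union}
    (hw : Continuous fun t => (w t : E)) (hN : ∀ t, (w t : E) ∈ F.space N) :
    Continuous fun t => (X (τ t) (w t) : E) := by
  refine continuous_iff_continuousAt.2 fun t₀ => ?_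
  have e : (fun t => (X (τ t) (w t) : E)) =
      fun t => (X (τ t) (w t - w t₀) : E) + (X (τ t) (w t₀) : E) := by
    funext t; simp
  rw [e, ContinuousAt]
  have h1 : Tendsto (fun t => (X (τ t) (w t - w t₀) : E)) (𝓝 t₀) (𝓝 0) := by
    refine squeeze_zero_norm (a := fun t => |C| * ‖(w t : E) - w t₀‖) (fun t => ?_) ?_
    · refine ((hb (τ t)) (w t - w t₀) ?_).2.trans ?_
      · simpa using sub_mem (hN t) (hN t₀)
      · simpa using mul_le_mul_of_nonneg_right (le_abs_self C) (norm_nonneg _)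
    · have : Tendsto (fun t => |C| * ‖(w t : E) - w t₀‖) (𝓝 t₀) (𝓝 (|C| * ‖(w t₀ : E) - w t₀‖)) :=
        ((hw.sub continuous_const).norm.const_mul |C|).tendsto t₀
      simpa using this
  have h2 : Tendsto (fun t => (X (τ t) (w t₀) : E)) (𝓝 t₀) (𝓝 (X (τ t₀) (w t₀) : E)) :=
    ((hX (w t₀)).comp hτ).tendsto t₀
  simpa using h1.add h2

/-- Strong continuity together with local boundedness on every level. -/
structure StronglyContinuous (X : ℝ → F.Op) : Prop where
  continuous : ∀ v : F.union, Continuous fun s => (X s v : E)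
  bound : ∀ N, ∃ C, 0 ≤ C ∧ ∀ s, OpBound (X s) N (N + 2) C

theorem StronglyContinuous.add {X Y : ℝ → F.Op} (hX : StronglyContinuous X)
    (hY : StronglyContinuous Y) : StronglyContinuous fun s => X s + Y s where
  continuous v := (hX.continuous v).add (hY.continuous v)
  bound N := by
    obtain ⟨C, hC, h⟩ := hX.bound N
    obtain ⟨C', hC', h'⟩ := hY.bound N
    exact ⟨C + C', by positivity, fun s => (h s).add (h' s)⟩

theorem StronglyContinuous.const {a : F.Op} (ha : ∀ N, ∃ C, 0 ≤ C ∧ OpBound a N (N + 2) C) :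
    StronglyContinuous fun _ => a where
  continuous _ := continuous_const
  bound N := by
    obtain ⟨C, hC, h⟩ := ha N
    exact ⟨C, hC, fun _ => h⟩

namespace StronglyContinuous

variable {X : ℝ → F.Op} (hX : StronglyContinuous X)
include hX

theorem continuous_listProd {T : Type*} [TopologicalSpace T] (L : List (T → ℝ))
    (hL : ∀ τ ∈ L, Continuous τ) : ∀ {N : ℕ} {w : T → F.union},
    Continuous (fun t => (w t : E)) → (∀ t, (w t : E) ∈ F.space N) →
    Continuous fun t => (listProd X (L.map fun τ => τ t) (w t) : E) := by
  induction L with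
  | nil => intro N w hw _; simpa using hw
  | cons τ L ih =>
    intro N w hw hN
    obtain ⟨C, -, hC⟩ := hX.bound N
    have h1 := continuous_op_apply hX.continuous hC (hL τ (by simp)) hw hN
    have h2 := ih (fun τ hτ => hL τ (by simp [hτ])) h1 fun t => ((hC (τ t)) _ (hN t)).1
    simpa [listProd_cons] using h2

/-- The closed chambers in which the times have a given order form a finite cover, and on each
chamber the product is an ordinary one. On common boundaries the reordered factors have equal times.
-/
theorem continuous_timeProd {n : ℕ} (v : F.union) :
    Continuous fun t : Fin n → ℝ => (timeProd X (List.ofFn t) v : E) := by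
  obtain ⟨N, hN⟩ := exists_mem_space v
  refine (locallyFinite_of_finite fun σ : Equiv.Perm (Fin n) =>
    {t : Fin n → ℝ | Monotone (t ∘ σ)}).continuous ?_ ?_ ?_
  · exact Set.eq_univ_of_forall fun t =>
      Set.mem_iUnion.2 ⟨Tuple.sort t, Tuple.monotone_sort t⟩
  · intro σ
    have : {t : Fin n → ℝ | Monotone (t ∘ σ)} =
        ⋂ i, ⋂ j, ⋂ _ : i ≤ j, {t : Fin n → ℝ | t (σ i) ≤ t (σ j)} := by
      ext t; simp [Monotone]
    rw [this]
    exact isClosed_iInter fun i => isClosed_iInter fun j => isClosed_iInter fun _ =>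
      isClosed_le (by fun_prop) (by fun_prop)
  · intro σ
    have h := hX.continuous_listProd (List.ofFn fun (i : Fin n) (t : Fin n → ℝ) => t (σ i))
      (fun τ hτ => by obtain ⟨i, rfl⟩ := List.mem_ofFn.1 hτ; fun_prop)
      (continuous_const (y := (v : E))) fun _ => hN
    refine h.continuousOn.congr fun t ht => ?_
    simp only [timeProd, insertionSort_ofFn t σ ht, List.map_ofFn]
    rfl

theorem continuous_timeProd_cons (l : List ℝ) (v : F.union) :
    Continuous fun p : ℝ => (timeProd X (p :: l) v : E) := by
  have h : Continuous fun p : ℝ => (Fin.cons p l.get : Fin (l.length + 1) → ℝ) :=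
    continuous_pi fun i => by
      refine Fin.cases ?_ (fun j => ?_) i
      · exact continuous_id
      · simpa using continuous_const
  have := (hX.continuous_timeProd v).comp h
  simpa [Function.comp_def, List.ofFn_cons] using this

end StronglyContinuous

/-- The distribution `∂⋯∂ T(X⋯X) v` tested with `φ`. -/
def starVec (X : ℝ → F.Op) {n : ℕ} (φ : Fin n → ℝ → ℂ) (v : F.union) : E :=
  ∫ t : Fin n → ℝ, (∏ i, -deriv (φ i) (t i)) • (timeProd X (List.ofFn t) v : E)

theorem continuous_weight {n : ℕ} {φ : Fin n → ℝ → ℂ} (hφ : ∀ i, IsTest (φ i)) :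
    Continuous fun t : Fin n → ℝ => ∏ i, -deriv (φ i) (t i) :=
  continuous_finsetProd _ fun i _ => ((hφ i).deriv.1.continuous.comp (continuous_apply i)).neg

theorem hasCompactSupport_weight {n : ℕ} {φ : Fin n → ℝ → ℂ} (hφ : ∀ i, IsTest (φ i)) :
    HasCompactSupport fun t : Fin n → ℝ => ∏ i, -deriv (φ i) (t i) := by
  refine HasCompactSupport.intro (isCompact_univ_pi fun i => (hφ i).2.isCompact) fun t ht => ?_
  simp only [Set.mem_univ_pi, not_forall] at ht
  obtain ⟨i, hi⟩ := ht
  exact Finset.prod_eq_zero (Finset.mem_univ i) (by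
    rw [deriv_eq_zero_of_notMem_tsupport hi, neg_zero])

theorem integrable_weight_smul {n : ℕ} {φ : Fin n → ℝ → ℂ} (hφ : ∀ i, IsTest (φ i))
    {g : (Fin n → ℝ) → E} (hg : Continuous g) :
    Integrable fun t => (∏ i, -deriv (φ i) (t i)) • g t :=
  Continuous.integrable_of_hasCompactSupport ((continuous_weight hφ).smul hg)
    (hasCompactSupport_weight hφ).smul_right

theorem starIntegrand_eq {n : ℕ} {Y : ℝ → E → E} {X : ℝ → F.Op} {φ : Fin n → ℝ → ℂ}
    (h : ∀ i, ∀ s ∈ tsupport (φ i), ∀ w : F.union, Y s w = X s w) (v : F.union) :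
    starIntegrand Y φ v =
      fun t => (∏ i, -deriv (φ i) (t i)) • (timeProd X (List.ofFn t) v : E) := by
  funext t
  by_cases ht : ∀ i, t i ∈ tsupport (φ i)
  · rw [starIntegrand, timeOrdered_eq t v fun i => h i _ (ht i)]
  · push Not at ht
    obtain ⟨i, hi⟩ := ht
    have : (∏ i, -deriv (φ i) (t i)) = 0 := Finset.prod_eq_zero (Finset.mem_univ i) (by
      rw [deriv_eq_zero_of_notMem_tsupport hi, neg_zero])
    simp [starIntegrand, this]

/-- A time-ordered product depends only on the multiset of its times, so permuting the coordinates
of integration permutes the test functions. -/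
theorem starVec_perm {X : ℝ → F.Op} {n : ℕ} (φ : Fin n → ℝ → ℂ) (v : F.union)
    (e : Equiv.Perm (Fin n)) : starVec X (φ ∘ e) v = starVec X φ v := by
  have hmp := volume_measurePreserving_piCongrLeft (fun _ : Fin n => ℝ) e
  rw [starVec, starVec, ← hmp.integral_comp (MeasurableEquiv.measurableEmbedding _)
    fun u => (∏ i, -deriv (φ i) (u i)) • (timeProd X (List.ofFn u) v : E)]
  refine integral_congr_ae (Eventually.of_forall fun t => ?_)
  have ht : ∀ i, (MeasurableEquiv.piCongrLeft (fun _ : Fin n => ℝ) e) t (e i) = t i := fun i =>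
    Equiv.piCongrLeft_apply_apply (fun _ : Fin n => ℝ) e t i
  set u := (MeasurableEquiv.piCongrLeft (fun _ : Fin n => ℝ) e) t with hu
  have hut : t = u ∘ e := funext fun i => (ht i).symm
  have h1 : timeProd X (List.ofFn t) = timeProd X (List.ofFn u) := by
    rw [timeProd, timeProd]
    congr 1
    refine List.Perm.eq_of_pairwise' (r := (· ≤ ·)) (List.pairwise_insertionSort _ _)
      (List.pairwise_insertionSort _ _) ?_
    refine (List.perm_insertionSort _ _).trans (.trans ?_ (List.perm_insertionSort _ _).symm)
    rw [hut]
    exact e.ofFn_comp_perm u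
  have h2 : ∏ i, -deriv ((φ ∘ e) i) (t i) = ∏ i, -deriv (φ i) (u i) := by
    rw [← Equiv.prod_comp e fun i => -deriv (φ i) (u i)]
    simp [hut]
  simp only [h1, h2, ← hu]

end TimeOrdering

/-! ### Convergence of regularized time-ordered correlators -/

section Limit

variable {E : Type*} [NormedAddCommGroup E] [NormedSpace ℂ E] {F : Filtered E}

open Filtered

/-- A charge, regularized on the time scale `ε`, as a sum of a constant, an outgoing and an
incoming part, whose commutation relations hold up to the time scale `ε` in `U`. -/
structure RegularizedCharge (F : Filtered E) (U : Set ℝ) where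
  rest : F.Op
  out : ℝ → ℝ → F.Op
  inc : ℝ → ℝ → F.Op
  continuous_out : ∀ ε > 0, ∀ v : F.union, Continuous fun t => (out ε t v : E)
  continuous_inc : ∀ ε > 0, ∀ v : F.union, Continuous fun t => (inc ε t v : E)
  -- Growth slower than every negative power of ε is enough, since finitely many factors compete
  -- against one power of ε. The level rises by two because a quadratic expression in the fields
  -- creates at most one pair.
  bound : ∀ N, ∀ δ > (0 : ℝ), ∃ C : ℝ, ∀ ε > (0 : ℝ), ∀ t : ℝ,
    OpBound rest N (N + 2) (C * (min ε 1) ^ (-δ)) ∧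
    OpBound (out ε t) N (N + 2) (C * (min ε 1) ^ (-δ)) ∧
    OpBound (inc ε t) N (N + 2) (C * (min ε 1) ^ (-δ))
  commute_out : ∀ ε > 0, ∀ p q s, p < q → Set.Icc (p - ε) (q + ε) ⊆ U → q + 2 * ε ≤ s →
    Commute (out ε q - out ε p) (rest + out ε s + inc ε s)
  commute_inc : ∀ ε > 0, ∀ p q s, p < q → Set.Icc (p - ε) (q + ε) ⊆ U → s ≤ p - 2 * ε →
    Commute (inc ε q - inc ε p) (rest + out ε s + inc ε s)
  -- The mixed charge, outgoing part at the earlier time and incoming part at the later one, is what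
  -- excludes a jump of the defect across s.
  commute_mid : ∀ ε > 0, ∀ p q s, p < q → Set.Icc (p - ε) (q + ε) ⊆ U →
    p + 2 * ε ≤ s → s ≤ q - 2 * ε →
    Commute (rest + out ε p + inc ε q) (rest + out ε s + inc ε s)

/-- `∫ -φ'(t) Y_ε(t) dt` is close to `J` of first order in `ε`. -/
def IsSmeared (Y : ℝ → ℝ → F.Op) (φ : ℝ → ℂ) (J : F.Op) : Prop :=
  ∃ Jε : ℝ → F.Op,
    (∀ ε > 0, ∀ w : F.union, ∫ t, (-deriv φ t) • (Y ε t w : E) = Jε ε w) ∧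
    ∀ N, ∃ C, 0 ≤ C ∧ OpBound J N (N + 2) C ∧
      ∀ ε > 0, ε ≤ 1 → OpBound (Jε ε - J) N (N + 2) (C * ε)

namespace RegularizedCharge

variable {U : Set ℝ} (S : RegularizedCharge F U)

/-- The full charge. -/
def charge (ε t : ℝ) : F.Op := S.rest + S.out ε t + S.inc ε t

theorem exists_uniform_bound (K : ℕ) {δ : ℝ} (hδ : 0 < δ) :
    ∃ C, 1 ≤ C ∧ ∀ M ≤ K, ∀ ε > 0, ∀ t,
      OpBound S.rest M (M + 2) (C * (min ε 1) ^ (-δ)) ∧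
      OpBound (S.out ε t) M (M + 2) (C * (min ε 1) ^ (-δ)) ∧
      OpBound (S.inc ε t) M (M + 2) (C * (min ε 1) ^ (-δ)) ∧
      OpBound (S.charge ε t) M (M + 2) (C * (min ε 1) ^ (-δ)) := by
  choose C hC using fun N => S.bound N δ hδ
  set C₁ := 1 + ∑ N ∈ Finset.range (K + 1), |C N| with hC₁
  have h0 : 0 ≤ ∑ N ∈ Finset.range (K + 1), |C N| := Finset.sum_nonneg fun _ _ => abs_nonneg _
  refine ⟨3 * C₁, by linarith, fun M hM ε hε t => ?_⟩
  have hr : 0 ≤ (min ε 1) ^ (-δ) := Real.rpow_nonneg (by positivity) _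
  have hM' : C M ≤ C₁ := by
    have := Finset.single_le_sum (f := fun N => |C N|) (fun _ _ => abs_nonneg _)
      (Finset.mem_range.2 (Nat.lt_succ_of_le hM))
    have := le_abs_self (C M)
    linarith
  obtain ⟨h1, h2, h3⟩ := hC M ε hε t
  have m1 : C M * (min ε 1) ^ (-δ) ≤ C₁ * (min ε 1) ^ (-δ) := by gcongr
  have m3 : C₁ * (min ε 1) ^ (-δ) ≤ 3 * C₁ * (min ε 1) ^ (-δ) := by gcongr; linarith
  refine ⟨h1.mono le_rfl (m1.trans m3), h2.mono le_rfl (m1.trans m3),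
    h3.mono le_rfl (m1.trans m3), ((h1.add h2).add h3).mono le_rfl ?_⟩
  linarith

theorem one_le_rpow_min {ε δ : ℝ} (hε : 0 < ε) (hδ : 0 < δ) : 1 ≤ (min ε 1) ^ (-δ) :=
  Real.one_le_rpow_of_pos_of_le_one_of_nonpos (by positivity) (min_le_right _ _) (by linarith)

theorem exists_bound (N : ℕ) : ∀ ε > 0, ∃ C, 0 ≤ C ∧ ∀ t,
    OpBound S.rest N (N + 2) C ∧ OpBound (S.out ε t) N (N + 2) C ∧
    OpBound (S.inc ε t) N (N + 2) C := fun ε hε => by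
  obtain ⟨C, hC, h⟩ := S.exists_uniform_bound N one_pos
  have := Real.rpow_nonneg (show 0 ≤ min ε 1 by positivity) (-1)
  exact ⟨_, by positivity, fun t => ⟨(h N le_rfl ε hε t).1, (h N le_rfl ε hε t).2.1,
    (h N le_rfl ε hε t).2.2.1⟩⟩

theorem stronglyContinuous_out {ε : ℝ} (hε : 0 < ε) : StronglyContinuous (S.out ε) :=
  ⟨S.continuous_out ε hε, fun N => by
    obtain ⟨C, hC, h⟩ := S.exists_bound N ε hε
    exact ⟨C, hC, fun t => (h t).2.1⟩⟩

theorem stronglyContinuous_inc {ε : ℝ} (hε : 0 < ε) : StronglyContinuous (S.inc ε) :=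
  ⟨S.continuous_inc ε hε, fun N => by
    obtain ⟨C, hC, h⟩ := S.exists_bound N ε hε
    exact ⟨C, hC, fun t => (h t).2.2⟩⟩

theorem stronglyContinuous_charge {ε : ℝ} (hε : 0 < ε) : StronglyContinuous (S.charge ε) :=
  ((StronglyContinuous.const fun N => by
    obtain ⟨C, hC, h⟩ := S.exists_bound N ε hε
    exact ⟨C, hC, (h 0).1⟩).add (S.stronglyContinuous_out hε)).add (S.stronglyContinuous_inc hε)

theorem continuous_orderDefect {ε : ℝ} (hε : 0 < ε) (l : List ℝ) (v : F.union) :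
    Continuous fun p => (orderDefect (S.charge ε) (S.out ε) (S.inc ε) l p v : E) := by
  obtain ⟨N, hN⟩ := exists_mem_space v
  have h1 := (S.stronglyContinuous_charge hε).continuous_timeProd_cons l v
  have h2 := S.continuous_out ε hε (timeProd (S.charge ε) l v)
  obtain ⟨C, hC0, hC⟩ := (S.stronglyContinuous_inc hε).bound N
  have h3 : Continuous fun p => (timeProd (S.charge ε) l (S.inc ε p v) : E) := by
    have := (S.stronglyContinuous_charge hε).continuous_listProd
      (((l.insertionSort (· ≤ ·))).map fun s (_ : ℝ) => s)
      (fun τ hτ => by obtain ⟨s, -, rfl⟩ := List.mem_map.1 hτ; exact continuous_const)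
      (w := fun p => S.inc ε p v) (S.continuous_inc ε hε v) fun t => ((hC t) v hN).1
    simpa [Function.comp_def, timeProd] using this
  exact h1.sub (h2.add h3)

theorem orderDefect_eq {ε : ℝ} (hε : 0 < ε) (l : List ℝ) {p q : ℝ} (hpq : p < q)
    (hU : Set.Icc (p - ε) (q + ε) ⊆ U) (hp : OffWindow l (2 * ε) p) (hq : OffWindow l (2 * ε) q) :
    orderDefect (S.charge ε) (S.out ε) (S.inc ε) l p =
      orderDefect (S.charge ε) (S.out ε) (S.inc ε) l q :=
  ScatteringModel.orderDefect_eq (r := S.rest) (fun _ => rfl) (by positivity : 0 < 2 * ε) hpq hp hq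
    (fun s hs => S.commute_out ε hε p q s hpq hU hs)
    (fun s hs => S.commute_inc ε hε p q s hpq hU hs)
    (fun s hs hs' => S.commute_mid ε hε p q s hpq hU hs hs')

end RegularizedCharge

/-- `W (i :: l) = J⁺ᵢ W l + W l J⁻ᵢ`. -/
def orderedSum {R ι : Type*} [Ring R] (Jp Jm : ι → R) : List ι → R
  | [] => 1
  | i :: l => Jp i * orderedSum Jp Jm l + orderedSum Jp Jm l * Jm i

theorem orderedSum_map {R ι κ : Type*} [Ring R] (Jp Jm : ι → R) (f : κ → ι) (l : List κ) :
    orderedSum Jp Jm (l.map f) = orderedSum (Jp ∘ f) (Jm ∘ f) l := by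
  induction l with
  | nil => rfl
  | cons i l ih => simp [orderedSum, ih]

theorem exists_pos_forall_mem {K U : Set ℝ} (hK : IsCompact K) (hU : IsOpen U) (h : K ⊆ U) :
    ∃ δ > 0, ∀ x ∈ K, ∀ y, |y - x| ≤ 3 * δ → y ∈ U := by
  obtain ⟨δ, hδ, h'⟩ := hK.exists_cthickening_subset_open hU h
  refine ⟨δ / 3, by positivity, fun x hx y hy => h' ?_⟩
  exact Metric.mem_cthickening_of_dist_le y x δ K hx (by rw [Real.dist_eq]; linarith)

variable [CompleteSpace E] {U : Set ℝ}

/-- The exponent is chosen so that n + 1 factors together cost ε^(-1/2), which leaves ε^(1/2). -/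
theorem tendsto_rpow_error (a : ℝ) (n : ℕ) :
    Tendsto (fun ε : ℝ => a * ε * (((min ε 1) ^ (-(1 / (2 * (n + 1 : ℝ))))) ^ (n + 1))) (𝓝[>] 0)
      (𝓝 0) := by
  have h : Tendsto (fun ε : ℝ => a * ε ^ (1 / 2 : ℝ)) (𝓝[>] 0) (𝓝 0) := by
    have : Tendsto (fun ε : ℝ => a * ε ^ (1 / 2 : ℝ)) (𝓝 0) (𝓝 (a * 0 ^ (1 / 2 : ℝ))) :=
      ((Real.continuous_rpow_const (by norm_num)).const_mul a).tendsto 0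
    rw [Real.zero_rpow (by norm_num), mul_zero] at this
    exact this.mono_left nhdsWithin_le_nhds
  refine h.congr' ?_
  filter_upwards [Ioc_mem_nhdsGT (zero_lt_one (α := ℝ))] with ε hε
  rw [min_eq_left hε.2, ← Real.rpow_natCast, ← Real.rpow_mul hε.1.le, mul_assoc]
  congr 1
  have : -(1 / (2 * (n + 1 : ℝ))) * ((n + 1 : ℕ) : ℝ) = -(1 / 2) := by
    push_cast
    field_simp
  rw [this]
  nth_rewrite 2 [← Real.rpow_one ε]
  rw [← Real.rpow_add hε.1]
  norm_num

/-- Induction on the number of factors. For fixed remaining times, the time-ordered product is the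
defect plus out·T plus T·inc. The defect contributes a small window error after integration against
φ₀'. The other two terms produce the smeared currents to the left and to the right of the shorter
product, to which the induction hypothesis applies. -/
theorem tendsto_starVec (S : RegularizedCharge F U) (hU : IsOpen U) : ∀ (n : ℕ)
    (φ : Fin n → ℝ → ℂ), (∀ i, IsTest (φ i) ∧ tsupport (φ i) ⊆ U) → ∀ Jp Jm : Fin n → F.Op,
    (∀ i, IsSmeared S.out (φ i) (Jp i) ∧ IsSmeared S.inc (φ i) (Jm i)) → ∀ v : F.union,
    Tendsto (fun ε => starVec (S.charge ε) φ v) (𝓝[>] 0)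
      (𝓝 (orderedSum Jp Jm (List.finRange n) v : E)) := by
  intro n
  induction n with
  | zero =>
    intro φ _ Jp Jm _ v
    have : ∀ ε, starVec (S.charge ε) φ v = v := fun ε => by
      simp [starVec, timeProd, volume_pi, Measure.real]
    simp [this, orderedSum]
  | succ n ih =>
    intro φ hφ Jp Jm hJ v
    have ih' := ih (fun i => φ i.succ) (fun i => hφ i.succ) (fun i => Jp i.succ)
      (fun i => Jm i.succ) (fun i => hJ i.succ)
    obtain ⟨⟨Jpε, hJp, hJp'⟩, ⟨Jmε, hJm, hJm'⟩⟩ := hJ 0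
    obtain ⟨N, hN⟩ := exists_mem_space v
    -- Each of the n + 1 factors raises the level by at most two, so K bounds every level that
    -- occurs.
    set K := N + 2 * n + 2 with hK
    set d : ℝ := 1 / (2 * (n + 1 : ℝ)) with hd
    have hd0 : 0 < d := by positivity
    obtain ⟨C, hC1, hC⟩ := S.exists_uniform_bound K hd0
    obtain ⟨Cp, hCp0, hCp, hCp'⟩ := hJp' (N + 2 * n)
    obtain ⟨Cm, hCm0, hCm, hCm'⟩ := hJm' N
    obtain ⟨δ, hδ, hδU⟩ := exists_pos_forall_mem (hφ 0).1.2.isCompact hU (hφ 0).2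
    obtain ⟨M, hM⟩ : ∃ M, ∀ t, ‖deriv (φ 0) t‖ ≤ M :=
      (hφ 0).1.deriv.1.continuous.bounded_above_of_compact_support (hφ 0).1.deriv.2
    have hM0 : 0 ≤ M := (norm_nonneg _).trans (hM 0)
    set Φ : (Fin n → ℝ) → ℂ := fun t => ∏ i, -deriv (φ i.succ) (t i) with hΦ
    set T : ℝ → (Fin n → ℝ) → F.Op := fun ε t => timeProd (S.charge ε) (List.ofFn t) with hT
    -- The outgoing current acts only on the union of the levels. Its bounded extension L from level
    -- N + 2n can be applied to convergent sequences and to integrals.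
    obtain ⟨L, hL⟩ := hCp.exists_clm
    -- the main term converges
    have hTb : ∀ ε > 0, ∀ t, ∀ M' ≤ N + 2, OpBound (T ε t) M' (M' + 2 * n)
        ((C * (min ε 1) ^ (-d)) ^ n) := fun ε hε t M' hM' => by
      have := OpBound.timeProd (F := F)
        (show 0 ≤ C * (min ε 1) ^ (-d) by
          have := RegularizedCharge.one_le_rpow_min hε hd0; positivity) K
        (fun s M hM => (hC M hM ε hε s).2.2.2) (List.ofFn t) M' (by simp; omega)
      simpa using this
    have hstar : ∀ ε > 0, starVec (S.charge ε) (fun i => φ i.succ) v ∈ F.space (N + 2 * n) :=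
      fun ε hε => integral_mem_space fun t =>
        (F.space _).smul_mem _ ((hTb ε hε t N (by omega)) v hN).1
    have hW : (orderedSum (fun i => Jp i.succ) (fun i => Jm i.succ) (List.finRange n) v : E) ∈
        F.space (N + 2 * n) :=
      (isClosed_space _).mem_of_tendsto (ih' v) (by
        filter_upwards [self_mem_nhdsWithin] with ε hε using hstar ε hε)
    have hmain : Tendsto (fun ε => L (starVec (S.charge ε) (fun i => φ i.succ) v) +
        starVec (S.charge ε) (fun i => φ i.succ) (Jm 0 v)) (𝓝[>] 0)
        (𝓝 (orderedSum Jp Jm (List.finRange (n + 1)) v : E)) := by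
      have h1 := ((L.continuous.tendsto _).comp (ih' v)).add (ih' (Jm 0 v))
      rw [hL _ hW] at h1
      have e : (orderedSum Jp Jm (List.finRange (n + 1)) v : E) =
          (Jp 0 (orderedSum (fun i => Jp i.succ) (fun i => Jm i.succ) (List.finRange n) v) : E)
          + (orderedSum (fun i => Jp i.succ) (fun i => Jm i.succ) (List.finRange n) (Jm 0 v) : E) := by
        rw [List.finRange_succ, orderedSum, orderedSum_map]
        rfl
      rw [e]
      exact h1
    -- the error is small
    set A : ℝ := ∫ t, ‖Φ t‖ with hA
    -- The first summand is the window estimate, with defect bounded by three products of n + 1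
    -- factors and n windows of length 4ε. The second comes from replacing the smeared currents at
    -- scale ε by their limits.
    set B : ℝ := (M * (2 * (3 * C ^ (n + 1) * ‖(v : E)‖)) * (n * 4) +
      (Cp * C ^ (n + 1) * ‖(v : E)‖ + C ^ (n + 1) * (Cm * ‖(v : E)‖))) with hB
    have herr : ∀ᶠ ε in 𝓝[>] (0 : ℝ), ‖starVec (S.charge ε) φ v -
        (L (starVec (S.charge ε) (fun i => φ i.succ) v) +
        starVec (S.charge ε) (fun i => φ i.succ) (Jm 0 v))‖ ≤
        A * B * ε * (((min ε 1) ^ (-d)) ^ (n + 1)) := by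
      have hsmall : ∀ᶠ ε in 𝓝[>] (0 : ℝ), n * (2 * (2 * ε)) < 2 * δ := by
        have : Tendsto (fun ε : ℝ => n * (2 * (2 * ε))) (𝓝 0) (𝓝 (n * (2 * (2 * 0)))) :=
          (by fun_prop : Continuous fun ε : ℝ => n * (2 * (2 * ε))).tendsto 0
        rw [mul_zero, mul_zero, mul_zero] at this
        exact (this.mono_left nhdsWithin_le_nhds).eventually (gt_mem_nhds (by positivity))
      filter_upwards [hsmall, Ioc_mem_nhdsGT (zero_lt_one (α := ℝ)), Ioc_mem_nhdsGT hδ]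
        with ε hε1 hε2 hε3
      have hε : 0 < ε := hε2.1
      have hr1 := RegularizedCharge.one_le_rpow_min hε hd0
      set r := (min ε 1) ^ (-d) with hr
      set c := C * r with hc
      have hc1 : 1 ≤ c := by nlinarith
      have hc0 : 0 ≤ c := by linarith
      have hX := S.stronglyContinuous_charge hε
      have hweight : ∀ (t0 : ℝ) (t : Fin n → ℝ),
          (∏ i, -deriv (φ i) ((Fin.cons t0 t : Fin (n + 1) → ℝ) i)) =
          (-deriv (φ 0) t0) * Φ t := fun t0 t => by
        rw [Fin.prod_univ_succ]; simp [hΦ]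
      have hcont := hX.continuous_timeProd (n := n + 1) v
      have hint := integrable_weight_smul (fun i => (hφ i).1) hcont
      have hmp := (volume_preserving_piFinSuccAbove (fun _ : Fin (n + 1) => ℝ) 0).symm
      have hcons : ∀ z : ℝ × (Fin n → ℝ),
          (MeasurableEquiv.piFinSuccAbove (fun _ : Fin (n + 1) => ℝ) 0).symm z =
            (Fin.cons z.1 z.2 : Fin (n + 1) → ℝ) := fun z => by
        simp [MeasurableEquiv.piFinSuccAbove, Fin.insertNthEquiv]
      have hint2 : Integrable (fun z : ℝ × (Fin n → ℝ) => ((-deriv (φ 0) z.1) * Φ z.2) •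
          (timeProd (S.charge ε) (z.1 :: List.ofFn z.2) v : E)) (volume.prod volume) := by
        have := (hmp.integrable_comp_emb (MeasurableEquiv.measurableEmbedding _)).2 hint
        refine this.congr (Eventually.of_forall fun z => ?_)
        simp only [Function.comp, hcons, hweight, List.ofFn_cons]
      -- Fubini with the first time innermost, so that the window estimate applies pointwise in the
      -- remaining times.
      have hfub : starVec (S.charge ε) φ v = ∫ t, ∫ t0, ((-deriv (φ 0) t0) * Φ t) •
          (timeProd (S.charge ε) (t0 :: List.ofFn t) v : E) := by
        rw [starVec, ← hmp.integral_comp (MeasurableEquiv.measurableEmbedding _)]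
        rw [← integral_prod_symm _ hint2]
        refine integral_congr_ae (Eventually.of_forall fun z => ?_)
        simp only [hcons, hweight, List.ofFn_cons]
      have hi1 := hint2.integral_prod_right
      have hi2 : Integrable fun t => Φ t • L (T ε t v : E) := integrable_weight_smul
        (fun i => (hφ i.succ).1) (L.continuous.comp (hX.continuous_timeProd v))
      have hi3 : Integrable fun t => Φ t • (T ε t (Jm 0 v) : E) := integrable_weight_smul
        (fun i => (hφ i.succ).1) (hX.continuous_timeProd _)
      have hL1 : L (starVec (S.charge ε) (fun i => φ i.succ) v) = ∫ t, Φ t • L (T ε t v : E) := by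
        rw [starVec, ← L.integral_comp_comm]
        · simp only [map_smul, hT, hΦ]
        · exact integrable_weight_smul (fun i => (hφ i.succ).1) (hX.continuous_timeProd v)
      rw [hfub, hL1, show starVec (S.charge ε) (fun i => φ i.succ) (Jm 0 v) =
        ∫ t, Φ t • (T ε t (Jm 0 v) : E) from rfl, ← integral_add hi2 hi3]
      have hsub : (∫ t, ∫ t0, ((-deriv (φ 0) t0) * Φ t) •
          (timeProd (S.charge ε) (t0 :: List.ofFn t) v : E)) -
          ∫ t, (Φ t • L (T ε t v : E) + Φ t • (T ε t (Jm 0 v) : E)) =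
          ∫ t, ((∫ t0, ((-deriv (φ 0) t0) * Φ t) •
          (timeProd (S.charge ε) (t0 :: List.ofFn t) v : E)) -
          (Φ t • L (T ε t v : E) + Φ t • (T ε t (Jm 0 v) : E))) :=
        (integral_sub hi1 (hi2.add hi3)).symm
      rw [hsub]
      have hpt : ∀ t : Fin n → ℝ, ‖(∫ t0, ((-deriv (φ 0) t0) * Φ t) •
          (timeProd (S.charge ε) (t0 :: List.ofFn t) v : E)) -
          (Φ t • L (T ε t v : E) + Φ t • (T ε t (Jm 0 v) : E))‖ ≤
          ‖Φ t‖ * (B * ε * r ^ (n + 1)) := by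
        intro t
        have hlen : (List.ofFn t).length = n := by simp
        have hTv := (hTb ε hε t N (by omega)) v hN
        set D : ℝ → E := fun p =>
          (orderDefect (S.charge ε) (S.out ε) (S.inc ε) (List.ofFn t) p v : E) with hD
        have hDc : Continuous D := S.continuous_orderDefect hε _ v
        have hTTv : ∀ p, ‖(timeProd (S.charge ε) (p :: List.ofFn t) v : E)‖ ≤
            c ^ (n + 1) * ‖(v : E)‖ := fun p => by
          have := OpBound.timeProd (F := F) hc0 K
            (fun s M hM => (hC M hM ε hε s).2.2.2) (p :: List.ofFn t) N (by simp; omega)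
          simpa using (this v hN).2
        have hDb : ∀ p, ‖D p‖ ≤ 3 * c ^ (n + 1) * ‖(v : E)‖ := fun p => by
          have h2 := ((hC (N + 2 * n) (by omega) ε hε p).2.1 _ hTv.1).2
          have h3 := (hC N (by omega) ε hε p).2.2.1 v hN
          have h4 := ((hTb ε hε t (N + 2) le_rfl) _ h3.1).2
          have h5 : ‖(S.out ε p (T ε t v) : E)‖ ≤ c ^ (n + 1) * ‖(v : E)‖ := by
            refine h2.trans ((mul_le_mul_of_nonneg_left hTv.2 hc0).trans (le_of_eq ?_))
            rw [pow_succ]; ring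
          have h6 : ‖(T ε t (S.inc ε p v) : E)‖ ≤ c ^ (n + 1) * ‖(v : E)‖ := by
            refine h4.trans ((mul_le_mul_of_nonneg_left h3.2 (by positivity)).trans (le_of_eq ?_))
            rw [pow_succ]; ring
          have e : D p = (timeProd (S.charge ε) (p :: List.ofFn t) v : E) -
            ((S.out ε p (T ε t v) : E) + (T ε t (S.inc ε p v) : E)) := rfl
          rw [e]
          have := norm_sub_le (timeProd (S.charge ε) (p :: List.ofFn t) v : E)
            ((S.out ε p (T ε t v) : E) + (T ε t (S.inc ε p v) : E))
          have := norm_add_le (S.out ε p (T ε t v) : E) (T ε t (S.inc ε p v) : E)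
          linarith [hTTv p]
        have hwin := norm_integral_deriv_smul_le (hφ 0).1 hδ hδU (l := List.ofFn t) hε hε3.2
          (by rw [hlen]; exact hε1) hDc hDb hM (fun p q hpq hU' hp hq => by
            simp only [hD]; rw [S.orderDefect_eq hε _ hpq hU' hp hq])
        rw [hlen] at hwin
        have hcs : ∀ {g : ℝ → E}, Continuous g →
            Integrable (fun p => (-deriv (φ 0) p) • g p) := fun hg =>
          Continuous.integrable_of_hasCompactSupport ((hφ 0).1.deriv.1.continuous.neg.smul hg)
            (((hφ 0).1.deriv.2.comp_left (g := Neg.neg) neg_zero).smul_right)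
        -- Insert the definition of the defect. The incoming integral moves through T because T does
        -- not involve the integration variable and is bounded on level N + 2.
        have hsplit : (∫ t0, ((-deriv (φ 0) t0) * Φ t) •
            (timeProd (S.charge ε) (t0 :: List.ofFn t) v : E)) =
            Φ t • (-(∫ p, deriv (φ 0) p • D p) + (Jpε ε (T ε t v) : E)
              + (T ε t (Jmε ε v) : E)) := by
          have hinc : ∫ p, (-deriv (φ 0) p) • (T ε t (S.inc ε p v) : E) = T ε t (Jmε ε v) := by
            have hmem : ∀ p, (((-deriv (φ 0) p) • S.inc ε p v : F.union) : E) ∈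
                F.space (N + 2) := fun p =>
              (F.space _).smul_mem _ ((hC N (by omega) ε hε p).2.2.1 v hN).1
            have := (hTb ε hε t (N + 2) le_rfl).integral_comm (μ := volume) hmem
              (hcs (S.continuous_inc ε hε v)) (Jmε ε v) (hJm ε hε v).symm
            simpa using this
          have hDn : Integrable fun p => -(deriv (φ 0) p • D p) :=
            (hcs hDc).congr (Eventually.of_forall fun p => neg_smul _ _)
          rw [← hJp ε hε (T ε t v), ← hinc, ← integral_neg, ← integral_add, ← integral_add,
            ← integral_smul]
          · refine integral_congr_ae (Eventually.of_forall fun p => ?_)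
            have e : D p = (timeProd (S.charge ε) (p :: List.ofFn t) v : E) -
              ((S.out ε p (T ε t v) : E) + (T ε t (S.inc ε p v) : E)) := rfl
            simp only [e]
            module
          · exact hDn.add (hcs (S.continuous_out ε hε (T ε t v)))
          · refine hcs ?_
            have h' := (hX.continuous_timeProd_cons (List.ofFn t) v).sub (hDc.add
              (S.continuous_out ε hε (T ε t v)))
            refine h'.congr fun p => ?_
            have e : D p = (timeProd (S.charge ε) (p :: List.ofFn t) v : E) -
              ((S.out ε p (T ε t v) : E) + (T ε t (S.inc ε p v) : E)) := rfl
            change (timeProd (S.charge ε) (p :: List.ofFn t) v : E) -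
              (D p + (S.out ε p (T ε t v) : E)) = _
            rw [e]
            abel
          · exact hDn
          · exact hcs (S.continuous_out ε hε (T ε t v))
        rw [hsplit, hL _ hTv.1, ← smul_add, ← smul_sub, norm_smul]
        refine mul_le_mul_of_nonneg_left ?_ (norm_nonneg _)
        have e1 := (hCp' ε hε hε2.2 (T ε t v) hTv.1).2
        have e2' := hCm' ε hε hε2.2 v hN
        have e2 := (hTb ε hε t (N + 2) le_rfl _ e2'.1).2
        have hcn : c ^ n ≤ c ^ (n + 1) := pow_le_pow_right₀ hc1 (Nat.le_succ n)
        have e3 : ‖((Jpε ε - Jp 0) (T ε t v) : E)‖ ≤ Cp * ε * (c ^ (n + 1) * ‖(v : E)‖) :=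
          e1.trans (mul_le_mul_of_nonneg_left (hTv.2.trans (by gcongr)) (by positivity))
        have e4 : ‖(T ε t ((Jmε ε - Jm 0) v) : E)‖ ≤ c ^ (n + 1) * (Cm * ε * ‖(v : E)‖) :=
          e2.trans (mul_le_mul hcn e2'.2 (norm_nonneg _) (by positivity))
        have e5 : -(∫ p, deriv (φ 0) p • D p) + (Jpε ε (T ε t v) : E) + (T ε t (Jmε ε v) : E) -
            ((Jp 0 (T ε t v) : E) + (T ε t (Jm 0 v) : E)) = -(∫ p, deriv (φ 0) p • D p) +
            ((Jpε ε - Jp 0) (T ε t v) : E) + (T ε t ((Jmε ε - Jm 0) v) : E) := by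
          simp only [LinearMap.sub_apply, map_sub, Submodule.coe_sub]
          abel
        rw [e5]
        refine (norm_add₃_le).trans ?_
        rw [norm_neg]
        have hcC : c ^ (n + 1) = C ^ (n + 1) * r ^ (n + 1) := by rw [hc, mul_pow]
        rw [hcC] at hwin e3 e4
        refine (add_le_add (add_le_add hwin e3) e4).trans (le_of_eq ?_)
        rw [hB]
        ring
      refine (norm_integral_le_of_norm_le ?_ (Eventually.of_forall hpt)).trans (le_of_eq ?_)
      · exact (Continuous.integrable_of_hasCompactSupport
          (continuous_weight fun i => (hφ i.succ).1)
          (hasCompactSupport_weight fun i => (hφ i.succ).1)).norm.mul_const _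
      · rw [integral_mul_const]
        ring
    have h0 := squeeze_zero_norm' herr (tendsto_rpow_error (A * B) n)
    simpa using h0.add hmain

end Limit

/-! ### Sums over orders of the factors -/

section Orders

variable {R ι : Type*} [Ring R] [DecidableEq ι]

/-- Product of the outgoing factors in the order of the list. -/
def outProd (Jp : ι → R) (A : Finset ι) (l : List ι) : R :=
  ((l.filter (fun i => decide (i ∈ A))).map Jp).prod

/-- Product of the incoming factors in the order of the list. -/
def inProd (Jm : ι → R) (A : Finset ι) (l : List ι) : R :=
  ((l.filter (fun i => decide (i ∉ A))).map Jm).prod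

/-- Each step of the recursion puts the new index either leftmost among the outgoing factors or
rightmost among the incoming ones. The head of the list thus ends on the outside, and the incoming
factors appear in reversed order. -/
theorem orderedSum_eq_sum (Jp Jm : ι → R) {l : List ι} (hl : l.Nodup) :
    orderedSum Jp Jm l = ∑ A ∈ l.toFinset.powerset, outProd Jp A l * inProd Jm A l.reverse := by
  induction l with
  | nil => simp [orderedSum, outProd, inProd]
  | cons i l ih =>
    obtain ⟨hi, hl'⟩ := List.nodup_cons.1 hl
    have hi' : i ∉ l.toFinset := by simpa using hi
    rw [List.toFinset_cons, Finset.sum_powerset_insert hi', orderedSum, ih hl', Finset.mul_sum,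
      Finset.sum_mul, add_comm]
    refine congrArg₂ _ (Finset.sum_congr rfl fun A hA => ?_) (Finset.sum_congr rfl fun A hA => ?_)
    · have hiA : i ∉ A := fun h => hi' (Finset.mem_powerset.1 hA h)
      simp [outProd, inProd, hiA, List.filter_append, mul_assoc]
    · have hiA : i ∉ A := fun h => hi' (Finset.mem_powerset.1 hA h)
      have hne : ∀ j ∈ l, j ≠ i := fun j hj h => hi (h ▸ hj)
      have e1 : l.filter (fun j => decide (j ∈ insert i A)) = l.filter fun j => decide (j ∈ A) :=
        List.filter_congr fun j hj => by simp [hne j hj]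
      have e2 : l.reverse.filter (fun j => decide (j ∉ insert i A)) =
          l.reverse.filter fun j => decide (j ∉ A) :=
        List.filter_congr fun j hj => by simp [hne j (List.mem_reverse.1 hj)]
      have e3 : (i :: l).filter (fun j => decide (j ∈ insert i A)) =
          i :: l.filter fun j => decide (j ∈ insert i A) :=
        List.filter_cons_of_pos (by simp)
      have e4 : [i].filter (fun j => decide (j ∉ insert i A)) = [] := by simp
      rw [outProd, outProd, inProd, inProd, e3, List.reverse_cons, List.filter_append, e4, e1, e2]
      simp [mul_assoc]

/-- The permutation reversing the order of the elements of `s`. -/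
def revOn {k : ℕ} (s : Finset (Fin k)) : Equiv.Perm (Fin k) :=
  Equiv.Perm.ofSubtype (p := (· ∈ s))
    ((s.orderIsoOfFin rfl).symm.toEquiv.trans (Fin.revPerm.trans (s.orderIsoOfFin rfl).toEquiv))

theorem revOn_apply_of_notMem {k : ℕ} {s : Finset (Fin k)} {i : Fin k} (h : i ∉ s) :
    revOn s i = i := Equiv.Perm.ofSubtype_apply_of_not_mem _ h

theorem revOn_orderEmb {k : ℕ} (s : Finset (Fin k)) (j : Fin s.card) :
    revOn s (s.orderEmbOfFin rfl j) = s.orderEmbOfFin rfl j.rev := by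
  have : s.orderEmbOfFin rfl j ∈ s := Finset.orderEmbOfFin_mem _ _ _
  rw [revOn, Equiv.Perm.ofSubtype_apply_of_mem _ this]
  have e : (⟨s.orderEmbOfFin rfl j, this⟩ : s) = s.orderIsoOfFin rfl j := rfl
  rw [e]
  simp [Finset.coe_orderIsoOfFin_apply]

theorem exists_orderEmb {k : ℕ} {s : Finset (Fin k)} {i : Fin k} (h : i ∈ s) :
    ∃ j, s.orderEmbOfFin rfl j = i := by
  have : i ∈ Set.range (s.orderEmbOfFin rfl) := by
    rw [Finset.range_orderEmbOfFin]; exact h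
  exact this

theorem revOn_mem {k : ℕ} (s : Finset (Fin k)) (i : Fin k) : revOn s i ∈ s ↔ i ∈ s := by
  by_cases h : i ∈ s
  · obtain ⟨j, rfl⟩ := exists_orderEmb h
    rw [revOn_orderEmb]
    simp [Finset.orderEmbOfFin_mem]
  · rw [revOn_apply_of_notMem h]

theorem revOn_revOn {k : ℕ} (s : Finset (Fin k)) (i : Fin k) : revOn s (revOn s i) = i := by
  by_cases h : i ∈ s
  · obtain ⟨j, rfl⟩ := exists_orderEmb h
    rw [revOn_orderEmb, revOn_orderEmb, Fin.rev_rev]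
  · rw [revOn_apply_of_notMem h, revOn_apply_of_notMem h]

theorem finRange_filter_eq {k : ℕ} (s : Finset (Fin k)) :
    (List.finRange k).filter (fun i => decide (i ∈ s)) = List.ofFn (s.orderEmbOfFin rfl) := by
  refine List.Perm.eq_of_pairwise' (r := (· ≤ ·)) ?_ ?_ ?_
  · exact ((List.pairwise_le_finRange k).filter _)
  · exact ((s.orderEmbOfFin rfl).monotone.sortedLE_ofFn).pairwise
  · refine (List.perm_ext_iff_of_nodup ((List.nodup_finRange k).filter _)
      (List.nodup_ofFn.2 (s.orderEmbOfFin rfl).injective)).2 fun i => ?_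
    rw [List.mem_filter, List.mem_ofFn]
    simp [← Set.mem_range, Finset.range_orderEmbOfFin]

theorem finRange_filter_map_revOn {k : ℕ} (s : Finset (Fin k)) :
    ((List.finRange k).filter (fun i => decide (i ∈ s))).map (revOn s) =
      ((List.finRange k).filter (fun i => decide (i ∈ s))).reverse := by
  rw [finRange_filter_eq, List.map_ofFn]
  have : revOn s ∘ s.orderEmbOfFin rfl = s.orderEmbOfFin rfl ∘ Fin.rev :=
    funext fun j => revOn_orderEmb s j
  rw [this]
  refine List.ext_getElem (by simp) fun n h1 h2 => ?_
  rw [List.getElem_reverse, List.getElem_ofFn, List.getElem_ofFn]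
  refine congrArg (s.orderEmbOfFin rfl) (Fin.ext ?_)
  simp only [Fin.val_rev, List.length_ofFn]
  omega

theorem ofFn_filter {k : ℕ} (e : Fin k → Fin k) (p : Fin k → Bool) :
    (List.ofFn e).filter p = ((List.finRange k).filter (p ∘ e)).map e := by
  rw [List.ofFn_eq_map, List.filter_map]

/-- The positions of the incoming factors. -/
def inPos {k : ℕ} (A : Finset (Fin k)) (e : Equiv.Perm (Fin k)) : Finset (Fin k) :=
  Finset.univ.filter fun j => e j ∉ A

/-- Reverse the order of the incoming factors. -/
def revIn {k : ℕ} (A : Finset (Fin k)) (e : Equiv.Perm (Fin k)) : Equiv.Perm (Fin k) :=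
  e * revOn (inPos A e)

theorem mem_inPos {k : ℕ} {A : Finset (Fin k)} {e : Equiv.Perm (Fin k)} {j : Fin k} :
    j ∈ inPos A e ↔ e j ∉ A := by simp [inPos]

theorem inPos_revIn {k : ℕ} (A : Finset (Fin k)) (e : Equiv.Perm (Fin k)) :
    inPos A (revIn A e) = inPos A e := by
  ext j
  rw [mem_inPos, ← revOn_mem (inPos A e) j, mem_inPos]
  rfl

theorem revIn_involutive {k : ℕ} (A : Finset (Fin k)) : Function.Involutive (revIn A) := by
  intro e
  rw [revIn, inPos_revIn, revIn, mul_assoc]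
  have : revOn (inPos A e) * revOn (inPos A e) = 1 := Equiv.ext fun i => revOn_revOn _ i
  rw [this, mul_one]

theorem ofFn_revIn_filter_mem {k : ℕ} (A : Finset (Fin k)) (e : Equiv.Perm (Fin k)) :
    (List.ofFn (revIn A e)).filter (fun i => decide (i ∈ A)) =
      (List.ofFn e).filter (fun i => decide (i ∈ A)) := by
  rw [ofFn_filter, ofFn_filter]
  have h : ∀ j, revIn A e j ∈ A ↔ e j ∈ A := fun j => by
    have : j ∈ inPos A (revIn A e) ↔ j ∈ inPos A e := by rw [inPos_revIn]
    simpa [inPos, not_iff_not] using this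
  have : ((fun i => decide (i ∈ A)) ∘ revIn A e) = ((fun i => decide (i ∈ A)) ∘ e) := by
    funext j; simp [h]
  rw [this]
  refine List.map_congr_left fun j hj => ?_
  have hj' : e j ∈ A := by simpa using (List.mem_filter.1 hj).2
  rw [revIn, Equiv.Perm.mul_apply, revOn_apply_of_notMem (by simpa [inPos] using hj')]

theorem ofFn_revIn_filter_notMem {k : ℕ} (A : Finset (Fin k)) (e : Equiv.Perm (Fin k)) :
    (List.ofFn (revIn A e)).filter (fun i => decide (i ∉ A)) =
      ((List.ofFn e).filter (fun i => decide (i ∉ A))).reverse := by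
  rw [ofFn_filter, ofFn_filter]
  have h : ∀ e' : Equiv.Perm (Fin k), ((fun i => decide (i ∉ A)) ∘ e') =
      fun j => decide (j ∈ inPos A e') := fun e' => by funext j; simp [inPos]
  rw [h, h, inPos_revIn]
  have : (revIn A e : Fin k → Fin k) = e ∘ revOn (inPos A e) := rfl
  rw [this, ← List.map_map, finRange_filter_map_revOn, List.map_reverse]

/-- For fixed `A`, reversing only the incoming indices is an involution of the permutations that
leaves the outgoing order alone. Summed over all permutations, the reversal disappears. -/
theorem sum_orderedSum {k : ℕ} (Jp Jm : Fin k → R) :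
    ∑ e : Equiv.Perm (Fin k), orderedSum Jp Jm (List.ofFn e) =
      ∑ e : Equiv.Perm (Fin k), ∑ A, outProd Jp A (List.ofFn e) * inProd Jm A (List.ofFn e) := by
  have h1 : ∀ e : Equiv.Perm (Fin k), orderedSum Jp Jm (List.ofFn e) =
      ∑ A, outProd Jp A (List.ofFn e) * inProd Jm A (List.ofFn e).reverse := fun e => by
    rw [orderedSum_eq_sum _ _ (List.nodup_ofFn.2 e.injective)]
    congr 1
    have : (List.ofFn e).toFinset = Finset.univ :=
      Finset.eq_univ_of_forall fun i => List.mem_toFinset.2 (List.mem_ofFn.2 (e.surjective i))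
    rw [this, Finset.powerset_univ]
  simp only [h1]
  rw [Finset.sum_comm, Finset.sum_comm (s := (Finset.univ : Finset (Equiv.Perm (Fin k))))]
  refine Finset.sum_congr rfl fun A _ => ?_
  rw [← Equiv.sum_comp (revIn_involutive A).toPerm]
  refine Finset.sum_congr rfl fun e _ => ?_
  simp only [Function.Involutive.coe_toPerm, outProd, inProd, ofFn_revIn_filter_mem,
    List.filter_reverse, ofFn_revIn_filter_notMem, List.reverse_reverse]

end Orders

/-! ### Averaging the limit over all orders of the currents -/

section Symmetrized

variable {E : Type*} [NormedAddCommGroup E] [NormedSpace ℂ E] {F : Filtered E}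

theorem foldr_eq {ι : Type*} {Y : ι → E → E} {J : ι → F.Op} (h : ∀ i, ∀ w : F.union, Y i w = J i w)
    (l : List ι) (w : F.union) : l.foldr (fun i u => Y i u) (w : E) = ((l.map J).prod w : F.union) := by
  induction l with
  | nil => simp
  | cons i l ih => rw [List.foldr_cons, ih, h]; simp

theorem inOutTerm_eq {k : ℕ} {Yp Ym : Fin k → E → E} {Jp Jm : Fin k → F.Op}
    (hp : ∀ i, ∀ w : F.union, Yp i w = Jp i w) (hm : ∀ i, ∀ w : F.union, Ym i w = Jm i w)
    (A : Finset (Fin k)) (e : Equiv.Perm (Fin k)) (v : F.union) :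
    inOutTerm Yp Ym A e v =
      ((outProd Jp A (List.ofFn e) * inProd Jm A (List.ofFn e)) v : F.union) := by
  rw [inOutTerm, foldr_eq hm, foldr_eq hp]
  rfl

variable [CompleteSpace E] {U : Set ℝ}

/-- The correlator does not depend on the order of the test functions, so it converges to the
ordered sum of every permutation. The limit therefore equals their average. -/
theorem tendsto_starVec_sym (S : RegularizedCharge F U) (hU : IsOpen U) {k : ℕ}
    (φ : Fin k → ℝ → ℂ) (hφ : ∀ i, IsTest (φ i) ∧ tsupport (φ i) ⊆ U) {Jp Jm : Fin k → F.Op}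
    (hJ : ∀ i, IsSmeared S.out (φ i) (Jp i) ∧ IsSmeared S.inc (φ i) (Jm i)) (v : F.union) :
    Tendsto (fun ε => starVec (S.charge ε) φ v) (𝓝[>] 0)
      (𝓝 ((k.factorial : ℂ)⁻¹ • ∑ e : Equiv.Perm (Fin k), ∑ A : Finset (Fin k),
        ((outProd Jp A (List.ofFn e) * inProd Jm A (List.ofFn e)) v : E))) := by
  have h1 : ∀ e : Equiv.Perm (Fin k), Tendsto (fun ε => starVec (S.charge ε) φ v) (𝓝[>] 0)
      (𝓝 (orderedSum Jp Jm (List.ofFn e) v : E)) := fun e => by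
    have := tendsto_starVec S hU k (φ ∘ e) (fun i => hφ (e i)) (Jp ∘ e) (Jm ∘ e)
      (fun i => hJ (e i)) v
    rw [← orderedSum_map, ← List.ofFn_eq_map] at this
    simpa only [starVec_perm] using this
  have h2 := (tendsto_finsetSum Finset.univ fun e _ => h1 e).const_smul ((k.factorial : ℂ)⁻¹)
  have hk : (k.factorial : ℂ) ≠ 0 := Nat.cast_ne_zero.2 k.factorial_ne_zero
  have e1 : ∀ x : E, (k.factorial : ℂ)⁻¹ • ∑ _e : Equiv.Perm (Fin k), x = x := fun x => by
    rw [Finset.sum_const, Finset.card_univ, Fintype.card_perm, Fintype.card_fin,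
      ← Nat.cast_smul_eq_nsmul ℂ, smul_smul, inv_mul_cancel₀ hk, one_smul]
  simp only [e1] at h2
  convert h2 using 3
  have := congrArg (fun a : F.Op => (a v : E)) (sum_orderedSum Jp Jm)
  simpa [LinearMap.sum_apply] using this.symm

end Symmetrized

/-! ### Canonical anticommutation relations -/

section CAR

variable {ι : Type*} [LinearOrder ι]

theorem jwSign_mul_self (i : ι) (Δ : Finset ι) : jwSign i Δ * jwSign i Δ = 1 := by
  rw [jwSign, ← mul_pow]; simp

theorem norm_jwSign (i : ι) (Δ : Finset ι) : ‖jwSign i Δ‖ = 1 := by simp [jwSign]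

theorem jwSign_insert_self (i : ι) (Δ : Finset ι) : jwSign i (insert i Δ) = jwSign i Δ := by
  simp [jwSign, Finset.filter_insert]

theorem jwSign_erase_self (i : ι) (Δ : Finset ι) : jwSign i (Δ.erase i) = jwSign i Δ := by
  rw [jwSign, jwSign]
  congr 2
  ext j
  simp only [Finset.mem_filter, Finset.mem_erase]
  exact ⟨fun h => ⟨h.1.2, h.2⟩, fun h => ⟨⟨h.2.ne, h.1⟩, h.2⟩⟩

theorem jwSign_insert {i j : ι} {Δ : Finset ι} (h : j ∉ Δ) :
    jwSign i (insert j Δ) = (if j < i then -1 else 1) * jwSign i Δ := by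
  rw [jwSign, jwSign, Finset.filter_insert]
  split_ifs with hj
  · rw [Finset.card_insert_of_notMem (by simp [h]), pow_succ]; ring
  · rw [one_mul]

theorem jwSign_erase {i j : ι} {Δ : Finset ι} (h : j ∈ Δ) :
    jwSign i (Δ.erase j) = (if j < i then -1 else 1) * jwSign i Δ := by
  have := jwSign_insert (i := i) (Finset.notMem_erase j Δ)
  rw [Finset.insert_erase h] at this
  rw [this]
  split_ifs <;> ring

/-- `annihilateExc` as a linear map. -/
def annL (i : ι) : Module.End ℂ (Finset ι → ℂ) where
  toFun := annihilateExc i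
  map_add' Ψ Ψ' := by
    funext Δ
    simp only [annihilateExc, Pi.add_apply]
    split_ifs <;> ring
  map_smul' z Ψ := by
    funext Δ
    simp only [annihilateExc, Pi.smul_apply, smul_eq_mul, RingHom.id_apply]
    split_ifs <;> ring

/-- `createExc` as a linear map. -/
def creL (i : ι) : Module.End ℂ (Finset ι → ℂ) where
  toFun := createExc i
  map_add' Ψ Ψ' := by
    funext Δ
    simp only [createExc, Pi.add_apply]
    split_ifs <;> ring
  map_smul' z Ψ := by
    funext Δ
    simp only [createExc, Pi.smul_apply, smul_eq_mul, RingHom.id_apply]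
    split_ifs <;> ring

theorem annL_apply (i : ι) (Ψ : Finset ι → ℂ) (Δ : Finset ι) :
    annL i Ψ Δ = if i ∈ Δ then 0 else jwSign i Δ * Ψ (insert i Δ) := rfl

theorem creL_apply (i : ι) (Ψ : Finset ι → ℂ) (Δ : Finset ι) :
    creL i Ψ Δ = if i ∈ Δ then jwSign i Δ * Ψ (Δ.erase i) else 0 := rfl

/-- The source of all anticommutation signs. Of two distinct modes exactly one precedes the other,
so exactly one of the two Jordan-Wigner signs flips when the order of the operators is exchanged. -/
theorem ite_lt_add_ite_lt {i j : ι} (h : i ≠ j) :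
    (if i < j then (-1 : ℂ) else 1) + (if j < i then -1 else 1) = 0 := by
  rcases lt_or_gt_of_ne h with h' | h'
  · simp [h', h'.not_gt]
  · simp [h', h'.not_gt]

theorem annL_annL (i j : ι) : annL i * annL j + annL j * annL i = 0 := by
  refine LinearMap.ext fun Ψ => funext fun Δ => ?_
  simp only [LinearMap.add_apply, Module.End.mul_apply, Pi.add_apply, LinearMap.zero_apply,
    Pi.zero_apply, annL_apply]
  by_cases hij : i = j
  · subst hij; simp
  by_cases hi : i ∈ Δ
  · simp [hi]
  by_cases hj : j ∈ Δ
  · simp [hj]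
  simp only [hi, hj, Finset.mem_insert, hij, Ne.symm hij, or_self, if_false,
    jwSign_insert hi, jwSign_insert hj, Finset.insert_comm j i]
  linear_combination (jwSign i Δ * jwSign j Δ * Ψ (insert i (insert j Δ))) *
    ite_lt_add_ite_lt hij

theorem creL_creL (i j : ι) : creL i * creL j + creL j * creL i = 0 := by
  refine LinearMap.ext fun Ψ => funext fun Δ => ?_
  simp only [LinearMap.add_apply, Module.End.mul_apply, Pi.add_apply, LinearMap.zero_apply,
    Pi.zero_apply, creL_apply]
  by_cases hij : i = j
  · subst hij; simp
  by_cases hi : i ∈ Δ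
  swap
  · simp [hi]
  by_cases hj : j ∈ Δ
  swap
  · simp [hj]
  simp only [hi, hj, Finset.mem_erase, ne_eq, hij, Ne.symm hij, not_false_eq_true, and_self,
    if_true, jwSign_erase hi, jwSign_erase hj, Finset.erase_right_comm (a := j) (b := i)]
  linear_combination (jwSign i Δ * jwSign j Δ * Ψ ((Δ.erase i).erase j)) *
    ite_lt_add_ite_lt hij

theorem annL_creL_ne {i j : ι} (hij : i ≠ j) : annL i * creL j + creL j * annL i = 0 := by
  refine LinearMap.ext fun Ψ => funext fun Δ => ?_
  simp only [LinearMap.add_apply, Module.End.mul_apply, Pi.add_apply, LinearMap.zero_apply,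
    Pi.zero_apply, annL_apply, creL_apply]
  by_cases hi : i ∈ Δ
  · simp [hi, hij]
  by_cases hj : j ∈ Δ
  swap
  · simp [hi, hj, Ne.symm hij]
  simp only [hi, hj, Finset.mem_insert, Finset.mem_erase, ne_eq, hij, Ne.symm hij,
    not_false_eq_true, and_false, or_true, if_true, if_false, jwSign_insert hi, jwSign_erase hj,
    Finset.erase_insert_of_ne hij]
  linear_combination (jwSign i Δ * jwSign j Δ * Ψ (insert i (Δ.erase j))) *
    ite_lt_add_ite_lt hij

theorem annL_creL_self (i : ι) : annL i * creL i + creL i * annL i = 1 := by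
  refine LinearMap.ext fun Ψ => funext fun Δ => ?_
  simp only [LinearMap.add_apply, Module.End.mul_apply, Pi.add_apply, Module.End.one_apply,
    annL_apply, creL_apply]
  by_cases hi : i ∈ Δ
  · simp [hi, jwSign_erase_self, ← mul_assoc, jwSign_mul_self]
  · simp [hi, jwSign_insert_self, ← mul_assoc, jwSign_mul_self]

variable (ρ : H →L[ℂ] H) (b : HilbertBasis ι ℂ H)

open Classical in
/-- `annihilate` as a linear map. -/
def aL (i : ι) : Module.End ℂ (Finset ι → ℂ) := if ρ (b i) = b i then creL i else annL i

open Classical in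
/-- `create` as a linear map. -/
def aLs (i : ι) : Module.End ℂ (Finset ι → ℂ) := if ρ (b i) = b i then annL i else creL i

theorem aL_apply (i : ι) (Ψ : Finset ι → ℂ) : aL ρ b i Ψ = annihilate ρ b i Ψ := by
  rw [aL, annihilate]; split_ifs <;> rfl

theorem aLs_apply (i : ι) (Ψ : Finset ι → ℂ) : aLs ρ b i Ψ = create ρ b i Ψ := by
  rw [aLs, create]; split_ifs <;> rfl

theorem aL_aL (i j : ι) : aL ρ b i * aL ρ b j + aL ρ b j * aL ρ b i = 0 := by
  by_cases hij : i = j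
  · subst hij
    rw [aL]; split_ifs
    · exact creL_creL i i
    · exact annL_annL i i
  · rw [aL, aL]; split_ifs
    · exact creL_creL i j
    · rw [add_comm]; exact annL_creL_ne (Ne.symm hij)
    · exact annL_creL_ne hij
    · exact annL_annL i j

theorem aLs_aLs (i j : ι) : aLs ρ b i * aLs ρ b j + aLs ρ b j * aLs ρ b i = 0 := by
  by_cases hij : i = j
  · subst hij
    rw [aLs]; split_ifs
    · exact annL_annL i i
    · exact creL_creL i i
  · rw [aLs, aLs]; split_ifs
    · exact annL_annL i j
    · exact annL_creL_ne hij
    · rw [add_comm]; exact annL_creL_ne (Ne.symm hij)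
    · exact creL_creL i j

open Classical in
theorem aL_aLs (i j : ι) :
    aL ρ b i * aLs ρ b j + aLs ρ b j * aL ρ b i = if i = j then 1 else 0 := by
  by_cases hij : i = j
  · subst hij
    rw [aL, aLs, if_pos rfl]; split_ifs
    · rw [add_comm]; exact annL_creL_self i
    · exact annL_creL_self i
  · rw [aL, aLs, if_neg hij]; split_ifs
    · rw [add_comm]; exact annL_creL_ne (Ne.symm hij)
    · exact creL_creL i j
    · exact annL_annL i j
    · exact annL_creL_ne hij

open Classical in
/-- `bilinear` as a linear map. -/
def biL (p : ι × ι) : Module.End ℂ (Finset ι → ℂ) :=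
  aLs ρ b p.1 * aL ρ b p.2 - (if p.1 = p.2 ∧ ρ (b p.1) = b p.1 then (1 : ℂ) else 0) • 1

theorem biL_apply (p : ι × ι) (Ψ : Finset ι → ℂ) : biL ρ b p Ψ = bilinear ρ b p.1 p.2 Ψ := by
  rw [bilinear, ← aL_apply, ← aLs_apply]
  simp only [biL, LinearMap.sub_apply, Module.End.mul_apply, LinearMap.smul_apply,
    Module.End.one_apply]

-- The commutator is a_i* {a_j, a_k*} - {a_i*, a_k*} a_j, and the subtracted expectation value drops
-- out.
open Classical in
theorem biL_comm_aLs (p : ι × ι) (k : ι) :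
    biL ρ b p * aLs ρ b k - aLs ρ b k * biL ρ b p = if p.2 = k then aLs ρ b p.1 else 0 := by
  have h1 := aL_aLs ρ b p.2 k
  have h2 := aLs_aLs ρ b p.1 k
  have e : biL ρ b p * aLs ρ b k - aLs ρ b k * biL ρ b p =
      aLs ρ b p.1 * (aL ρ b p.2 * aLs ρ b k + aLs ρ b k * aL ρ b p.2) -
      (aLs ρ b p.1 * aLs ρ b k + aLs ρ b k * aLs ρ b p.1) * aL ρ b p.2 := by
    simp only [biL, sub_mul, mul_sub, smul_mul_assoc, mul_smul_comm, one_mul, mul_one]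
    noncomm_ring
  rw [e, h1, h2]
  split_ifs <;> simp

open Classical in
theorem biL_comm_aL (p : ι × ι) (k : ι) :
    biL ρ b p * aL ρ b k - aL ρ b k * biL ρ b p = if p.1 = k then -aL ρ b p.2 else 0 := by
  have h1 := aL_aLs ρ b k p.1
  have h2 := aL_aL ρ b p.2 k
  have e : biL ρ b p * aL ρ b k - aL ρ b k * biL ρ b p =
      aLs ρ b p.1 * (aL ρ b p.2 * aL ρ b k + aL ρ b k * aL ρ b p.2) -
      (aL ρ b k * aLs ρ b p.1 + aLs ρ b p.1 * aL ρ b k) * aL ρ b p.2 := by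
    simp only [biL, sub_mul, mul_sub, smul_mul_assoc, mul_smul_comm, one_mul, mul_one]
    noncomm_ring
  rw [e, h1, h2]
  by_cases h : p.1 = k
  · simp [h]
  · simp [h, Ne.symm h]

theorem biL_of_empty_empty {p : ι × ι} (h1 : ρ (b p.1) ≠ b p.1) (h2 : ρ (b p.2) ≠ b p.2) :
    biL ρ b p = creL p.1 * annL p.2 := by simp [biL, aL, aLs, h1, h2]

theorem biL_of_empty_occ {p : ι × ι} (h1 : ρ (b p.1) ≠ b p.1) (h2 : ρ (b p.2) = b p.2) :
    biL ρ b p = creL p.1 * creL p.2 := by simp [biL, aL, aLs, h1, h2]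

theorem biL_of_occ_empty {p : ι × ι} (h1 : ρ (b p.1) = b p.1) (h2 : ρ (b p.2) ≠ b p.2) :
    biL ρ b p = annL p.1 * annL p.2 := by
  have : p.1 ≠ p.2 := fun h => h2 (h ▸ h1)
  simp [biL, aL, aLs, h1, h2, this]

/-- Between occupied modes the subtracted expectation is the contraction that normal orders the
product, at the price of a sign. -/
theorem biL_of_occ_occ {p : ι × ι} (h1 : ρ (b p.1) = b p.1) (h2 : ρ (b p.2) = b p.2) :
    biL ρ b p = -(creL p.2 * annL p.1) := by
  by_cases h : p.1 = p.2
  · have e := annL_creL_self p.2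
    simp only [biL, aL, aLs, h, h2, if_true, and_self, one_smul]
    rw [← e]; abel
  · have e := annL_creL_ne h
    simp only [biL, aL, aLs, h, h1, h2, if_true, false_and, if_false, zero_smul, sub_zero]
    exact eq_neg_of_add_eq_zero_left e

end CAR

/-! ### Square sums -/

section SquareSum

variable {α β : Type*}

/-- The sum of the squared absolute values. -/
def sqSum (f : α → ℂ) : ℝ≥0∞ := ∑' a, ‖f a‖ₑ ^ 2

theorem tsum_mul_sq_le (f g : α → ℝ≥0∞) :
    (∑' a, f a * g a) ^ 2 ≤ (∑' a, f a ^ 2) * ∑' a, g a ^ 2 := by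
  have h : ∑' a, f a * g a ≤ (∑' a, f a ^ 2) ^ (1 / 2 : ℝ) * (∑' a, g a ^ 2) ^ (1 / 2 : ℝ) := by
    rw [ENNReal.tsum_eq_iSup_sum]
    refine iSup_le fun s => ?_
    refine (ENNReal.inner_le_Lp_mul_Lq s f g Real.HolderConjugate.two_two).trans ?_
    simp only [ENNReal.rpow_ofNat]
    gcongr
    · exact ENNReal.sum_le_tsum s
    · exact ENNReal.sum_le_tsum s
  refine (pow_le_pow_left₀ (zero_le) h 2).trans (le_of_eq ?_)
  rw [mul_pow, ← ENNReal.rpow_natCast, ← ENNReal.rpow_natCast, ← ENNReal.rpow_mul,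
    ← ENNReal.rpow_mul]
  norm_num

theorem tsum_sq_le_card [DecidableEq α] (s : Finset α) {f : α → ℝ≥0∞} (h : ∀ a ∉ s, f a = 0) :
    (∑' a, f a) ^ 2 ≤ s.card * ∑' a, f a ^ 2 := by
  have e : ∀ a, f a = (if a ∈ s then 1 else 0) * f a := fun a => by
    by_cases ha : a ∈ s <;> simp [ha, h a]
  have h1 := tsum_mul_sq_le (fun a => if a ∈ s then (1 : ℝ≥0∞) else 0) f
  simp only [← e] at h1
  refine h1.trans (le_of_eq ?_)
  congr 1
  rw [tsum_eq_sum (s := s) fun a ha => by simp [ha]]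
  rw [Finset.sum_congr rfl fun a ha => by rw [if_pos ha, one_pow]]
  simp

theorem summable_of_tsum_enorm {f : α → ℂ} (h : ∑' a, ‖f a‖ₑ ≠ ⊤) : Summable f :=
  (tsum_enorm_ne_top_iff_summable_norm.1 h).of_norm

theorem sqSum_ne_top_iff {f : α → ℂ} : sqSum f ≠ ⊤ ↔ Memℓp f 2 := by
  rw [memℓp_gen_iff (by norm_num)]
  have : ∀ a, ‖f a‖ₑ ^ 2 = ‖‖f a‖ ^ 2‖ₑ := fun a => by rw [enorm_pow, enorm_norm]
  simp only [sqSum, this]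
  rw [tsum_enorm_ne_top_iff_summable_norm]
  simp

theorem sqSum_lp (Ψ : lp (fun _ : α => ℂ) 2) : sqSum (Ψ : α → ℂ) = ‖Ψ‖ₑ ^ 2 := by
  have h1 := lp.norm_rpow_eq_tsum (p := 2) (by norm_num) Ψ
  have h2 : Summable fun a => ‖Ψ a‖ ^ 2 := by
    have := (lp.memℓp Ψ).summable (by norm_num)
    simpa using this
  simp only [ENNReal.toReal_ofNat, Real.rpow_ofNat] at h1
  have e : ∀ x : ℂ, ‖x‖ₑ ^ 2 = ENNReal.ofReal (‖x‖ ^ 2) := fun x => by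
    rw [ENNReal.ofReal_pow (norm_nonneg _), ofReal_norm]
  rw [← ofReal_norm, ← ENNReal.ofReal_pow (norm_nonneg _), h1,
    ENNReal.ofReal_tsum_of_nonneg (fun _ => by positivity) h2]
  simp only [sqSum, e]

theorem add_sq_le_two (x y : ℝ≥0∞) : (x + y) ^ 2 ≤ 2 * (x ^ 2 + y ^ 2) := by
  have h := ENNReal.rpow_add_le_mul_rpow_add_rpow x y (p := 2) (by norm_num)
  have : (2 : ℝ) - 1 = 1 := by norm_num
  simpa [this] using h

theorem sqSum_add_le (f g : α → ℂ) : sqSum (f + g) ≤ 2 * (sqSum f + sqSum g) := by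
  rw [sqSum, sqSum, sqSum, ← ENNReal.tsum_add, ← ENNReal.tsum_mul_left]
  refine ENNReal.tsum_le_tsum fun a => ?_
  exact (pow_le_pow_left₀ zero_le (enorm_add_le _ _) 2).trans (add_sq_le_two _ _)

theorem sqSum_neg (f : α → ℂ) : sqSum (-f) = sqSum f := by simp [sqSum]

theorem enorm_tsum_mul_sq_le (x y : α → ℂ) :
    (∑' a, ‖x a * y a‖ₑ) ^ 2 ≤ sqSum x * sqSum y := by
  simp only [enorm_mul]
  exact tsum_mul_sq_le _ _

theorem tsum_enorm_mul_ne_top {x y : α → ℂ} (hx : sqSum x ≠ ⊤) (hy : sqSum y ≠ ⊤) :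
    ∑' a, ‖x a * y a‖ₑ ≠ ⊤ := fun h => by
  have := enorm_tsum_mul_sq_le x y
  rw [h] at this
  simp only [ne_eq, OfNat.ofNat_ne_zero, not_false_eq_true, ENNReal.top_pow, top_le_iff] at this
  exact ENNReal.mul_ne_top hx hy this

end SquareSum

/-! ### Number bounds -/

section Number

variable {ι : Type*} [LinearOrder ι]

/-- At most `N` excitations. -/
def ExcLE (N : ℕ) (Ψ : Finset ι → ℂ) : Prop := ∀ Δ : Finset ι, N < Δ.card → Ψ Δ = 0

/-- Add `j` if it is absent, remove it if it is present. -/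
def toggle (j : ι) (Δ : Finset ι) : Finset ι := if j ∈ Δ then Δ.erase j else insert j Δ

theorem toggle_involutive (j : ι) : Function.Involutive (toggle j) := fun Δ => by
  by_cases h : j ∈ Δ <;> simp [toggle, h, Finset.insert_erase]

theorem mem_toggle (j : ι) (Δ : Finset ι) : j ∈ toggle j Δ ↔ j ∉ Δ := by
  by_cases h : j ∈ Δ <;> simp [toggle, h]

theorem tsum_toggle (j : ι) (f : Finset ι → ℝ≥0∞) : ∑' Δ, f (toggle j Δ) = ∑' Δ, f Δ :=
  (toggle_involutive j).toPerm.tsum_eq f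

theorem enorm_annL (j : ι) (Ψ : Finset ι → ℂ) (Δ : Finset ι) :
    ‖annL j Ψ Δ‖ₑ ^ 2 = if j ∈ toggle j Δ then ‖Ψ (toggle j Δ)‖ₑ ^ 2 else 0 := by
  have h1 : ‖jwSign j Δ‖ₑ = 1 := by rw [← ofReal_norm, norm_jwSign]; simp
  by_cases h : j ∈ Δ
  · simp [annL_apply, mem_toggle, h]
  · simp [annL_apply, h, enorm_mul, h1, toggle]

theorem enorm_creL (j : ι) (Ψ : Finset ι → ℂ) (Δ : Finset ι) :
    ‖creL j Ψ Δ‖ₑ ^ 2 = if j ∈ toggle j Δ then 0 else ‖Ψ (toggle j Δ)‖ₑ ^ 2 := by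
  have h1 : ‖jwSign j Δ‖ₑ = 1 := by rw [← ofReal_norm, norm_jwSign]; simp
  by_cases h : j ∈ Δ
  · simp [creL_apply, h, enorm_mul, h1, toggle]
  · simp [creL_apply, mem_toggle, h]

theorem sqSum_annL (j : ι) (Ψ : Finset ι → ℂ) :
    sqSum (annL j Ψ) = ∑' Δ : Finset ι, if j ∈ Δ then ‖Ψ Δ‖ₑ ^ 2 else 0 := by
  simp only [sqSum, enorm_annL]
  exact tsum_toggle j fun Δ => if j ∈ Δ then ‖Ψ Δ‖ₑ ^ 2 else 0

theorem sqSum_creL (j : ι) (Ψ : Finset ι → ℂ) :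
    sqSum (creL j Ψ) = ∑' Δ : Finset ι, if j ∈ Δ then 0 else ‖Ψ Δ‖ₑ ^ 2 := by
  simp only [sqSum, enorm_creL]
  exact tsum_toggle j fun Δ => if j ∈ Δ then 0 else ‖Ψ Δ‖ₑ ^ 2

theorem sqSum_creL_le (j : ι) (Ψ : Finset ι → ℂ) : sqSum (creL j Ψ) ≤ sqSum Ψ := by
  rw [sqSum_creL]
  exact ENNReal.tsum_le_tsum fun Δ => by split_ifs <;> simp

/-- The left side is the expectation of the number operator, since every Δ is counted once for each
of its elements. -/
theorem tsum_sqSum_annL_le {N : ℕ} {Ψ : Finset ι → ℂ} (h : ExcLE N Ψ) :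
    ∑' j, sqSum (annL j Ψ) ≤ N * sqSum Ψ := by
  simp only [sqSum_annL]
  rw [ENNReal.tsum_comm, sqSum, ← ENNReal.tsum_mul_left]
  refine ENNReal.tsum_le_tsum fun Δ => ?_
  rw [tsum_eq_sum (s := Δ) fun j hj => by simp [hj], Finset.sum_congr rfl fun j hj => if_pos hj,
    Finset.sum_const, nsmul_eq_mul]
  by_cases hΔ : Δ.card ≤ N
  · gcongr
  · simp [h Δ (not_le.1 hΔ)]

theorem ExcLE.annL {N : ℕ} {Ψ : Finset ι → ℂ} (h : ExcLE (N + 1) Ψ) (j : ι) :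
    ExcLE N (annL j Ψ) := fun Δ hΔ => by
  rw [annL_apply]
  split_ifs with hj
  · rfl
  · rw [h _ (by rw [Finset.card_insert_of_notMem hj]; omega), mul_zero]

omit [LinearOrder ι] in
theorem ExcLE.mono {N M : ℕ} {Ψ : Finset ι → ℂ} (h : ExcLE N Ψ) (hNM : N ≤ M) : ExcLE M Ψ :=
  fun Δ hΔ => h Δ (by omega)

theorem ExcLE.annL' {N : ℕ} {Ψ : Finset ι → ℂ} (h : ExcLE N Ψ) (j : ι) :
    ExcLE N (ScatteringModel.annL j Ψ) := (h.mono (Nat.le_succ N)).annL j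

theorem ExcLE.creL {N : ℕ} {Ψ : Finset ι → ℂ} (h : ExcLE N Ψ) (j : ι) :
    ExcLE (N + 1) (creL j Ψ) := fun Δ hΔ => by
  rw [creL_apply]
  split_ifs with hj
  · rw [h _ (by rw [Finset.card_erase_of_mem hj]; omega), mul_zero]
  · rfl

theorem annL_eq_zero {N : ℕ} {Ψ : Finset ι → ℂ} (h : ExcLE N Ψ) (j : ι) {Δ : Finset ι}
    (hΔ : N ≤ Δ.card) : annL j Ψ Δ = 0 := by
  rw [annL_apply]
  split_ifs with hj
  · rfl
  · rw [h _ (by rw [Finset.card_insert_of_notMem hj]; omega), mul_zero]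

/-! ### Bounds on quadratic expressions -/

/-- Pair annihilation with square summable coefficients. -/
theorem pair_annihilation_bound {N : ℕ} {Ψ : Finset ι → ℂ} (h : ExcLE N Ψ) (x : ι × ι → ℂ) :
    ∑' Δ : Finset ι, (∑' p, ‖x p * (annL p.1 * annL p.2) Ψ Δ‖ₑ) ^ 2 ≤
      N ^ 2 * sqSum x * sqSum Ψ := by
  have h1 : ∀ Δ : Finset ι, (∑' p, ‖x p * (annL p.1 * annL p.2) Ψ Δ‖ₑ) ^ 2 ≤
      sqSum x * sqSum (fun p : ι × ι => (annL p.1 * annL p.2) Ψ Δ) := fun Δ =>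
    enorm_tsum_mul_sq_le x fun p => (annL p.1 * annL p.2) Ψ Δ
  refine (ENNReal.tsum_le_tsum h1).trans ?_
  rw [ENNReal.tsum_mul_left]
  have h2 : ∑' Δ : Finset ι, sqSum (fun p : ι × ι => (annL p.1 * annL p.2) Ψ Δ) =
      ∑' j, ∑' i, sqSum (annL i (annL j Ψ)) := by
    simp only [sqSum]
    rw [ENNReal.tsum_comm, ENNReal.tsum_prod', ENNReal.tsum_comm]
    rfl
  rw [h2]
  have h3 : ∑' j, ∑' i, sqSum (annL i (annL j Ψ)) ≤ N * (N * sqSum Ψ) := by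
    calc ∑' j, ∑' i, sqSum (annL i (annL j Ψ)) ≤ ∑' j, N * sqSum (annL j Ψ) :=
          ENNReal.tsum_le_tsum fun j => tsum_sqSum_annL_le (h.annL' j)
      _ = N * ∑' j, sqSum (annL j Ψ) := ENNReal.tsum_mul_left
      _ ≤ _ := by gcongr; exact tsum_sqSum_annL_le h
  refine (mul_le_mul_right h3 _).trans (le_of_eq ?_)
  ring

/-- Pair creation with square summable coefficients. -/
theorem pair_creation_bound {N : ℕ} {Ψ : Finset ι → ℂ} (h : ExcLE N Ψ) (x : ι × ι → ℂ) :
    ∑' Δ : Finset ι, (∑' p, ‖x p * (creL p.1 * creL p.2) Ψ Δ‖ₑ) ^ 2 ≤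
      (N + 2) ^ 2 * sqSum x * sqSum Ψ := by
  have h1 : ∀ Δ : Finset ι, (∑' p, ‖x p * (creL p.1 * creL p.2) Ψ Δ‖ₑ) ^ 2 ≤
      (N + 2) ^ 2 * ∑' p, ‖x p * (creL p.1 * creL p.2) Ψ Δ‖ₑ ^ 2 := fun Δ => by
    by_cases hΔ : Δ.card ≤ N + 2
    -- At a fixed Δ only pairs inside Δ × Δ contribute, at most (N + 2)² of them, so Cauchy-Schwarz
    -- bounds the square of the sum by the sum of squares.
    · refine (tsum_sq_le_card (Δ ×ˢ Δ) fun p hp => ?_).trans ?_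
      · have : (creL p.1 * creL p.2) Ψ Δ = 0 := by
          simp only [Module.End.mul_apply, creL_apply]
          by_cases h1 : p.1 ∈ Δ
          · have h2 : p.2 ∉ Δ := fun h2 => hp (Finset.mem_product.2 ⟨h1, h2⟩)
            simp [h2]
          · simp [h1]
        simp [this]
      · rw [Finset.card_product]
        gcongr
        have : (Δ.card : ℝ≥0∞) ≤ N + 2 := by exact_mod_cast hΔ
        push_cast
        rw [sq]
        gcongr
    · have : ∀ p : ι × ι, (creL p.1 * creL p.2) Ψ Δ = 0 := fun p =>
        ((h.creL p.2).creL p.1) Δ (by omega)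
      simp [this]
  refine (ENNReal.tsum_le_tsum h1).trans ?_
  rw [ENNReal.tsum_mul_left, mul_assoc, ENNReal.tsum_comm]
  gcongr
  rw [sqSum, ← ENNReal.tsum_mul_right]
  refine ENNReal.tsum_le_tsum fun p => ?_
  simp only [enorm_mul, mul_pow, ENNReal.tsum_mul_left]
  gcongr
  exact (sqSum_creL_le p.1 (creL p.2 Ψ)).trans (sqSum_creL_le p.2 Ψ)

/-- The matrix `B` acts boundedly on square summable sequences. -/
def MatBound (B : ι → ι → ℂ) (c : ℝ≥0∞) : Prop :=
  ∀ x : ι → ℂ, sqSum x ≠ ⊤ → (∀ i, ∑' j, ‖B i j * x j‖ₑ ≠ ⊤) ∧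
    ∑' i, ‖∑' j, B i j * x j‖ₑ ^ 2 ≤ c ^ 2 * sqSum x

theorem number_preserving_summable {N : ℕ} {Ψ : Finset ι → ℂ} (h : ExcLE N Ψ)
    (hΨ : sqSum Ψ ≠ ⊤) {B : ι → ι → ℂ} {c : ℝ≥0∞} (hB : MatBound B c) (Δ : Finset ι) :
    ∑' p : ι × ι, ‖B p.1 p.2 * (creL p.1 * annL p.2) Ψ Δ‖ₑ ≠ ⊤ := by
  have hs : ∀ Δ' : Finset ι, sqSum (fun j => annL j Ψ Δ') ≠ ⊤ := fun Δ' => by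
    refine ne_top_of_le_ne_top (ENNReal.mul_ne_top (ENNReal.natCast_ne_top N) hΨ)
      (le_trans ?_ (tsum_sqSum_annL_le h))
    exact ENNReal.tsum_le_tsum fun j => ENNReal.le_tsum (f := fun Δ' => ‖annL j Ψ Δ'‖ₑ ^ 2) Δ'
  rw [ENNReal.tsum_prod', tsum_eq_sum (s := Δ) fun i hi => by
    simp [Module.End.mul_apply, creL_apply, hi]]
  refine ENNReal.sum_ne_top.2 fun i hi => ?_
  have h1 : ‖jwSign i Δ‖ₑ = 1 := by rw [← ofReal_norm, norm_jwSign]; simp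
  have := (hB _ (hs (Δ.erase i))).1 i
  simpa [Module.End.mul_apply, creL_apply, hi, enorm_mul, h1] using this

/-- Number preserving operators. -/
theorem number_preserving_bound {N : ℕ} {Ψ : Finset ι → ℂ} (h : ExcLE N Ψ) (hΨ : sqSum Ψ ≠ ⊤)
    {B : ι → ι → ℂ} {c : ℝ≥0∞} (hB : MatBound B c) :
    sqSum (fun Δ => ∑' p : ι × ι, B p.1 p.2 * (creL p.1 * annL p.2) Ψ Δ) ≤
      (c * N) ^ 2 * sqSum Ψ := by
  have hs : ∀ Δ' : Finset ι, sqSum (fun j => annL j Ψ Δ') ≠ ⊤ := fun Δ' => by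
    refine ne_top_of_le_ne_top (ENNReal.mul_ne_top (ENNReal.natCast_ne_top N) hΨ)
      (le_trans ?_ (tsum_sqSum_annL_le h))
    exact ENNReal.tsum_le_tsum fun j => ENNReal.le_tsum (f := fun Δ' => ‖annL j Ψ Δ'‖ₑ ^ 2) Δ'
  -- The operator is a sum of creations applied to w i. For each Δ, `MatBound` is used on the
  -- sequence of the values of annL j Ψ at Δ, whose total square sum is the number expectation.
  set w : ι → Finset ι → ℂ := fun i Δ => ∑' j, B i j * annL j Ψ Δ with hw
  have e : ∀ Δ : Finset ι, ∑' p : ι × ι, B p.1 p.2 * (creL p.1 * annL p.2) Ψ Δ =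
      ∑' i, creL i (w i) Δ := fun Δ => by
    have hsum := summable_of_tsum_enorm (number_preserving_summable h hΨ hB Δ)
    rw [hsum.tsum_prod]
    refine tsum_congr fun i => ?_
    simp only [hw, creL_apply, Module.End.mul_apply]
    split_ifs
    · rw [← tsum_mul_left]
      exact tsum_congr fun j => by ring
    · simp
  have h1 : ∀ Δ : Finset ι, ‖∑' i, creL i (w i) Δ‖ₑ ^ 2 ≤ N * ∑' i, ‖creL i (w i) Δ‖ₑ ^ 2 :=
    fun Δ => by
    by_cases hΔ : Δ.card ≤ N
    · refine (pow_le_pow_left₀ zero_le enorm_tsum_le_tsum_enorm 2).trans ?_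
      refine (tsum_sq_le_card Δ fun i hi => by simp [creL_apply, hi]).trans ?_
      gcongr
    · have : ∀ i, creL i (w i) Δ = 0 := fun i => by
        rw [creL_apply]
        split_ifs with hi
        · have : ∀ j, annL j Ψ (Δ.erase i) = 0 := fun j =>
            annL_eq_zero h j (by rw [Finset.card_erase_of_mem hi]; omega)
          simp [hw, this]
        · rfl
      simp [this]
  simp only [sqSum, e]
  refine (ENNReal.tsum_le_tsum h1).trans ?_
  rw [ENNReal.tsum_mul_left, ENNReal.tsum_comm]
  have h2 : ∑' i, ∑' Δ, ‖creL i (w i) Δ‖ₑ ^ 2 ≤ ∑' i, ∑' Δ, ‖w i Δ‖ₑ ^ 2 :=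
    ENNReal.tsum_le_tsum fun i => sqSum_creL_le i (w i)
  have h3 : ∑' i, ∑' Δ, ‖w i Δ‖ₑ ^ 2 ≤ c ^ 2 * (N * sqSum Ψ) := by
    rw [ENNReal.tsum_comm]
    calc ∑' Δ, ∑' i, ‖w i Δ‖ₑ ^ 2 ≤ ∑' Δ, c ^ 2 * sqSum (fun j => annL j Ψ Δ) :=
          ENNReal.tsum_le_tsum fun Δ => (hB _ (hs Δ)).2
      _ = c ^ 2 * ∑' j, sqSum (annL j Ψ) := by
          rw [ENNReal.tsum_mul_left]
          congr 1
          simp only [sqSum]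
          rw [ENNReal.tsum_comm]
      _ ≤ _ := by gcongr; exact tsum_sqSum_annL_le h
  refine (mul_le_mul_right (h2.trans h3) _).trans (le_of_eq ?_)
  simp only [sqSum]
  ring

end Number

/-! ### Matrix elements of bounded operators -/

section HatBounds

variable {ι : Type*}

theorem sqSum_inner (b : HilbertBasis ι ℂ H) (y : H) : sqSum (fun i => ⟪b i, y⟫_ℂ) = ‖y‖ₑ ^ 2 := by
  rw [show (fun i => ⟪b i, y⟫_ℂ) = (b.repr y : ι → ℂ) from
    funext fun i => (b.repr_apply_apply y i).symm, sqSum_lp, ← ofReal_norm, ← ofReal_norm, LinearIsometryEquiv.norm_map]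

theorem sqSum_star (f : ι → ℂ) : sqSum (fun i => star (f i)) = sqSum f := by
  have : ∀ z : ℂ, ‖star z‖ₑ = ‖z‖ₑ := fun z => by rw [← ofReal_norm, ← ofReal_norm, norm_star]
  simp only [sqSum, this]

theorem sqSum_mono {f g : ι → ℂ} (h : ∀ i, ‖f i‖ ≤ ‖g i‖) : sqSum f ≤ sqSum g :=
  ENNReal.tsum_le_tsum fun i => pow_le_pow_left₀ zero_le (enorm_le_iff_norm_le.2 (h i)) 2

theorem sqSum_inner_left (b : HilbertBasis ι ℂ H) (y : H) :
    sqSum (fun i => ⟪y, b i⟫_ℂ) = ‖y‖ₑ ^ 2 := by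
  rw [← sqSum_inner b y, ← sqSum_star]
  congr 1
  funext i
  exact inner_conj_symm _ _

variable [LinearOrder ι]

-- A square summable sequence is the coordinate sequence of a vector y, and the matrix sends it to
-- the coordinates of T y.
omit [LinearOrder ι] in
theorem matBound_inner (b : HilbertBasis ι ℂ H) (T : H →L[ℂ] H) :
    MatBound (fun i j => ⟪b i, T (b j)⟫_ℂ) ‖T‖ₑ := by
  intro x hx
  have hs : ∀ i, ∑' j, ‖⟪b i, T (b j)⟫_ℂ * x j‖ₑ ≠ ⊤ := fun i => by
    refine tsum_enorm_mul_ne_top ?_ hx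
    simp only [← ContinuousLinearMap.adjoint_inner_left]
    rw [sqSum_inner_left]
    exact ENNReal.pow_ne_top (by simp)
  refine ⟨hs, ?_⟩
  set X : lp (fun _ : ι => ℂ) 2 := ⟨x, sqSum_ne_top_iff.1 hx⟩
  set y := b.repr.symm X
  have hy : HasSum (fun j => x j • b j) y := b.hasSum_repr_symm X
  have h1 : ∀ i, ∑' j, ⟪b i, T (b j)⟫_ℂ * x j = ⟪b i, T y⟫_ℂ := fun i => by
    have := (hy.mapL (innerSL ℂ (b i) ∘L T)).tsum_eq
    rw [← show _ = ⟪b i, T y⟫_ℂ from this]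
    refine tsum_congr fun j => ?_
    simp [mul_comm]
  simp only [h1]
  have h2 := sqSum_inner b (T y)
  simp only [sqSum] at h2 ⊢
  rw [h2]
  have h3 : ‖y‖ₑ ^ 2 = sqSum x := by
    rw [← ofReal_norm, LinearIsometryEquiv.norm_map, ofReal_norm, ← sqSum_lp]
  simp only [sqSum] at h3
  rw [← h3, ← mul_pow]
  refine pow_le_pow_left₀ zero_le ?_ 2
  rw [← ofReal_norm, ← ofReal_norm, ← ofReal_norm, ← ENNReal.ofReal_mul (norm_nonneg _)]
  exact ENNReal.ofReal_le_ofReal (T.le_opNorm y)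

omit [LinearOrder ι] in
theorem MatBound.star {B : ι → ι → ℂ} {c : ℝ≥0∞} (h : MatBound B c) :
    MatBound (fun i j => star (B i j)) c := by
  intro x hx
  have hx' : sqSum (fun i => Star.star (x i)) ≠ ⊤ := by rwa [sqSum_star]
  have hn : ∀ z : ℂ, ‖Star.star z‖ₑ = ‖z‖ₑ := fun z => by
    rw [← ofReal_norm, ← ofReal_norm, norm_star]
  have e : ∀ i j, Star.star (B i j) * x j = Star.star (B i j * Star.star (x j)) := fun i j => by
    simp [mul_comm]
  obtain ⟨h1, h2⟩ := h _ hx'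
  refine ⟨fun i => ?_, ?_⟩
  · simp only [e, hn]; exact h1 i
  · simp only [e, ← tsum_star, hn]
    rwa [sqSum_star] at h2

open Classical in
omit [LinearOrder ι] in
theorem MatBound.restrict {B : ι → ι → ℂ} {c : ℝ≥0∞} (h : MatBound B c) (s : ι → Prop) :
    MatBound (fun i j => if s i ∧ s j then B i j else 0) c := by
  intro x hx
  set x' : ι → ℂ := fun j => if s j then x j else 0 with hx'
  have hle : sqSum x' ≤ sqSum x := sqSum_mono fun i => by
    simp only [hx']; split_ifs <;> simp
  obtain ⟨h1, h2⟩ := h x' (ne_top_of_le_ne_top hx hle)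
  have e : ∀ i j, (if s i ∧ s j then B i j else 0) * x j = if s i then B i j * x' j else 0 :=
    fun i j => by by_cases hi : s i <;> by_cases hj : s j <;> simp [hx', hi, hj]
  simp only [e]
  refine ⟨fun i => ?_, ?_⟩
  · by_cases hi : s i
    · simpa [hi] using h1 i
    · simp [hi]
  · refine le_trans (ENNReal.tsum_le_tsum fun i => ?_) (h2.trans (by gcongr))
    by_cases hi : s i <;> simp [hi]

end HatBounds

/-- A projection together with an adapted orthonormal basis. -/
structure Sea (ι : Type*) where
  ρ : H →L[ℂ] H
  b : HilbertBasis ι ℂ H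
  symm : ∀ x y : H, ⟪ρ x, y⟫_ℂ = ⟪x, ρ y⟫_ℂ
  adapted : Adapted ρ b

namespace Sea

variable {ι : Type*} (s : Sea ι)

/-- The mode `i` is occupied. -/
def Occ (i : ι) : Prop := s.ρ (s.b i) = s.b i

variable {s}

theorem apply_of_not_occ {i : ι} (h : ¬ s.Occ i) : s.ρ (s.b i) = 0 :=
  (s.adapted i).resolve_left h

variable (s)

/-- Matrix elements. -/
def mat (A : H →L[ℂ] H) (p : ι × ι) : ℂ := ⟪s.b p.1, A (s.b p.2)⟫_ℂ

/-- Matrix elements of the commutator with `ρ`. -/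
def comMat (A : H →L[ℂ] H) (p : ι × ι) : ℂ :=
  ⟪s.b p.1, A (s.ρ (s.b p.2)) - s.ρ (A (s.b p.2))⟫_ℂ

/-- The squared Hilbert-Schmidt norm of the commutator with `ρ`. -/
def hsSq (A : H →L[ℂ] H) : ℝ≥0∞ := ∑' i, ‖A (s.ρ (s.b i)) - s.ρ (A (s.b i))‖ₑ ^ 2

theorem sqSum_comMat (A : H →L[ℂ] H) : sqSum (s.comMat A) = s.hsSq A := by
  rw [sqSum, ENNReal.tsum_prod', ENNReal.tsum_comm, hsSq]
  refine tsum_congr fun j => ?_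
  have := sqSum_inner s.b (A (s.ρ (s.b j)) - s.ρ (A (s.b j)))
  rwa [sqSum] at this

theorem implementable_iff {A : H →L[ℂ] H} : Implementable s.ρ s.b A ↔ s.hsSq A ≠ ⊤ := by
  have : ∀ i, ‖A (s.ρ (s.b i)) - s.ρ (A (s.b i))‖ₑ ^ 2 =
      ‖‖A (s.ρ (s.b i)) - s.ρ (A (s.b i))‖ ^ 2‖ₑ := fun a => by rw [enorm_pow, enorm_norm]
  simp only [hsSq, this]
  rw [tsum_enorm_ne_top_iff_summable_norm, Implementable]
  simp

/-- The commutator with ρ keeps, up to sign, exactly the blocks of A that connect occupied and empty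
modes. This is why its Hilbert-Schmidt norm governs pair creation and annihilation. -/
theorem comMat_empty_occ (A : H →L[ℂ] H) {p : ι × ι} (h1 : ¬ s.Occ p.1) (h2 : s.Occ p.2) :
    s.comMat A p = s.mat A p := by
  rw [comMat, show s.ρ (s.b p.2) = s.b p.2 from h2, inner_sub_right, ← s.symm,
    apply_of_not_occ h1]
  simp [mat]

theorem comMat_occ_empty (A : H →L[ℂ] H) {p : ι × ι} (h1 : s.Occ p.1) (h2 : ¬ s.Occ p.2) :
    s.comMat A p = -s.mat A p := by
  rw [comMat, apply_of_not_occ h2, inner_sub_right, ← s.symm, show s.ρ (s.b p.1) = s.b p.1 from h1]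
  simp [mat]

variable [LinearOrder ι]

open Classical in
/-- Entries between empty modes. -/
def matEE (A : H →L[ℂ] H) (p : ι × ι) : ℂ := if ¬ s.Occ p.1 ∧ ¬ s.Occ p.2 then s.mat A p else 0

open Classical in
/-- Entries from an occupied to an empty mode. -/
def matEO (A : H →L[ℂ] H) (p : ι × ι) : ℂ := if ¬ s.Occ p.1 ∧ s.Occ p.2 then s.mat A p else 0

open Classical in
/-- Entries from an empty to an occupied mode. -/
def matOE (A : H →L[ℂ] H) (p : ι × ι) : ℂ := if s.Occ p.1 ∧ ¬ s.Occ p.2 then s.mat A p else 0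

open Classical in
/-- Entries between occupied modes. -/
def matOO (A : H →L[ℂ] H) (p : ι × ι) : ℂ := if s.Occ p.1 ∧ s.Occ p.2 then s.mat A p else 0

/-- The normal-ordered form by blocks. Diagonal blocks preserve the number of excitations, the
empty-occupied block creates pairs, and the occupied-empty block annihilates them. -/
theorem hatTerm_eq (A : H →L[ℂ] H) (Ψ : Finset ι → ℂ) (Δ : Finset ι) (p : ι × ι) :
    hatTerm s.ρ s.b A Ψ Δ p = (s.matEE A p * (creL p.1 * annL p.2) Ψ Δ +
      s.matEO A p * (creL p.1 * creL p.2) Ψ Δ) + (s.matOE A p * (annL p.1 * annL p.2) Ψ Δ +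
      -(s.matOO A p * (creL p.2 * annL p.1) Ψ Δ)) := by
  rw [hatTerm, ← biL_apply]
  by_cases h1 : s.Occ p.1 <;> by_cases h2 : s.Occ p.2 <;>
    simp only [matEE, matEO, matOE, matOO, mat, h1, h2, not_true_eq_false, not_false_eq_true,
      and_self, and_false, false_and, if_true, if_false, zero_mul, add_zero, zero_add, neg_zero]
  · rw [biL_of_occ_occ _ _ h1 h2]; simp
  · rw [biL_of_occ_empty _ _ h1 h2]
  · rw [biL_of_empty_occ _ _ h1 h2]
  · rw [biL_of_empty_empty _ _ h1 h2]

omit [LinearOrder ι] in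
theorem sqSum_matEO_le (A : H →L[ℂ] H) : sqSum (s.matEO A) ≤ s.hsSq A := by
  rw [← sqSum_comMat]
  refine sqSum_mono fun p => ?_
  rw [matEO]
  split_ifs with h
  · rw [s.comMat_empty_occ A h.1 h.2]
  · simp

omit [LinearOrder ι] in
theorem sqSum_matOE_le (A : H →L[ℂ] H) : sqSum (s.matOE A) ≤ s.hsSq A := by
  rw [← sqSum_comMat]
  refine sqSum_mono fun p => ?_
  rw [matOE]
  split_ifs with h
  · rw [s.comMat_occ_empty A h.1 h.2, norm_neg]
  · simp

omit [LinearOrder ι] in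
theorem matBound_matEE (A : H →L[ℂ] H) : MatBound (fun i j => s.matEE A (i, j)) ‖A‖ₑ :=
  by
  have h := (matBound_inner s.b A).restrict fun i => ¬ s.Occ i
  convert! h using 3 with i j
  simp only [matEE, mat]
  congr

omit [LinearOrder ι] in
theorem matBound_matOO (A : H →L[ℂ] H) : MatBound (fun i j => s.matOO A (j, i)) ‖A‖ₑ := by
  have h := ((matBound_inner s.b A.adjoint).star.restrict s.Occ)
  rw [show ‖A.adjoint‖ₑ = ‖A‖ₑ by rw [← ofReal_norm, ← ofReal_norm, LinearIsometryEquiv.norm_map]]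
    at h
  convert! h using 3 with i j
  have e : star ⟪s.b i, A.adjoint (s.b j)⟫_ℂ = ⟪s.b j, A (s.b i)⟫_ℂ := by
    rw [ContinuousLinearMap.adjoint_inner_right, ← inner_conj_symm (s.b j)]
    rfl
  by_cases h1 : s.Occ i <;> by_cases h2 : s.Occ j <;> simp [matOO, mat, h1, h2, ← e]

variable {s}

section Bound

variable {A : H →L[ℂ] H} {Ψ : Finset ι → ℂ} {N : ℕ}

theorem summable_EE (h : ExcLE N Ψ) (hΨ : sqSum Ψ ≠ ⊤) (Δ : Finset ι) :
    Summable fun p : ι × ι => s.matEE A p * (creL p.1 * annL p.2) Ψ Δ :=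
  summable_of_tsum_enorm (number_preserving_summable h hΨ (s.matBound_matEE A) Δ)

theorem summable_OO (h : ExcLE N Ψ) (hΨ : sqSum Ψ ≠ ⊤) (Δ : Finset ι) :
    Summable fun p : ι × ι => s.matOO A p * (creL p.2 * annL p.1) Ψ Δ :=
  (Equiv.prodComm ι ι).summable_iff.1
    (summable_of_tsum_enorm (number_preserving_summable h hΨ (s.matBound_matOO A) Δ))

theorem summable_EO (hA : s.hsSq A ≠ ⊤) (h : ExcLE N Ψ) (hΨ : sqSum Ψ ≠ ⊤) (Δ : Finset ι) :
    Summable fun p : ι × ι => s.matEO A p * (creL p.1 * creL p.2) Ψ Δ := by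
  have h1 := pair_creation_bound h (s.matEO A)
  have h2 := (ENNReal.le_tsum Δ).trans h1
  refine summable_of_tsum_enorm fun h3 => ?_
  rw [h3] at h2
  simp only [ne_eq, OfNat.ofNat_ne_zero, not_false_eq_true, ENNReal.top_pow, top_le_iff] at h2
  refine ENNReal.mul_ne_top (ENNReal.mul_ne_top ?_
    (ne_top_of_le_ne_top hA (s.sqSum_matEO_le A))) hΨ h2
  exact ENNReal.pow_ne_top (by exact_mod_cast ENNReal.natCast_ne_top (N + 2))

theorem summable_OE (hA : s.hsSq A ≠ ⊤) (h : ExcLE N Ψ) (hΨ : sqSum Ψ ≠ ⊤) (Δ : Finset ι) :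
    Summable fun p : ι × ι => s.matOE A p * (annL p.1 * annL p.2) Ψ Δ := by
  have h1 := pair_annihilation_bound h (s.matOE A)
  have h2 := (ENNReal.le_tsum Δ).trans h1
  refine summable_of_tsum_enorm fun h3 => ?_
  rw [h3] at h2
  simp only [ne_eq, OfNat.ofNat_ne_zero, not_false_eq_true, ENNReal.top_pow, top_le_iff] at h2
  exact ENNReal.mul_ne_top (ENNReal.mul_ne_top (ENNReal.pow_ne_top (ENNReal.natCast_ne_top N))
    (ne_top_of_le_ne_top hA (s.sqSum_matOE_le A))) hΨ h2

theorem summable_hatTerm (hA : s.hsSq A ≠ ⊤) (h : ExcLE N Ψ) (hΨ : sqSum Ψ ≠ ⊤)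
    (Δ : Finset ι) : Summable (hatTerm s.ρ s.b A Ψ Δ) := by
  rw [show hatTerm s.ρ s.b A Ψ Δ = _ from funext fun p => s.hatTerm_eq A Ψ Δ p]
  exact ((summable_EE h hΨ Δ).add (summable_EO hA h hΨ Δ)).add
    ((summable_OE hA h hΨ Δ).add (summable_OO h hΨ Δ).neg)

/-- The operator norm controls the two diagonal blocks, and the Hilbert-Schmidt norm of the
commutator controls the two off-diagonal ones. The factor 8 comes from using (x + y)² ≤ 2(x² + y²)
twice for four terms. -/
theorem sqSum_hatCoeff_le (hA : s.hsSq A ≠ ⊤) (h : ExcLE N Ψ) (hΨ : sqSum Ψ ≠ ⊤) :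
    sqSum (hatCoeff s.ρ s.b A Ψ) ≤
      8 * (N + 2) ^ 2 * (‖A‖ₑ ^ 2 + s.hsSq A) * sqSum Ψ := by
  have e : hatCoeff s.ρ s.b A Ψ =
      ((fun Δ => ∑' p : ι × ι, s.matEE A p * (creL p.1 * annL p.2) Ψ Δ) +
      fun Δ => ∑' p : ι × ι, s.matEO A p * (creL p.1 * creL p.2) Ψ Δ) +
      ((fun Δ => ∑' p : ι × ι, s.matOE A p * (annL p.1 * annL p.2) Ψ Δ) +
      -fun Δ => ∑' p : ι × ι, s.matOO A p * (creL p.2 * annL p.1) Ψ Δ) := by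
    funext Δ
    rw [hatCoeff, tsum_congr fun p => s.hatTerm_eq A Ψ Δ p]
    rw [((summable_EE h hΨ Δ).add (summable_EO hA h hΨ Δ)).tsum_add
      ((summable_OE hA h hΨ Δ).add (summable_OO h hΨ Δ).neg),
      (summable_EE h hΨ Δ).tsum_add (summable_EO hA h hΨ Δ),
      (summable_OE hA h hΨ Δ).tsum_add (summable_OO h hΨ Δ).neg, tsum_neg]
    rfl
  have hN : (N : ℝ≥0∞) ≤ N + 2 := le_self_add
  have b1 : sqSum (fun Δ => ∑' p : ι × ι, s.matEE A p * (creL p.1 * annL p.2) Ψ Δ) ≤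
      (N + 2) ^ 2 * ‖A‖ₑ ^ 2 * sqSum Ψ :=
    (number_preserving_bound h hΨ (s.matBound_matEE A)).trans (by
      rw [mul_pow, mul_comm (‖A‖ₑ ^ 2)]; gcongr)
  have b4 : sqSum (-fun Δ => ∑' p : ι × ι, s.matOO A p * (creL p.2 * annL p.1) Ψ Δ) ≤
      (N + 2) ^ 2 * ‖A‖ₑ ^ 2 * sqSum Ψ := by
    rw [sqSum_neg]
    have e' : (fun Δ => ∑' p : ι × ι, s.matOO A p * (creL p.2 * annL p.1) Ψ Δ) =
        fun Δ => ∑' p : ι × ι, s.matOO A (p.2, p.1) * (creL p.1 * annL p.2) Ψ Δ :=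
      funext fun Δ => ((Equiv.prodComm ι ι).tsum_eq _).symm
    rw [e']
    exact (number_preserving_bound h hΨ (s.matBound_matOO A)).trans (by
      rw [mul_pow, mul_comm (‖A‖ₑ ^ 2)]; gcongr)
  have b2 : sqSum (fun Δ => ∑' p : ι × ι, s.matEO A p * (creL p.1 * creL p.2) Ψ Δ) ≤
      (N + 2) ^ 2 * s.hsSq A * sqSum Ψ := by
    refine (ENNReal.tsum_le_tsum fun Δ =>
      pow_le_pow_left₀ zero_le enorm_tsum_le_tsum_enorm 2).trans
      ((pair_creation_bound h (s.matEO A)).trans ?_)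
    gcongr
    exact s.sqSum_matEO_le A
  have b3 : sqSum (fun Δ => ∑' p : ι × ι, s.matOE A p * (annL p.1 * annL p.2) Ψ Δ) ≤
      (N + 2) ^ 2 * s.hsSq A * sqSum Ψ := by
    refine (ENNReal.tsum_le_tsum fun Δ =>
      pow_le_pow_left₀ zero_le enorm_tsum_le_tsum_enorm 2).trans
      ((pair_annihilation_bound h (s.matOE A)).trans ?_)
    gcongr
    exact s.sqSum_matOE_le A
  rw [e]
  refine (sqSum_add_le _ _).trans ?_
  calc _ ≤ 2 * (2 * ((N + 2) ^ 2 * ‖A‖ₑ ^ 2 * sqSum Ψ + (N + 2) ^ 2 * s.hsSq A * sqSum Ψ) +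
        2 * ((N + 2) ^ 2 * s.hsSq A * sqSum Ψ + (N + 2) ^ 2 * ‖A‖ₑ ^ 2 * sqSum Ψ)) := by
        gcongr
        · exact (sqSum_add_le _ _).trans (by gcongr)
        · exact (sqSum_add_le _ _).trans (by gcongr)
    _ = _ := by ring

theorem bilinear_excLE (h : ExcLE N Ψ) (p : ι × ι) : ExcLE (N + 2) (biL s.ρ s.b p Ψ) := by
  by_cases h1 : s.Occ p.1 <;> by_cases h2 : s.Occ p.2
  · rw [biL_of_occ_occ _ _ h1 h2]
    intro Δ hΔ
    have := ((h.annL' p.1).creL p.2) Δ (by omega)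
    simpa using this
  · rw [biL_of_occ_empty _ _ h1 h2]
    exact ((h.annL' p.2).annL' p.1).mono (by omega)
  · rw [biL_of_empty_occ _ _ h1 h2]
    exact (h.creL p.2).creL p.1
  · rw [biL_of_empty_empty _ _ h1 h2]
    exact ((h.annL' p.2).creL p.1).mono (by omega)

theorem hatCoeff_excLE (h : ExcLE N Ψ) : ExcLE (N + 2) (hatCoeff s.ρ s.b A Ψ) := fun Δ hΔ => by
  rw [hatCoeff]
  have : ∀ p, hatTerm s.ρ s.b A Ψ Δ p = 0 := fun p => by
    rw [hatTerm, ← biL_apply, bilinear_excLE h p Δ hΔ, mul_zero]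
  simp [this]

end Bound

end Sea

/-! ### The filtration of Fock space by the number of excitations -/

section Filtration

variable (ι : Type*)

/-- At most `N` excitations. -/
def excSpace (N : ℕ) : Submodule ℂ (Fock ι) where
  carrier := {Ψ | ExcLE N Ψ}
  add_mem' h h' := fun Δ hΔ => by simp [h Δ hΔ, h' Δ hΔ]
  zero_mem' := fun Δ _ => by simp
  smul_mem' z Ψ h := fun Δ hΔ => by simp [h Δ hΔ]

theorem isClosed_excSpace (N : ℕ) : IsClosed (excSpace ι N : Set (Fock ι)) := by
  have : (excSpace ι N : Set (Fock ι)) =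
      ⋂ Δ : Finset ι, ⋂ (_ : N < Δ.card), {Ψ | lp.evalCLM ℂ (fun _ : Finset ι => ℂ) 2 Δ Ψ = 0} := by
    ext Ψ
    simp only [Set.mem_iInter]
    rfl
  rw [this]
  exact isClosed_iInter fun Δ => isClosed_iInter fun _ =>
    isClosed_eq (lp.evalCLM ℂ (fun _ : Finset ι => ℂ) 2 Δ).continuous continuous_const

instance (N : ℕ) : CompleteSpace (excSpace ι N) := (isClosed_excSpace ι N).completeSpace_coe

/-- Fock space, filtered by the number of excitations. -/
def fockFilt : Filtered (Fock ι) where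
  space := excSpace ι
  proj N := (excSpace ι N).starProjection
  mono _ _ h _ hv := ExcLE.mono hv h
  proj_mem _ v := Submodule.starProjection_apply_mem _ v
  proj_eq _ _ hv := Submodule.starProjection_eq_self_iff.2 hv

variable {ι}

theorem mem_space_iff {N : ℕ} {Ψ : Fock ι} : Ψ ∈ (fockFilt ι).space N ↔ ExcLE N Ψ := Iff.rfl

theorem finiteExcitation_iff {Ψ : Fock ι} : FiniteExcitation Ψ ↔ Ψ ∈ (fockFilt ι).union := by
  rw [Filtered.mem_union]; rfl

theorem sqSum_fock_ne_top (Ψ : Fock ι) : sqSum (Ψ : Finset ι → ℂ) ≠ ⊤ :=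
  sqSum_ne_top_iff.2 (lp.memℓp Ψ)

/-- A vector given by square summable coefficients. -/
def mkFock (f : Finset ι → ℂ) (h : sqSum f ≠ ⊤) : Fock ι := ⟨f, sqSum_ne_top_iff.1 h⟩

theorem norm_mkFock_le {f : Finset ι → ℂ} (h : sqSum f ≠ ⊤) {Ψ : Fock ι} {c : ℝ} (hc : 0 ≤ c)
    (hf : sqSum f ≤ (ENNReal.ofReal c) ^ 2 * sqSum (Ψ : Finset ι → ℂ)) :
    ‖mkFock f h‖ ≤ c * ‖Ψ‖ := by
  have h1 := sqSum_lp (mkFock f h)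
  rw [show ((mkFock f h : Fock ι) : Finset ι → ℂ) = f from rfl] at h1
  rw [sqSum_lp, h1, ← mul_pow] at hf
  have h2 := (ENNReal.pow_le_pow_left_iff two_ne_zero).1 hf
  rw [← ofReal_norm, ← ofReal_norm, ← ENNReal.ofReal_mul hc] at h2
  exact (ENNReal.ofReal_le_ofReal_iff (by positivity)).1 h2

open Classical in
/-- The basis vector `|Δ⟩`. -/
def ket (Δ : Finset ι) : (fockFilt ι).union :=
  ⟨lp.single 2 Δ (1 : ℂ), Filtered.space_le_union Δ.card (show ExcLE Δ.card _ from fun Δ' h => by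
    rw [lp.single_apply_ne]
    rintro rfl
    exact lt_irrefl _ h)⟩

open Classical in
theorem ket_apply (Δ Δ' : Finset ι) : ((ket Δ : (fockFilt ι).union) : Fock ι) Δ' =
    if Δ' = Δ then 1 else 0 := by
  rw [ket, lp.coeFn_single]
  simp [Pi.single_apply]

theorem ket_mem {N : ℕ} {Δ : Finset ι} (h : Δ.card ≤ N) :
    ((ket Δ : (fockFilt ι).union) : Fock ι) ∈ (fockFilt ι).space N := fun Δ' hΔ' => by
  rw [ket_apply, if_neg]
  rintro rfl
  omega

open Classical in
theorem hasSum_ket (v : (fockFilt ι).union) :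
    HasSum (fun Δ : Finset ι => (v : Fock ι) Δ • ((ket Δ : (fockFilt ι).union) : Fock ι)) v := by
  have := lp.hasSum_single (p := 2) (by norm_num) (v : Fock ι)
  convert this using 2 with Δ
  rw [ket, ← lp.single_smul]
  simp

/-- Operators with bounds on levels are determined by their values on basis vectors. -/
theorem op_ext {a b : (fockFilt ι).Op} (ha : ∀ N, ∃ M C, Filtered.OpBound a N M C)
    (hb : ∀ N, ∃ M C, Filtered.OpBound b N M C) (h : ∀ Δ, a (ket Δ) = b (ket Δ)) : a = b := by
  refine LinearMap.ext fun v => Subtype.ext ?_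
  obtain ⟨N, hN⟩ := Filtered.exists_mem_space v
  obtain ⟨M, C, ha⟩ := ha N
  obtain ⟨M', C', hb⟩ := hb N
  obtain ⟨L, hL⟩ := ha.exists_clm
  obtain ⟨L', hL'⟩ := hb.exists_clm
  rw [← hL v hN, ← hL' v hN]
  refine ((hasSum_ket v).mapL L).unique ?_
  convert! (hasSum_ket v).mapL L' using 2 with Δ
  by_cases hΔ : Δ.card ≤ N
  · rw [map_smul, map_smul, hL _ (ket_mem hΔ), hL' _ (ket_mem hΔ), h]
  · rw [show (v : Fock ι) Δ = 0 from hN Δ (not_le.1 hΔ)]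
    simp

end Filtration

/-! ### Second quantized operators -/

namespace Sea

variable {ι : Type*} [LinearOrder ι] (s : Sea ι)

theorem sqSum_hatCoeff_ne_top {A : H →L[ℂ] H} (hA : s.hsSq A ≠ ⊤) {Ψ : Fock ι} {N : ℕ}
    (h : ExcLE N (Ψ : Finset ι → ℂ)) : sqSum (hatCoeff s.ρ s.b A Ψ) ≠ ⊤ := by
  refine ne_top_of_le_ne_top ?_ (sqSum_hatCoeff_le hA h (sqSum_fock_ne_top Ψ))
  refine ENNReal.mul_ne_top (ENNReal.mul_ne_top (ENNReal.mul_ne_top (by simp) ?_) ?_)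
    (sqSum_fock_ne_top Ψ)
  · exact ENNReal.pow_ne_top (by exact_mod_cast ENNReal.natCast_ne_top (N + 2))
  · exact ENNReal.add_ne_top.2 ⟨ENNReal.pow_ne_top (by simp), hA⟩

theorem hat_coe {A : H →L[ℂ] H} (hA : s.hsSq A ≠ ⊤) {Ψ : Fock ι} (h : FiniteExcitation Ψ) :
    (hat s.ρ s.b A Ψ : Finset ι → ℂ) = hatCoeff s.ρ s.b A Ψ := by
  obtain ⟨N, hN⟩ := h
  rw [hat, dif_pos (sqSum_ne_top_iff.1 (s.sqSum_hatCoeff_ne_top hA hN))]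

theorem memlp_hatCoeff {A : H →L[ℂ] H} (hA : s.hsSq A ≠ ⊤) {Ψ : Fock ι}
    (h : FiniteExcitation Ψ) : Memℓp (hatCoeff s.ρ s.b A Ψ) 2 := by
  rw [← s.hat_coe hA h]
  exact lp.memℓp _

theorem hat_mem_space {A : H →L[ℂ] H} (hA : s.hsSq A ≠ ⊤) {Ψ : Fock ι} {N : ℕ}
    (h : ExcLE N (Ψ : Finset ι → ℂ)) : hat s.ρ s.b A Ψ ∈ (fockFilt ι).space (N + 2) := by
  rw [mem_space_iff, s.hat_coe hA ⟨N, h⟩]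
  exact hatCoeff_excLE h

theorem hatTerm_add_vec (A : H →L[ℂ] H) (Ψ Ψ' : Finset ι → ℂ) (Δ : Finset ι) :
    hatTerm s.ρ s.b A (Ψ + Ψ') Δ = hatTerm s.ρ s.b A Ψ Δ + hatTerm s.ρ s.b A Ψ' Δ := by
  funext p
  simp only [hatTerm, ← biL_apply, map_add, Pi.add_apply, mul_add]

theorem hatTerm_smul_vec (A : H →L[ℂ] H) (z : ℂ) (Ψ : Finset ι → ℂ) (Δ : Finset ι) :
    hatTerm s.ρ s.b A (z • Ψ) Δ = z • hatTerm s.ρ s.b A Ψ Δ := by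
  funext p
  simp only [hatTerm, ← biL_apply, map_smul, Pi.smul_apply, smul_eq_mul]
  ring

open Classical in
/-- The second quantization as an operator on vectors of finite excitation. -/
def hatOp (A : H →L[ℂ] H) : (fockFilt ι).Op :=
  if hA : s.hsSq A ≠ ⊤ then
  { toFun := fun v => ⟨hat s.ρ s.b A v, by
      obtain ⟨N, hN⟩ := Filtered.exists_mem_space v
      exact Filtered.space_le_union _ (s.hat_mem_space hA hN)⟩
    map_add' := fun v w => by
      refine Subtype.ext (lp.ext (funext fun Δ => ?_))
      obtain ⟨N, hN⟩ := Filtered.exists_mem_space v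
      obtain ⟨M, hM⟩ := Filtered.exists_mem_space w
      have h1 := s.hat_coe hA (finiteExcitation_iff.2 v.2)
      have h2 := s.hat_coe hA (finiteExcitation_iff.2 w.2)
      have h3 := s.hat_coe hA (finiteExcitation_iff.2 (v + w).2)
      simp only [Submodule.coe_add, lp.coeFn_add, Pi.add_apply] at h3 ⊢
      rw [h1, h2, h3, hatCoeff, hatCoeff, hatCoeff, hatTerm_add_vec]
      exact (summable_hatTerm hA hN (sqSum_fock_ne_top _) Δ).tsum_add
        (summable_hatTerm hA hM (sqSum_fock_ne_top _) Δ)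
    map_smul' := fun z v => by
      refine Subtype.ext (lp.ext (funext fun Δ => ?_))
      have h1 := s.hat_coe hA (finiteExcitation_iff.2 v.2)
      have h3 := s.hat_coe hA (finiteExcitation_iff.2 (z • v).2)
      simp only [Submodule.coe_smul, lp.coeFn_smul, Pi.smul_apply, RingHom.id_apply] at h3 ⊢
      rw [h1, h3, hatCoeff, hatCoeff, hatTerm_smul_vec]
      exact tsum_const_smul'' z }
  else 0

variable {s}

theorem hatOp_coe {A : H →L[ℂ] H} (hA : s.hsSq A ≠ ⊤) (v : (fockFilt ι).union) :
    (s.hatOp A v : Fock ι) = hat s.ρ s.b A v := by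
  rw [hatOp, dif_pos hA]; rfl

theorem hatOp_apply {A : H →L[ℂ] H} (hA : s.hsSq A ≠ ⊤) (v : (fockFilt ι).union) (Δ : Finset ι) :
    (s.hatOp A v : Fock ι) Δ = ∑' p, hatTerm s.ρ s.b A (v : Fock ι) Δ p := by
  rw [hatOp_coe hA, s.hat_coe hA (finiteExcitation_iff.2 v.2)]; rfl

omit [LinearOrder ι] in
variable (s) in
/-- `A` and its commutator with `ρ` are bounded by `c` in operator, respectively
Hilbert-Schmidt, norm. -/
def Tame (A : H →L[ℂ] H) (c : ℝ) : Prop := ‖A‖ ≤ c ∧ s.hsSq A ≤ ENNReal.ofReal c ^ 2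

namespace Tame

variable {A B : H →L[ℂ] H} {c c' : ℝ}

omit [LinearOrder ι] in
theorem nonneg (h : s.Tame A c) : 0 ≤ c := (norm_nonneg _).trans h.1

omit [LinearOrder ι] in
theorem ne_top (h : s.Tame A c) : s.hsSq A ≠ ⊤ :=
  ne_top_of_le_ne_top (ENNReal.pow_ne_top ENNReal.ofReal_ne_top) h.2

omit [LinearOrder ι] in
theorem mono (h : s.Tame A c) (hc : c ≤ c') : s.Tame A c' :=
  ⟨h.1.trans hc, h.2.trans (by gcongr)⟩

omit [LinearOrder ι] in
theorem smul (z : ℂ) (h : s.Tame A c) : s.Tame (z • A) (‖z‖ * c) := by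
  refine ⟨by rw [norm_smul]; gcongr; exact h.1, ?_⟩
  have : s.hsSq (z • A) = ‖z‖ₑ ^ 2 * s.hsSq A := by
    rw [hsSq, hsSq, ← ENNReal.tsum_mul_left]
    refine tsum_congr fun i => ?_
    rw [← mul_pow, ← enorm_smul, smul_sub]
    simp
  rw [this, ENNReal.ofReal_mul (norm_nonneg z), ofReal_norm, mul_pow]
  gcongr
  exact h.2

omit [LinearOrder ι] in
theorem add (hA : s.Tame A c) (hB : s.Tame B c') : s.Tame (A + B) (2 * (c + c')) := by
  have h0 := hA.nonneg
  have h0' := hB.nonneg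
  refine ⟨(norm_add_le _ _).trans (by linarith [hA.1, hB.1]), ?_⟩
  have : s.hsSq (A + B) ≤ 2 * (s.hsSq A + s.hsSq B) := by
    rw [hsSq, hsSq, hsSq, ← ENNReal.tsum_add, ← ENNReal.tsum_mul_left]
    refine ENNReal.tsum_le_tsum fun i => ?_
    rw [show (A + B) (s.ρ (s.b i)) - s.ρ ((A + B) (s.b i)) =
      (A (s.ρ (s.b i)) - s.ρ (A (s.b i))) + (B (s.ρ (s.b i)) - s.ρ (B (s.b i))) by
        simp only [add_apply, map_add]; abel]
    exact (pow_le_pow_left₀ zero_le (enorm_add_le _ _) 2).trans (add_sq_le_two _ _)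
  refine this.trans ?_
  calc 2 * (s.hsSq A + s.hsSq B) ≤ 2 * (ENNReal.ofReal c ^ 2 + ENNReal.ofReal c' ^ 2) := by
        gcongr
        · exact hA.2
        · exact hB.2
    _ = ENNReal.ofReal (2 * (c ^ 2 + c' ^ 2)) := by
        rw [ENNReal.ofReal_mul (by norm_num), ENNReal.ofReal_add (by positivity) (by positivity),
          ENNReal.ofReal_pow h0, ENNReal.ofReal_pow h0']
        simp
    _ ≤ ENNReal.ofReal ((2 * (c + c')) ^ 2) := by
        apply ENNReal.ofReal_le_ofReal
        nlinarith
    _ = _ := by rw [ENNReal.ofReal_pow (by positivity)]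

/-- Second quantization is bounded on levels. -/
theorem opBound (h : s.Tame A c) (N : ℕ) :
    Filtered.OpBound (s.hatOp A) N (N + 2) (4 * (N + 2) * c) := fun v hv => by
  have h0 := h.nonneg
  have h1 := sqSum_hatCoeff_le h.ne_top (N := N) hv (sqSum_fock_ne_top _)
  rw [hatOp_coe h.ne_top]
  refine ⟨s.hat_mem_space h.ne_top hv, ?_⟩
  -- The constant is chosen so that 8 (N + 2)² · 2c² = (4 (N + 2) c)².
  have h2 : sqSum (hatCoeff s.ρ s.b A (v : Fock ι)) ≤
      (ENNReal.ofReal (4 * (N + 2) * c)) ^ 2 * sqSum ((v : Fock ι) : Finset ι → ℂ) := by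
    refine h1.trans ?_
    gcongr
    have h3 : ‖A‖ₑ ≤ ENNReal.ofReal c := by
      rw [← ofReal_norm]; exact ENNReal.ofReal_le_ofReal h.1
    calc 8 * ((N : ℝ≥0∞) + 2) ^ 2 * (‖A‖ₑ ^ 2 + s.hsSq A) ≤
        8 * ((N : ℝ≥0∞) + 2) ^ 2 * (ENNReal.ofReal c ^ 2 + ENNReal.ofReal c ^ 2) := by
          gcongr; exact h.2
      _ = (4 * (N + 2) * ENNReal.ofReal c) ^ 2 := by ring
      _ = _ := by
        rw [ENNReal.ofReal_mul (by positivity), ENNReal.ofReal_mul (by norm_num),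
          ENNReal.ofReal_add (by positivity) (by norm_num), ENNReal.ofReal_natCast]
        simp
  have h4 := norm_mkFock_le (s.sqSum_hatCoeff_ne_top h.ne_top hv) (by positivity) h2
  have h5 : hat s.ρ s.b A v = mkFock _ (s.sqSum_hatCoeff_ne_top h.ne_top hv) :=
    lp.ext (s.hat_coe h.ne_top ⟨N, hv⟩)
  rwa [h5]

end Tame

variable {A B : H →L[ℂ] H} {c c' : ℝ}

theorem hatOp_add (hA : s.Tame A c) (hB : s.Tame B c') :
    s.hatOp (A + B) = s.hatOp A + s.hatOp B := by
  refine LinearMap.ext fun v => Subtype.ext (lp.ext (funext fun Δ => ?_))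
  obtain ⟨N, hN⟩ := Filtered.exists_mem_space v
  simp only [LinearMap.add_apply, Submodule.coe_add, lp.coeFn_add, Pi.add_apply]
  rw [hatOp_apply hA.ne_top, hatOp_apply hB.ne_top, hatOp_apply (hA.add hB).ne_top,
    ← (summable_hatTerm hA.ne_top hN (sqSum_fock_ne_top _) Δ).tsum_add
      (summable_hatTerm hB.ne_top hN (sqSum_fock_ne_top _) Δ)]
  refine tsum_congr fun p => ?_
  simp only [hatTerm, add_apply, inner_add_right, add_mul]

theorem annL_ket {Δ : Finset ι} {i : ι} (hi : i ∉ Δ) :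
    annL i ((ket Δ : (fockFilt ι).union) : Fock ι) = 0 := by
  funext D
  rw [annL_apply, ket_apply, if_neg (c := insert i D = Δ), mul_zero, ite_self]
  · rfl
  · rintro rfl
    exact hi (Finset.mem_insert_self i D)

/-- Only modes of `Δ` and `Δ'` contribute to a matrix element between `|Δ'⟩` and `|Δ⟩`. -/
theorem biL_ket_eq_zero {Δ Δ' : Finset ι} {p : ι × ι} (hp : p ∉ (Δ ∪ Δ') ×ˢ (Δ ∪ Δ')) :
    biL s.ρ s.b p ((ket Δ' : (fockFilt ι).union) : Fock ι) Δ = 0 := by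
  have hp' : (p.1 ∉ Δ ∧ p.1 ∉ Δ') ∨ (p.2 ∉ Δ ∧ p.2 ∉ Δ') := by
    simp only [Finset.mem_product, Finset.mem_union] at hp
    tauto
  have hc : ∀ {i : ι} (Ψ : Finset ι → ℂ), i ∉ Δ → creL i Ψ Δ = 0 := fun Ψ h => by
    rw [creL_apply, if_neg h]
  by_cases h1 : s.Occ p.1 <;> by_cases h2 : s.Occ p.2
  · rw [biL_of_occ_occ _ _ h1 h2]
    simp only [LinearMap.neg_apply, Module.End.mul_apply, Pi.neg_apply, neg_eq_zero]
    rcases hp' with h | h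
    · rw [annL_ket h.2, map_zero]; rfl
    · exact hc _ h.1
  · rw [biL_of_occ_empty _ _ h1 h2]
    rcases hp' with h | h
    · rw [eq_neg_of_add_eq_zero_left (annL_annL p.1 p.2), LinearMap.neg_apply,
        Module.End.mul_apply, annL_ket h.2, map_zero]; simp
    · rw [Module.End.mul_apply, annL_ket h.2, map_zero]; rfl
  · rw [biL_of_empty_occ _ _ h1 h2, Module.End.mul_apply]
    rcases hp' with h | h
    · exact hc _ h.1
    · rw [creL_apply, creL_apply, if_neg fun h' => h.1 (Finset.mem_of_mem_erase h'), mul_zero,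
        ite_self]
  · rw [biL_of_empty_empty _ _ h1 h2, Module.End.mul_apply]
    rcases hp' with h | h
    · exact hc _ h.1
    · rw [annL_ket h.2, map_zero]; rfl

theorem hatOp_ket_apply (hA : s.hsSq A ≠ ⊤) (Δ Δ' : Finset ι) :
    (s.hatOp A (ket Δ') : Fock ι) Δ = ∑ p ∈ (Δ ∪ Δ') ×ˢ (Δ ∪ Δ'),
      s.mat A p * biL s.ρ s.b p ((ket Δ' : (fockFilt ι).union) : Fock ι) Δ := by
  rw [hatOp_apply hA, tsum_eq_sum (s := (Δ ∪ Δ') ×ˢ (Δ ∪ Δ')) fun p hp => ?_]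
  · exact Finset.sum_congr rfl fun p _ => by rw [hatTerm, ← biL_apply]; rfl
  · rw [hatTerm, ← biL_apply, biL_ket_eq_zero hp, mul_zero]

/-- Second quantization commutes with weighted integrals. -/
theorem integral_hatOp {At : ℝ → H →L[ℂ] H} {w : ℝ → ℂ} (hA : ∀ t, s.Tame (At t) c)
    (hB : s.Tame B c') (hw : Integrable w)
    (hc : ∀ v : (fockFilt ι).union, Continuous fun t => (s.hatOp (At t) v : Fock ι))
    (hint : ∀ i j, Integrable fun t => w t * ⟪s.b i, At t (s.b j)⟫_ℂ)
    (h : ∀ i j, ∫ t, w t * ⟪s.b i, At t (s.b j)⟫_ℂ = ⟪s.b i, B (s.b j)⟫_ℂ)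
    (v : (fockFilt ι).union) :
    ∫ t, w t • (s.hatOp (At t) v : Fock ι) = (s.hatOp B v : Fock ι) := by
  have hbd : ∀ {N : ℕ} {v : (fockFilt ι).union}, (v : Fock ι) ∈ (fockFilt ι).space N →
      ∀ t, ‖w t • (s.hatOp (At t) v : Fock ι)‖ ≤ ‖w t‖ * (4 * (N + 2) * c * ‖(v : Fock ι)‖) :=
    fun hv t => by
      rw [norm_smul]
      gcongr
      exact ((hA t).opBound _ _ hv).2
  have hi : ∀ v : (fockFilt ι).union, Integrable fun t => w t • (s.hatOp (At t) v : Fock ι) :=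
    fun v => by
      obtain ⟨N, hN⟩ := Filtered.exists_mem_space v
      exact (hw.norm.mul_const _).mono' (hw.aestronglyMeasurable.smul (hc v).aestronglyMeasurable)
        (Eventually.of_forall (hbd hN))
  have hmem : ∀ {N : ℕ} {v : (fockFilt ι).union}, (v : Fock ι) ∈ (fockFilt ι).space N →
      ∫ t, w t • (s.hatOp (At t) v : Fock ι) ∈ (fockFilt ι).space (N + 2) := fun hv =>
    Filtered.integral_mem_space fun t =>
      Submodule.smul_mem _ _ ((hA t).opBound _ _ hv).1
  -- The integral is itself an operator bounded on levels. By `op_ext` it suffices to compare matrix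
  -- elements between kets, and these involve only finitely many one-particle matrix elements.
  let I : (fockFilt ι).Op :=
    { toFun := fun v => ⟨∫ t, w t • (s.hatOp (At t) v : Fock ι), by
        obtain ⟨N, hN⟩ := Filtered.exists_mem_space v
        exact Filtered.space_le_union _ (hmem hN)⟩
      map_add' := fun v v' => Subtype.ext (by
        simp only [map_add, Submodule.coe_add, smul_add]
        exact integral_add (hi v) (hi v'))
      map_smul' := fun z v => Subtype.ext (by
        simp only [map_smul, Submodule.coe_smul, RingHom.id_apply]
        rw [← integral_smul]
        exact integral_congr_ae (Eventually.of_forall fun t => smul_comm _ _ _)) }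
  have hI : I = s.hatOp B := by
    refine op_ext (fun N => ⟨N + 2, ∫ t, ‖w t‖ * (4 * (N + 2) * c), fun v hv => ⟨hmem hv, ?_⟩⟩)
      (fun N => ⟨_, _, hB.opBound N⟩) fun Δ' => Subtype.ext (lp.ext (funext fun Δ => ?_))
    · refine (norm_integral_le_of_norm_le (hw.norm.mul_const _)
        (Eventually.of_forall (hbd hv))).trans (le_of_eq ?_)
      rw [integral_mul_const, integral_mul_const]
      ring
    · change lp.evalCLM ℂ (fun _ : Finset ι => ℂ) 2 Δ
        (∫ t, w t • (s.hatOp (At t) (ket Δ') : Fock ι)) = _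
      rw [← ContinuousLinearMap.integral_comp_comm _ (hi _), hatOp_ket_apply hB.ne_top]
      have e : ∀ t, lp.evalCLM ℂ (fun _ : Finset ι => ℂ) 2 Δ
          (w t • (s.hatOp (At t) (ket Δ') : Fock ι)) = ∑ p ∈ (Δ ∪ Δ') ×ˢ (Δ ∪ Δ'),
          w t * ⟪s.b p.1, At t (s.b p.2)⟫_ℂ *
            biL s.ρ s.b p ((ket Δ' : (fockFilt ι).union) : Fock ι) Δ := fun t => by
        rw [map_smul, show lp.evalCLM ℂ (fun _ : Finset ι => ℂ) 2 Δ
          (s.hatOp (At t) (ket Δ') : Fock ι) = (s.hatOp (At t) (ket Δ') : Fock ι) Δ from rfl,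
          hatOp_ket_apply (hA t).ne_top, smul_eq_mul, Finset.mul_sum]
        exact Finset.sum_congr rfl fun p _ => by rw [mat, mul_assoc]
      simp only [e]
      rw [integral_finsetSum _ fun p _ => (hint p.1 p.2).mul_const _]
      exact Finset.sum_congr rfl fun p _ => by rw [integral_mul_const, h, mat]
  change ((I v : (fockFilt ι).union) : Fock ι) = _
  rw [hI]

end Sea

/-! ### Field operators -/

section Field

variable {ι : Type*} [LinearOrder ι]

/-- `z i` creates or annihilates the excitation `i`. -/
def IsModes (z : ι → Module.End ℂ (Finset ι → ℂ)) : Prop := ∀ i, z i = annL i ∨ z i = creL i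

theorem field_ann_bound {N : ℕ} {Ψ : Finset ι → ℂ} (h : ExcLE N Ψ) (x : ι → ℂ) :
    ∑' Δ : Finset ι, (∑' i, ‖x i * annL i Ψ Δ‖ₑ) ^ 2 ≤ (N + 1) * (sqSum x * sqSum Ψ) := by
  refine (ENNReal.tsum_le_tsum fun Δ => enorm_tsum_mul_sq_le x fun i => annL i Ψ Δ).trans ?_
  rw [ENNReal.tsum_mul_left]
  have : ∑' Δ : Finset ι, sqSum (fun i => annL i Ψ Δ) ≤ N * sqSum Ψ := by
    refine le_trans (le_of_eq ?_) (tsum_sqSum_annL_le h)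
    simp only [sqSum]
    rw [ENNReal.tsum_comm]
  calc sqSum x * ∑' Δ : Finset ι, sqSum (fun i => annL i Ψ Δ) ≤ sqSum x * ((N + 1) * sqSum Ψ) := by
        gcongr
        exact this.trans (by gcongr; exact le_self_add)
    _ = _ := by ring

theorem field_cre_bound {N : ℕ} {Ψ : Finset ι → ℂ} (h : ExcLE N Ψ) (x : ι → ℂ) :
    ∑' Δ : Finset ι, (∑' i, ‖x i * creL i Ψ Δ‖ₑ) ^ 2 ≤ (N + 1) * (sqSum x * sqSum Ψ) := by
  have h1 : ∀ Δ : Finset ι, (∑' i, ‖x i * creL i Ψ Δ‖ₑ) ^ 2 ≤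
      (N + 1) * ∑' i, ‖x i * creL i Ψ Δ‖ₑ ^ 2 := fun Δ => by
    by_cases hΔ : Δ.card ≤ N + 1
    · refine (tsum_sq_le_card Δ fun i hi => by simp [creL_apply, hi]).trans ?_
      gcongr
      exact_mod_cast hΔ
    · have : ∀ i, creL i Ψ Δ = 0 := fun i => (h.creL i) Δ (by omega)
      simp [this]
  refine (ENNReal.tsum_le_tsum h1).trans ?_
  rw [ENNReal.tsum_mul_left, ENNReal.tsum_comm]
  gcongr
  rw [sqSum, ← ENNReal.tsum_mul_right]
  refine ENNReal.tsum_le_tsum fun i => ?_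
  simp only [enorm_mul, mul_pow, ENNReal.tsum_mul_left]
  gcongr
  exact sqSum_creL_le i Ψ

variable {z : ι → Module.End ℂ (Finset ι → ℂ)}

theorem IsModes.bound (hz : IsModes z) {N : ℕ} {Ψ : Finset ι → ℂ} (h : ExcLE N Ψ) (x : ι → ℂ) :
    ∑' Δ : Finset ι, (∑' i, ‖x i * z i Ψ Δ‖ₑ) ^ 2 ≤ 4 * (N + 1) * (sqSum x * sqSum Ψ) := by
  have h1 : ∀ Δ : Finset ι, (∑' i, ‖x i * z i Ψ Δ‖ₑ) ^ 2 ≤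
      2 * ((∑' i, ‖x i * annL i Ψ Δ‖ₑ) ^ 2 + (∑' i, ‖x i * creL i Ψ Δ‖ₑ) ^ 2) := fun Δ => by
    refine (pow_le_pow_left₀ zero_le ?_ 2).trans (add_sq_le_two _ _)
    rw [← ENNReal.tsum_add]
    refine ENNReal.tsum_le_tsum fun i => ?_
    rcases hz i with h | h <;> rw [h]
    · exact le_self_add
    · exact le_add_self
  refine (ENNReal.tsum_le_tsum h1).trans ?_
  rw [ENNReal.tsum_mul_left, ENNReal.tsum_add]
  calc _ ≤ 2 * ((N + 1) * (sqSum x * sqSum Ψ) + (N + 1) * (sqSum x * sqSum Ψ)) := by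
        gcongr
        · exact field_ann_bound h x
        · exact field_cre_bound h x
    _ = _ := by ring

theorem IsModes.excLE (hz : IsModes z) {N : ℕ} {Ψ : Finset ι → ℂ} (h : ExcLE N Ψ) (i : ι) :
    ExcLE (N + 1) (z i Ψ) := by
  rcases hz i with h' | h' <;> rw [h']
  · exact (h.annL' i).mono (Nat.le_succ N)
  · exact h.creL i

/-- A mode operator evaluated at one Δ reads a single coefficient up to sign, so it commutes with
pointwise sums without any convergence assumption. -/
theorem IsModes.tsum (hz : IsModes z) {α : Type*} (f : α → Finset ι → ℂ) (i : ι)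
    (Δ : Finset ι) : z i (fun Δ => ∑' a, f a Δ) Δ = ∑' a, z i (f a) Δ := by
  rcases hz i with h' | h' <;> rw [h']
  · simp only [annL_apply]
    split_ifs
    · simp
    · rw [tsum_mul_left]
  · simp only [creL_apply]
    split_ifs
    · rw [tsum_mul_left]
    · simp

/-- Coefficients of `∑ x_i z_i Ψ`. -/
def fieldCoeff (z : ι → Module.End ℂ (Finset ι → ℂ)) (x : ι → ℂ) (Ψ : Finset ι → ℂ) :
    Finset ι → ℂ := fun Δ => ∑' i, x i * z i Ψ Δ

theorem IsModes.sqSum_fieldCoeff_le (hz : IsModes z) {N : ℕ} {Ψ : Finset ι → ℂ} (h : ExcLE N Ψ)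
    (x : ι → ℂ) : sqSum (fieldCoeff z x Ψ) ≤ 4 * (N + 1) * (sqSum x * sqSum Ψ) :=
  (ENNReal.tsum_le_tsum fun _ =>
    pow_le_pow_left₀ zero_le enorm_tsum_le_tsum_enorm 2).trans (hz.bound h x)

abbrev Seq (ι : Type*) : Type _ := lp (fun _ : ι => ℂ) 2

omit [LinearOrder ι] in
theorem sqSum_seq_ne_top (x : Seq ι) : sqSum (x : ι → ℂ) ≠ ⊤ := sqSum_ne_top_iff.2 (lp.memℓp x)

theorem IsModes.summable (hz : IsModes z) {N : ℕ} {Ψ : Fock ι} (h : ExcLE N (Ψ : Finset ι → ℂ))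
    (x : Seq ι) (Δ : Finset ι) : Summable fun i => x i * z i Ψ Δ := by
  have h2 := (ENNReal.le_tsum Δ).trans (hz.bound h x)
  refine summable_of_tsum_enorm fun h3 => ?_
  rw [h3] at h2
  simp only [ne_eq, OfNat.ofNat_ne_zero, not_false_eq_true, ENNReal.top_pow, top_le_iff] at h2
  refine ENNReal.mul_ne_top (ENNReal.mul_ne_top (by simp) ?_)
    (ENNReal.mul_ne_top (sqSum_seq_ne_top x) (sqSum_fock_ne_top Ψ)) h2
  exact_mod_cast ENNReal.natCast_ne_top (N + 1)

theorem IsModes.sqSum_fieldCoeff_ne_top (hz : IsModes z) {N : ℕ} {Ψ : Fock ι}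
    (h : ExcLE N (Ψ : Finset ι → ℂ)) (x : Seq ι) : sqSum (fieldCoeff z x Ψ) ≠ ⊤ := by
  refine ne_top_of_le_ne_top (ENNReal.mul_ne_top (ENNReal.mul_ne_top (by simp) ?_)
    (ENNReal.mul_ne_top (sqSum_seq_ne_top x) (sqSum_fock_ne_top Ψ))) (hz.sqSum_fieldCoeff_le h x)
  exact_mod_cast ENNReal.natCast_ne_top (N + 1)

theorem IsModes.fieldCoeff_excLE (hz : IsModes z) {N : ℕ} {Ψ : Finset ι → ℂ} (h : ExcLE N Ψ)
    (x : ι → ℂ) : ExcLE (N + 1) (fieldCoeff z x Ψ) := fun Δ hΔ => by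
  have : ∀ i, z i Ψ Δ = 0 := fun i => hz.excLE h i Δ hΔ
  simp [fieldCoeff, this]

/-- The operator `∑ x_i z_i` on vectors of finite excitation. -/
def IsModes.op (hz : IsModes z) (x : Seq ι) : (fockFilt ι).Op where
  toFun v := ⟨mkFock (fieldCoeff z x (v : Fock ι)) (by
      obtain ⟨N, hN⟩ := Filtered.exists_mem_space v
      exact hz.sqSum_fieldCoeff_ne_top hN x), by
    obtain ⟨N, hN⟩ := Filtered.exists_mem_space v
    exact Filtered.space_le_union (N + 1) (hz.fieldCoeff_excLE hN x)⟩
  map_add' v w := by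
    refine Subtype.ext (lp.ext (funext fun Δ => ?_))
    obtain ⟨N, hN⟩ := Filtered.exists_mem_space v
    obtain ⟨M, hM⟩ := Filtered.exists_mem_space w
    change ∑' i, x i * z i ((v : Fock ι) + (w : Fock ι) : Finset ι → ℂ) Δ =
      (∑' i, x i * z i (v : Fock ι) Δ) + ∑' i, x i * z i (w : Fock ι) Δ
    rw [← (hz.summable hN x Δ).tsum_add (hz.summable hM x Δ)]
    exact tsum_congr fun i => by rw [map_add, Pi.add_apply, mul_add]
  map_smul' c v := by
    refine Subtype.ext (lp.ext (funext fun Δ => ?_))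
    change ∑' i, x i * z i (c • ((v : Fock ι) : Finset ι → ℂ)) Δ =
      c * ∑' i, x i * z i (v : Fock ι) Δ
    rw [← tsum_mul_left]
    exact tsum_congr fun i => by rw [map_smul, Pi.smul_apply, smul_eq_mul]; ring

theorem IsModes.op_apply (hz : IsModes z) (x : Seq ι) (v : (fockFilt ι).union) (Δ : Finset ι) :
    (hz.op x v : Fock ι) Δ = ∑' i, x i * z i (v : Fock ι) Δ := rfl

theorem IsModes.op_bound (hz : IsModes z) (x : Seq ι) (N : ℕ) :
    Filtered.OpBound (hz.op x) N (N + 1) (2 * (N + 1) * ‖x‖) := fun v hv => by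
  refine ⟨hz.fieldCoeff_excLE hv x, ?_⟩
  refine norm_mkFock_le (hz.sqSum_fieldCoeff_ne_top hv x) (by positivity) ((hz.sqSum_fieldCoeff_le hv x).trans ?_)
  rw [sqSum_lp x, ← mul_assoc]
  gcongr
  rw [ENNReal.ofReal_mul (by positivity), ENNReal.ofReal_mul (by norm_num), ofReal_norm,
    ENNReal.ofReal_add (by positivity) (by norm_num), ENNReal.ofReal_natCast]
  simp only [ENNReal.ofReal_ofNat, ENNReal.ofReal_one, mul_pow]
  gcongr
  · norm_num
  · rw [sq]
    exact le_mul_of_one_le_left zero_le le_add_self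

/-- `op` as an additive function of the coefficients. -/
def IsModes.evalHom (hz : IsModes z) (v : (fockFilt ι).union) : Seq ι →+ Fock ι where
  toFun x := hz.op x v
  map_zero' := by
    refine lp.ext (funext fun Δ => ?_)
    rw [hz.op_apply]
    simp
  map_add' x y := by
    obtain ⟨N, hN⟩ := Filtered.exists_mem_space v
    refine lp.ext (funext fun Δ => ?_)
    rw [lp.coeFn_add, Pi.add_apply, hz.op_apply, hz.op_apply, hz.op_apply,
      ← (hz.summable hN x Δ).tsum_add (hz.summable hN y Δ)]
    exact tsum_congr fun i => by rw [lp.coeFn_add, Pi.add_apply, add_mul]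

theorem IsModes.continuous_evalHom (hz : IsModes z) (v : (fockFilt ι).union) :
    Continuous (hz.evalHom v) := by
  obtain ⟨N, hN⟩ := Filtered.exists_mem_space v
  refine AddMonoidHomClass.continuous_of_bound _ (2 * (N + 1) * ‖(v : Fock ι)‖) fun x => ?_
  refine ((hz.op_bound x N) v hN).2.trans (le_of_eq ?_)
  ring

end Field

/-! ### Commutators of second quantized operators with fields and with each other -/

namespace Sea

variable {ι : Type*} [LinearOrder ι] {s : Sea ι} {A B : H →L[ℂ] H} {c c' : ℝ}
  {z : ι → Module.End ℂ (Finset ι → ℂ)}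

variable (s) in
theorem isModes_aLs : IsModes (aLs s.ρ s.b) := fun i => by
  rw [aLs]; split_ifs <;> simp

variable (s) in
theorem isModes_aL : IsModes (aL s.ρ s.b) := fun i => by
  rw [aL]; split_ifs <;> simp

/-- For a field supported on a single mode, both double series converge absolutely and may be
subtracted term by term. -/
theorem comm_op_apply (hz : IsModes z) (hA : s.Tame A c) (x : Seq ι) {k : ι}
    (hx : ∀ i, i ≠ k → x i = 0) (v : (fockFilt ι).union) (Δ : Finset ι) :
    (s.hatOp A (hz.op x v) : Fock ι) Δ - (hz.op x (s.hatOp A v) : Fock ι) Δ =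
      x k * ∑' p, s.mat A p * (biL s.ρ s.b p * z k - z k * biL s.ρ s.b p) (v : Fock ι) Δ := by
  obtain ⟨N, hN⟩ := Filtered.exists_mem_space v
  have hop : ∀ w : (fockFilt ι).union, ((hz.op x w : Fock ι) : Finset ι → ℂ) =
      x k • z k (w : Fock ι) := fun w => funext fun Δ => by
    rw [hz.op_apply, tsum_eq_single k fun i hi => by rw [hx i hi, zero_mul]]; rfl
  have h1 : Summable (hatTerm s.ρ s.b A (hz.op x v : Fock ι) Δ) :=
    summable_hatTerm hA.ne_top ((hz.op_bound x N) v hN).1 (sqSum_fock_ne_top _) Δ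
  have e1 : ∀ p, hatTerm s.ρ s.b A (hz.op x v : Fock ι) Δ p =
      x k * (s.mat A p * biL s.ρ s.b p (z k (v : Fock ι)) Δ) := fun p => by
    rw [hatTerm, ← biL_apply, hop, map_smul, Pi.smul_apply, smul_eq_mul, mat]; ring
  have e2 : (hz.op x (s.hatOp A v) : Fock ι) Δ =
      ∑' p, x k * (s.mat A p * z k (biL s.ρ s.b p (v : Fock ι)) Δ) := by
    rw [hop, tsum_mul_left, Pi.smul_apply, smul_eq_mul,
      show ((s.hatOp A v : Fock ι) : Finset ι → ℂ) =
        fun Δ => ∑' p, hatTerm s.ρ s.b A (v : Fock ι) Δ p from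
        funext fun Δ => hatOp_apply hA.ne_top v Δ, hz.tsum (fun p Δ => hatTerm s.ρ s.b A v Δ p)]
    congr 1
    refine tsum_congr fun p => ?_
    rw [show (fun Δ => hatTerm s.ρ s.b A (v : Fock ι) Δ p) =
      s.mat A p • biL s.ρ s.b p (v : Fock ι) from funext fun Δ => by
        rw [hatTerm, ← biL_apply]; rfl, map_smul]
    rfl
  have h2 : Summable fun p => x k * (s.mat A p * z k (biL s.ρ s.b p (v : Fock ι)) Δ) := by
    have h3 : ∀ Δ : Finset ι, Summable (hatTerm s.ρ s.b A (v : Fock ι) Δ) := fun Δ =>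
      summable_hatTerm hA.ne_top hN (sqSum_fock_ne_top _) Δ
    refine Summable.mul_left _ ?_
    have e : ∀ p Δ, s.mat A p * biL s.ρ s.b p (v : Fock ι) Δ =
        hatTerm s.ρ s.b A (v : Fock ι) Δ p := fun p Δ => by rw [hatTerm, ← biL_apply]; rfl
    rcases hz k with h' | h' <;> rw [h']
    · simp only [annL_apply]
      split_ifs
      · simp
      · refine ((h3 (insert k Δ)).mul_left (jwSign k Δ)).congr fun p => ?_
        rw [← e]; ring
    · simp only [creL_apply]
      split_ifs
      · refine ((h3 (Δ.erase k)).mul_left (jwSign k Δ)).congr fun p => ?_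
        rw [← e]; ring
      · simp
  rw [hatOp_apply hA.ne_top, e2, ← h1.tsum_sub h2, ← tsum_mul_left]
  refine tsum_congr fun p => ?_
  rw [e1, LinearMap.sub_apply, Pi.sub_apply, Module.End.mul_apply, Module.End.mul_apply]
  ring

/-- The coordinates of `y`. -/
def creHom (s : Sea ι) : H →+ Seq ι := s.b.repr.toLinearEquiv.toLinearMap.toAddMonoidHom

/-- The conjugates of the coordinates of `y`. -/
def annHom (s : Sea ι) : H →+ Seq ι := (starAddEquiv : Seq ι ≃+ Seq ι).toAddMonoidHom.comp s.creHom

omit [LinearOrder ι] in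
theorem creHom_apply (y : H) (i : ι) : s.creHom y i = ⟪s.b i, y⟫_ℂ := s.b.repr_apply_apply y i

omit [LinearOrder ι] in
theorem annHom_apply (y : H) (i : ι) : s.annHom y i = ⟪y, s.b i⟫_ℂ := by
  rw [← inner_conj_symm, ← creHom_apply]; rfl

omit [LinearOrder ι] in
theorem continuous_creHom : Continuous s.creHom := s.b.repr.continuous

omit [LinearOrder ι] in
theorem continuous_annHom : Continuous s.annHom := continuous_star.comp s.continuous_creHom

/-- Only the terms with second index k survive in the double series, and the remaining sum over the
first index collects the coordinates of A b_k. -/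
theorem comm_cre (hA : s.Tame A c) (a : ℂ) (k : ι) (v : (fockFilt ι).union) :
    (s.hatOp A (s.isModes_aLs.op (s.creHom (a • s.b k)) v) : Fock ι) -
      s.isModes_aLs.op (s.creHom (a • s.b k)) (s.hatOp A v) =
      (s.isModes_aLs.op (s.creHom (A (a • s.b k))) v : Fock ι) := by
  have hx : ∀ i, i ≠ k → s.creHom (a • s.b k) i = 0 := fun i hi => by
    rw [creHom_apply, inner_smul_right, s.b.orthonormal.2 hi, mul_zero]
  have hk : s.creHom (a • s.b k) k = a := by
    rw [creHom_apply, inner_smul_right, inner_self_eq_norm_sq_to_K, s.b.orthonormal.1]; simp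
  refine lp.ext (funext fun Δ => ?_)
  rw [lp.coeFn_sub, Pi.sub_apply, comm_op_apply s.isModes_aLs hA _ hx, hk, IsModes.op_apply]
  simp only [biL_comm_aLs]
  rw [← tsum_mul_left, ← Function.Injective.tsum_eq (g := fun i : ι => (i, k))
    (fun i j h => (Prod.ext_iff.1 h).1)]
  · refine tsum_congr fun i => ?_
    rw [if_pos rfl, creHom_apply, map_smul, inner_smul_right, mat, mul_assoc]
  · intro p hp
    by_cases h : p.2 = k
    · exact ⟨p.1, by rw [← h]⟩
    · simp [h] at hp

theorem comm_ann (hA : s.Tame A c) (a : ℂ) (k : ι) (v : (fockFilt ι).union) :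
    (s.hatOp A (s.isModes_aL.op (s.annHom (a • s.b k)) v) : Fock ι) -
      s.isModes_aL.op (s.annHom (a • s.b k)) (s.hatOp A v) =
      (s.isModes_aL.op (s.annHom ((-A.adjoint) (a • s.b k))) v : Fock ι) := by
  have hx : ∀ i, i ≠ k → s.annHom (a • s.b k) i = 0 := fun i hi => by
    rw [annHom_apply, inner_smul_left, s.b.orthonormal.2 hi.symm, mul_zero]
  have hk : s.annHom (a • s.b k) k = star a := by
    rw [annHom_apply, inner_smul_left, inner_self_eq_norm_sq_to_K, s.b.orthonormal.1]; simp
  refine lp.ext (funext fun Δ => ?_)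
  rw [lp.coeFn_sub, Pi.sub_apply, comm_op_apply s.isModes_aL hA _ hx, hk, IsModes.op_apply]
  simp only [biL_comm_aL]
  rw [← tsum_mul_left, ← Function.Injective.tsum_eq (g := fun i : ι => (k, i))
    (fun i j h => (Prod.ext_iff.1 h).2)]
  · refine tsum_congr fun i => ?_
    rw [if_pos rfl, annHom_apply, map_smul, inner_smul_left,
      show (-A.adjoint) (s.b k) = -(A.adjoint (s.b k)) from rfl, inner_neg_left,
      ContinuousLinearMap.adjoint_inner_left, mat, LinearMap.neg_apply, Pi.neg_apply]
    simp only [RCLike.star_def]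
    ring
  · intro p hp
    by_cases h : p.1 = k
    · exact ⟨p.2, by rw [← h]⟩
    · simp [h] at hp

/-- A commutation rule with fields extends from basis vectors. -/
theorem comm_field (hz : IsModes z) (hA : s.Tame A c) {g : H →+ Seq ι} (hg : Continuous g)
    {D : H →L[ℂ] H} (h : ∀ (a : ℂ) (k : ι) (v : (fockFilt ι).union),
      (s.hatOp A (hz.op (g (a • s.b k)) v) : Fock ι) - hz.op (g (a • s.b k)) (s.hatOp A v) =
        (hz.op (g (D (a • s.b k))) v : Fock ι)) (y : H) :
    s.hatOp A * hz.op (g y) - hz.op (g y) * s.hatOp A = hz.op (g (D y)) := by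
  refine LinearMap.ext fun v => Subtype.ext ?_
  obtain ⟨N, hN⟩ := Filtered.exists_mem_space v
  -- The vector is expanded in the basis and the rule applied termwise. The extension L of Â from
  -- level N + 1 is what may be applied to the resulting convergent series in Fock space.
  obtain ⟨L, hL⟩ := (hA.opBound (N + 1)).exists_clm
  have hy := s.b.hasSum_repr y
  have h1 := (hy.map g hg).map (hz.evalHom v) (hz.continuous_evalHom v)
  have h2 := h1.mapL L
  have h3 := (hy.map g hg).map (hz.evalHom (s.hatOp A v)) (hz.continuous_evalHom _)
  have h4 := ((hy.mapL D).map g hg).map (hz.evalHom v) (hz.continuous_evalHom v)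
  have h5 := h2.sub h3
  have e : ∀ x, L (hz.evalHom v x) = (s.hatOp A (hz.op x v) : Fock ι) := fun x =>
    hL _ ((hz.op_bound x N) v hN).1
  simp only [Function.comp_apply, e] at h4 h5
  refine (HasSum.unique ?_ h5).trans ?_ |>.symm
  · exact (h4.congr_fun fun i => h _ i v : HasSum _ _)
  · rfl

/-- The commutator of second quantizations of commuting operators commutes with the fields. -/
theorem commute_comm_field (hz : IsModes z) {g : H →+ Seq ι} {DA DB : H →L[ℂ] H} (hD : DA ∘L DB = DB ∘L DA)
    (hgA : ∀ y, s.hatOp A * hz.op (g y) - hz.op (g y) * s.hatOp A = hz.op (g (DA y)))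
    (hgB : ∀ y, s.hatOp B * hz.op (g y) - hz.op (g y) * s.hatOp B = hz.op (g (DB y))) (y : H) :
    Commute (s.hatOp A * s.hatOp B - s.hatOp B * s.hatOp A) (hz.op (g y)) := by
  have h1 := hgA (DB y)
  have h2 := hgB (DA y)
  have h3 : DA (DB y) = DB (DA y) := DFunLike.congr_fun hD y
  rw [← hgB y] at h1
  rw [← hgA y] at h2
  -- Jacobi identity: the double commutator with the field of y is the field of [DA, DB] y, which
  -- vanishes.
  rw [commute_iff_lie_eq, Ring.lie_def, ← sub_self (hz.op (g (DA (DB y))))]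
  nth_rw 2 [h3]
  rw [← h1, ← h2]
  simp only [mul_sub, sub_mul, mul_assoc]
  abel

omit [LinearOrder ι] in
theorem ket_empty_apply (Δ : Finset ι) (h : Δ ≠ ∅) :
    ((ket ∅ : (fockFilt ι).union) : Fock ι) Δ = 0 := by rw [ket_apply, if_neg h]

/-- An operator commuting with all creation and annihilation operators is a scalar. -/
theorem eq_smul_one_of_commute {K : (fockFilt ι).Op}
    (hK : ∀ N, ∃ M C, Filtered.OpBound K N M C)
    (hann : ∀ i, ∀ v w : (fockFilt ι).union, ((w : Fock ι) : Finset ι → ℂ) = annL i (v : Fock ι) →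
      ((K w : Fock ι) : Finset ι → ℂ) = annL i (K v : Fock ι))
    (hcre : ∀ i, ∀ v w : (fockFilt ι).union, ((w : Fock ι) : Finset ι → ℂ) = creL i (v : Fock ι) →
      ((K w : Fock ι) : Finset ι → ℂ) = creL i (K v : Fock ι)) :
    K = (K (ket ∅) : Fock ι) ∅ • 1 := by
  set κ := (K (ket ∅) : Fock ι) ∅
  refine op_ext hK (fun N => ⟨N, _, (Filtered.OpBound.one N).smul κ⟩) fun Δ => ?_
  simp only [LinearMap.smul_apply, Module.End.one_apply]
  induction Δ using Finset.induction_on with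
  | empty =>
    refine Subtype.ext (lp.ext (funext fun Δ => ?_))
    rw [Submodule.coe_smul, lp.coeFn_smul, Pi.smul_apply, smul_eq_mul]
    by_cases h : Δ = ∅
    · rw [h, ket_apply, if_pos rfl, mul_one]
    · rw [ket_empty_apply Δ h, mul_zero]
      obtain ⟨i, hi⟩ := Finset.nonempty_iff_ne_empty.2 h
      -- Every excitation annihilator kills |∅⟩, hence also K|∅⟩, so the coefficient of K|∅⟩ at a
      -- nonempty Δ vanishes.
      have h1 := hann i (ket ∅) 0 (by rw [annL_ket (Finset.notMem_empty i)]; rfl)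
      rw [map_zero] at h1
      have h2 := congrFun h1 (Δ.erase i)
      rw [annL_apply, if_neg (Finset.notMem_erase i Δ), Finset.insert_erase hi] at h2
      refine (mul_eq_zero.1 (show jwSign i (Δ.erase i) * (K (ket ∅) : Fock ι) Δ = 0 from ?_)
        ).resolve_left (norm_ne_zero_iff.1 (by rw [norm_jwSign]; exact one_ne_zero))
      rw [← h2]; rfl
  | insert i Δ hi ih =>
    -- A ket with one more excitation is, up to sign, a creator applied to the smaller ket, and K
    -- commutes with it.
    have h1 : ((jwSign i Δ • ket (insert i Δ) : (fockFilt ι).union) : Fock ι) =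
        (creL i (ket Δ : Fock ι) : Finset ι → ℂ) := funext fun D => by
      rw [Submodule.coe_smul, lp.coeFn_smul, Pi.smul_apply, creL_apply, ket_apply, ket_apply]
      by_cases hD : D = insert i Δ
      · subst hD
        simp [hi, jwSign_insert_self]
      · rw [if_neg hD]
        split_ifs with h2 h3
        · exact absurd (by rw [← h3, Finset.insert_erase h2]) hD
        · simp
        · simp
    have h2 := hcre i (ket Δ) _ h1
    rw [map_smul, ih, Submodule.coe_smul, Submodule.coe_smul, lp.coeFn_smul, lp.coeFn_smul,
      map_smul, ← h1, Submodule.coe_smul, lp.coeFn_smul, smul_comm] at h2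
    have h3 : jwSign i Δ ≠ 0 := norm_ne_zero_iff.1 (by rw [norm_jwSign]; exact one_ne_zero)
    have h4 := smul_right_injective _ h3 h2
    exact Subtype.ext (lp.ext h4)

theorem op_basis (hz : IsModes z) {g : H →+ Seq ι} {k : ι} (hk : ∀ i, g (s.b k) i = if i = k then 1 else 0)
    (v : (fockFilt ι).union) : ((hz.op (g (s.b k)) v : Fock ι) : Finset ι → ℂ) = z k (v : Fock ι) := by
  funext Δ
  rw [hz.op_apply, tsum_eq_single k fun i hi => by rw [hk, if_neg hi, zero_mul], hk, if_pos rfl,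
    one_mul]

theorem commute_mode (hz : IsModes z) {g : H →+ Seq ι} {k : ι}
    (hk : ∀ i, g (s.b k) i = if i = k then 1 else 0) {K : (fockFilt ι).Op}
    (h : Commute K (hz.op (g (s.b k)))) (v w : (fockFilt ι).union)
    (hw : ((w : Fock ι) : Finset ι → ℂ) = z k (v : Fock ι)) :
    ((K w : Fock ι) : Finset ι → ℂ) = z k (K v : Fock ι) := by
  rw [← op_basis hz hk] at hw ⊢
  rw [Subtype.ext (lp.ext hw) (a1 := w)]
  exact congrArg (fun x : (fockFilt ι).union => ((x : Fock ι) : Finset ι → ℂ))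
    (LinearMap.congr_fun h.eq v)

/-- The commutator of second quantizations of commuting operators is a scalar. -/
theorem comm_eq_smul_one (hA : s.Tame A c) (hB : s.Tame B c') (hAB : A ∘L B = B ∘L A) :
    s.hatOp A * s.hatOp B - s.hatOp B * s.hatOp A =
      ((s.hatOp A * s.hatOp B - s.hatOp B * s.hatOp A) (ket ∅) : Fock ι) ∅ • 1 := by
  have hb : ∀ i k, ⟪s.b i, s.b k⟫_ℂ = if i = k then 1 else 0 := orthonormal_iff_ite.1 s.b.orthonormal
  have hc : ∀ k i, s.creHom (s.b k) i = if i = k then 1 else 0 := fun k i => by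
    rw [creHom_apply, hb]
  have ha : ∀ k i, s.annHom (s.b k) i = if i = k then 1 else 0 := fun k i => by
    rw [annHom_apply, hb]; simp [eq_comm]
  have h1 := commute_comm_field s.isModes_aLs hAB
    (comm_field s.isModes_aLs hA s.continuous_creHom (comm_cre hA))
    (comm_field s.isModes_aLs hB s.continuous_creHom (comm_cre hB))
  -- Annihilation fields transform with minus the adjoint, and the adjoints commute as well.
  have hAB' : (-A.adjoint) ∘L (-B.adjoint) = (-B.adjoint) ∘L (-A.adjoint) := by
    have := congrArg ContinuousLinearMap.adjoint hAB
    rw [ContinuousLinearMap.adjoint_comp, ContinuousLinearMap.adjoint_comp] at this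
    simp [ContinuousLinearMap.comp_neg, ContinuousLinearMap.neg_comp, this]
  have h2 := commute_comm_field s.isModes_aL hAB'
    (comm_field s.isModes_aL hA s.continuous_annHom (comm_ann hA))
    (comm_field s.isModes_aL hB s.continuous_annHom (comm_ann hB))
  refine eq_smul_one_of_commute (fun N => ⟨N + 2 + 2, _,
    ((hA.opBound (N + 2)).mul (by have := hA.nonneg; positivity) (hB.opBound N)).sub
    ((hB.opBound (N + 2)).mul (by have := hB.nonneg; positivity) (hA.opBound N))⟩)
    (fun i v w hw => ?_) fun i v w hw => ?_
  · by_cases hi : s.ρ (s.b i) = s.b i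
    · have e : aLs s.ρ s.b i = annL i := by rw [aLs, if_pos hi]
      rw [← e] at hw ⊢
      exact commute_mode s.isModes_aLs (hc i) (h1 _) v w hw
    · have e : aL s.ρ s.b i = annL i := by rw [aL, if_neg hi]
      rw [← e] at hw ⊢
      exact commute_mode s.isModes_aL (ha i) (h2 _) v w hw
  · by_cases hi : s.ρ (s.b i) = s.b i
    · have e : aL s.ρ s.b i = creL i := by rw [aL, if_pos hi]
      rw [← e] at hw ⊢
      exact commute_mode s.isModes_aL (ha i) (h2 _) v w hw
    · have e : aLs s.ρ s.b i = creL i := by rw [aLs, if_neg hi]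
      rw [← e] at hw ⊢
      exact commute_mode s.isModes_aLs (hc i) (h1 _) v w hw

theorem annL_annL_tsum {α : Type*} (f : α → Finset ι → ℂ) (i j : ι) (Δ : Finset ι) :
    annL i (annL j (fun Δ => ∑' a, f a Δ)) Δ = ∑' a, annL i (annL j (f a)) Δ := by
  have hm : IsModes (fun i : ι => annL i) := fun i => Or.inl rfl
  have e : annL j (fun Δ => ∑' a, f a Δ) = fun Δ => ∑' a, annL j (f a) Δ :=
    funext fun Δ => hm.tsum f j Δ
  rw [e]
  exact hm.tsum (fun a => annL j (f a)) i Δ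

/-- The expectation of a product of second quantized operators. -/
theorem expectation_mul (hA : s.Tame A c) (hB : s.Tame B c') :
    ((s.hatOp A * s.hatOp B) (ket ∅) : Fock ι) ∅ = ∑' p, s.matOE A p * s.matEO B p.swap := by
  obtain ⟨Ω, hΩ⟩ : ∃ Ω : Finset ι → ℂ, Ω = ((ket ∅ : (fockFilt ι).union) : Fock ι) := ⟨_, rfl⟩
  have hB' : ((s.hatOp B (ket ∅) : Fock ι) : Finset ι → ℂ) =
      fun Δ => ∑' q, hatTerm s.ρ s.b B Ω Δ q :=
    funext fun Δ => by rw [hatOp_apply hB.ne_top (ket ∅) Δ, hΩ]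
  have hv : ∀ i : ι, annL i Ω = 0 := fun i => hΩ ▸ annL_ket (Finset.notMem_empty i)
  have hc : ∀ (i : ι) (Ψ : Finset ι → ℂ), creL i Ψ ∅ = 0 := fun i Ψ => by simp [creL_apply]
  rw [Module.End.mul_apply, hatOp_apply hA.ne_top]
  refine tsum_congr fun p => ?_
  rw [hatTerm, ← biL_apply]
  by_cases h1 : s.Occ p.1 <;> by_cases h2 : s.Occ p.2
  · rw [biL_of_occ_occ _ _ h1 h2, matOE, if_neg (by tauto), zero_mul]
    simp [hc]
  swap
  · rw [biL_of_empty_occ _ _ h1 h2, matOE, if_neg (by tauto), zero_mul]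
    simp [hc]
  swap
  · rw [biL_of_empty_empty _ _ h1 h2, matOE, if_neg (by tauto), zero_mul]
    simp [hc]
  -- Only the pair-annihilating block of A has a component along the vacuum. From B|∅⟩ it selects
  -- the pair that it removes, namely q = p.swap.
  rw [biL_of_occ_empty _ _ h1 h2, matOE, if_pos ⟨h1, h2⟩, Module.End.mul_apply, hB']
  rw [show ⟪s.b p.1, A (s.b p.2)⟫_ℂ = s.mat A p from rfl]
  congr 1
  refine (annL_annL_tsum (fun q Δ => hatTerm s.ρ s.b B Ω Δ q) p.1 p.2 ∅).trans ?_
  have e3 : ∀ q, (fun Δ => hatTerm s.ρ s.b B Ω Δ q) =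
      s.matEO B q • creL q.1 (creL q.2 Ω) := fun q => by
    funext Δ
    rw [s.hatTerm_eq]
    simp [hv]
  have hac : ∀ {i j : ι} (Ψ : Finset ι → ℂ), annL i (creL j Ψ) =
      (if i = j then Ψ else 0) - creL j (annL i Ψ) := fun {i j} Ψ => by
    split_ifs with h
    · subst h
      have := LinearMap.congr_fun (annL_creL_self i) Ψ
      exact eq_sub_of_add_eq this
    · have := LinearMap.congr_fun (annL_creL_ne h) Ψ
      exact eq_sub_of_add_eq this
  have h0 : Ω ∅ = 1 := by rw [hΩ, ket_apply, if_pos rfl]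
  have e4 : ∀ q, annL p.1 (annL p.2 (fun Δ => hatTerm s.ρ s.b B Ω Δ q)) ∅ =
      if q = p.swap then s.matEO B q else 0 := fun q => by
    rw [e3, map_smul, map_smul, Pi.smul_apply, smul_eq_mul]
    by_cases hq : ¬ s.Occ q.1 ∧ s.Occ q.2
    · have h3 : p.2 ≠ q.2 := fun h => h2 (h ▸ hq.2)
      rw [hac, hac, if_neg h3, hv, map_zero, sub_zero, map_zero, sub_zero]
      by_cases h4 : p.2 = q.1
      · rw [if_pos h4, hac, hv, map_zero, sub_zero]
        by_cases h5 : p.1 = q.2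
        · rw [if_pos h5, if_pos (Prod.ext h4.symm h5.symm), h0, mul_one]
        · rw [if_neg h5, if_neg (fun h => h5 (by rw [h]; rfl)), Pi.zero_apply, mul_zero]
      · rw [if_neg h4, if_neg (fun h => h4 (by rw [h]; rfl)), map_zero, Pi.zero_apply, mul_zero]
    · rw [matEO, if_neg hq, zero_mul, ite_self]
  rw [tsum_congr e4, tsum_ite_eq]

/-- The Schwinger term: the trace of `[A, ρ] (1 - 2 ρ) [B, ρ]` up to sign. -/
def schwinger (s : Sea ι) (A B : H →L[ℂ] H) : ℂ :=
  ∑' i, ⟪A.adjoint (s.ρ (s.b i)) - s.ρ (A.adjoint (s.b i)),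
    (B (s.ρ (s.b i)) - s.ρ (B (s.b i))) - (2 : ℂ) • s.ρ (B (s.ρ (s.b i)) - s.ρ (B (s.b i)))⟫_ℂ

end Sea

/-! ### The Schwinger term as a difference of vacuum expectations -/

namespace Sea

variable {ι : Type*} {s : Sea ι} {A B : H →L[ℂ] H} {c c' : ℝ}

theorem comMat_same {p : ι × ι} (h : s.Occ p.1 ↔ s.Occ p.2) : s.comMat A p = 0 := by
  rw [comMat, inner_sub_right, ← s.symm]
  by_cases h2 : s.Occ p.2
  · rw [show s.ρ (s.b p.2) = s.b p.2 from h2, show s.ρ (s.b p.1) = s.b p.1 from h.2 h2, sub_self]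
  · rw [apply_of_not_occ h2, apply_of_not_occ (mt h.1 h2)]
    simp

/-- The commutators restrict to the off-diagonal blocks, and 1 - 2ρ supplies the relative sign
between occupied and empty intermediate modes. What remains is the antisymmetrized vacuum
expectation. -/
theorem schwinger_term (p : ι × ι) :
    ⟪A.adjoint (s.ρ (s.b p.1)) - s.ρ (A.adjoint (s.b p.1)), s.b p.2⟫_ℂ *
      ⟪s.b p.2, (B (s.ρ (s.b p.1)) - s.ρ (B (s.b p.1))) -
        (2 : ℂ) • s.ρ (B (s.ρ (s.b p.1)) - s.ρ (B (s.b p.1)))⟫_ℂ =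
      s.matOE A p * s.matEO B p.swap - s.matEO A p * s.matOE B p.swap := by
  have e1 : ⟪A.adjoint (s.ρ (s.b p.1)) - s.ρ (A.adjoint (s.b p.1)), s.b p.2⟫_ℂ =
      -s.comMat A p := by
    rw [comMat, inner_sub_left, ContinuousLinearMap.adjoint_inner_left, s.symm, s.symm,
      ContinuousLinearMap.adjoint_inner_left, inner_sub_right]
    ring
  have e2 : ⟪s.b p.2, (B (s.ρ (s.b p.1)) - s.ρ (B (s.b p.1))) -
        (2 : ℂ) • s.ρ (B (s.ρ (s.b p.1)) - s.ρ (B (s.b p.1)))⟫_ℂ =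
      s.comMat B p.swap - 2 * ⟪s.ρ (s.b p.2), B (s.ρ (s.b p.1)) - s.ρ (B (s.b p.1))⟫_ℂ := by
    rw [inner_sub_right, inner_smul_right, s.symm]; rfl
  rw [e1, e2]
  by_cases h1 : s.Occ p.1 <;> by_cases h2 : s.Occ p.2
  · rw [comMat_same (iff_of_true h1 h2)]
    simp [matOE, matEO, h1, h2]
  · rw [s.comMat_occ_empty A h1 h2, apply_of_not_occ h2, s.comMat_empty_occ B (p := p.swap) h2 h1]
    simp [matOE, matEO, h1, h2]
  · rw [show s.ρ (s.b p.2) = s.b p.2 from h2, s.comMat_empty_occ A h1 h2,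
      s.comMat_occ_empty B (p := p.swap) h2 h1,
      show ⟪s.b p.2, B (s.ρ (s.b p.1)) - s.ρ (B (s.b p.1))⟫_ℂ = s.comMat B p.swap from rfl,
      s.comMat_occ_empty B (p := p.swap) h2 h1]
    simp only [matOE, matEO, Prod.fst_swap, Prod.snd_swap, h1, h2, not_true_eq_false,
      not_false_eq_true, and_self, if_true, if_false]
    ring
  · rw [comMat_same (iff_of_false h1 h2)]
    simp [matOE, matEO, h1, h2]

theorem summable_mul_swap (hA : s.Tame A c) (hB : s.Tame B c') :
    Summable fun p => s.matOE A p * s.matEO B p.swap := by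
  refine summable_of_tsum_enorm (tsum_enorm_mul_ne_top
    (ne_top_of_le_ne_top hA.ne_top (s.sqSum_matOE_le A))
    (y := fun p : ι × ι => s.matEO B p.swap) ?_)
  refine ne_top_of_le_ne_top hB.ne_top (le_trans (le_of_eq ?_) (s.sqSum_matEO_le B))
  exact (Equiv.prodComm ι ι).tsum_eq fun p => ‖s.matEO B p‖ₑ ^ 2

theorem schwinger_eq (hA : s.Tame A c) (hB : s.Tame B c') :
    s.schwinger A B = ∑' p, s.matOE A p * s.matEO B p.swap -
      ∑' p, s.matOE B p * s.matEO A p.swap := by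
  have h1 := s.summable_mul_swap hA hB
  have h2 : Summable fun p : ι × ι => s.matEO A p * s.matOE B p.swap := by
    rw [← (Equiv.prodComm ι ι).summable_iff]
    exact (s.summable_mul_swap hB hA).congr fun p => mul_comm _ _
  have e : ∑' p, s.matOE B p * s.matEO A p.swap = ∑' p : ι × ι, s.matEO A p * s.matOE B p.swap := by
    rw [← (Equiv.prodComm ι ι).tsum_eq]
    exact tsum_congr fun p => mul_comm _ _
  rw [e, ← h1.tsum_sub h2, (h1.sub h2).tsum_prod, schwinger]
  refine tsum_congr fun i => ?_
  rw [← (s.b.hasSum_inner_mul_inner _ _).tsum_eq]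
  exact tsum_congr fun j => schwinger_term (i, j)

/-- Second quantizations of commuting operators with vanishing Schwinger term commute. -/
theorem commute_hatOp [LinearOrder ι] (hA : s.Tame A c) (hB : s.Tame B c')
    (hAB : A ∘L B = B ∘L A) (h : s.schwinger A B = 0) : Commute (s.hatOp A) (s.hatOp B) := by
  have h1 := comm_eq_smul_one hA hB hAB
  rw [LinearMap.sub_apply, Submodule.coe_sub, lp.coeFn_sub, Pi.sub_apply, expectation_mul hA hB,
    expectation_mul hB hA, ← schwinger_eq hA hB, h, zero_smul] at h1
  exact sub_eq_zero.1 h1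

end Sea

/-! ### Hilbert-Schmidt sums of integral operators -/

/-- Balls of radius 1/2 around basis vectors are disjoint and `H` is separable. Countability allows
almost-everywhere statements to hold for all basis vectors at once. -/
theorem countable_of_hilbertBasis {ι : Type*} (b : HilbertBasis ι ℂ H) : Countable ι := by
  have : Fact ((2 : ℝ≥0∞) ≠ ⊤) := ⟨ENNReal.ofNat_ne_top⟩
  have : SecondCountableTopology H := Lp.SecondCountableTopology
  refine Pairwise.countable_of_isOpen_disjoint (s := fun i => Metric.ball (b i) (1 / 2))
    (fun i j hij => ?_) (fun i => Metric.isOpen_ball) fun i => ⟨b i, by simp⟩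
  refine Set.disjoint_left.2 fun x hi hj => ?_
  have h1 : dist (b i) (b j) < 1 := by
    have := dist_triangle_right (b i) (b j) x
    rw [Metric.mem_ball, dist_comm] at hi hj
    linarith
  have h2 : ‖b i - b j‖ ^ 2 = 2 := by
    have := norm_sub_sq (𝕜 := ℂ) (b i) (b j)
    rw [b.orthonormal.2 hij, b.orthonormal.1, b.orthonormal.1] at this
    norm_num at this
    exact this
  rw [dist_eq_norm] at h1
  nlinarith [norm_nonneg (b i - b j)]

theorem enorm_lead_sq (v : Lead) : ‖v‖ₑ ^ 2 = ∑ j, ‖v j‖ₑ ^ 2 := by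
  have h := EuclideanSpace.norm_sq_eq v
  have e : ∀ {E : Type} [NormedAddCommGroup E] (x : E), ‖x‖ₑ ^ 2 = ENNReal.ofReal (‖x‖ ^ 2) :=
    fun x => by rw [ENNReal.ofReal_pow (norm_nonneg _), ofReal_norm]
  rw [e, h, ENNReal.ofReal_sum_of_nonneg fun _ _ => by positivity]
  simp only [e]

theorem enorm_H_sq (f : H) : ‖f‖ₑ ^ 2 = ∫⁻ x, ‖f x‖ₑ ^ 2 := by
  rw [Lp.enorm_def, eLpNorm_eq_lintegral_rpow_enorm_toReal (by norm_num) (by norm_num)]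
  simp only [ENNReal.toReal_ofNat, ENNReal.rpow_ofNat]
  rw [← ENNReal.rpow_natCast, ← ENNReal.rpow_mul]
  norm_num

/-- `T` acts as the integral operator with rows `R`. -/
def RowRep (T : H →L[ℂ] H) (R : Fin 2 → ℝ → H) : Prop :=
  ∀ (φ : H) (j : Fin 2), ∀ᵐ p, (T φ : ℝ → Lead) p j = ⟪R j p, φ⟫_ℂ

theorem aestronglyMeasurable_coord (f : H) (j : Fin 2) :
    AEStronglyMeasurable (fun p => (f : ℝ → Lead) p j) volume :=
  (EuclideanSpace.proj (𝕜 := ℂ) j).continuous.comp_aestronglyMeasurable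
    (Lp.aestronglyMeasurable f)

namespace RowRep

variable {T T' : H →L[ℂ] H} {R R' : Fin 2 → ℝ → H} {ι : Type*}

theorem tsum_enorm_sq (h : RowRep T R) (c : HilbertBasis ι ℂ H) :
    ∑' i, ‖T (c i)‖ₑ ^ 2 = ∫⁻ p, ∑ j, ‖R j p‖ₑ ^ 2 := by
  have := countable_of_hilbertBasis c
  simp only [enorm_H_sq, enorm_lead_sq]
  rw [← lintegral_tsum fun i => Finset.aemeasurable_fun_sum _ fun j _ =>
    ((aestronglyMeasurable_coord (T (c i)) j).enorm).pow_const 2]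
  have h1 : ∀ᵐ p, ∀ (j : Fin 2) (i : ι), (T (c i) : ℝ → Lead) p j = ⟪R j p, c i⟫_ℂ :=
    ae_all_iff.2 fun j => ae_all_iff.2 fun i => h (c i) j
  refine lintegral_congr_ae (h1.mono fun p hp => ?_)
  simp only
  rw [Summable.tsum_finsetSum fun j _ => ENNReal.summable]
  refine Finset.sum_congr rfl fun j _ => ?_
  simp only [hp, ← enorm_lead_sq]
  rw [← enorm_H_sq]
  exact sqSum_inner_left c (R j p)

/-- The trace of T* T' becomes an integral over rows, again by Parseval at fixed p. The finite
Hilbert-Schmidt norms justify exchanging the sum and the integral. -/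
theorem tsum_inner (h : RowRep T R) (h' : RowRep T' R') (c : HilbertBasis ι ℂ H)
    (hT : ∑' i, ‖T (c i)‖ₑ ^ 2 ≠ ⊤) (hT' : ∑' i, ‖T' (c i)‖ₑ ^ 2 ≠ ⊤) :
    ∑' i, ⟪T (c i), T' (c i)⟫_ℂ = ∫ p, ∑ j, ⟪R' j p, R j p⟫_ℂ := by
  have := countable_of_hilbertBasis c
  simp only [L2.inner_def]
  have hm : ∀ i, AEStronglyMeasurable
      (fun p => ⟪(T (c i) : ℝ → Lead) p, (T' (c i) : ℝ → Lead) p⟫_ℂ) volume := fun i =>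
    (Lp.aestronglyMeasurable (T (c i))).inner (Lp.aestronglyMeasurable (T' (c i)))
  have hle : ∀ i, ∫⁻ p, ‖⟪(T (c i) : ℝ → Lead) p, (T' (c i) : ℝ → Lead) p⟫_ℂ‖ₑ ≤
      ‖T (c i)‖ₑ ^ 2 + ‖T' (c i)‖ₑ ^ 2 := fun i => by
    rw [enorm_H_sq, enorm_H_sq, ← lintegral_add_left'
      ((Lp.aestronglyMeasurable (T (c i))).enorm.pow_const 2)]
    refine lintegral_mono fun p => ?_
    have h1 : ‖⟪(T (c i) : ℝ → Lead) p, (T' (c i) : ℝ → Lead) p⟫_ℂ‖ₑ ≤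
        ‖(T (c i) : ℝ → Lead) p‖ₑ * ‖(T' (c i) : ℝ → Lead) p‖ₑ := by
      rw [← ofReal_norm, ← ofReal_norm, ← ofReal_norm, ← ENNReal.ofReal_mul (norm_nonneg _)]
      exact ENNReal.ofReal_le_ofReal (norm_inner_le_norm _ _)
    refine h1.trans ?_
    rcases le_total ‖(T (c i) : ℝ → Lead) p‖ₑ ‖(T' (c i) : ℝ → Lead) p‖ₑ with h2 | h2
    · exact (mul_le_mul_left h2 _).trans (by rw [sq, sq]; exact le_add_self)
    · exact (mul_le_mul_right h2 _).trans (by rw [sq, sq]; exact le_self_add)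
  have hfin : ∑' i, ∫⁻ p, ‖⟪(T (c i) : ℝ → Lead) p, (T' (c i) : ℝ → Lead) p⟫_ℂ‖ₑ ≠ ⊤ := by
    refine ne_top_of_le_ne_top ?_ (ENNReal.tsum_le_tsum hle)
    rw [ENNReal.tsum_add]
    exact ENNReal.add_ne_top.2 ⟨hT, hT'⟩
  rw [← integral_tsum hm hfin]
  have h1 : ∀ᵐ p, ∀ (j : Fin 2) (i : ι), (T (c i) : ℝ → Lead) p j = ⟪R j p, c i⟫_ℂ :=
    ae_all_iff.2 fun j => ae_all_iff.2 fun i => h (c i) j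
  have h2 : ∀ᵐ p, ∀ (j : Fin 2) (i : ι), (T' (c i) : ℝ → Lead) p j = ⟪R' j p, c i⟫_ℂ :=
    ae_all_iff.2 fun j => ae_all_iff.2 fun i => h' (c i) j
  refine integral_congr_ae ((h1.and h2).mono fun p hp => ?_)
  simp only
  have e : ∀ i, ⟪(T (c i) : ℝ → Lead) p, (T' (c i) : ℝ → Lead) p⟫_ℂ =
      ∑ j, ⟪R' j p, c i⟫_ℂ * ⟪c i, R j p⟫_ℂ := fun i => by
    rw [PiLp.inner_apply]
    refine Finset.sum_congr rfl fun j _ => ?_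
    rw [hp.1, hp.2, ← inner_conj_symm (c i)]
    rfl
  simp only [e]
  rw [Summable.tsum_finsetSum fun j _ => (c.hasSum_inner_mul_inner _ _).summable]
  simp only [L2.inner_def]
  exact Finset.sum_congr rfl fun j _ => (c.hasSum_inner_mul_inner (R' j p) (R j p)).tsum_eq

theorem sub (h : RowRep T R) (h' : RowRep T' R') : RowRep (T - T') fun j p => R j p - R' j p :=
  fun φ j => by
    filter_upwards [h φ j, h' φ j, Lp.coeFn_sub (T φ) (T' φ)] with p h1 h2 h3
    rw [inner_sub_left, ← h1, ← h2, show (T - T') φ = T φ - T' φ from rfl, h3]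
    simp

end RowRep

/-! ### The algebra of multiplication operators -/

theorem matAct_mul (A B : Mat) : matAct (A * B) = matAct A ∘L matAct B := by
  rw [matAct, map_mul]; rfl

theorem matAct_add (A B : Mat) : matAct (A + B) = matAct A + matAct B := map_add _ _ _

theorem matAct_smul (z : ℂ) (A : Mat) : matAct (z • A) = z • matAct A := map_smul _ _ _

theorem matAct_star (A : Mat) : matAct (star A) = (matAct A).adjoint := by
  rw [matAct, map_star, ContinuousLinearMap.star_eq_adjoint]; rfl

theorem matAct_apply (A : Mat) (v : Lead) (j : Fin 2) : matAct A v j = ∑ k, A j k * v k := by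
  rw [matAct, Matrix.ofLp_toEuclideanCLM]
  rfl

theorem matAct_eq_sum (A : Mat) :
    matAct A = ∑ j, ∑ k, A j k • matAct (Matrix.single j k 1) := by
  conv_lhs => rw [Matrix.matrix_eq_sum_single A]
  rw [matAct, map_sum]
  refine Finset.sum_congr rfl fun j _ => ?_
  rw [map_sum]
  refine Finset.sum_congr rfl fun k _ => ?_
  rw [← matAct, ← matAct_smul]
  simp

theorem norm_matAct_single_le (j k : Fin 2) : ‖matAct (Matrix.single j k 1)‖ ≤ 1 := by
  refine ContinuousLinearMap.opNorm_le_bound _ zero_le_one fun v => ?_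
  have : matAct (Matrix.single j k 1) v = EuclideanSpace.single j (v k) := by
    ext i
    rw [matAct_apply, Finset.sum_eq_single k (fun l _ hl => by simp [Ne.symm hl]) (by simp)]
    by_cases h : i = j
    · subst h; simp
    · simp [h, Ne.symm h]
  rw [this, EuclideanSpace.single, PiLp.norm_single, one_mul]
  exact PiLp.norm_apply_le v k

theorem norm_matAct_le {A : Mat} {C : ℝ} (h : ∀ j k, ‖A j k‖ ≤ C) : ‖matAct A‖ ≤ 4 * C := by
  have e : ∀ j k, ‖A j k • matAct (Matrix.single j k 1)‖ ≤ C := fun j k => by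
    rw [norm_smul]
    calc _ ≤ ‖A j k‖ * 1 := by gcongr; exact norm_matAct_single_le j k
      _ ≤ C := by rw [mul_one]; exact h j k
  rw [matAct_eq_sum]
  refine (norm_sum_le _ _).trans ((Finset.sum_le_sum fun j _ =>
    (norm_sum_le _ _).trans (Finset.sum_le_sum fun k _ => e j k)).trans (le_of_eq ?_))
  simp
  ring

/-- A bounded measurable matrix function. -/
def BddSym (m : ℝ → Mat) : Prop :=
  (∀ j k, Measurable fun x => m x j k) ∧ ∃ C, ∀ x j k, ‖m x j k‖ ≤ C

namespace BddSym

variable {m n : ℝ → Mat}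

theorem memLp (h : BddSym m) : MemLp (fun x => matAct (m x)) ⊤ (volume : Measure ℝ) := by
  obtain ⟨h1, C, h2⟩ := h
  refine memLp_top_of_bound ?_ (4 * C) (Eventually.of_forall fun x => norm_matAct_le (h2 x))
  have : (fun x => matAct (m x)) = fun x => ∑ j, ∑ k, m x j k • matAct (Matrix.single j k 1) :=
    funext fun x => matAct_eq_sum _
  rw [this]
  refine StronglyMeasurable.aestronglyMeasurable ?_
  exact Finset.stronglyMeasurable_fun_sum _ fun j _ => Finset.stronglyMeasurable_fun_sum _ fun k _ =>
    (h1 j k).stronglyMeasurable.smul_const _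

theorem ae (h : BddSym m) (f : H) : (mulOp m f : ℝ → Lead) =ᵐ[volume] fun x => matAct (m x) (f x) :=
  mulOp_ae m h.memLp f

theorem const (A : Mat) : BddSym fun _ => A :=
  ⟨fun _ _ => measurable_const, ∑ j, ∑ k, ‖A j k‖, fun _ j k =>
    (Finset.single_le_sum (f := fun k => ‖A j k‖) (fun _ _ => norm_nonneg _)
      (Finset.mem_univ k)).trans (Finset.single_le_sum (f := fun j => ∑ k, ‖A j k‖)
      (fun _ _ => Finset.sum_nonneg fun _ _ => norm_nonneg _) (Finset.mem_univ j))⟩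

theorem add (hm : BddSym m) (hn : BddSym n) : BddSym fun x => m x + n x := by
  obtain ⟨h1, C, h2⟩ := hm
  obtain ⟨h3, D, h4⟩ := hn
  exact ⟨fun j k => (h1 j k).add (h3 j k), C + D, fun x j k =>
    (norm_add_le _ _).trans (add_le_add (h2 x j k) (h4 x j k))⟩

theorem neg (hm : BddSym m) : BddSym fun x => -m x := by
  obtain ⟨h1, C, h2⟩ := hm
  exact ⟨fun j k => (h1 j k).neg, C, fun x j k => by simpa using h2 x j k⟩

theorem mul (hm : BddSym m) (hn : BddSym n) : BddSym fun x => m x * n x := by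
  obtain ⟨h1, C, h2⟩ := hm
  obtain ⟨h3, D, h4⟩ := hn
  have hC : 0 ≤ C := (norm_nonneg _).trans (h2 0 0 0)
  refine ⟨fun j k => ?_, 2 * (C * D), fun x j k => ?_⟩
  · simp only [Matrix.mul_apply]
    exact Finset.measurable_fun_sum _ fun l _ => (h1 j l).mul (h3 l k)
  · change ‖(m x * n x) j k‖ ≤ _
    rw [Matrix.mul_apply]
    refine (norm_sum_le _ _).trans ((Finset.sum_le_sum (g := fun _ => C * D) fun l _ => ?_).trans
      (by simp))
    rw [norm_mul]
    exact mul_le_mul (h2 x j l) (h4 x l k) (norm_nonneg _) hC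

theorem smul {f : ℝ → ℂ} (hf : Measurable f) {D : ℝ} (hD : ∀ x, ‖f x‖ ≤ D) (hm : BddSym m) :
    BddSym fun x => f x • m x := by
  obtain ⟨h1, C, h2⟩ := hm
  have h0 : 0 ≤ D := (norm_nonneg _).trans (hD 0)
  exact ⟨fun j k => hf.mul (h1 j k), D * C, fun x j k => by
    change ‖f x * m x j k‖ ≤ _
    rw [norm_mul]
    exact mul_le_mul (hD x) (h2 x j k) (norm_nonneg _) h0⟩

theorem star (hm : BddSym m) : BddSym fun x => star (m x) := by
  obtain ⟨h1, C, h2⟩ := hm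
  exact ⟨fun j k => (continuous_star.measurable.comp (h1 k j)), C, fun x j k => by
    change ‖Star.star (m x k j)‖ ≤ C
    rw [norm_star]; exact h2 x k j⟩

theorem piecewise {p : ℝ → Prop} [DecidablePred p] (hp : MeasurableSet {x | p x}) (hm : BddSym m)
    (hn : BddSym n) : BddSym fun x => if p x then m x else n x := by
  obtain ⟨h1, C, h2⟩ := hm
  obtain ⟨h3, D, h4⟩ := hn
  refine ⟨fun j k => ?_, max C D, fun x j k => ?_⟩
  · have : (fun x => (if p x then m x else n x) j k) = fun x => if p x then m x j k else n x j k :=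
      funext fun x => by split_ifs <;> rfl
    rw [this]
    exact (h1 j k).ite hp (h3 j k)
  · beta_reduce
    split_ifs
    · exact (h2 x j k).trans (le_max_left _ _)
    · exact (h4 x j k).trans (le_max_right _ _)

end BddSym

variable {m n : ℝ → Mat}

theorem mulOp_congr (hm : BddSym m) (hn : BddSym n) (h : m =ᵐ[volume] n) : mulOp m = mulOp n := by
  refine ContinuousLinearMap.ext fun f => Lp.ext ?_
  filter_upwards [hm.ae f, hn.ae f, h] with x h1 h2 h3
  rw [h1, h2, h3]

theorem mulOp_add (hm : BddSym m) (hn : BddSym n) :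
    mulOp (fun x => m x + n x) = mulOp m + mulOp n := by
  refine ContinuousLinearMap.ext fun f => Lp.ext ?_
  filter_upwards [hm.ae f, hn.ae f, (hm.add hn).ae f, Lp.coeFn_add (mulOp m f) (mulOp n f)]
    with x h1 h2 h3 h4
  rw [show (mulOp m + mulOp n) f = mulOp m f + mulOp n f from rfl, h3, h4, Pi.add_apply, h1, h2,
    matAct_add]
  rfl

theorem mulOp_comp (hm : BddSym m) (hn : BddSym n) :
    mulOp m ∘L mulOp n = mulOp fun x => m x * n x := by
  refine ContinuousLinearMap.ext fun f => Lp.ext ?_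
  filter_upwards [hn.ae f, hm.ae (mulOp n f), (hm.mul hn).ae f] with x h1 h2 h3
  rw [h3, matAct_mul]
  change (mulOp m (mulOp n f) : ℝ → Lead) x = _
  rw [h2, h1]
  rfl

theorem mulOp_adjoint (hm : BddSym m) : (mulOp m).adjoint = mulOp fun x => star (m x) := by
  symm
  rw [ContinuousLinearMap.eq_adjoint_iff]
  intro f g
  rw [L2.inner_def, L2.inner_def]
  refine integral_congr_ae ?_
  filter_upwards [hm.ae g, hm.star.ae f] with x h1 h2
  rw [h1, h2, matAct_star, ContinuousLinearMap.adjoint_inner_left]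

theorem norm_mulOp_le (hm : BddSym m) {C : ℝ} (h0 : 0 ≤ C) (h : ∀ x j k, ‖m x j k‖ ≤ C) :
    ‖mulOp m‖ ≤ 4 * C := by
  refine ContinuousLinearMap.opNorm_le_bound _ (by positivity) fun f => ?_
  refine Lp.norm_le_mul_norm_of_ae_le_mul ?_
  filter_upwards [hm.ae f] with x hx
  rw [hx]
  exact ((matAct (m x)).le_opNorm _).trans (by gcongr; exact norm_matAct_le (h x))

/-! ### The Fermi sea as a Sea -/

theorem bddSym_fermiSymbol (μL μR : ℝ) : BddSym (fermiSymbol μL μR) := by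
  classical
  have hm : ∀ c : ℝ, Measurable fun ξ : ℝ => if 2 * Real.pi * ξ < c then (1 : ℂ) else 0 := fun c =>
    Measurable.ite (measurableSet_lt (by fun_prop) measurable_const) measurable_const measurable_const
  refine ⟨fun j k => ?_, 1, fun x j k => ?_⟩
  · fin_cases j <;> fin_cases k
    · exact hm μL
    · exact measurable_const
    · exact measurable_const
    · exact hm μR
  · fin_cases j <;> fin_cases k <;> simp [fermiSymbol] <;> split_ifs <;> simp

/-! ### Smooth symbols and their Fourier transforms -/

section IsTest

variable {F : Type*} [NormedAddCommGroup F] [NormedSpace ℝ F]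

theorem IsTest.add {f g : ℝ → F} (hf : IsTest f) (hg : IsTest g) : IsTest fun x => f x + g x :=
  ⟨hf.1.add hg.1, hf.2.add hg.2⟩

theorem IsTest.finsetSum {α : Type*} (s : Finset α) {f : α → ℝ → F} (h : ∀ i ∈ s, IsTest (f i)) :
    IsTest fun x => ∑ i ∈ s, f i x := by
  classical
  induction s using Finset.induction_on with
  | empty => simp only [Finset.sum_empty]; exact ⟨contDiff_const, HasCompactSupport.zero⟩
  | insert a s ha ih =>
    simp only [Finset.sum_insert ha]
    exact (h a (by simp)).add (ih fun i hi => h i (by simp [hi]))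

theorem IsTest.smul_const [NormedSpace ℂ F] {f : ℝ → ℂ} (hf : IsTest f) (v : F) :
    IsTest fun x => f x • v :=
  ⟨hf.1.smul contDiff_const, hf.2.smul_right⟩

end IsTest

/-- A matrix function with test functions as entries. -/
def IsSymbol (a : ℝ → Mat) : Prop := ∀ j k, IsTest fun x => a x j k

namespace IsSymbol

variable {a : ℝ → Mat}

theorem isTest_matAct (ha : IsSymbol a) : IsTest fun x => matAct (a x) := by
  simp only [fun x => matAct_eq_sum (a x)]
  exact IsTest.finsetSum _ fun j _ => IsTest.finsetSum _ fun k _ => (ha j k).smul_const _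

theorem bddSym (ha : IsSymbol a) : BddSym a := by
  refine ⟨fun j k => (ha j k).1.continuous.measurable, ?_⟩
  have h : ∀ j k, ∃ C, ∀ x, ‖a x j k‖ ≤ C := fun j k =>
    (ha j k).2.exists_bound_of_continuous (ha j k).1.continuous
  choose C hC using h
  exact ⟨∑ j, ∑ k, |C j k|, fun x j k => (hC j k x).trans ((le_abs_self _).trans
    ((Finset.single_le_sum (f := fun k => |C j k|) (fun _ _ => abs_nonneg _)
      (Finset.mem_univ k)).trans (Finset.single_le_sum (f := fun j => ∑ k, |C j k|)
      (fun _ _ => Finset.sum_nonneg fun _ _ => abs_nonneg _) (Finset.mem_univ j))))⟩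

theorem star (ha : IsSymbol a) : IsSymbol fun x => star (a x) := fun j k =>
  ⟨Complex.conjCLE.contDiff.comp (ha k j).1, (ha k j).2.comp_left (g := Star.star) (star_zero _)⟩

/-- The symbol as a Schwartz function. -/
def toS (ha : IsSymbol a) : SchwartzMap ℝ (Lead →L[ℂ] Lead) :=
  ha.isTest_matAct.2.toSchwartzMap ha.isTest_matAct.1

end IsSymbol

/-- The Fourier transform on the one-particle space. -/
def FT : H ≃ₗᵢ[ℂ] H := Lp.fourierTransformₗᵢ ℝ Lead

theorem FT_toLp (f : SchwartzMap ℝ Lead) : FT (f.toLp 2) = (𝓕 f).toLp 2 :=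
  SchwartzMap.toLp_fourier_eq f

theorem FT_symm_toLp (f : SchwartzMap ℝ Lead) : FT.symm (f.toLp 2) = (𝓕⁻ f).toLp 2 :=
  SchwartzMap.toLp_fourierInv_eq f

/-- Conjugation by the Fourier transform. -/
def conjFT (T : H →L[ℂ] H) : H →L[ℂ] H :=
  FT.toContinuousLinearEquiv.toContinuousLinearMap ∘L T ∘L
    FT.symm.toContinuousLinearEquiv.toContinuousLinearMap

theorem conjFT_apply (T : H →L[ℂ] H) (f : H) : conjFT T f = FT (T (FT.symm f)) := rfl

theorem memLp_row (S : SchwartzMap ℝ (Lead →L[ℂ] Lead)) (j : Fin 2) (p : ℝ) :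
    MemLp (fun q => (S (p - q)).adjoint (EuclideanSpace.single j 1)) 2 (volume : Measure ℝ) := by
  have h1 : MemLp (fun q => S (p - q)) 2 (volume : Measure ℝ) :=
    (S.memLp 2).comp_measurePreserving (Measure.measurePreserving_sub_left volume p)
  have hc : Continuous fun T : Lead →L[ℂ] Lead => T.adjoint (EuclideanSpace.single j (1 : ℂ)) :=
    (ContinuousLinearMap.adjoint (𝕜 := ℂ) (E := Lead) (F := Lead)).continuous.clm_apply
      continuous_const
  refine h1.of_le (hc.comp_aestronglyMeasurable h1.1) (Eventually.of_forall fun q => ?_)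
  refine (ContinuousLinearMap.le_opNorm _ _).trans (le_of_eq ?_)
  rw [LinearIsometryEquiv.norm_map, EuclideanSpace.single, PiLp.norm_single]
  simp

/-- Rows of the convolution with `S`. -/
def row (S : SchwartzMap ℝ (Lead →L[ℂ] Lead)) (j : Fin 2) (p : ℝ) : H := (memLp_row S j p).toLp

theorem row_ae (S : SchwartzMap ℝ (Lead →L[ℂ] Lead)) (j : Fin 2) (p : ℝ) :
    (row S j p : ℝ → Lead) =ᵐ[volume] fun q => (S (p - q)).adjoint (EuclideanSpace.single j 1) :=
  (memLp_row S j p).coeFn_toLp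

/-- A convergent sequence in L² converges almost everywhere along a subsequence, while the inner
product with the row converges at every p. Row representations thus need checking only on Schwartz
functions. -/
theorem isClosed_rowRep (T : H →L[ℂ] H) (r : ℝ → H) (j : Fin 2) :
    IsClosed {φ : H | ∀ᵐ p, (T φ : ℝ → Lead) p j = ⟪r p, φ⟫_ℂ} := by
  refine IsSeqClosed.isClosed fun u φ hu hφ => ?_
  have h1 : Tendsto (fun n => T (u n)) atTop (𝓝 (T φ)) := (T.continuous.tendsto φ).comp hφ
  obtain ⟨ns, hns, h2⟩ := (tendstoInMeasure_of_tendsto_Lp h1).exists_seq_tendsto_ae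
  have h3 : ∀ᵐ p, ∀ n, (T (u n) : ℝ → Lead) p j = ⟪r p, u n⟫_ℂ := ae_all_iff.2 hu
  filter_upwards [h2, h3] with p h4 h5
  have h6 : Tendsto (fun i => (T (u (ns i)) : ℝ → Lead) p j) atTop (𝓝 ((T φ : ℝ → Lead) p j)) :=
    ((EuclideanSpace.proj (𝕜 := ℂ) j).continuous.tendsto _).comp h4
  refine tendsto_nhds_unique h6 ?_
  simp only [h5]
  exact ((innerSL ℂ (r p)).continuous.tendsto φ).comp (hφ.comp hns.tendsto_atTop)

/-- Fourier transform of a product. -/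
theorem fourier_pairing (S : SchwartzMap ℝ (Lead →L[ℂ] Lead)) (h : SchwartzMap ℝ Lead) (p : ℝ) :
    𝓕 (SchwartzMap.pairing (ContinuousLinearMap.id ℂ (Lead →L[ℂ] Lead)) S h) p =
      ∫ q, (𝓕 S) (p - q) ((𝓕 h) q) := by
  set B := ContinuousLinearMap.id ℂ (Lead →L[ℂ] Lead)
  have e1 : ∀ {E : Type} [NormedAddCommGroup E] [NormedSpace ℂ E] (f : SchwartzMap ℝ E) (x : ℝ),
      (𝓕⁻ f) x = (𝓕 f) (-x) := fun f x => by
    rw [SchwartzMap.fourierInv_coe, SchwartzMap.fourier_coe, Real.fourierInv_eq_fourier_neg]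
  have h1 : 𝓕⁻ (SchwartzMap.pairing B S h) = SchwartzMap.convolution B (𝓕⁻ S) (𝓕⁻ h) := by
    simp [SchwartzMap.convolution]
  have h2 := congrArg (fun f : SchwartzMap ℝ Lead => f (-p)) h1
  simp only [e1, neg_neg, SchwartzMap.convolution_apply] at h2
  rw [h2, MeasureTheory.convolution, ← integral_sub_right_eq_self _ p]
  refine integral_congr_ae (Eventually.of_forall fun q => ?_)
  simp only [e1]
  rw [show -(q - p) = p - q by ring, show -(-p - (q - p)) = q by ring]
  rfl

/-- Multiplication by a smooth symbol is convolution in momentum space. -/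
theorem rowRep_conjFT {a : ℝ → Mat} (ha : IsSymbol a) :
    RowRep (conjFT (mulOp a)) (row (𝓕 ha.toS)) := by
  intro φ j
  refine (SchwartzMap.denseRange_toLpCLM (E := ℝ) (F := Lead) (μ := (volume : Measure ℝ)) (p := 2) ENNReal.ofNat_ne_top).induction_on
    (p := fun φ : H => ∀ᵐ p, (conjFT (mulOp a) φ : ℝ → Lead) p j = ⟪row (𝓕 ha.toS) j p, φ⟫_ℂ)
    φ (isClosed_rowRep _ _ j) fun g => ?_
  have h0 : SchwartzMap.toLpCLM ℝ (E := ℝ) Lead 2 volume g = g.toLp 2 := rfl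
  rw [h0, conjFT_apply, FT_symm_toLp]
  have h1 : mulOp a ((𝓕⁻ g).toLp 2) =
      (SchwartzMap.pairing (ContinuousLinearMap.id ℂ (Lead →L[ℂ] Lead)) ha.toS (𝓕⁻ g)).toLp 2 := by
    refine Lp.ext ?_
    filter_upwards [ha.bddSym.ae ((𝓕⁻ g).toLp 2), (𝓕⁻ g).coeFn_toLp 2,
      (SchwartzMap.pairing (ContinuousLinearMap.id ℂ (Lead →L[ℂ] Lead)) ha.toS
        (𝓕⁻ g)).coeFn_toLp 2] with x h1 h2 h3
    rw [h1, h2, h3, SchwartzMap.pairing_apply_apply]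
    rfl
  rw [h1, FT_toLp]
  filter_upwards [(𝓕 (SchwartzMap.pairing (ContinuousLinearMap.id ℂ (Lead →L[ℂ] Lead)) ha.toS
    (𝓕⁻ g))).coeFn_toLp 2] with p hp
  rw [hp, fourier_pairing, FourierTransform.fourier_fourierInv_eq, L2.inner_def]
  have h2 : Integrable fun q => (𝓕 ha.toS) (p - q) (g q) := by
    obtain ⟨C, hC⟩ : ∃ C, ∀ x, ‖(𝓕 ha.toS) x‖ ≤ C :=
      ⟨_, fun x => SchwartzMap.norm_le_seminorm ℝ (𝓕 ha.toS) x⟩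
    refine (g.integrable.norm.const_mul C).mono' ?_ (Eventually.of_forall fun q => ?_)
    · exact (((𝓕 ha.toS).continuous.comp (by fun_prop)).clm_apply g.continuous).aestronglyMeasurable
    · exact ((ContinuousLinearMap.le_opNorm _ _)).trans (by gcongr; exact hC _)
  refine Eq.trans ((EuclideanSpace.proj (𝕜 := ℂ) j : Lead →L[ℂ] ℂ).integral_comp_comm h2).symm ?_
  refine integral_congr_ae ?_
  filter_upwards [row_ae (𝓕 ha.toS) j p, g.coeFn_toLp 2] with q h3 h4
  rw [h3, h4, ContinuousLinearMap.adjoint_inner_left, EuclideanSpace.inner_single_left]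
  simp

/-! ### The commutator with the Fermi sea in momentum space -/

/-- Fermi momentum divided by `2π`. -/
def fermiMom (μL μR : ℝ) (j : Fin 2) : ℝ := (if j = 0 then μL else μR) / (2 * Real.pi)

/-- Indicator of occupied momenta. -/
def occ (m p : ℝ) : ℂ := if p < m then 1 else 0

theorem measurable_occ (m : ℝ) : Measurable (occ m) :=
  Measurable.ite measurableSet_Iio measurable_const measurable_const

theorem fermiSymbol_apply (μL μR ξ : ℝ) (j k : Fin 2) :
    fermiSymbol μL μR ξ j k = if j = k then occ (fermiMom μL μR j) ξ else 0 := by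
  have h : ∀ c : ℝ, 2 * Real.pi * ξ < c ↔ ξ < c / (2 * Real.pi) := fun c => by
    rw [lt_div_iff₀ (by positivity), mul_comm]
  fin_cases j <;> fin_cases k <;> simp [fermiSymbol, occ, fermiMom, h]

/-- Multiplication by the Fermi symbol in momentum space. -/
def fermiM (μL μR : ℝ) : H →L[ℂ] H := mulOp (fermiSymbol μL μR)

section

variable (μL μR : ℝ)

theorem fermiM_ae (f : H) : ∀ᵐ p, ∀ j, (fermiM μL μR f : ℝ → Lead) p j =
    occ (fermiMom μL μR j) p * (f : ℝ → Lead) p j := by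
  filter_upwards [(bddSym_fermiSymbol μL μR).ae f] with p hp j
  rw [fermiM, hp, matAct_apply]
  simp [fermiSymbol_apply]

theorem fermiM_symm (f g : H) : ⟪fermiM μL μR f, g⟫_ℂ = ⟪f, fermiM μL μR g⟫_ℂ := by
  rw [← ContinuousLinearMap.adjoint_inner_right, fermiM, mulOp_adjoint (bddSym_fermiSymbol μL μR)]
  congr 3
  funext ξ
  ext j k
  rw [Matrix.star_apply, fermiSymbol_apply, fermiSymbol_apply]
  by_cases h : j = k
  · subst h; simp only [if_true, occ]; split_ifs <;> simp
  · simp [h, Ne.symm h]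

theorem fermiSea_apply (f : H) : fermiSea μL μR f = FT.symm (fermiM μL μR (FT f)) := rfl

theorem fermiSea_symm (f g : H) : ⟪fermiSea μL μR f, g⟫_ℂ = ⟪f, fermiSea μL μR g⟫_ℂ := by
  rw [fermiSea_apply, fermiSea_apply, ← FT.inner_map_map, ← FT.inner_map_map f,
    FT.apply_symm_apply, FT.apply_symm_apply, fermiM_symm]

variable {μL μR}

/-- The Fermi sea with an adapted basis. -/
def fermi {ι : Type*} {b : HilbertBasis ι ℂ H} (hb : Adapted (fermiSea μL μR) b) : Sea ι where
  ρ := fermiSea μL μR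
  b := b
  symm := fermiSea_symm μL μR
  adapted := hb

variable (μL μR)

/-- The commutator with the Fermi sea. -/
def com (A : H →L[ℂ] H) : H →L[ℂ] H := A ∘L fermiSea μL μR - fermiSea μL μR ∘L A

/-- Rows of the kernel of the commutator. -/
def comRow (S : SchwartzMap ℝ (Lead →L[ℂ] Lead)) (j : Fin 2) (p : ℝ) : H :=
  fermiM μL μR (row S j p) - occ (fermiMom μL μR j) p • row S j p

theorem conj_occ (m p : ℝ) : starRingEnd ℂ (occ m p) = occ m p := by
  rw [occ]; split_ifs <;> simp

theorem rowRep_com {a : ℝ → Mat} (ha : IsSymbol a) :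
    RowRep (conjFT (com μL μR (mulOp a))) (comRow μL μR (𝓕 ha.toS)) := by
  have e : conjFT (com μL μR (mulOp a)) =
      conjFT (mulOp a) ∘L fermiM μL μR - fermiM μL μR ∘L conjFT (mulOp a) := by
    refine ContinuousLinearMap.ext fun f => ?_
    simp only [conjFT_apply, com, sub_apply, ContinuousLinearMap.comp_apply, map_sub,
      fermiSea_apply, FT.apply_symm_apply]
  rw [e]
  refine RowRep.sub (fun φ j => ?_) fun φ j => ?_
  · filter_upwards [rowRep_conjFT ha (fermiM μL μR φ) j] with p hp
    rw [fermiM_symm, ← hp]; rfl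
  · filter_upwards [rowRep_conjFT ha φ j, fermiM_ae μL μR (conjFT (mulOp a) φ)] with p h1 h2
    rw [inner_smul_left, conj_occ, ← h1, ← h2 j]; rfl

/-- The entries of the Fourier transform of a symbol. -/
def hatE (a : ℝ → Mat) (j k : Fin 2) : ℝ → ℂ := 𝓕 fun x => a x j k

theorem hatE_eq {a : ℝ → Mat} (ha : IsSymbol a) (j k : Fin 2) (r : ℝ) :
    (𝓕 ha.toS) r (EuclideanSpace.single k 1) j = hatE a j k r := by
  set L : (Lead →L[ℂ] Lead) →L[ℂ] ℂ := (EuclideanSpace.proj (𝕜 := ℂ) j : Lead →L[ℂ] ℂ) ∘L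
    ContinuousLinearMap.apply ℂ Lead (EuclideanSpace.single k (1 : ℂ))
  have hL : ∀ x, L (ha.toS x) = a x j k := fun x => by
    change matAct (a x) (EuclideanSpace.single k 1) j = _
    rw [matAct_apply]
    simp
  change L ((𝓕 ha.toS) r) = _
  rw [hatE, SchwartzMap.fourier_coe, Real.fourier_eq, Real.fourier_eq,
    ← L.integral_comp_comm ((Real.fourierIntegral_convergent_iff r).2 ha.toS.integrable)]
  refine integral_congr_ae (Eventually.of_forall fun x => ?_)
  simp only
  rw [← hL x, Circle.smul_def, Circle.smul_def, map_smul]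

theorem comRow_ae {a : ℝ → Mat} (ha : IsSymbol a) (j : Fin 2) (p : ℝ) :
    ∀ᵐ q, ∀ k, (comRow μL μR (𝓕 ha.toS) j p : ℝ → Lead) q k =
      (occ (fermiMom μL μR k) q - occ (fermiMom μL μR j) p) *
        starRingEnd ℂ (hatE a j k (p - q)) := by
  filter_upwards [Lp.coeFn_sub (fermiM μL μR (row (𝓕 ha.toS) j p))
    (occ (fermiMom μL μR j) p • row (𝓕 ha.toS) j p),
    Lp.coeFn_smul (occ (fermiMom μL μR j) p) (row (𝓕 ha.toS) j p),
    fermiM_ae μL μR (row (𝓕 ha.toS) j p), row_ae (𝓕 ha.toS) j p] with q h1 h2 h3 h4 k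
  rw [comRow, h1, Pi.sub_apply, PiLp.sub_apply, h2, Pi.smul_apply, PiLp.smul_apply, h3, h4,
    smul_eq_mul, ← sub_mul]
  congr 1
  rw [← hatE_eq ha]
  have := EuclideanSpace.inner_single_left k (1 : ℂ)
    ((𝓕 ha.toS (p - q)).adjoint (EuclideanSpace.single j 1))
  rw [ContinuousLinearMap.adjoint_inner_right, EuclideanSpace.inner_single_right] at this
  simpa using this.symm

end

/-! ### Integrals of differences of step functions -/

theorem occ_sub_eq (u v p : ℝ) : occ u p - occ v p =
    (Set.Ico v u).indicator 1 p - (Set.Ico u v).indicator 1 p := by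
  simp only [occ, Set.indicator, Set.mem_Ico, Pi.one_apply]
  by_cases h1 : p < u <;> by_cases h2 : p < v
  · simp [h1, h2, not_le.2 h1, not_le.2 h2]
  · simp [h1, h2, not_lt.1 h2, not_le.2 h1]
  · simp [h1, h2, not_lt.1 h1, not_le.2 h2]
  · simp [h1, h2]

theorem integrable_indicator_Ico (a b : ℝ) :
    Integrable ((Set.Ico a b).indicator (1 : ℝ → ℂ)) :=
  (integrable_indicator_iff measurableSet_Ico).2 (integrableOn_const (by simp) (by simp))

theorem integral_indicator_Ico (a b : ℝ) :
    ∫ p, (Set.Ico a b).indicator (1 : ℝ → ℂ) p = (max (b - a) 0 : ℝ) := by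
  have := integral_indicator_const (μ := (volume : Measure ℝ)) (1 : ℂ) (measurableSet_Ico (a := a) (b := b))
  rw [Real.volume_real_Ico] at this
  refine Eq.trans this ?_
  simp

theorem integrable_occ_sub (u v : ℝ) : Integrable fun p => occ u p - occ v p := by
  simp only [occ_sub_eq]
  exact (integrable_indicator_Ico v u).sub (integrable_indicator_Ico u v)

theorem integral_occ_sub (u v : ℝ) : ∫ p, (occ u p - occ v p) = u - v := by
  simp only [occ_sub_eq]
  rw [integral_sub (integrable_indicator_Ico v u) (integrable_indicator_Ico u v),
    integral_indicator_Ico, integral_indicator_Ico]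
  rcases le_total u v with h | h
  · rw [max_eq_right (by linarith), max_eq_left (by linarith)]; push_cast; ring
  · rw [max_eq_left (by linarith), max_eq_right (by linarith)]; push_cast; ring

theorem enorm_occ_sub_sq (u v p : ℝ) : ‖occ u p - occ v p‖ₑ ^ 2 =
    (Set.Ico (min u v) (max u v)).indicator 1 p := by
  simp only [occ, Set.indicator, Set.mem_Ico, Pi.one_apply]
  by_cases h1 : p < u <;> by_cases h2 : p < v
  · simp [h1, h2]
  · simp [h1, h2, not_lt.1 h2]
  · simp [h1, h2, not_lt.1 h1]
  · simp [h1, h2]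

theorem measurable_occ_sub_sq (u v : ℝ) : Measurable fun p => ‖occ u p - occ v p‖ₑ ^ 2 :=
  ((measurable_occ u).sub (measurable_occ v)).enorm.pow_const 2

theorem lintegral_occ_sub (u v : ℝ) :
    ∫⁻ p, ‖occ u p - occ v p‖ₑ ^ 2 = ENNReal.ofReal |u - v| := by
  simp only [enorm_occ_sub_sq]
  rw [lintegral_indicator_one measurableSet_Ico, Real.volume_Ico, max_sub_min_eq_abs']

theorem integral_norm_occ_sub (u v : ℝ) : ∫ p, ‖occ u p - occ v p‖ = |u - v| := by
  have e : ∀ p, ‖occ u p - occ v p‖ = (‖occ u p - occ v p‖ₑ ^ 2).toReal := fun p => by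
    simp only [occ]; split_ifs <;> simp
  simp only [e]
  rw [integral_toReal (measurable_occ_sub_sq u v).aemeasurable, lintegral_occ_sub,
    ENNReal.toReal_ofReal (abs_nonneg _)]
  exact Eventually.of_forall fun p => ENNReal.pow_lt_top enorm_lt_top

theorem occ_shift (m p r : ℝ) : occ m (p - r) = occ (m + r) p := by
  simp only [occ, sub_lt_iff_lt_add]

/-- With r = p - q the p-integral measures the set where two step functions with edges u + r and v
differ, an interval of length |u + r - v|. -/
theorem lintegral_lintegral_occ (u v : ℝ) {g : ℝ → ℝ≥0∞} (hg : Measurable g) :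
    ∫⁻ p, ∫⁻ q, ‖occ u q - occ v p‖ₑ ^ 2 * g (p - q) =
      ∫⁻ r, ENNReal.ofReal |u + r - v| * g r := by
  have e : ∀ p, ∫⁻ q, ‖occ u q - occ v p‖ₑ ^ 2 * g (p - q) =
      ∫⁻ r, ‖occ (u + r) p - occ v p‖ₑ ^ 2 * g r := fun p => by
    rw [← lintegral_sub_left_eq_self _ p]
    simp only [occ_shift, sub_sub_cancel]
  simp only [e]
  have hm : Measurable fun z : ℝ × ℝ => ‖occ (u + z.2) z.1 - occ v z.1‖ₑ ^ 2 * g z.2 := by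
    have h1 : Measurable fun z : ℝ × ℝ => occ (u + z.2) z.1 :=
      Measurable.ite (measurableSet_lt (by fun_prop) (by fun_prop)) measurable_const measurable_const
    exact ((h1.sub ((measurable_occ v).comp measurable_fst)).enorm.pow_const 2).mul
      (hg.comp measurable_snd)
  rw [lintegral_lintegral_swap hm.aemeasurable]
  refine lintegral_congr fun r => ?_
  rw [lintegral_mul_const _ (measurable_occ_sub_sq _ _), lintegral_occ_sub]

theorem measurable_occ_shift (u : ℝ) : Measurable fun z : ℝ × ℝ => occ (u + z.2) z.1 :=
  Measurable.ite (measurableSet_lt (by fun_prop) (by fun_prop)) measurable_const measurable_const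

theorem integrable_occ_prod (u v : ℝ) {g : ℝ → ℂ} (hg : Measurable g)
    (hi : Integrable fun r => |u + r - v| * ‖g r‖) :
    Integrable (fun z : ℝ × ℝ => (occ (u + z.2) z.1 - occ v z.1) * g z.2)
      ((volume : Measure ℝ).prod (volume : Measure ℝ)) := by
  have hm : Measurable fun z : ℝ × ℝ => (occ (u + z.2) z.1 - occ v z.1) * g z.2 :=
    ((measurable_occ_shift u).sub ((measurable_occ v).comp measurable_fst)).mul
      (hg.comp measurable_snd)
  refine (integrable_prod_iff' hm.aestronglyMeasurable).2 ⟨?_, ?_⟩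
  · exact Eventually.of_forall fun r => (integrable_occ_sub (u + r) v).mul_const (g r)
  · have e : ∀ r, ∫ p, ‖(occ (u + r) p - occ v p) * g r‖ = |u + r - v| * ‖g r‖ := fun r => by
      simp only [norm_mul]
      rw [integral_mul_const, integral_norm_occ_sub]
    simpa only [e] using hi

/-- The signed counterpart: the p-integral of the difference of step functions is the displacement u
+ r - v itself. Its part linear in r later becomes a derivative in position space. -/
theorem integral_occ_prod (u v : ℝ) {g : ℝ → ℂ} (hg : Measurable g)
    (hi : Integrable fun r => |u + r - v| * ‖g r‖) :
    Integrable (fun p => ∫ q, (occ u q - occ v p) * g (p - q)) ∧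
    ∫ p, ∫ q, (occ u q - occ v p) * g (p - q) = ∫ r, ((u + r - v : ℝ) : ℂ) * g r := by
  have e : ∀ p, ∫ q, (occ u q - occ v p) * g (p - q) =
      ∫ r, (occ (u + r) p - occ v p) * g r := fun p => by
    rw [← integral_sub_left_eq_self _ _ p]
    simp only [occ_shift, sub_sub_cancel]
  simp only [e]
  have h := integrable_occ_prod u v hg hi
  refine ⟨h.integral_prod_left, ?_⟩
  rw [integral_integral_swap h]
  refine integral_congr_ae (Eventually.of_forall fun r => ?_)
  simp only
  rw [integral_mul_const, integral_occ_sub]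
  push_cast
  rfl

/-! ### Hilbert-Schmidt norms of commutators of smooth symbols -/

section

variable {μL μR : ℝ} {ι : Type*} {b : HilbertBasis ι ℂ H}

/-- The basis in momentum space. -/
def momBasis (b : HilbertBasis ι ℂ H) : HilbertBasis ι ℂ H :=
  HilbertBasis.ofRepr (FT.symm.trans b.repr)

theorem momBasis_apply (b : HilbertBasis ι ℂ H) (i : ι) : momBasis b i = FT (b i) := by
  classical
  rw [← HilbertBasis.repr_symm_single, ← HilbertBasis.repr_symm_single]
  rfl

theorem conjFT_momBasis (T : H →L[ℂ] H) (i : ι) : conjFT T (momBasis b i) = FT (T (b i)) := by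
  rw [conjFT_apply, momBasis_apply, FT.symm_apply_apply]

theorem hsSq_eq (hb : Adapted (fermiSea μL μR) b) (A : H →L[ℂ] H) :
    (fermi hb).hsSq A = ∑' i, ‖conjFT (com μL μR A) (momBasis b i)‖ₑ ^ 2 := by
  refine tsum_congr fun i => ?_
  rw [conjFT_momBasis, ← ofReal_norm, ← ofReal_norm, LinearIsometryEquiv.norm_map]
  rfl

/-- An entry of a symbol as a Schwartz function. -/
def IsSymbol.entry {a : ℝ → Mat} (ha : IsSymbol a) (j k : Fin 2) : SchwartzMap ℝ ℂ :=
  (ha j k).2.toSchwartzMap (ha j k).1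

theorem IsSymbol.continuous_hatE {a : ℝ → Mat} (ha : IsSymbol a) (j k : Fin 2) :
    Continuous (hatE a j k) := (𝓕 (ha.entry j k)).continuous

theorem measurable_occ_kernel (u v : ℝ) {g : ℝ → ℝ≥0∞} (hg : Measurable g) :
    Measurable fun z : ℝ × ℝ => ‖occ u z.2 - occ v z.1‖ₑ ^ 2 * g (z.1 - z.2) := by
  have h1 : Measurable fun z : ℝ × ℝ => occ u z.2 := (measurable_occ u).comp measurable_snd
  have h2 : Measurable fun z : ℝ × ℝ => occ v z.1 := (measurable_occ v).comp measurable_fst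
  have h3 : Measurable fun z : ℝ × ℝ => g (z.1 - z.2) :=
    hg.comp (measurable_fst.sub measurable_snd)
  exact ((h1.sub h2).enorm.pow_const 2).mul h3

theorem measurable_occ_kernel_right (u v : ℝ) {g : ℝ → ℝ≥0∞} (hg : Measurable g) (p : ℝ) :
    Measurable fun q => ‖occ u q - occ v p‖ₑ ^ 2 * g (p - q) := by
  have h1 : Measurable fun q => occ u q := measurable_occ u
  have h3 : Measurable fun q => g (p - q) := hg.comp (measurable_const.sub measurable_id)
  exact ((h1.sub measurable_const).enorm.pow_const 2).mul h3

theorem measurable_lintegral_occ_kernel (u v : ℝ) {g : ℝ → ℝ≥0∞} (hg : Measurable g) :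
    Measurable fun p => ∫⁻ q, ‖occ u q - occ v p‖ₑ ^ 2 * g (p - q) :=
  (measurable_occ_kernel u v hg).lintegral_prod_right'

theorem IsSymbol.measurable_sq_hatE {a : ℝ → Mat} (ha : IsSymbol a) (j k : Fin 2) :
    Measurable fun r => ‖hatE a j k r‖ₑ ^ 2 :=
  (ha.continuous_hatE j k).measurable.enorm.pow_const 2

theorem enorm_comRow_sq (μL μR : ℝ) {a : ℝ → Mat} (ha : IsSymbol a) (j : Fin 2) (p : ℝ) :
    ‖comRow μL μR (𝓕 ha.toS) j p‖ₑ ^ 2 = ∑ k, ∫⁻ q,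
      ‖occ (fermiMom μL μR k) q - occ (fermiMom μL μR j) p‖ₑ ^ 2 * ‖hatE a j k (p - q)‖ₑ ^ 2 := by
  rw [enorm_H_sq, ← lintegral_finsetSum _ fun k _ =>
    measurable_occ_kernel_right _ _ (ha.measurable_sq_hatE j k) p]
  refine lintegral_congr_ae ?_
  filter_upwards [comRow_ae μL μR ha j p] with q hq
  rw [enorm_lead_sq]
  refine Finset.sum_congr rfl fun k _ => ?_
  rw [hq, enorm_mul, mul_pow, RCLike.enorm_conj]

theorem lintegral_comRow (μL μR : ℝ) {a : ℝ → Mat} (ha : IsSymbol a) :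
    ∫⁻ p, ∑ j, ‖comRow μL μR (𝓕 ha.toS) j p‖ₑ ^ 2 = ∑ j, ∑ k,
      ∫⁻ r, ENNReal.ofReal |fermiMom μL μR k + r - fermiMom μL μR j| * ‖hatE a j k r‖ₑ ^ 2 := by
  simp only [enorm_comRow_sq]
  rw [lintegral_finsetSum _ fun j _ => Finset.measurable_fun_sum _ fun k _ =>
    measurable_lintegral_occ_kernel _ _ (ha.measurable_sq_hatE j k)]
  refine Finset.sum_congr rfl fun j _ => ?_
  rw [lintegral_finsetSum _ fun k _ =>
    measurable_lintegral_occ_kernel _ _ (ha.measurable_sq_hatE j k)]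
  exact Finset.sum_congr rfl fun k _ =>
    lintegral_lintegral_occ _ _ (ha.measurable_sq_hatE j k)

/-- The commutator has kernel (occ_k(q) - occ_j(p)) times the conjugate of â_jk(p - q). Its
Hilbert-Schmidt norm is therefore a half-derivative Sobolev norm shifted by the Fermi momenta,
finite for smooth symbols but not in general for jumps. -/
theorem hsSq_symbol (hb : Adapted (fermiSea μL μR) b) {a : ℝ → Mat} (ha : IsSymbol a) :
    (fermi hb).hsSq (mulOp a) = ∑ j, ∑ k,
      ∫⁻ r, ENNReal.ofReal |fermiMom μL μR k + r - fermiMom μL μR j| * ‖hatE a j k r‖ₑ ^ 2 := by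
  rw [hsSq_eq, (rowRep_com μL μR ha).tsum_enorm_sq, lintegral_comRow]

end

/-! ### Decay of Fourier transforms -/

theorem IsTest.integrable {f : ℝ → ℂ} (hf : IsTest f) : Integrable f :=
  hf.1.continuous.integrable_of_hasCompactSupport hf.2

/-- Bounds on `f` and its first two derivatives, the second being larger by `ε⁻¹`. -/
structure C2Bound (f : ℝ → ℂ) (B ε : ℝ) : Prop where
  sup : ∀ x, ‖f x‖ ≤ B
  int : ∫ x, ‖f x‖ ≤ B
  int_deriv : ∫ x, ‖deriv f x‖ ≤ B
  int_deriv2 : ∫ x, ‖deriv (deriv f) x‖ ≤ B / ε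

theorem IsTest.fourier_deriv {f : ℝ → ℂ} (hf : IsTest f) (r : ℝ) :
    𝓕 (_root_.deriv f) r = (2 * Real.pi * Complex.I * r) * 𝓕 f r := by
  have := congrFun (Real.fourier_deriv hf.integrable (hf.1.differentiable (by simp))
    hf.deriv.integrable) r
  simpa using this

theorem IsTest.norm_fourier_le {f : ℝ → ℂ} (r : ℝ) : ‖𝓕 f r‖ ≤ ∫ x, ‖f x‖ :=
  VectorFourier.norm_fourierIntegral_le_integral_norm _ _ _ _ _

theorem IsTest.abs_mul_norm_fourier_le {f : ℝ → ℂ} (hf : IsTest f) (r : ℝ) :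
    |r| * ‖𝓕 f r‖ ≤ ‖𝓕 (_root_.deriv f) r‖ := by
  rw [hf.fourier_deriv, norm_mul]
  gcongr
  simp only [norm_mul, Complex.norm_ofNat, Complex.norm_real, Complex.norm_I, Real.norm_eq_abs,
    mul_one, abs_of_pos Real.pi_pos]
  nlinarith [Real.pi_gt_three, abs_nonneg r]

/-- Interpolation between derivatives: for |r| ≤ 1 use the L¹ norm, for 1 ≤ |r| ≤ 1/ε the first
derivative together with |r|^δ ≤ ε^(-δ), and beyond 1/ε the second derivative. -/
theorem C2Bound.fourier_le {f : ℝ → ℂ} (hf : IsTest f) {B ε δ : ℝ} (h : C2Bound f B ε)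
    (hε : 0 < ε) (hε1 : ε ≤ 1) (hδ : 0 < δ) (hδ1 : δ ≤ 1) (r : ℝ) :
    ‖𝓕 f r‖ ≤ 4 * B * ε ^ (-δ) * (1 + |r|) ^ (-(1 + δ)) := by
  set y := ‖𝓕 f r‖
  have hy : 0 ≤ y := norm_nonneg _
  have hB : 0 ≤ B := (norm_nonneg _).trans (h.sup 0)
  have h0 : y ≤ B := (IsTest.norm_fourier_le r).trans h.int
  have h1 : |r| * y ≤ B := (hf.abs_mul_norm_fourier_le r).trans
    ((IsTest.norm_fourier_le r).trans h.int_deriv)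
  have h2 : |r| * (|r| * y) ≤ B / ε := by
    calc |r| * (|r| * y) ≤ |r| * ‖𝓕 (deriv f) r‖ := by
          gcongr; exact hf.abs_mul_norm_fourier_le r
      _ ≤ _ := (hf.deriv.abs_mul_norm_fourier_le r).trans
          ((IsTest.norm_fourier_le r).trans h.int_deriv2)
  have hεδ : 1 ≤ ε ^ (-δ) := Real.one_le_rpow_of_pos_of_le_one_of_nonpos hε hε1 (by linarith)
  have h3 : 0 < 1 + |r| := by positivity
  rw [Real.rpow_neg h3.le, ← div_eq_mul_inv, le_div_iff₀ (by positivity)]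
  have hp : (1 + |r|) ^ (1 + δ) ≤ 4 * max 1 |r| ^ (1 + δ) := by
    have hm : (1 : ℝ) ≤ max 1 |r| := le_max_left _ _
    calc (1 + |r|) ^ (1 + δ) ≤ (2 * max 1 |r|) ^ (1 + δ) := by
          gcongr; linarith [le_max_right 1 |r|]
      _ = 2 ^ (1 + δ) * max 1 |r| ^ (1 + δ) := Real.mul_rpow (by norm_num) (by positivity)
      _ ≤ 2 ^ (2 : ℝ) * max 1 |r| ^ (1 + δ) := by
          gcongr
          · norm_num
          · linarith
      _ = _ := by norm_num
  have hmain : y * max 1 |r| ^ (1 + δ) ≤ B * ε ^ (-δ) := by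
    rcases le_total |r| 1 with h4 | h4
    · rw [max_eq_left h4, Real.one_rpow, mul_one]
      nlinarith
    · rw [max_eq_right h4]
      have hr : 0 < |r| := by linarith
      rcases le_total |r| (1 / ε) with h5 | h5
      · calc y * |r| ^ (1 + δ) = (|r| * y) * |r| ^ δ := by
              rw [Real.rpow_add hr, Real.rpow_one]; ring
          _ ≤ B * (1 / ε) ^ δ := by gcongr
          _ = _ := by rw [one_div, Real.inv_rpow hε.le, Real.rpow_neg hε.le]
      · calc y * |r| ^ (1 + δ) = (|r| * (|r| * y)) * |r| ^ (δ - 1) := by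
              rw [Real.rpow_add hr, Real.rpow_sub hr, Real.rpow_one]; field_simp
          _ ≤ B / ε * (1 / ε) ^ (δ - 1) := by
              refine mul_le_mul h2 ?_ (by positivity) (by positivity)
              exact Real.rpow_le_rpow_of_nonpos (by positivity) h5 (by linarith)
          _ = _ := by
              rw [one_div, Real.inv_rpow hε.le, Real.rpow_sub hε, Real.rpow_neg hε.le,
                Real.rpow_one]
              field_simp
  calc y * (1 + |r|) ^ (1 + δ) ≤ y * (4 * max 1 |r| ^ (1 + δ)) := by gcongr
    _ = 4 * (y * max 1 |r| ^ (1 + δ)) := by ring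
    _ ≤ 4 * (B * ε ^ (-δ)) := by gcongr
    _ = _ := by ring

/-- Second quantizability of smooth symbols, with a bound depending weakly on the scale `ε`. -/
theorem exists_tame_bound (μL μR : ℝ) {δ : ℝ} (hδ : 0 < δ) (hδ1 : δ ≤ 1) : ∃ C, 0 ≤ C ∧
    ∀ {ι : Type*} {b : HilbertBasis ι ℂ H} (hb : Adapted (fermiSea μL μR) b) {a : ℝ → Mat}
      (_ : IsSymbol a) {B ε : ℝ}, 0 < ε → ε ≤ 1 → (∀ j k, C2Bound (fun x => a x j k) B ε) →
      (fermi hb).Tame (mulOp a) (C * B * ε ^ (-δ)) := by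
  set M : ℝ := 1 + ∑ j, |fermiMom μL μR j| with hM
  set I : ℝ := ∫ r : ℝ, (1 + ‖r‖) ^ (-(1 + 2 * δ)) with hI
  have hII : Integrable fun r : ℝ => (1 + ‖r‖) ^ (-(1 + 2 * δ)) :=
    integrable_one_add_norm (by simp; linarith)
  have hI0 : 0 ≤ I := integral_nonneg fun r => by positivity
  have hM0 : 0 ≤ M := by positivity
  -- The 4 covers the operator norm. The four entries of the symbol contribute 128 M I D² to the
  -- squared Hilbert-Schmidt norm, and 128 M I ≤ C².
  set C : ℝ := 4 + 64 * M * I with hC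
  have hC4 : 4 ≤ C := by rw [hC]; nlinarith [mul_nonneg hM0 hI0]
  have hC0 : 0 ≤ C := by linarith
  refine ⟨C, hC0, @fun ι b hb a ha B ε hε hε1 h => ?_⟩
  have hB : 0 ≤ B := (norm_nonneg _).trans ((h 0 0).sup 0)
  have hεδ : 1 ≤ ε ^ (-δ) := Real.one_le_rpow_of_pos_of_le_one_of_nonpos hε hε1 (by linarith)
  refine ⟨(norm_mulOp_le ha.bddSym hB fun x j k => (h j k).sup x).trans ?_, ?_⟩
  · calc 4 * B ≤ C * B := by gcongr
      _ = C * B * 1 := by ring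
      _ ≤ _ := by gcongr
  · set D : ℝ := B * ε ^ (-δ) with hD
    have hD0 : 0 ≤ D := by positivity
    have hfm : ∀ j, |fermiMom μL μR j| ≤ ∑ j, |fermiMom μL μR j| := fun j =>
      Finset.single_le_sum (f := fun j => |fermiMom μL μR j|) (fun _ _ => abs_nonneg _)
        (Finset.mem_univ j)
    have key : ∀ j k, ∫⁻ r, ENNReal.ofReal |fermiMom μL μR k + r - fermiMom μL μR j| *
        ‖hatE a j k r‖ₑ ^ 2 ≤ ENNReal.ofReal (32 * M * D ^ 2 * I) := fun j k => by
      rw [hI, ← integral_const_mul, ofReal_integral_eq_lintegral_ofReal (hII.const_mul _)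
        (Eventually.of_forall fun r => by positivity)]
      refine lintegral_mono fun r => ?_
      rw [← ofReal_norm, ← ENNReal.ofReal_pow (norm_nonneg _), ← ENNReal.ofReal_mul (abs_nonneg _)]
      refine ENNReal.ofReal_le_ofReal ?_
      have h1 : ‖hatE a j k r‖ ≤ 4 * D * (1 + |r|) ^ (-(1 + δ)) := by
        refine ((h j k).fourier_le (ha j k) hε hε1 hδ hδ1 r).trans (le_of_eq ?_)
        rw [hD]; ring
      -- The weight grows linearly, so against the square of (1 + |r|)^(-(1 + δ)) it leaves the
      -- integrable power -(1 + 2δ).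
      have h2 : |fermiMom μL μR k + r - fermiMom μL μR j| ≤ 2 * M * (1 + |r|) := by
        have h3 : |fermiMom μL μR k + r - fermiMom μL μR j| ≤
            |fermiMom μL μR k| + |r| + |fermiMom μL μR j| :=
          (abs_sub _ _).trans (add_le_add (abs_add_le _ _) le_rfl)
        have h6 : 0 ≤ (M - 1) * |r| := mul_nonneg
          (by rw [hM, add_sub_cancel_left]; positivity) (abs_nonneg r)
        have h7 := hfm j
        have h8 := hfm k
        have h9 := abs_nonneg r
        linarith
      have hr : 0 < 1 + |r| := by positivity
      calc |fermiMom μL μR k + r - fermiMom μL μR j| * ‖hatE a j k r‖ ^ 2 ≤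
          2 * M * (1 + |r|) * (4 * D * (1 + |r|) ^ (-(1 + δ))) ^ 2 := by gcongr
        _ = 32 * M * D ^ 2 * ((1 + |r|) ^ (1 : ℝ) * ((1 + |r|) ^ (-(1 + δ)) *
              (1 + |r|) ^ (-(1 + δ)))) := by rw [Real.rpow_one]; ring
        _ = 32 * M * D ^ 2 * (1 + |r|) ^ (-(1 + 2 * δ)) := by
          rw [← Real.rpow_add hr, ← Real.rpow_add hr]
          congr 2
          ring
    rw [hsSq_symbol hb ha]
    refine (Finset.sum_le_sum fun j _ => Finset.sum_le_sum fun k _ => key j k).trans ?_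
    rw [show C * B * ε ^ (-δ) = C * D by rw [hD]; ring, ← ENNReal.ofReal_pow (by positivity)]
    simp only [Finset.sum_const, Finset.card_univ, Fintype.card_fin, nsmul_eq_mul]
    rw [← mul_assoc, show ((2 : ℕ) : ℝ≥0∞) * (2 : ℕ) = ENNReal.ofReal 4 by norm_num,
      ← ENNReal.ofReal_mul (by norm_num)]
    refine ENNReal.ofReal_le_ofReal ?_
    have h5 : 128 * M * I ≤ C ^ 2 := by rw [hC]; nlinarith [mul_nonneg hM0 hI0]
    calc 4 * (32 * M * D ^ 2 * I) = 128 * M * I * D ^ 2 := by ring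
      _ ≤ C ^ 2 * D ^ 2 := by gcongr
      _ = _ := by ring

/-! ### The Schwinger term of smooth symbols -/

theorem IsTest.exists_c2Bound {f : ℝ → ℂ} (hf : IsTest f) : ∃ B, C2Bound f B 1 := by
  obtain ⟨C, hC⟩ := hf.2.exists_bound_of_continuous hf.1.continuous
  have h0 : ∀ g : ℝ → ℂ, 0 ≤ ∫ x, ‖g x‖ := fun g => integral_nonneg fun x => norm_nonneg _
  have hC0 : 0 ≤ C := (norm_nonneg _).trans (hC 0)
  have h1 := h0 f
  have h2 := h0 (_root_.deriv f)
  have h3 := h0 (_root_.deriv (_root_.deriv f))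
  refine ⟨C + ((∫ x, ‖f x‖) + ((∫ x, ‖_root_.deriv f x‖) +
    ∫ x, ‖_root_.deriv (_root_.deriv f) x‖)), fun x => (hC x).trans ?_, ?_, ?_, ?_⟩
  · linarith
  · linarith
  · linarith
  · rw [div_one]; linarith

theorem C2Bound.mono {f : ℝ → ℂ} {B B' ε : ℝ} (h : C2Bound f B ε) (hB : B ≤ B') (hε : 0 ≤ ε) :
    C2Bound f B' ε :=
  ⟨fun x => (h.sup x).trans hB, h.int.trans hB, h.int_deriv.trans hB,
    h.int_deriv2.trans (by gcongr)⟩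

section

variable {μL μR : ℝ} {ι : Type*} {b : HilbertBasis ι ℂ H}

theorem IsSymbol.exists_tame (hb : Adapted (fermiSea μL μR) b) {a : ℝ → Mat} (ha : IsSymbol a) :
    ∃ c, (fermi hb).Tame (mulOp a) c := by
  obtain ⟨C, -, hC⟩ := exists_tame_bound μL μR one_pos le_rfl
  choose B hB using fun j k => (ha j k).exists_c2Bound
  have h0 : ∀ j k, 0 ≤ B j k := fun j k => (norm_nonneg _).trans ((hB j k).sup 0)
  refine ⟨_, hC hb ha (B := ∑ j, ∑ k, B j k) one_pos le_rfl fun j k =>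
    (hB j k).mono ?_ zero_le_one⟩
  exact (Finset.single_le_sum (f := fun k => B j k) (fun k _ => h0 j k) (Finset.mem_univ k)).trans
    (Finset.single_le_sum (f := fun j => ∑ k, B j k)
      (fun j _ => Finset.sum_nonneg fun k _ => h0 j k) (Finset.mem_univ j))

theorem integrable_schwartz_mul_conj (f g : SchwartzMap ℝ ℂ) :
    Integrable fun r => f r * starRingEnd ℂ (g r) := by
  refine (f.integrable.norm.const_mul (SchwartzMap.seminorm ℝ 0 0 g)).mono'
    (f.continuous.mul (Complex.continuous_conj.comp g.continuous)).aestronglyMeasurable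
    (Eventually.of_forall fun r => ?_)
  rw [norm_mul, RCLike.norm_conj, mul_comm]
  gcongr
  exact SchwartzMap.norm_le_seminorm ℝ g r

/-- The derivative of an entry of a symbol. -/
def IsSymbol.entryDeriv {a : ℝ → Mat} (ha : IsSymbol a) (j k : Fin 2) : SchwartzMap ℝ ℂ :=
  (ha j k).deriv.2.toSchwartzMap (ha j k).deriv.1

/-- Product of Fourier transforms of entries. -/
def hatProd (a b : ℝ → Mat) (j k : Fin 2) (r : ℝ) : ℂ :=
  hatE b j k r * starRingEnd ℂ (hatE (fun x => star (a x)) j k r)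

variable {a d : ℝ → Mat} (ha : IsSymbol a) (hd : IsSymbol d)
include ha hd

theorem continuous_hatProd (j k : Fin 2) : Continuous (hatProd a d j k) :=
  (hd.continuous_hatE j k).mul (Complex.continuous_conj.comp (ha.star.continuous_hatE j k))

theorem integrable_hatProd (j k : Fin 2) : Integrable (hatProd a d j k) :=
  integrable_schwartz_mul_conj (𝓕 (hd.entry j k)) (𝓕 (ha.star.entry j k))

theorem mul_hatProd (j k : Fin 2) (r : ℝ) : (r : ℂ) * hatProd a d j k r =
    (2 * Real.pi * Complex.I)⁻¹ *
      ((𝓕 (hd.entryDeriv j k)) r * starRingEnd ℂ ((𝓕 (ha.star.entry j k)) r)) := by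
  have h : (𝓕 (hd.entryDeriv j k)) r = (2 * Real.pi * Complex.I * r) * hatE d j k r := by
    rw [SchwartzMap.fourier_coe]
    exact (hd j k).fourier_deriv r
  have h1 : (𝓕 (ha.star.entry j k)) r = hatE (fun x => star (a x)) j k r := rfl
  rw [h, hatProd, h1]
  have h2 : (2 * Real.pi * Complex.I : ℂ) ≠ 0 := Complex.two_pi_I_ne_zero
  field_simp

theorem integrable_mul_hatProd (j k : Fin 2) : Integrable fun r : ℝ => (r : ℂ) * hatProd a d j k r := by
  simp only [mul_hatProd ha hd]
  exact (integrable_schwartz_mul_conj _ _).const_mul _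

omit ha hd in
theorem integral_fourier_mul_conj (f g : SchwartzMap ℝ ℂ) :
    ∫ r, (𝓕 f) r * starRingEnd ℂ ((𝓕 g) r) = ∫ x, f x * starRingEnd ℂ (g x) :=
  SchwartzMap.integral_inner_fourier_fourier g f

theorem integral_hatProd (j k : Fin 2) : ∫ r, hatProd a d j k r = ∫ x, a x k j * d x j k := by
  refine (integral_fourier_mul_conj (hd.entry j k) (ha.star.entry j k)).trans ?_
  refine integral_congr_ae (Eventually.of_forall fun x => ?_)
  change d x j k * starRingEnd ℂ ((star (a x)) j k) = _
  rw [Matrix.star_apply, starRingEnd_apply, star_star, mul_comm]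

theorem integral_mul_hatProd (j k : Fin 2) : ∫ r : ℝ, (r : ℂ) * hatProd a d j k r =
    (2 * Real.pi * Complex.I)⁻¹ * ∫ x, a x k j * deriv (fun x => d x j k) x := by
  simp only [mul_hatProd ha hd]
  rw [integral_const_mul, integral_fourier_mul_conj]
  congr 1
  refine integral_congr_ae (Eventually.of_forall fun x => ?_)
  change deriv (fun x => d x j k) x * starRingEnd ℂ ((star (a x)) j k) = _
  rw [Matrix.star_apply, starRingEnd_apply, star_star, mul_comm]

variable (μL μR) in
omit ha in
theorem rowRep_sign_com : RowRep (conjFT (com μL μR (mulOp d)) -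
      (2 : ℂ) • (fermiM μL μR ∘L conjFT (com μL μR (mulOp d))))
    (fun j p => (1 - 2 * occ (fermiMom μL μR j) p) • comRow μL μR (𝓕 hd.toS) j p) := by
  intro φ j
  set ψ := conjFT (com μL μR (mulOp d)) φ with hψ
  have e : (conjFT (com μL μR (mulOp d)) -
      (2 : ℂ) • (fermiM μL μR ∘L conjFT (com μL μR (mulOp d)))) φ =
      ψ - (2 : ℂ) • fermiM μL μR ψ := rfl
  filter_upwards [rowRep_com μL μR hd φ j, fermiM_ae μL μR ψ,
    Lp.coeFn_sub ψ ((2 : ℂ) • fermiM μL μR ψ), Lp.coeFn_smul (2 : ℂ) (fermiM μL μR ψ)]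
    with p h1 h2 h3 h4
  rw [e, h3, Pi.sub_apply, PiLp.sub_apply, h4, Pi.smul_apply, PiLp.smul_apply, h2 j, hψ, h1,
    inner_smul_left, map_sub, map_mul, conj_occ, map_one, smul_eq_mul, RCLike.conj_ofNat]
  ring

/-- Occupations take only the values 0 and 1, so (1 - 2 occ_j)(occ_k - occ_j)² = occ_k - occ_j. The
sign from 1 - 2ρ turns the squared kernel into one linear in the occupations, to which
`integral_occ_prod` applies. -/
theorem inner_sign_comRow (j : Fin 2) (p : ℝ) :
    ⟪(1 - 2 * occ (fermiMom μL μR j) p) • comRow μL μR (𝓕 hd.toS) j p,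
      comRow μL μR (𝓕 ha.star.toS) j p⟫_ℂ = ∑ k, ∫ q,
      (occ (fermiMom μL μR k) q - occ (fermiMom μL μR j) p) * hatProd a d j k (p - q) := by
  have hint : ∀ k, Integrable fun q =>
      (occ (fermiMom μL μR k) q - occ (fermiMom μL μR j) p) * hatProd a d j k (p - q) := fun k => by
    refine (((integrable_hatProd ha hd j k).comp_sub_left p).norm.const_mul 2).mono'
      ((((measurable_occ _).sub measurable_const).mul
        ((continuous_hatProd ha hd j k).measurable.comp
          (measurable_const.sub measurable_id))).aestronglyMeasurable)
      (Eventually.of_forall fun q => ?_)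
    rw [norm_mul]
    gcongr
    simp only [occ]; split_ifs <;> norm_num
  rw [inner_smul_left, L2.inner_def, ← integral_finsetSum _ fun k _ => hint k,
    ← integral_const_mul]
  refine integral_congr_ae ?_
  filter_upwards [comRow_ae μL μR hd j p, comRow_ae μL μR ha.star j p] with q h1 h2
  rw [PiLp.inner_apply, Finset.mul_sum]
  refine Finset.sum_congr rfl fun k _ => ?_
  rw [h1, h2, hatProd, RCLike.inner_apply, map_mul, map_sub, map_sub, map_mul, conj_occ, conj_occ,
    starRingEnd_self_apply, map_one, RCLike.conj_ofNat]
  simp only [occ]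
  split_ifs <;> ring

variable (μL μR) in
theorem integral_occ_hatProd (j k : Fin 2) :
    Integrable (fun p => ∫ q, (occ (fermiMom μL μR k) q - occ (fermiMom μL μR j) p) *
      hatProd a d j k (p - q)) ∧
    ∫ p, ∫ q, (occ (fermiMom μL μR k) q - occ (fermiMom μL μR j) p) * hatProd a d j k (p - q) =
      (2 * Real.pi * Complex.I)⁻¹ * (∫ x, a x k j * deriv (fun x => d x j k) x) +
        (fermiMom μL μR k - fermiMom μL μR j) * ∫ x, a x k j * d x j k := by
  set u := fermiMom μL μR k
  set v := fermiMom μL μR j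
  have e : ∀ r, ((u + r - v : ℝ) : ℂ) * hatProd a d j k r =
      (r : ℂ) * hatProd a d j k r + ((u - v : ℝ) : ℂ) * hatProd a d j k r := fun r => by
    push_cast; ring
  have h1 := integrable_mul_hatProd ha hd j k
  have h2 := (integrable_hatProd ha hd j k).const_mul ((u - v : ℝ) : ℂ)
  obtain ⟨h3, h4⟩ := integral_occ_prod u v (continuous_hatProd ha hd j k).measurable
    (by
      refine (h1.add h2).norm.congr (Eventually.of_forall fun r => ?_)
      simp only [Pi.add_apply]
      rw [← e, norm_mul, Complex.norm_real, Real.norm_eq_abs])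
  refine ⟨h3, ?_⟩
  rw [h4]
  simp only [e]
  rw [integral_add h1 h2, integral_const_mul, integral_mul_hatProd ha hd, integral_hatProd ha hd]
  push_cast
  rfl

/-- The Schwinger term of two smooth symbols. -/
theorem schwinger_symbol (hb : Adapted (fermiSea μL μR) b) :
    (fermi hb).schwinger (mulOp a) (mulOp d) = ∑ j, ∑ k,
      ((2 * Real.pi * Complex.I)⁻¹ * (∫ x, a x k j * deriv (fun x => d x j k) x) +
        (fermiMom μL μR k - fermiMom μL μR j) * ∫ x, a x k j * d x j k) := by
  set T' := conjFT (com μL μR (mulOp d)) -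
      (2 : ℂ) • (fermiM μL μR ∘L conjFT (com μL μR (mulOp d))) with hT'
  have e : (fermi hb).schwinger (mulOp a) (mulOp d) =
      ∑' i, ⟪conjFT (com μL μR (mulOp fun x => star (a x))) (momBasis b i),
        T' (momBasis b i)⟫_ℂ := by
    refine tsum_congr fun i => ?_
    have e1 : T' (momBasis b i) = FT (com μL μR (mulOp d) (b i) -
        (2 : ℂ) • fermiSea μL μR (com μL μR (mulOp d) (b i))) := by
      change conjFT _ (momBasis b i) - (2 : ℂ) • fermiM μL μR (conjFT _ (momBasis b i)) = _
      rw [conjFT_momBasis, map_sub, map_smul, fermiSea_apply, FT.apply_symm_apply]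
    rw [e1, conjFT_momBasis, FT.inner_map_map, ← mulOp_adjoint ha.bddSym]
    rfl
  have hfin : ∀ {m : ℝ → Mat}, IsSymbol m →
      ∑' i, ‖conjFT (com μL μR (mulOp m)) (momBasis b i)‖ₑ ^ 2 ≠ ⊤ := fun hm => by
    obtain ⟨c, hc⟩ := hm.exists_tame hb
    rw [← hsSq_eq hb]
    exact hc.ne_top
  have hfin' : ∑' i, ‖T' (momBasis b i)‖ₑ ^ 2 ≠ ⊤ := by
    set V : H →L[ℂ] H := ContinuousLinearMap.id ℂ H - (2 : ℂ) • fermiM μL μR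
    have h1 : ∀ i, ‖T' (momBasis b i)‖ₑ ^ 2 ≤
        ‖V‖ₑ ^ 2 * ‖conjFT (com μL μR (mulOp d)) (momBasis b i)‖ₑ ^ 2 := fun i => by
      rw [← mul_pow]
      gcongr
      exact V.le_opENorm _
    refine ne_top_of_le_ne_top ?_ (ENNReal.tsum_le_tsum h1)
    rw [ENNReal.tsum_mul_left]
    exact ENNReal.mul_ne_top (by simp) (hfin hd)
  rw [e, RowRep.tsum_inner (rowRep_com μL μR ha.star) (rowRep_sign_com μL μR hd) _
    (hfin ha.star) hfin']
  simp only [inner_sign_comRow ha hd]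
  rw [integral_finsetSum _ fun j _ => integrable_finsetSum _ fun k _ =>
    (integral_occ_hatProd μL μR ha hd j k).1]
  refine Finset.sum_congr rfl fun j _ => ?_
  rw [integral_finsetSum _ fun k _ => (integral_occ_hatProd μL μR ha hd j k).1]
  exact Finset.sum_congr rfl fun k _ => (integral_occ_hatProd μL μR ha hd j k).2

omit ha hd in
theorem IsTest.integrable_mul {f g : ℝ → ℂ} (hf : IsTest f) (hg : IsTest g) :
    Integrable fun x => f x * g x :=
  (hf.1.continuous.mul hg.1.continuous).integrable_of_hasCompactSupport hf.2.mul_right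

/-- The Schwinger term vanishes if the diagonal of the commutator and the integral of
`tr (a d')` vanish. -/
theorem schwinger_symbol_eq_zero (hb : Adapted (fermiSea μL μR) b)
    (h : ∀ᵐ x, ∀ k, (a x * d x) k k = (d x * a x) k k)
    (h0 : ∫ x, ∑ j, ∑ k, a x k j * deriv (fun x => d x j k) x = 0) :
    (fermi hb).schwinger (mulOp a) (mulOp d) = 0 := by
  rw [schwinger_symbol ha hd hb]
  simp only [Finset.sum_add_distrib, ← Finset.mul_sum]
  have h1 : ∑ j, ∑ k, ∫ x, a x k j * deriv (fun x => d x j k) x = 0 := by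
    rw [← h0, integral_finsetSum _ fun j _ => integrable_finsetSum _ fun k _ =>
      (ha k j).integrable_mul (hd j k).deriv]
    refine Finset.sum_congr rfl fun j _ => ?_
    rw [integral_finsetSum _ fun k _ => (ha k j).integrable_mul (hd j k).deriv]
  have h2 : ∀ k, ∑ j, ∫ x, a x k j * d x j k = ∫ x, (a x * d x) k k := fun k => by
    rw [← integral_finsetSum _ fun j _ => (ha k j).integrable_mul (hd j k)]
    simp only [Matrix.mul_apply]
  have h3 : ∀ j, ∑ k, ∫ x, a x k j * d x j k = ∫ x, (d x * a x) j j := fun j => by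
    rw [← integral_finsetSum _ fun k _ => (ha k j).integrable_mul (hd j k)]
    simp only [Matrix.mul_apply, mul_comm]
  rw [h1, mul_zero, zero_add]
  -- The Fermi momentum term is the sum over k of the momentum of lead k times the integral of the
  -- k-th diagonal entry of [a, d].
  simp only [sub_mul, Finset.sum_sub_distrib]
  rw [Finset.sum_comm]
  simp only [← Finset.mul_sum, h2, h3]
  have h4 : ∀ k, ∫ x, (a x * d x) k k = ∫ x, (d x * a x) k k := fun k =>
    integral_congr_ae (h.mono fun x hx => hx k)
  simp only [h4]
  exact sub_self _

end

/-! ### Test functions vanishing near the scatterer -/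

/-- A step function with values `z` on the left and `w` on the right. -/
def step (z w : ℂ) (x : ℝ) : ℂ := if x < 0 then z else w

theorem norm_step_le {z w : ℂ} {K : ℝ} (hz : ‖z‖ ≤ K) (hw : ‖w‖ ≤ K) (x : ℝ) :
    ‖step z w x‖ ≤ K := by
  rw [step]; split_ifs <;> assumption

/-- Away from 0 the step is locally constant, and near 0 the test function vanishes. Hence products
with steps stay smooth, and derivatives ignore the jump. -/
theorem mul_step_eventuallyEq {f : ℝ → ℂ} (h0 : 0 ∉ tsupport f) (z w : ℂ) (x : ℝ) :
    (fun y => f y * step z w y) =ᶠ[𝓝 x] fun y => f y * step z w x := by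
  rcases lt_trichotomy x 0 with h | h | h
  · filter_upwards [Iio_mem_nhds h] with y hy
    rw [step, step, if_pos h, if_pos (Set.mem_Iio.1 hy)]
  · subst h
    filter_upwards [notMem_tsupport_iff_eventuallyEq.1 h0] with y hy
    rw [hy, Pi.zero_apply, zero_mul, zero_mul]
  · filter_upwards [Ioi_mem_nhds h] with y hy
    rw [step, step, if_neg h.le.not_gt, if_neg (not_lt.2 (le_of_lt hy))]

theorem deriv_mul_step {f : ℝ → ℂ} (hf : Differentiable ℝ f) (h0 : 0 ∉ tsupport f) (z w : ℂ)
    (x : ℝ) : deriv (fun y => f y * step z w y) x = deriv f x * step z w x := by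
  rw [(mul_step_eventuallyEq h0 z w x).deriv_eq, deriv_mul_const (hf x)]

theorem IsTest.mul_step {f : ℝ → ℂ} (hf : IsTest f) (h0 : 0 ∉ tsupport f) (z w : ℂ) :
    IsTest fun y => f y * step z w y := by
  refine ⟨contDiff_iff_contDiffAt.2 fun x => ?_, hf.2.mul_right⟩
  exact (hf.1.contDiffAt.mul contDiffAt_const).congr_of_eventuallyEq
    (mul_step_eventuallyEq h0 z w x)

theorem IsTest.comp_neg {f : ℝ → ℂ} (hf : IsTest f) : IsTest fun x => f (-x) :=
  ⟨hf.1.comp contDiff_neg, hf.2.comp_homeomorph (Homeomorph.neg ℝ)⟩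

theorem zero_notMem_tsupport_comp_neg {f : ℝ → ℂ} (h0 : 0 ∉ tsupport f) :
    0 ∉ tsupport fun x => f (-x) := by
  rw [notMem_tsupport_iff_eventuallyEq] at h0 ⊢
  have : Tendsto (fun x : ℝ => -x) (𝓝 0) (𝓝 0) := by
    simpa using (continuous_neg (G := ℝ)).tendsto 0
  exact this.eventually h0

theorem IsTest.mul_left {g f : ℝ → ℂ} (hf : IsTest f) (hg : ContDiff ℝ ∞ g) :
    IsTest fun x => f x * g x := ⟨hf.1.mul hg, hf.2.mul_right⟩

theorem integral_norm_mul_le {u v : ℝ → ℂ} (hu : Integrable u) {K : ℝ} (hv : ∀ x, ‖v x‖ ≤ K) :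
    ∫ x, ‖u x * v x‖ ≤ K * ∫ x, ‖u x‖ := by
  rw [← integral_const_mul]
  refine integral_mono_of_nonneg (Eventually.of_forall fun x => norm_nonneg _)
    (hu.norm.const_mul K) (Eventually.of_forall fun x => ?_)
  simp only
  rw [norm_mul, mul_comm]
  gcongr
  exact hv x

theorem C2Bound.mul_step {f : ℝ → ℂ} (hf : IsTest f) (h0 : 0 ∉ tsupport f) {B ε K : ℝ}
    (h : C2Bound f B ε) {z w : ℂ} (hz : ‖z‖ ≤ K) (hw : ‖w‖ ≤ K) :
    C2Bound (fun y => f y * step z w y) (K * B) ε := by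
  have hK : 0 ≤ K := (norm_nonneg _).trans hz
  have hs := norm_step_le hz hw
  have e1 : deriv (fun y => f y * step z w y) = fun y => deriv f y * step z w y :=
    funext (deriv_mul_step (hf.1.differentiable (by simp)) h0 z w)
  have h0' : 0 ∉ tsupport (deriv f) := fun h => h0 (tsupport_deriv_subset h)
  have e2 : deriv (fun y => deriv f y * step z w y) = fun y => deriv (deriv f) y * step z w y :=
    funext (deriv_mul_step (hf.deriv.1.differentiable (by simp)) h0' z w)
  refine ⟨fun x => ?_, ?_, ?_, ?_⟩
  · rw [norm_mul, mul_comm]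
    exact mul_le_mul (hs x) (h.sup x) (norm_nonneg _) hK
  · exact (integral_norm_mul_le hf.integrable hs).trans (by gcongr; exact h.int)
  · rw [e1]
    exact (integral_norm_mul_le hf.deriv.integrable hs).trans (by gcongr; exact h.int_deriv)
  · rw [e1, e2, mul_div_assoc]
    exact (integral_norm_mul_le hf.deriv.deriv.integrable hs).trans (by gcongr; exact h.int_deriv2)

theorem C2Bound.comp_neg {f : ℝ → ℂ} {B ε : ℝ} (h : C2Bound f B ε) :
    C2Bound (fun x => f (-x)) B ε := by
  have e1 : deriv (fun x => f (-x)) = fun x => -deriv f (-x) := funext fun x => deriv_comp_neg f x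
  have e2 : deriv (fun x => -deriv f (-x)) = fun x => deriv (deriv f) (-x) := funext fun x => by
    rw [deriv.fun_neg, deriv_comp_neg, neg_neg]
  refine ⟨fun x => h.sup _, ?_, ?_, ?_⟩
  · rw [integral_neg_eq_self fun x => ‖f x‖]; exact h.int
  · rw [e1]; simp only [norm_neg]
    rw [integral_neg_eq_self fun x => ‖deriv f x‖]; exact h.int_deriv
  · rw [e1, e2, integral_neg_eq_self fun x => ‖deriv (deriv f) x‖]; exact h.int_deriv2

theorem C2Bound.add {f g : ℝ → ℂ} (hf : IsTest f) (hg : IsTest g) {B B' ε : ℝ}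
    (h : C2Bound f B ε) (h' : C2Bound g B' ε) : C2Bound (fun x => f x + g x) (B + B') ε := by
  have hle : ∀ {u v : ℝ → ℂ}, Integrable u → Integrable v →
      ∫ x, ‖u x + v x‖ ≤ (∫ x, ‖u x‖) + ∫ x, ‖v x‖ := fun hu hv => by
    rw [← integral_add hu.norm hv.norm]
    exact integral_mono (hu.add hv).norm (hu.norm.add hv.norm) fun x => norm_add_le _ _
  have e1 : deriv (fun x => f x + g x) = fun x => deriv f x + deriv g x := funext fun x =>
    deriv_fun_add (hf.1.differentiable (by simp) x) (hg.1.differentiable (by simp) x)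
  have e2 : deriv (fun x => deriv f x + deriv g x) =
      fun x => deriv (deriv f) x + deriv (deriv g) x := funext fun x =>
    deriv_fun_add (hf.deriv.1.differentiable (by simp) x) (hg.deriv.1.differentiable (by simp) x)
  refine ⟨fun x => (norm_add_le _ _).trans (add_le_add (h.sup x) (h'.sup x)),
    (hle hf.integrable hg.integrable).trans (add_le_add h.int h'.int), ?_, ?_⟩
  · rw [e1]
    exact (hle hf.deriv.integrable hg.deriv.integrable).trans
      (add_le_add h.int_deriv h'.int_deriv)
  · rw [e1, e2, add_div]
    exact (hle hf.deriv.deriv.integrable hg.deriv.deriv.integrable).trans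
      (add_le_add h.int_deriv2 h'.int_deriv2)

/-- Leibniz rule; the term with the second derivative of g is the one allowed to be of size 1/ε in
the hypotheses. -/
theorem C2Bound.mul {χ g : ℝ → ℂ} (hχ : IsTest χ) (hg : ContDiff ℝ ∞ g) {K M A ε : ℝ}
    (hε : 0 < ε) (hε1 : ε ≤ 1) (h : C2Bound χ K 1) (hM : ∀ x, ‖g x‖ ≤ M)
    (hA : ∫ x, ‖χ x * deriv g x‖ ≤ A) (hA' : ∫ x, ‖deriv χ x * deriv g x‖ ≤ A)
    (hA'' : ∫ x, ‖χ x * deriv (deriv g) x‖ ≤ A / ε) :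
    C2Bound (fun x => χ x * g x) (K * M + 3 * A) ε := by
  have hK : 0 ≤ K := (norm_nonneg _).trans (h.sup 0)
  have hM0 : 0 ≤ M := (norm_nonneg _).trans (hM 0)
  have hA0 : 0 ≤ A := (integral_nonneg fun x => norm_nonneg _).trans hA
  have hKM : 0 ≤ K * M := by positivity
  have hg' : ContDiff ℝ ∞ (deriv g) := hg.iterate_deriv 1
  have hg'' : ContDiff ℝ ∞ (deriv (deriv g)) := hg.iterate_deriv 2
  have dχ : Differentiable ℝ χ := hχ.1.differentiable (by simp)
  have dχ' : Differentiable ℝ (deriv χ) := hχ.deriv.1.differentiable (by simp)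
  have dg : Differentiable ℝ g := hg.differentiable (by simp)
  have dg' : Differentiable ℝ (deriv g) := hg'.differentiable (by simp)
  have e1 : deriv (fun x => χ x * g x) = fun x => deriv χ x * g x + χ x * deriv g x :=
    funext fun x => deriv_fun_mul (dχ x) (dg x)
  have e2 : deriv (fun x => deriv χ x * g x + χ x * deriv g x) =
      fun x => (deriv (deriv χ) x * g x + deriv χ x * deriv g x) +
        (deriv χ x * deriv g x + χ x * deriv (deriv g) x) := funext fun x =>
    (((dχ' x).hasDerivAt.fun_mul (dg x).hasDerivAt).fun_add
      ((dχ x).hasDerivAt.fun_mul (dg' x).hasDerivAt)).deriv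
  have hle : ∀ {u v : ℝ → ℂ}, Integrable u → Integrable v →
      ∫ x, ‖u x + v x‖ ≤ (∫ x, ‖u x‖) + ∫ x, ‖v x‖ := fun hu hv => by
    rw [← integral_add hu.norm hv.norm]
    exact integral_mono (hu.add hv).norm (hu.norm.add hv.norm) fun x => norm_add_le _ _
  have i0 := (hχ.mul_left hg).integrable
  have i1 := (hχ.deriv.mul_left hg).integrable
  have i2 := (hχ.deriv.deriv.mul_left hg).integrable
  have i3 := (hχ.mul_left hg').integrable
  have i4 := (hχ.deriv.mul_left hg').integrable
  have i5 := (hχ.mul_left hg'').integrable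
  have b0 : ∫ x, ‖χ x * g x‖ ≤ M * K :=
    (integral_norm_mul_le hχ.integrable hM).trans (by gcongr; exact h.int)
  have b1 : ∫ x, ‖deriv χ x * g x‖ ≤ M * K :=
    (integral_norm_mul_le hχ.deriv.integrable hM).trans (by gcongr; exact h.int_deriv)
  have b2 : ∫ x, ‖deriv (deriv χ) x * g x‖ ≤ M * K :=
    (integral_norm_mul_le hχ.deriv.deriv.integrable hM).trans
      (by gcongr; simpa using h.int_deriv2)
  have hεA : A ≤ A / ε := by rw [le_div_iff₀ hε]; nlinarith
  have hεM : M * K ≤ K * M / ε := by rw [le_div_iff₀ hε]; nlinarith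
  refine ⟨fun x => ?_, by linarith, ?_, ?_⟩
  · rw [norm_mul]
    have := mul_le_mul (h.sup x) (hM x) (norm_nonneg _) hK
    linarith
  · rw [e1]
    have := hle i1 i3
    linarith
  · rw [e1, e2]
    have h1 := hle (i2.add i4) (i4.add i5)
    have h2 := hle i2 i4
    have h3 := hle i4 i5
    simp only [Pi.add_apply] at h1
    rw [add_div, mul_div_assoc 3 A ε]
    linarith

/-- Products with smooth functions bounded together with their derivatives. -/
theorem exists_c2Bound_mul {χ : ℝ → ℂ} (hχ : IsTest χ) : ∃ K, 0 ≤ K ∧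
    ∀ (g : ℝ → ℂ) (M : ℝ), ContDiff ℝ ∞ g → (∀ x, ‖g x‖ ≤ M) → (∀ x, ‖deriv g x‖ ≤ M) →
      (∀ x, ‖deriv (deriv g) x‖ ≤ M) → C2Bound (fun x => χ x * g x) (K * M) 1 := by
  obtain ⟨B, hB⟩ := hχ.exists_c2Bound
  have hB0 : 0 ≤ B := (norm_nonneg _).trans (hB.sup 0)
  refine ⟨B + 3 * B, by positivity, fun g M hg h0 h1 h2 => ?_⟩
  have hM0 : 0 ≤ M := (norm_nonneg _).trans (h0 0)
  have := C2Bound.mul hχ hg one_pos le_rfl hB h0 (A := M * B)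
    ((integral_norm_mul_le hχ.integrable h1).trans (by gcongr; exact hB.int))
    ((integral_norm_mul_le hχ.deriv.integrable h1).trans (by gcongr; exact hB.int_deriv))
    ((integral_norm_mul_le hχ.integrable h2).trans (by rw [div_one]; gcongr; exact hB.int))
  convert this using 1
  ring

/-- Products with smooth functions whose derivatives are integrable. -/
theorem exists_c2Bound_mul_of_integral {χ : ℝ → ℂ} (hχ : IsTest χ) : ∃ K, 0 ≤ K ∧
    ∀ (g : ℝ → ℂ) (M ε : ℝ), 0 < ε → ε ≤ 1 → ContDiff ℝ ∞ g → IsTest (deriv g) →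
      (∀ x, ‖g x‖ ≤ M) → ∫ x, ‖deriv g x‖ ≤ M → ∫ x, ‖deriv (deriv g) x‖ ≤ M / ε →
      C2Bound (fun x => χ x * g x) (K * M) ε := by
  obtain ⟨B, hB⟩ := hχ.exists_c2Bound
  obtain ⟨B', hB'⟩ := hχ.deriv.exists_c2Bound
  have hB0 : 0 ≤ B := (norm_nonneg _).trans (hB.sup 0)
  have hB0' : 0 ≤ B' := (norm_nonneg _).trans (hB'.sup 0)
  refine ⟨B + 3 * (B + B'), by positivity, fun g M ε hε hε1 hg hg' h0 h1 h2 => ?_⟩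
  have hM0 : 0 ≤ M := (norm_nonneg _).trans (h0 0)
  have := C2Bound.mul hχ hg hε hε1 hB h0 (A := (B + B') * M) ?_ ?_ ?_
  · convert this using 1
    ring
  · simp only [mul_comm (χ _)]
    refine (integral_norm_mul_le hg'.integrable hB.sup).trans ?_
    gcongr
    linarith
  · simp only [mul_comm (deriv χ _)]
    refine (integral_norm_mul_le hg'.integrable hB'.sup).trans ?_
    gcongr
    linarith
  · simp only [mul_comm (χ _)]
    refine (integral_norm_mul_le hg'.deriv.integrable hB.sup).trans ?_
    rw [mul_div_assoc]
    gcongr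
    linarith

/-! ### Smoothed time intervals -/

theorem IsTest.ofReal {χ : ℝ → ℝ} (hχ : IsTest χ) : IsTest fun s => (χ s : ℂ) :=
  ⟨Complex.ofRealCLM.contDiff.comp hχ.1, hχ.2.comp_left (g := ((↑) : ℝ → ℂ)) Complex.ofReal_zero⟩

theorem zero_notMem_tsupport_ofReal {χ : ℝ → ℝ} (h0 : 0 ∉ tsupport χ) :
    0 ∉ tsupport fun s => (χ s : ℂ) := by
  rw [notMem_tsupport_iff_eventuallyEq] at h0 ⊢
  filter_upwards [h0] with s hs
  simp [hs]

namespace IsSmoothStep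

variable {G : ℝ → ℝ} (hG : IsSmoothStep G)
include hG

theorem contDiff_ofReal : ContDiff ℝ ∞ fun s => (G s : ℂ) := Complex.ofRealCLM.contDiff.comp hG.1

theorem isTest_deriv : IsTest (deriv fun s => (G s : ℂ)) := by
  refine ⟨hG.contDiff_ofReal.iterate_deriv 1,
    HasCompactSupport.of_support_subset_isCompact (isCompact_Icc (a := -1) (b := 1)) fun s hs => ?_⟩
  by_contra h
  rw [Set.mem_Icc, not_and_or, not_le, not_le] at h
  refine hs ?_
  have : (fun s => (G s : ℂ)) =ᶠ[𝓝 s] fun _ => (G s : ℂ) := by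
    rcases h with h | h
    · filter_upwards [Iio_mem_nhds h] with y hy
      rw [hG.2.1 y (le_of_lt hy), hG.2.1 s h.le]
    · filter_upwards [Ioi_mem_nhds h] with y hy
      rw [hG.2.2 y (le_of_lt hy), hG.2.2 s h.le]
  rw [this.deriv_eq, deriv_const]

theorem exists_bound : ∃ M, ∀ s, ‖(G s : ℂ)‖ ≤ M := by
  obtain ⟨M, hM⟩ := (isCompact_Icc (a := (-1 : ℝ)) (b := 1)).exists_bound_of_continuousOn
    hG.contDiff_ofReal.continuous.continuousOn
  refine ⟨max M 1, fun s => ?_⟩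
  rcases le_total s (-1) with h | h
  · simp [hG.2.1 s h]
  rcases le_total 1 s with h' | h'
  · simp [hG.2.2 s h']
  · exact (hM s ⟨h, h'⟩).trans (le_max_left _ _)

theorem integral_deriv : ∫ u, deriv (fun s => (G s : ℂ)) u = 1 := by
  have hd := hG.contDiff_ofReal.differentiable (by simp)
  have h1 : Tendsto (fun s => (G s : ℂ)) atBot (𝓝 0) := by
    refine tendsto_const_nhds.congr' ?_
    filter_upwards [eventually_le_atBot (-1)] with s hs
    rw [hG.2.1 s hs, Complex.ofReal_zero]
  have h2 : Tendsto (fun s => (G s : ℂ)) atTop (𝓝 1) := by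
    refine tendsto_const_nhds.congr' ?_
    filter_upwards [eventually_ge_atTop 1] with s hs
    rw [hG.2.2 s hs, Complex.ofReal_one]
  rw [integral_of_hasDerivAt_of_tendsto (fun s => (hd s).hasDerivAt) hG.isTest_deriv.integrable
    h1 h2, sub_zero]

/-- The first two derivatives of the smoothed step at scale `ε`. -/
theorem deriv_scaled (ε t : ℝ) :
    deriv (fun s => (G ((t - s) / ε) : ℂ)) =
      fun s => (-ε⁻¹ : ℝ) • deriv (fun s => (G s : ℂ)) ((t - s) / ε) := funext fun s => by
  have h1 : HasDerivAt (fun s => (t - s) / ε) (-ε⁻¹) s := by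
    simpa [neg_div] using ((hasDerivAt_id s).const_sub t).div_const ε
  exact ((hG.contDiff_ofReal.differentiable (by simp) _).hasDerivAt.scomp s h1).deriv

theorem deriv_deriv_scaled (ε t : ℝ) :
    deriv (deriv (fun s => (G ((t - s) / ε) : ℂ))) =
      fun s => (ε⁻¹ ^ 2 : ℝ) • deriv (deriv (fun s => (G s : ℂ))) ((t - s) / ε) := by
  rw [hG.deriv_scaled]
  funext s
  have h1 : HasDerivAt (fun s => (t - s) / ε) (-ε⁻¹) s := by
    simpa [neg_div] using ((hasDerivAt_id s).const_sub t).div_const ε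
  refine ((((hG.isTest_deriv.1.differentiable (by simp) _).hasDerivAt.scomp s h1).const_smul
    (-ε⁻¹ : ℝ)).deriv).trans ?_
  rw [smul_smul]
  congr 1
  ring

theorem contDiff_scaled (ε t : ℝ) : ContDiff ℝ ∞ fun s => (G ((t - s) / ε) : ℂ) :=
  hG.contDiff_ofReal.comp ((contDiff_const.sub contDiff_id).div_const ε)

omit hG in
theorem integral_scaled (F : ℝ → ℝ) {ε : ℝ} (hε : 0 < ε) (t : ℝ) :
    ∫ s, F ((t - s) / ε) = ε * ∫ u, F u := by
  rw [integral_sub_left_eq_self (fun x => F (x / ε)) volume t, Measure.integral_comp_div,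
    abs_of_pos hε, smul_eq_mul]

theorem isTest_deriv_scaled {ε : ℝ} (hε : 0 < ε) (t : ℝ) :
    IsTest (deriv fun s => (G ((t - s) / ε) : ℂ)) := by
  refine ⟨(hG.contDiff_scaled ε t).iterate_deriv 1, ?_⟩
  rw [hG.deriv_scaled]
  refine HasCompactSupport.smul_left (f := fun _ : ℝ => (-ε⁻¹ : ℝ)) ?_
  refine HasCompactSupport.of_support_subset_isCompact
    (isCompact_Icc (a := t - ε) (b := t + ε)) fun s hs => ?_
  by_contra h
  refine hs ?_
  have : (fun s => (G s : ℂ)) =ᶠ[𝓝 ((t - s) / ε)] fun _ => (G ((t - s) / ε) : ℂ) := by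
    rw [Set.mem_Icc, not_and_or, not_le, not_le] at h
    rcases h with h | h
    · have h' : 1 < (t - s) / ε := by rw [lt_div_iff₀ hε]; linarith
      filter_upwards [Ioi_mem_nhds h'] with y hy
      rw [hG.2.2 y (le_of_lt hy), hG.2.2 _ h'.le]
    · have h' : (t - s) / ε < -1 := by rw [div_lt_iff₀ hε]; linarith
      filter_upwards [Iio_mem_nhds h'] with y hy
      rw [hG.2.1 y (le_of_lt hy), hG.2.1 _ h'.le]
  simp only
  rw [this.deriv_eq, deriv_const]

end IsSmoothStep

section SmoothInterval

variable {χ G : ℝ → ℝ} (hχ : IsTest χ) (h0 : 0 ∉ tsupport χ) (hG : IsSmoothStep G)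

theorem smoothInterval_eq (χ G : ℝ → ℝ) (ε t s : ℝ) : smoothInterval χ G ε t s =
    χ s * G ((t - s) / ε) + χ s * step (-1) 0 s := by
  rw [smoothInterval, step]
  split_ifs <;> ring

include hχ h0 hG

theorem isTest_smoothInterval (ε t : ℝ) : IsTest (smoothInterval χ G ε t) := by
  simp only [funext (smoothInterval_eq χ G ε t)]
  exact (hχ.ofReal.mul_left (hG.contDiff_scaled ε t)).add
    (hχ.ofReal.mul_step (zero_notMem_tsupport_ofReal h0) _ _)

omit hχ hG in
theorem zero_notMem_tsupport_smoothInterval (ε t : ℝ) :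
    0 ∉ tsupport (smoothInterval χ G ε t) := by
  rw [notMem_tsupport_iff_eventuallyEq] at h0 ⊢
  filter_upwards [h0] with s hs
  simp [smoothInterval, hs]

/-- By rescaling, the first derivative of G((t - s)/ε) has an L¹ norm independent of ε and the
second costs one factor 1/ε, uniformly in t. For ε ≥ 1 the bound is used at scale 1. -/
theorem exists_c2Bound_smoothInterval : ∃ B, 0 ≤ B ∧ ∀ ε > 0, ∀ t,
    C2Bound (smoothInterval χ G ε t) B (min ε 1) := by
  obtain ⟨K, hK, h⟩ := exists_c2Bound_mul_of_integral hχ.ofReal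
  obtain ⟨B, hB⟩ := (hχ.ofReal.mul_step (zero_notMem_tsupport_ofReal h0) (-1) 0).exists_c2Bound
  obtain ⟨M₀, hM₀⟩ := hG.exists_bound
  set M₁ := ∫ u, ‖deriv (fun s => (G s : ℂ)) u‖
  set M₂ := ∫ u, ‖deriv (deriv fun s => (G s : ℂ)) u‖
  have hM0 : 0 ≤ M₀ := (norm_nonneg _).trans (hM₀ 0)
  have hM1 : 0 ≤ M₁ := integral_nonneg fun _ => norm_nonneg _
  have hM2 : 0 ≤ M₂ := integral_nonneg fun _ => norm_nonneg _
  have hB0 : 0 ≤ B := (norm_nonneg _).trans (hB.sup 0)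
  refine ⟨K * (M₀ + M₁ + M₂) + B, by positivity, fun ε hε t => ?_⟩
  have hm : 0 < min ε 1 := by positivity
  have hm1 : min ε 1 ≤ 1 := min_le_right _ _
  have h1 := h (fun s => (G ((t - s) / ε) : ℂ)) (M₀ + M₁ + M₂) (min ε 1) hm hm1
    (hG.contDiff_scaled ε t) (hG.isTest_deriv_scaled hε t)
    (fun s => (hM₀ _).trans (by linarith)) (by
      simp only [hG.deriv_scaled, norm_smul, norm_neg, norm_inv, Real.norm_eq_abs, abs_of_pos hε]
      rw [integral_const_mul,
        IsSmoothStep.integral_scaled (fun u => ‖deriv (fun s => (G s : ℂ)) u‖) hε,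
        inv_mul_cancel_left₀ hε.ne']
      linarith) (by
      simp only [hG.deriv_deriv_scaled, norm_smul, norm_pow, norm_inv, Real.norm_eq_abs,
        abs_of_pos hε]
      rw [integral_const_mul,
        IsSmoothStep.integral_scaled (fun u => ‖deriv (deriv fun s => (G s : ℂ)) u‖) hε]
      calc ε⁻¹ ^ 2 * (ε * M₂) = M₂ / ε := by field_simp
        _ ≤ M₂ / min ε 1 := by gcongr; exact min_le_left _ _
        _ ≤ _ := by gcongr; linarith)
  have h2 : C2Bound (fun y => (χ y : ℂ) * step (-1) 0 y) B (min ε 1) :=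
    ⟨hB.sup, hB.int, hB.int_deriv, hB.int_deriv2.trans (by gcongr)⟩
  simp only [funext (smoothInterval_eq χ G ε t)]
  exact C2Bound.add (hχ.ofReal.mul_left (hG.contDiff_scaled ε t))
    (hχ.ofReal.mul_step (zero_notMem_tsupport_ofReal h0) _ _) h1 h2

omit hχ h0 hG in
theorem exists_lipschitz_of_isTest_deriv {f : ℝ → ℂ} (hf : Differentiable ℝ f)
    (h : IsTest (deriv f)) : ∃ L, 0 ≤ L ∧ ∀ x y, ‖f x - f y‖ ≤ L * |x - y| := by
  obtain ⟨L, hL⟩ := h.2.exists_bound_of_continuous h.1.continuous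
  refine ⟨L, (norm_nonneg _).trans (hL 0), fun x y => ?_⟩
  exact Convex.norm_image_sub_le_of_norm_deriv_le (s := Set.univ) (fun x _ => hf x)
    (fun x _ => hL x) convex_univ (Set.mem_univ y) (Set.mem_univ x)

-- The term with the jump at s = 0 does not depend on t and cancels in the difference. The bound,
-- with a constant depending on ε, gives Lipschitz dependence of the charge on t.
omit h0 in
theorem exists_c2Bound_smoothInterval_sub {ε : ℝ} (hε : 0 < ε) : ∃ B, 0 ≤ B ∧ ∀ t t',
    C2Bound (fun s => smoothInterval χ G ε t s - smoothInterval χ G ε t' s) (B * |t - t'|) 1 := by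
  obtain ⟨K, hK, h⟩ := exists_c2Bound_mul hχ.ofReal
  obtain ⟨L₀, hL0, hL₀⟩ := exists_lipschitz_of_isTest_deriv
    (hG.contDiff_ofReal.differentiable (by simp)) hG.isTest_deriv
  obtain ⟨L₁, hL1, hL₁⟩ := exists_lipschitz_of_isTest_deriv
    (hG.isTest_deriv.1.differentiable (by simp)) hG.isTest_deriv.deriv
  obtain ⟨L₂, hL2, hL₂⟩ := exists_lipschitz_of_isTest_deriv
    (hG.isTest_deriv.deriv.1.differentiable (by simp)) hG.isTest_deriv.deriv.deriv
  set M := L₀ * ε⁻¹ + ε⁻¹ * (L₁ * ε⁻¹) + ε⁻¹ ^ 2 * (L₂ * ε⁻¹) with hM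
  have hM0 : 0 ≤ L₀ * ε⁻¹ := by positivity
  have hM1 : 0 ≤ ε⁻¹ * (L₁ * ε⁻¹) := by positivity
  have hM2 : 0 ≤ ε⁻¹ ^ 2 * (L₂ * ε⁻¹) := by positivity
  refine ⟨K * M, by positivity, fun t t' => ?_⟩
  have e : ∀ s, |(t - s) / ε - (t' - s) / ε| = ε⁻¹ * |t - t'| := fun s => by
    rw [← sub_div, sub_sub_sub_cancel_right, abs_div, abs_of_pos hε, div_eq_inv_mul]
  have hd : ∀ t, Differentiable ℝ fun s => (G ((t - s) / ε) : ℂ) := fun t =>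
    (hG.contDiff_scaled ε t).differentiable (by simp)
  have hd' : ∀ t, Differentiable ℝ (deriv fun s => (G ((t - s) / ε) : ℂ)) := fun t =>
    (hG.isTest_deriv_scaled hε t).1.differentiable (by simp)
  have e1 : deriv (fun s => (G ((t - s) / ε) : ℂ) - G ((t' - s) / ε)) = fun s =>
      deriv (fun s => (G ((t - s) / ε) : ℂ)) s - deriv (fun s => (G ((t' - s) / ε) : ℂ)) s :=
    funext fun s => deriv_fun_sub (hd t s) (hd t' s)
  have e2 : deriv (fun s => deriv (fun s => (G ((t - s) / ε) : ℂ)) s -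
      deriv (fun s => (G ((t' - s) / ε) : ℂ)) s) = fun s =>
      deriv (deriv fun s => (G ((t - s) / ε) : ℂ)) s -
        deriv (deriv fun s => (G ((t' - s) / ε) : ℂ)) s :=
    funext fun s => deriv_fun_sub (hd' t s) (hd' t' s)
  have h1 := h (fun s => (G ((t - s) / ε) : ℂ) - G ((t' - s) / ε)) (M * |t - t'|)
    ((hG.contDiff_scaled ε t).sub (hG.contDiff_scaled ε t')) (fun s => by
      refine (hL₀ _ _).trans ?_
      rw [e, ← mul_assoc]
      gcongr
      linarith) (fun s => by
      rw [e1]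
      simp only [hG.deriv_scaled, ← smul_sub, norm_smul, norm_neg, norm_inv, Real.norm_eq_abs,
        abs_of_pos hε]
      calc _ ≤ ε⁻¹ * (L₁ * (ε⁻¹ * |t - t'|)) := by
            gcongr; exact (hL₁ _ _).trans (le_of_eq (by rw [e]))
        _ = ε⁻¹ * (L₁ * ε⁻¹) * |t - t'| := by ring
        _ ≤ _ := by gcongr; linarith) (fun s => by
      rw [e1, e2]
      simp only [hG.deriv_deriv_scaled, ← smul_sub, norm_smul, norm_pow, norm_inv,
        Real.norm_eq_abs, abs_of_pos hε]
      calc _ ≤ ε⁻¹ ^ 2 * (L₂ * (ε⁻¹ * |t - t'|)) := by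
            gcongr; exact (hL₂ _ _).trans (le_of_eq (by rw [e]))
        _ = ε⁻¹ ^ 2 * (L₂ * ε⁻¹) * |t - t'| := by ring
        _ ≤ _ := by gcongr; linarith)
  have e3 : (fun s => smoothInterval χ G ε t s - smoothInterval χ G ε t' s) =
      fun s => (χ s : ℂ) * ((G ((t - s) / ε) : ℂ) - G ((t' - s) / ε)) := funext fun s => by
    rw [smoothInterval, smoothInterval]; ring
  rw [e3, mul_assoc]
  exact h1

end SmoothInterval

/-! ### Mollification by the derivative of the smooth step -/

section Mollify

variable {χ G : ℝ → ℝ}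

/-- Average of `φ` at the scale `ε` around a point. -/
def mollify (G : ℝ → ℝ) (ε : ℝ) (φ : ℝ → ℂ) (s : ℝ) : ℂ :=
  ∫ u, φ (s + ε * u) * deriv (fun s => (G s : ℂ)) u

variable (hG : IsSmoothStep G)
include hG

theorem integrable_mollify {φ : ℝ → ℂ} (hφ : Continuous φ) (ε s : ℝ) :
    Integrable fun u => φ (s + ε * u) * deriv (fun s => (G s : ℂ)) u :=
  ((hφ.comp (by fun_prop)).mul hG.isTest_deriv.1.continuous).integrable_of_hasCompactSupport
    hG.isTest_deriv.2.mul_left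

theorem hasDerivAt_mollify {φ : ℝ → ℂ} (hφ : IsTest φ) (ε s : ℝ) :
    HasDerivAt (mollify G ε φ) (mollify G ε (deriv φ) s) s := by
  obtain ⟨L, hL⟩ := hφ.deriv.2.exists_bound_of_continuous hφ.deriv.1.continuous
  refine (hasDerivAt_integral_of_dominated_loc_of_deriv_le
    (F := fun s u => φ (s + ε * u) * deriv (fun s => (G s : ℂ)) u)
    (F' := fun s u => deriv φ (s + ε * u) * deriv (fun s => (G s : ℂ)) u)
    (bound := fun u => L * ‖deriv (fun s => (G s : ℂ)) u‖) univ_mem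
    (Eventually.of_forall fun s =>
      (integrable_mollify hG hφ.1.continuous ε s).aestronglyMeasurable)
    (integrable_mollify hG hφ.1.continuous ε s)
    (integrable_mollify hG hφ.deriv.1.continuous ε s).aestronglyMeasurable
    (Eventually.of_forall fun u s _ => ?_)
    (hG.isTest_deriv.integrable.norm.const_mul L) (Eventually.of_forall fun u s _ => ?_)).2
  · rw [norm_mul]
    gcongr
    exact hL _
  · exact ((hφ.1.differentiable (by simp) _).hasDerivAt.comp_add_const s (ε * u)).mul_const _

theorem deriv_mollify {φ : ℝ → ℂ} (hφ : IsTest φ) (ε : ℝ) :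
    deriv (mollify G ε φ) = mollify G ε (deriv φ) :=
  funext fun s => (hasDerivAt_mollify hG hφ ε s).deriv

theorem contDiff_mollify {φ : ℝ → ℂ} (hφ : IsTest φ) (ε : ℝ) :
    ContDiff ℝ ∞ (mollify G ε φ) := by
  refine contDiff_infty.2 fun n => ?_
  induction n generalizing φ with
  | zero =>
    exact contDiff_zero.2 (continuous_iff_continuousAt.2 fun s =>
      (hasDerivAt_mollify hG hφ ε s).continuousAt)
  | succ n ih =>
    rw [Nat.cast_succ]
    refine contDiff_succ_iff_deriv.2
      ⟨fun s => (hasDerivAt_mollify hG hφ ε s).differentiableAt, fun h => by simp at h, ?_⟩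
    rw [deriv_mollify hG hφ]
    exact ih hφ.deriv

theorem norm_mollify_sub_le {φ : ℝ → ℂ} (hφ : IsTest φ) : ∃ L, 0 ≤ L ∧ ∀ ε, 0 < ε → ∀ s,
    ‖mollify G ε φ s - φ s‖ ≤ L * ε := by
  obtain ⟨L, hL0, hL⟩ := exists_lipschitz_of_isTest_deriv (hφ.1.differentiable (by simp)) hφ.deriv
  have hi : Integrable fun u => |u| * ‖deriv (fun s => (G s : ℂ)) u‖ :=
    (continuous_abs.mul hG.isTest_deriv.1.continuous.norm).integrable_of_hasCompactSupport
      hG.isTest_deriv.2.norm.mul_left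
  refine ⟨L * ∫ u, |u| * ‖deriv (fun s => (G s : ℂ)) u‖,
    mul_nonneg hL0 (integral_nonneg fun _ => by positivity), fun ε hε s => ?_⟩
  have e : mollify G ε φ s - φ s =
      ∫ u, (φ (s + ε * u) - φ s) * deriv (fun s => (G s : ℂ)) u := by
    simp only [sub_mul]
    rw [integral_sub (integrable_mollify hG hφ.1.continuous ε s)
      (hG.isTest_deriv.integrable.const_mul _), integral_const_mul, hG.integral_deriv, mul_one]
    rfl
  rw [e, mul_right_comm, ← integral_const_mul]
  refine norm_integral_le_of_norm_le (hi.const_mul _) (Eventually.of_forall fun u => ?_)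
  rw [norm_mul]
  calc _ ≤ L * |s + ε * u - s| * ‖deriv (fun s => (G s : ℂ)) u‖ := by gcongr; exact hL _ _
    _ = _ := by rw [add_sub_cancel_left, abs_mul, abs_of_pos hε]; ring

/-- Mollification commutes with differentiation, so the first-order Lipschitz estimate applies to φ
and its first two derivatives alike. -/
theorem exists_c2Bound_mollify_sub (hχ : IsTest χ) {φ : ℝ → ℂ} (hφ : IsTest φ) :
    ∃ B, 0 ≤ B ∧ ∀ ε, 0 < ε →
      C2Bound (fun s => χ s * (mollify G ε φ s - φ s)) (B * ε) 1 := by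
  obtain ⟨K, hK, h⟩ := exists_c2Bound_mul hχ.ofReal
  obtain ⟨L₀, h0, hL₀⟩ := norm_mollify_sub_le hG hφ
  obtain ⟨L₁, h1, hL₁⟩ := norm_mollify_sub_le hG hφ.deriv
  obtain ⟨L₂, h2, hL₂⟩ := norm_mollify_sub_le hG hφ.deriv.deriv
  refine ⟨K * (L₀ + L₁ + L₂), by positivity, fun ε hε => ?_⟩
  have e1 : deriv (fun s => mollify G ε φ s - φ s) =
      fun s => mollify G ε (deriv φ) s - deriv φ s := funext fun s =>
    ((hasDerivAt_mollify hG hφ ε s).sub (hφ.1.differentiable (by simp) s).hasDerivAt).deriv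
  have e2 : deriv (fun s => mollify G ε (deriv φ) s - deriv φ s) =
      fun s => mollify G ε (deriv (deriv φ)) s - deriv (deriv φ) s := funext fun s =>
    ((hasDerivAt_mollify hG hφ.deriv ε s).sub
      (hφ.deriv.1.differentiable (by simp) s).hasDerivAt).deriv
  rw [mul_assoc]
  refine h _ _ ((contDiff_mollify hG hφ ε).sub hφ.1) (fun s => (hL₀ ε hε s).trans ?_)
    (fun s => ?_) fun s => ?_
  · gcongr; linarith
  · rw [e1]
    exact (hL₁ ε hε s).trans (by gcongr; linarith)
  · rw [e1, e2]
    exact (hL₂ ε hε s).trans (by gcongr; linarith)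

/-- Smearing the smoothed intervals. -/
theorem integral_deriv_mul_smoothInterval {φ : ℝ → ℂ} (hφ : IsTest φ) {ε : ℝ} (hε : 0 < ε)
    (s : ℝ) : ∫ t, -deriv φ t * smoothInterval χ G ε t s = χ s * mollify G ε φ s := by
  have h1 : ∀ t, HasDerivAt (fun t => (G ((t - s) / ε) : ℂ))
      ((ε⁻¹ : ℝ) • deriv (fun s => (G s : ℂ)) ((t - s) / ε)) t := fun t => by
    have h1 : HasDerivAt (fun t => (t - s) / ε) ε⁻¹ t := by
      simpa using ((hasDerivAt_id t).sub_const s).div_const ε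
    exact (hG.contDiff_ofReal.differentiable (by simp) _).hasDerivAt.scomp t h1
  have hc : Continuous fun t => (G ((t - s) / ε) : ℂ) :=
    continuous_iff_continuousAt.2 fun t => (h1 t).continuousAt
  have haff : Continuous fun t => (t - s) / ε := by fun_prop
  have hc' : Continuous fun t => (ε⁻¹ : ℝ) • deriv (fun s => (G s : ℂ)) ((t - s) / ε) :=
    (hG.isTest_deriv.1.continuous.comp haff).const_smul ε⁻¹
  have i1 : Integrable fun t => (G ((t - s) / ε) : ℂ) * deriv φ t :=
    (hc.mul hφ.deriv.1.continuous).integrable_of_hasCompactSupport hφ.deriv.2.mul_left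
  have i2 : Integrable fun t => (ε⁻¹ : ℝ) • deriv (fun s => (G s : ℂ)) ((t - s) / ε) * φ t :=
    (hc'.mul hφ.1.continuous).integrable_of_hasCompactSupport hφ.2.mul_left
  have i3 : Integrable fun t => (G ((t - s) / ε) : ℂ) * φ t :=
    (hc.mul hφ.1.continuous).integrable_of_hasCompactSupport hφ.2.mul_left
  have e1 := integral_mul_deriv_eq_deriv_mul_of_integrable (fun t _ => h1 t)
    (fun t _ => (hφ.1.differentiable (by simp) t).hasDerivAt) i1 i2 i3
  have e2 : ∫ t, (ε⁻¹ : ℝ) • deriv (fun s => (G s : ℂ)) ((t - s) / ε) * φ t =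
      mollify G ε φ s := by
    have h2 := integral_sub_right_eq_self
      (fun t => (ε⁻¹ : ℝ) • deriv (fun s => (G s : ℂ)) (t / ε) * φ (s + ε * (t / ε))) s
      (μ := volume)
    have h3 : ∀ t, (ε⁻¹ : ℝ) • deriv (fun s => (G s : ℂ)) ((t - s) / ε) * φ t =
        (ε⁻¹ : ℝ) • deriv (fun s => (G s : ℂ)) ((t - s) / ε) * φ (s + ε * ((t - s) / ε)) :=
      fun t => by rw [mul_div_cancel₀ _ hε.ne', add_sub_cancel]
    simp only [h3]
    rw [h2, Measure.integral_comp_div (fun x => (ε⁻¹ : ℝ) • deriv (fun s => (G s : ℂ)) x *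
      φ (s + ε * x)), abs_of_pos hε, ← integral_smul]
    refine integral_congr_ae (Eventually.of_forall fun u => ?_)
    simp only [smul_mul_assoc]
    rw [smul_inv_smul₀ hε.ne', mul_comm]
  have e3 : ∫ t, deriv φ t = 0 :=
    integral_eq_zero_of_hasDerivAt_of_integrable
      (fun t => (hφ.1.differentiable (by simp) t).hasDerivAt) hφ.deriv.integrable hφ.integrable
  -- The term with the jump at s = 0 is independent of t and drops out since φ' has integral zero.
  -- The other term is integrated by parts.
  have e4 : ∀ t, -deriv φ t * smoothInterval χ G ε t s =
      -(χ s : ℂ) * ((G ((t - s) / ε) : ℂ) * deriv φ t) +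
        -((χ s : ℂ) * step (-1) 0 s) * deriv φ t := fun t => by
    rw [smoothInterval_eq]; ring
  simp only [e4]
  rw [integral_add (i1.const_mul _) (hφ.deriv.integrable.const_mul _), integral_const_mul,
    integral_const_mul, e1, e2, e3]
  ring

end Mollify

/-! ### The matrices of the scattering model -/

/-- A matrix function with values `L` on the left and `R` on the right. -/
def pw (L R : Mat) (x : ℝ) : Mat := if x < 0 then L else R

/-- The matrix of the outgoing current. -/
def outMat (S : Mat) : ℝ → Mat := pw (star S * chargeMat * S) chargeMat

/-- The matrix of the incoming current, up to sign. -/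
def inMat (S : Mat) : ℝ → Mat := pw chargeMat (S * chargeMat * star S)

theorem pw_apply (L R : Mat) (x : ℝ) (j k : Fin 2) : pw L R x j k = step (L j k) (R j k) x := by
  rw [pw, step]; split_ifs <;> rfl

theorem chargeMat_mul_self : chargeMat * chargeMat = chargeMat := by
  ext j k; fin_cases j <;> fin_cases k <;> simp [chargeMat]

theorem star_chargeMat : star chargeMat = chargeMat := by
  ext j k; fin_cases j <;> fin_cases k <;> simp [chargeMat, Matrix.star_apply]

theorem trace_chargeMat : chargeMat.trace = 1 := by simp [chargeMat, Matrix.trace_fin_two]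

/-- The charge matrix is diagonal, so commuting with it leaves no diagonal part. The bare charge can
therefore be dropped from the diagonal of a commutator. -/
theorem chargeMat_comm_diag (M : Mat) (k : Fin 2) :
    (chargeMat * M) k k = (M * chargeMat) k k := by
  fin_cases k <;> simp [chargeMat, Matrix.mul_apply, Fin.sum_univ_two]

section Unitary

variable {S : Mat} (hS : S ∈ Matrix.unitaryGroup (Fin 2) ℂ)
include hS

theorem conj_chargeMat_mul_self :
    (S * chargeMat * star S) * (S * chargeMat * star S) = S * chargeMat * star S := by
  have h : star S * S = 1 := (Matrix.mem_unitaryGroup_iff' (A := S)).1 hS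
  calc _ = S * chargeMat * (star S * S) * chargeMat * star S := by noncomm_ring
    _ = S * (chargeMat * chargeMat) * star S := by rw [h]; noncomm_ring
    _ = _ := by rw [chargeMat_mul_self]

theorem trace_conj_chargeMat : (S * chargeMat * star S).trace = 1 := by
  have h : star S * S = 1 := (Matrix.mem_unitaryGroup_iff' (A := S)).1 hS
  rw [Matrix.trace_mul_comm, ← mul_assoc, h, one_mul, trace_chargeMat]

theorem star_mem_unitary : star S ∈ Matrix.unitaryGroup (Fin 2) ℂ := Unitary.star_mem hS

theorem outMat_mul_self (x : ℝ) : outMat S x * outMat S x = outMat S x := by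
  have := conj_chargeMat_mul_self (star_mem_unitary hS)
  rw [star_star] at this
  rw [outMat, pw]
  split_ifs
  · exact this
  · exact chargeMat_mul_self

theorem inMat_mul_self (x : ℝ) : inMat S x * inMat S x = inMat S x := by
  rw [inMat, pw]
  split_ifs
  · exact chargeMat_mul_self
  · exact conj_chargeMat_mul_self hS

theorem trace_outMat (x : ℝ) : (outMat S x).trace = 1 := by
  have := trace_conj_chargeMat (star_mem_unitary hS)
  rw [star_star] at this
  rw [outMat, pw]
  split_ifs
  · exact this
  · exact trace_chargeMat

theorem trace_inMat (x : ℝ) : (inMat S x).trace = 1 := by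
  rw [inMat, pw]
  split_ifs
  · exact trace_chargeMat
  · exact trace_conj_chargeMat hS

-- By cyclicity the overlap of the two projections is the same on both sides of the scatterer. The
-- Schwinger trace then has a coefficient independent of position.
omit hS in
theorem trace_outMat_mul_inMat (x : ℝ) :
    (outMat S x * inMat S x).trace = (star S * chargeMat * S * chargeMat).trace := by
  rw [outMat, inMat, pw, pw]
  split_ifs
  · rfl
  · rw [← mul_assoc, ← mul_assoc, Matrix.trace_mul_comm, ← mul_assoc, ← mul_assoc]

/-- Both matrices are projections of trace one with a constant overlap, so the four terms collect
into a multiple of u + v. -/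
theorem trace_model (x : ℝ) (u v : ℂ) :
    ((u • outMat S x - v • inMat S x) * (outMat S x - inMat S x)).trace =
      (1 - (star S * chargeMat * S * chargeMat).trace) * (u + v) := by
  have h := trace_outMat_mul_inMat (S := S) x
  have h' : (inMat S x * outMat S x).trace = (star S * chargeMat * S * chargeMat).trace := by
    rw [Matrix.trace_mul_comm, h]
  rw [sub_mul, mul_sub, mul_sub, smul_mul_assoc, smul_mul_assoc, smul_mul_assoc, smul_mul_assoc,
    outMat_mul_self hS, inMat_mul_self hS, Matrix.trace_sub, Matrix.trace_sub, Matrix.trace_sub,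
    Matrix.trace_smul, Matrix.trace_smul, Matrix.trace_smul, Matrix.trace_smul, h, h',
    trace_outMat hS, trace_inMat hS]
  simp only [smul_eq_mul]
  ring

end Unitary

/-! ### Pointwise commutation of regularized charges -/

/-- A family of regularized time intervals: `f t` is the indicator of the interval from `0` to
`t` in `U`, up to the smearing of the end point `t` at the scale `ε`. -/
structure StepFamily (U : Set ℝ) (ε : ℝ) (f : ℝ → ℝ → ℂ) where
  χ : ℝ → ℂ
  g : ℝ → ℝ → ℂ
  eq : ∀ t y, f t y = χ y * (g t y - step 1 0 y)
  one : ∀ y ∈ U, χ y = 1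
  early : ∀ t y, y ≤ t - ε → g t y = 1
  late : ∀ t y, t + ε ≤ y → g t y = 0

/-- The matrix of the charge with separate regularizations of the currents. -/
def modelMat (S : Mat) (u v : ℝ → ℂ) (x : ℝ) : Mat :=
  chargeMat + (u (-x) • outMat S x - v (-x) • inMat S x)

namespace StepFamily

variable {U : Set ℝ} {ε : ℝ} {f : ℝ → ℝ → ℂ} (F : StepFamily U ε f) {S : Mat}
include F

theorem eq_of_early {t t' y : ℝ} (h : y ≤ t - ε) (h' : y ≤ t' - ε) : f t y = f t' y := by
  rw [F.eq, F.eq, F.early t y h, F.early t' y h']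

theorem eq_of_late {t t' y : ℝ} (h : t + ε ≤ y) (h' : t' + ε ≤ y) : f t y = f t' y := by
  rw [F.eq, F.eq, F.late t y h, F.late t' y h']

/-- To the left of the scatterer the bare charge is the incoming matrix, to the right it is the
outgoing one. In both cases it combines with the step in f so that only the smoothed indicators
remain. -/
theorem modelMat_eq {p q x : ℝ} (hx : x ≠ 0) (hU : -x ∈ U) : modelMat S (f p) (f q) x =
    F.g p (-x) • outMat S x + (1 - F.g q (-x)) • inMat S x := by
  rw [modelMat, F.eq, F.eq, F.one _ hU, one_mul, one_mul]
  rcases hx.lt_or_gt with h | h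
  · rw [inMat, pw, if_pos h, step, if_neg (by linarith)]
    module
  · rw [outMat, pw, if_neg h.not_gt, step, if_pos (by linarith)]
    module

/-- The increment vanishes unless -x lies between p - ε and q + ε. There the indicator at the later
time s equals 1, and the charge is the outgoing matrix itself. -/
theorem commute_out {p q s x : ℝ} (hpq : p < q)
    (hU : Set.Icc (p - ε) (q + ε) ⊆ U) (hs : q + 2 * ε ≤ s) (hx : x ≠ 0) :
    Commute ((f q (-x) - f p (-x)) • outMat S x) (modelMat S (f s) (f s) x) := by
  by_cases h : f q (-x) = f p (-x)
  · rw [h, sub_self, zero_smul]; exact Commute.zero_left _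
  have h1 : p - ε ≤ -x := not_lt.1 fun h1 => h (F.eq_of_early (by linarith) (by linarith))
  have h2 : -x ≤ q + ε := not_lt.1 fun h1 => h (F.eq_of_late (by linarith) (by linarith))
  rw [F.modelMat_eq hx (hU ⟨h1, h2⟩), F.early s (-x) (by linarith), one_smul, sub_self, zero_smul,
    add_zero]
  exact (Commute.refl _).smul_left _

theorem commute_inc {p q s x : ℝ} (hpq : p < q)
    (hU : Set.Icc (p - ε) (q + ε) ⊆ U) (hs : s ≤ p - 2 * ε) (hx : x ≠ 0) :
    Commute ((f q (-x) - f p (-x)) • inMat S x) (modelMat S (f s) (f s) x) := by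
  by_cases h : f q (-x) = f p (-x)
  · rw [h, sub_self, zero_smul]; exact Commute.zero_left _
  have h1 : p - ε ≤ -x := not_lt.1 fun h1 => h (F.eq_of_early (by linarith) (by linarith))
  have h2 : -x ≤ q + ε := not_lt.1 fun h1 => h (F.eq_of_late (by linarith) (by linarith))
  rw [F.modelMat_eq hx (hU ⟨h1, h2⟩), F.late s (-x) (by linarith), zero_smul, sub_zero, one_smul,
    zero_add]
  exact (Commute.refl _).smul_left _

/-- Outside [p - ε, q + ε] all three intervals agree and the two matrices coincide. Inside, on the
side -x ≤ s the mixed matrix is a multiple of the outgoing one, and it is nonzero only where the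
charge at s equals that matrix. On the other side the incoming matrix plays this role. -/
theorem commute_mid (hε : 0 < ε) {p q s x : ℝ} (hU : Set.Icc (p - ε) (q + ε) ⊆ U)
    (hs : p + 2 * ε ≤ s) (hs' : s ≤ q - 2 * ε) (hx : x ≠ 0) :
    Commute (modelMat S (f p) (f q) x) (modelMat S (f s) (f s) x) := by
  rcases le_total (-x) (p - ε) with h1 | h1
  · rw [modelMat, modelMat, F.eq_of_early h1 (t' := s) (by linarith),
      F.eq_of_early (t := q) (t' := s) (y := -x) (by linarith) (by linarith)]
  rcases le_total (q + ε) (-x) with h2 | h2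
  · rw [modelMat, modelMat, F.eq_of_late h2 (t' := s) (by linarith),
      F.eq_of_late (t := p) (t' := s) (y := -x) (by linarith) (by linarith)]
  have hxU := hU ⟨h1, h2⟩
  rw [F.modelMat_eq hx hxU, F.modelMat_eq hx hxU]
  rcases le_total (-x) s with h3 | h3
  · rw [F.early q (-x) (by linarith), sub_self, zero_smul, add_zero]
    rcases le_total (p + ε) (-x) with h4 | h4
    · rw [F.late p _ h4, zero_smul]; exact Commute.zero_left _
    · rw [F.early s (-x) (by linarith), sub_self, zero_smul, add_zero, one_smul]
      exact (Commute.refl _).smul_left _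
  · rw [F.late p (-x) (by linarith), zero_smul, zero_add]
    rcases le_total (-x) (q - ε) with h4 | h4
    · rw [F.early q _ h4, sub_self, zero_smul]; exact Commute.zero_left _
    · rw [F.late s (-x) (by linarith), zero_smul, zero_add, sub_zero, one_smul]
      exact (Commute.refl _).smul_left _

theorem deriv_eq_zero (h0 : 0 ∉ U) {t y a b : ℝ} {c : ℂ} (hy : y ∈ Set.Ioo a b)
    (hU : Set.Ioo a b ⊆ U) (hg : ∀ z ∈ Set.Ioo a b, F.g t z = c) : deriv (f t) y = 0 := by
  have hy0 : y ≠ 0 := fun h => h0 (h ▸ hU hy)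
  have hstep : ∀ᶠ z in 𝓝 y, step 1 0 z = step 1 0 y := by
    rcases hy0.lt_or_gt with h | h
    · filter_upwards [Iio_mem_nhds h] with z hz
      rw [step, step, if_pos h, if_pos (Set.mem_Iio.1 hz)]
    · filter_upwards [Ioi_mem_nhds h] with z hz
      rw [step, step, if_neg h.le.not_gt, if_neg (not_lt.2 (le_of_lt hz))]
  have : f t =ᶠ[𝓝 y] fun _ => c - step 1 0 y := by
    filter_upwards [hstep, Ioo_mem_nhds hy.1 hy.2] with z hz hz'
    rw [F.eq, F.one z (hU hz'), hg z hz', one_mul, hz]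
  rw [this.deriv_eq, deriv_const]

theorem deriv_mul_sub_eq_zero_of_le (h0 : 0 ∉ U) {p q s : ℝ} (hpq : p < q)
    (hU : Set.Icc (p - ε) (q + ε) ⊆ U) (hs : q + 2 * ε ≤ s) (y : ℝ) :
    deriv (f s) y * (f q y - f p y) = 0 := by
  by_cases h : f q y = f p y
  · rw [h, sub_self, mul_zero]
  have h1 : p - ε < y := not_le.1 fun h1 => h (F.eq_of_early (by linarith) (by linarith))
  have h2 : y < q + ε := not_le.1 fun h1 => h (F.eq_of_late (by linarith) (by linarith))
  rw [F.deriv_eq_zero h0 ⟨h1, h2⟩ (Set.Ioo_subset_Icc_self.trans hU)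
    fun z hz => F.early s z (by linarith [hz.2]), zero_mul]

theorem deriv_mul_sub_eq_zero_of_ge (h0 : 0 ∉ U) {p q s : ℝ} (hpq : p < q)
    (hU : Set.Icc (p - ε) (q + ε) ⊆ U) (hs : s ≤ p - 2 * ε) (y : ℝ) :
    deriv (f s) y * (f q y - f p y) = 0 := by
  by_cases h : f q y = f p y
  · rw [h, sub_self, mul_zero]
  have h1 : p - ε < y := not_le.1 fun h1 => h (F.eq_of_early (by linarith) (by linarith))
  have h2 : y < q + ε := not_le.1 fun h1 => h (F.eq_of_late (by linarith) (by linarith))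
  rw [F.deriv_eq_zero h0 ⟨h1, h2⟩ (Set.Ioo_subset_Icc_self.trans hU)
    fun z hz => F.late s z (by linarith [hz.1]), zero_mul]

/-- The integrand is the derivative of f_s f_p + f_s f_q - f_p f_q. The superfluous terms f_p'(f_s -
f_q) and f_q'(f_s - f_p) vanish because f_p varies only before the part where f_s and f_q differ,
and f_q only after the part where f_s and f_p differ, up to the common variation near y = 0 and at
the cutoff, where the differences vanish. -/
theorem integral_deriv_mul_add (hf : ∀ t, IsTest (f t)) (hε : 0 < ε) (h0 : 0 ∉ U) {p q s : ℝ}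
    (hU : Set.Icc (p - ε) (q + ε) ⊆ U) (hs : p + 2 * ε ≤ s) (hs' : s ≤ q - 2 * ε) :
    ∫ y, deriv (f s) y * (f p y + f q y) = 0 := by
  have d : ∀ t y, HasDerivAt (f t) (deriv (f t) y) y := fun t y =>
    ((hf t).1.differentiable (by simp) y).hasDerivAt
  have h1 : ∀ y, deriv (f p) y * (f s y - f q y) = 0 := fun y => by
    by_cases h : f s y = f q y
    · rw [h, sub_self, mul_zero]
    have h1 : s - ε < y := not_le.1 fun h1 => h (F.eq_of_early (by linarith) (by linarith))
    have h2 : y < q + ε := not_le.1 fun h1 => h (F.eq_of_late (by linarith) (by linarith))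
    rw [F.deriv_eq_zero h0 ⟨h1, h2⟩ (fun z hz => hU ⟨by linarith [hz.1], hz.2.le⟩)
      fun z hz => F.late p z (by linarith [hz.1]), zero_mul]
  have h2 : ∀ y, deriv (f q) y * (f s y - f p y) = 0 := fun y => by
    by_cases h : f s y = f p y
    · rw [h, sub_self, mul_zero]
    have h1 : p - ε < y := not_le.1 fun h1 => h (F.eq_of_early (by linarith) (by linarith))
    have h2 : y < s + ε := not_le.1 fun h1 => h (F.eq_of_late (by linarith) (by linarith))
    rw [F.deriv_eq_zero h0 ⟨h1, h2⟩ (fun z hz => hU ⟨hz.1.le, by linarith [hz.2]⟩)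
      fun z hz => F.early q z (by linarith [hz.2]), zero_mul]
  have h3 : ∀ y, HasDerivAt (fun y => f s y * f p y + f s y * f q y - f p y * f q y)
      (deriv (f s) y * (f p y + f q y)) y := fun y => by
    refine ((((d s y).mul (d p y)).add ((d s y).mul (d q y))).sub
      ((d p y).mul (d q y))).congr_deriv ?_
    linear_combination h1 y + h2 y
  refine integral_eq_zero_of_hasDerivAt_of_integrable h3 ?_ ?_
  · exact (hf s).deriv.integrable_mul ((hf p).add (hf q))
  · exact (((hf s).integrable_mul (hf p)).add ((hf s).integrable_mul (hf q))).sub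
      ((hf p).integrable_mul (hf q))

end StepFamily

/-! ### Currents as operators -/

/-- A bounded measurable function. -/
def BddMeas (f : ℝ → ℂ) : Prop := Measurable f ∧ ∃ C, ∀ x, ‖f x‖ ≤ C

theorem IsTest.bddMeas {f : ℝ → ℂ} (hf : IsTest f) : BddMeas f :=
  ⟨hf.1.continuous.measurable, hf.2.exists_bound_of_continuous hf.1.continuous⟩

theorem BddSym.pw (L R : Mat) : BddSym (pw L R) :=
  (BddSym.const L).piecewise measurableSet_Iio (BddSym.const R)

theorem BddMeas.bddSym {f : ℝ → ℂ} (hf : BddMeas f) {N : ℝ → Mat} (hN : BddSym N) :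
    BddSym fun x => f (-x) • N x := by
  obtain ⟨h1, C, h2⟩ := hf
  exact BddSym.smul (h1.comp measurable_neg) (fun x => h2 (-x)) hN

theorem BddMeas.sub {f g : ℝ → ℂ} (hf : BddMeas f) (hg : BddMeas g) :
    BddMeas fun x => f x - g x := by
  obtain ⟨h1, C, h2⟩ := hf
  obtain ⟨h3, D, h4⟩ := hg
  exact ⟨h1.sub h3, C + D, fun x => (norm_sub_le _ _).trans (add_le_add (h2 x) (h4 x))⟩

theorem bddSym_outMat (S : Mat) : BddSym (outMat S) := BddSym.pw _ _

theorem bddSym_inMat (S : Mat) : BddSym (inMat S) := BddSym.pw _ _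

theorem currentOut_eq (S : Mat) (f : ℝ → ℂ) :
    currentOut S f = mulOp fun x => f (-x) • outMat S x := rfl

theorem currentIn_eq (S : Mat) (f : ℝ → ℂ) :
    currentIn S f = mulOp fun x => f (-x) • -inMat S x := by
  simp only [smul_neg]; rfl

theorem mulOp_sub {m n : ℝ → Mat} (hm : BddSym m) (hn : BddSym n) :
    mulOp m - mulOp n = mulOp fun x => m x - n x := by
  rw [sub_eq_iff_eq_add, ← mulOp_add (by simpa only [sub_eq_add_neg] using hm.add hn.neg) hn]
  simp only [sub_add_cancel]

theorem mulOp_smul_sub {N : ℝ → Mat} (hN : BddSym N) {u v : ℝ → ℂ} (hu : BddMeas u)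
    (hv : BddMeas v) : (mulOp fun x => u (-x) • N x) - (mulOp fun x => v (-x) • N x) =
      mulOp fun x => (u (-x) - v (-x)) • N x := by
  rw [mulOp_sub (hu.bddSym hN) (hv.bddSym hN)]
  simp only [sub_smul]

theorem mulOp_commute {m n : ℝ → Mat} (hm : BddSym m) (hn : BddSym n)
    (h : ∀ x ≠ 0, Commute (m x) (n x)) : Commute (mulOp m) (mulOp n) := by
  change mulOp m ∘L mulOp n = mulOp n ∘L mulOp m
  rw [mulOp_comp hm hn, mulOp_comp hn hm]
  refine mulOp_congr (hm.mul hn) (hn.mul hm) ?_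
  have h0 : ∀ᵐ x : ℝ, x ≠ 0 := by simp [ae_iff]
  filter_upwards [h0] with x hx using h x hx

section

variable {S : Mat} {u v : ℝ → ℂ}

theorem bddSym_model (S : Mat) (hu : BddMeas u) (hv : BddMeas v) : BddSym (modelMat S u v) := by
  have := (BddSym.const chargeMat).add ((hu.bddSym (bddSym_outMat S)).add
    (hv.bddSym (bddSym_inMat S)).neg)
  simp only [← sub_eq_add_neg] at this
  exact this

theorem charge_add_currents (S : Mat) (hu : BddMeas u) (hv : BddMeas v) :
    charge + currentOut S u + currentIn S v = mulOp (modelMat S u v) := by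
  have e : modelMat S u v =
      fun x => chargeMat + u (-x) • outMat S x + v (-x) • -inMat S x := funext fun x => by
    rw [modelMat]; module
  rw [currentOut_eq, currentIn_eq, charge, e, mulOp_add ((BddSym.const _).add
    (hu.bddSym (bddSym_outMat S))) (hv.bddSym (bddSym_inMat S).neg),
    mulOp_add (BddSym.const _) (hu.bddSym (bddSym_outMat S))]

theorem currentOut_sub (S : Mat) (hu : BddMeas u) (hv : BddMeas v) :
    currentOut S u - currentOut S v = mulOp fun x => (u (-x) - v (-x)) • outMat S x :=
  mulOp_smul_sub (bddSym_outMat S) hu hv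

theorem currentIn_sub (S : Mat) (hu : BddMeas u) (hv : BddMeas v) :
    currentIn S u - currentIn S v = mulOp fun x => (u (-x) - v (-x)) • -inMat S x := by
  rw [currentIn_eq, currentIn_eq, mulOp_smul_sub (bddSym_inMat S).neg hu hv]

end

namespace StepFamily

variable {U : Set ℝ} {ε : ℝ} {f : ℝ → ℝ → ℂ} (F : StepFamily U ε f) (S : Mat)
  (hf : ∀ t, BddMeas (f t))
include F hf

theorem commute_currentOut {p q s : ℝ} (hpq : p < q) (hU : Set.Icc (p - ε) (q + ε) ⊆ U)
    (hs : q + 2 * ε ≤ s) : Commute (currentOut S (f q) - currentOut S (f p))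
      (charge + currentOut S (f s) + currentIn S (f s)) := by
  rw [currentOut_sub S (hf q) (hf p), charge_add_currents S (hf s) (hf s)]
  exact mulOp_commute (((hf q).sub (hf p)).bddSym (bddSym_outMat S))
    (bddSym_model S (hf s) (hf s)) fun x hx => F.commute_out hpq hU hs hx

theorem commute_currentIn {p q s : ℝ} (hpq : p < q) (hU : Set.Icc (p - ε) (q + ε) ⊆ U)
    (hs : s ≤ p - 2 * ε) : Commute (currentIn S (f q) - currentIn S (f p))
      (charge + currentOut S (f s) + currentIn S (f s)) := by
  rw [currentIn_sub S (hf q) (hf p), charge_add_currents S (hf s) (hf s)]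
  refine mulOp_commute (((hf q).sub (hf p)).bddSym (bddSym_inMat S).neg)
    (bddSym_model S (hf s) (hf s)) fun x hx => ?_
  rw [smul_neg]
  exact (F.commute_inc hpq hU hs hx).neg_left

theorem commute_charge (hε : 0 < ε) {p q s : ℝ} (hU : Set.Icc (p - ε) (q + ε) ⊆ U)
    (hs : p + 2 * ε ≤ s) (hs' : s ≤ q - 2 * ε) :
    Commute (charge + currentOut S (f p) + currentIn S (f q))
      (charge + currentOut S (f s) + currentIn S (f s)) := by
  rw [charge_add_currents S (hf p) (hf q), charge_add_currents S (hf s) (hf s)]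
  exact mulOp_commute (bddSym_model S (hf p) (hf q)) (bddSym_model S (hf s) (hf s))
    fun x hx => F.commute_mid hε hU hs hs' hx

end StepFamily

/-! ### Integrals of families of currents -/

theorem inner_mulOp {m : ℝ → Mat} (hm : BddSym m) (v w : H) :
    ⟪v, mulOp m w⟫_ℂ = ∫ x, ⟪(v : ℝ → Lead) x, matAct (m x) ((w : ℝ → Lead) x)⟫_ℂ := by
  rw [L2.inner_def]
  refine integral_congr_ae ?_
  filter_upwards [hm.ae w] with x hx
  rw [hx]

/-- Fubini against the integrable density of φ and `mulOp N ψ`. The pointwise smearing identity for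
scalar functions passes to weak matrix elements. -/
theorem integral_inner_mulOp {N : ℝ → Mat} (hN : BddSym N) {w : ℝ → ℂ} (hw : Integrable w)
    {f : ℝ → ℝ → ℂ} (hf : Measurable fun z : ℝ × ℝ => f z.1 z.2) {C : ℝ}
    (hC : ∀ t x, ‖f t x‖ ≤ C) {F : ℝ → ℂ} (hF : BddMeas F)
    (h : ∀ x, ∫ t, w t * f t x = F x) (φ ψ : H) :
    Integrable (fun t => w t * ⟪φ, mulOp (fun x => f t (-x) • N x) ψ⟫_ℂ) ∧
    ∫ t, w t * ⟪φ, mulOp (fun x => f t (-x) • N x) ψ⟫_ℂ =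
      ⟪φ, mulOp (fun x => F (-x) • N x) ψ⟫_ℂ := by
  have hft : ∀ t, BddMeas (f t) := fun t => ⟨hf.comp measurable_prodMk_left, C, hC t⟩
  set κ : ℝ → ℂ := fun x => ⟪(φ : ℝ → Lead) x, ((mulOp N ψ : H) : ℝ → Lead) x⟫_ℂ with hκ
  have hκi : Integrable κ := L2.integrable_inner φ (mulOp N ψ)
  have e : ∀ g, BddMeas g → ⟪φ, mulOp (fun x => g (-x) • N x) ψ⟫_ℂ = ∫ x, g (-x) * κ x :=
    fun g hg => by
      rw [inner_mulOp (hg.bddSym hN)]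
      refine integral_congr_ae ?_
      filter_upwards [hN.ae ψ] with x hx
      rw [matAct_smul, smul_apply, inner_smul_right, hκ]
      simp only [hx]
  simp only [e _ (hft _), e F hF]
  have hi : Integrable (fun z : ℝ × ℝ => w z.1 * (f z.1 (-z.2) * κ z.2))
      ((volume : Measure ℝ).prod (volume : Measure ℝ)) := by
    have h1 : Integrable (fun z : ℝ × ℝ => w z.1 * κ z.2)
        ((volume : Measure ℝ).prod (volume : Measure ℝ)) := hw.mul_prod hκi
    have h2 : Measurable fun z : ℝ × ℝ => f z.1 (-z.2) :=
      hf.comp (measurable_fst.prodMk measurable_snd.neg)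
    refine (h1.bdd_mul (c := C) h2.aestronglyMeasurable
      (Eventually.of_forall fun z => hC _ _)).congr (Eventually.of_forall fun z => ?_)
    ring
  have h3 : ∀ t, ∫ x, w t * (f t (-x) * κ x) = w t * ∫ x, f t (-x) * κ x := fun t =>
    integral_const_mul _ _
  constructor
  · simpa only [h3] using hi.integral_prod_left
  · simp only [← h3]
    rw [integral_integral_swap hi]
    refine integral_congr_ae (Eventually.of_forall fun x => ?_)
    simp only [← h, ← mul_assoc]
    rw [integral_mul_const]

/-! ### The charge commutes with the Fermi sea -/

theorem charge_adjoint : charge.adjoint = charge := by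
  rw [charge, mulOp_adjoint (BddSym.const _)]
  simp only [star_chargeMat]

theorem mulOp_const_toLp (A : Mat) (g : SchwartzMap ℝ Lead) :
    mulOp (fun _ => A) (g.toLp 2) = (g.postcompCLM (matAct A)).toLp 2 := by
  refine Lp.ext ?_
  filter_upwards [(BddSym.const A).ae (g.toLp 2), g.coeFn_toLp 2,
    (g.postcompCLM (matAct A)).coeFn_toLp 2] with x h1 h2 h3
  rw [h1, h2, h3, SchwartzMap.postcompCLM_apply]

theorem FT_mulOp_const (A : Mat) (f : H) :
    FT (mulOp (fun _ => A) f) = mulOp (fun _ => A) (FT f) := by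
  refine (SchwartzMap.denseRange_toLpCLM (E := ℝ) (F := Lead) (μ := (volume : Measure ℝ)) (p := 2)
    ENNReal.ofNat_ne_top).induction_on
    (p := fun f : H => FT (mulOp (fun _ => A) f) = mulOp (fun _ => A) (FT f)) f
    (isClosed_eq (FT.continuous.comp (ContinuousLinearMap.continuous _))
      ((ContinuousLinearMap.continuous _).comp FT.continuous)) fun g => ?_
  have h0 : SchwartzMap.toLpCLM ℝ (E := ℝ) Lead 2 volume g = g.toLp 2 := rfl
  rw [h0, mulOp_const_toLp, FT_toLp, FT_toLp, mulOp_const_toLp]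
  congr 1
  ext1 p
  rw [SchwartzMap.postcompCLM_apply, SchwartzMap.fourier_coe, SchwartzMap.fourier_coe,
    Real.fourier_eq, Real.fourier_eq, ← (matAct A).integral_comp_comm
      ((Real.fourierIntegral_convergent_iff p).2 g.integrable)]
  refine integral_congr_ae (Eventually.of_forall fun x => ?_)
  simp only [SchwartzMap.postcompCLM_apply, Circle.smul_def, map_smul]

/-- A constant matrix commutes with the Fourier transform, and the charge matrix and the Fermi
symbol are both diagonal in the leads. -/
theorem charge_fermiSea (μL μR : ℝ) (f : H) :
    charge (fermiSea μL μR f) = fermiSea μL μR (charge f) := by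
  have h1 : ∀ f : H, FT (charge f) = charge (FT f) := FT_mulOp_const chargeMat
  have h2 : ∀ f : H, FT.symm (charge f) = charge (FT.symm f) := fun f =>
    FT.injective (by rw [h1, FT.apply_symm_apply, FT.apply_symm_apply])
  rw [fermiSea_apply, fermiSea_apply, ← h2, h1]
  congr 1
  change (charge ∘L fermiM μL μR) (FT f) = (fermiM μL μR ∘L charge) (FT f)
  congr 1
  rw [charge, fermiM, mulOp_comp (BddSym.const _) (bddSym_fermiSymbol μL μR),
    mulOp_comp (bddSym_fermiSymbol μL μR) (BddSym.const _)]
  congr 1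
  funext ξ
  ext j k
  fin_cases j <;> fin_cases k <;> simp [chargeMat, fermiSymbol, Matrix.mul_apply]

section

variable {μL μR : ℝ} {ι : Type*} {b : HilbertBasis ι ℂ H} (hb : Adapted (fermiSea μL μR) b)

theorem exists_tame_charge (μL μR : ℝ) : ∃ c, 0 ≤ c ∧ ∀ {ι : Type*} {b : HilbertBasis ι ℂ H}
    (hb : Adapted (fermiSea μL μR) b), (fermi hb).Tame charge c := by
  refine ⟨‖charge‖, norm_nonneg _, @fun ι b hb => ⟨le_rfl, ?_⟩⟩
  have : (fermi hb).hsSq charge = 0 := ENNReal.tsum_eq_zero.2 fun i => by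
    change ‖charge (fermiSea μL μR (b i)) - fermiSea μL μR (charge (b i))‖ₑ ^ 2 = 0
    rw [charge_fermiSea, sub_self]; simp
  rw [this]
  exact zero_le

theorem schwinger_charge_add_left (A B : H →L[ℂ] H) :
    (fermi hb).schwinger (charge + A) B = (fermi hb).schwinger A B := by
  refine tsum_congr fun i => ?_
  congr 1
  rw [map_add, charge_adjoint]
  change charge (fermiSea μL μR (b i)) + A.adjoint (fermiSea μL μR (b i)) -
    fermiSea μL μR (charge (b i) + A.adjoint (b i)) = A.adjoint (fermiSea μL μR (b i)) -
    fermiSea μL μR (A.adjoint (b i))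
  rw [map_add, charge_fermiSea]
  abel

theorem schwinger_charge_add_right (A B : H →L[ℂ] H) :
    (fermi hb).schwinger A (charge + B) = (fermi hb).schwinger A B := by
  refine tsum_congr fun i => ?_
  have : (charge + B) (fermiSea μL μR (b i)) - fermiSea μL μR ((charge + B) (b i)) =
      B (fermiSea μL μR (b i)) - fermiSea μL μR (B (b i)) := by
    change charge (fermiSea μL μR (b i)) + B (fermiSea μL μR (b i)) -
      fermiSea μL μR (charge (b i) + B (b i)) = _
    rw [map_add, charge_fermiSea]
    abel
  simp only [fermi, this]

end

/-! ### Symbols of smeared currents -/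

theorem IsTest.sub {f g : ℝ → ℂ} (hf : IsTest f) (hg : IsTest g) : IsTest fun x => f x - g x :=
  ⟨hf.1.sub hg.1, hf.2.sub hg.2⟩

theorem notMem_tsupport_sub {f g : ℝ → ℂ} {x : ℝ} (hf : x ∉ tsupport f) (hg : x ∉ tsupport g) :
    x ∉ tsupport fun y => f y - g y := by
  rw [notMem_tsupport_iff_eventuallyEq] at hf hg ⊢
  filter_upwards [hf, hg] with y h1 h2
  simp [h1, h2]

/-- A test function vanishing near the scatterer. -/
def IsOffTest (f : ℝ → ℂ) : Prop := IsTest f ∧ 0 ∉ tsupport f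

theorem IsOffTest.sub {f g : ℝ → ℂ} (hf : IsOffTest f) (hg : IsOffTest g) :
    IsOffTest fun x => f x - g x := ⟨hf.1.sub hg.1, notMem_tsupport_sub hf.2 hg.2⟩

theorem IsOffTest.zero : IsOffTest fun _ => 0 :=
  ⟨⟨contDiff_const, HasCompactSupport.zero⟩, by simp [tsupport, Function.support]⟩

theorem IsOffTest.isSymbol {f : ℝ → ℂ} (hf : IsOffTest f) (L R : Mat) :
    IsSymbol fun x => f (-x) • pw L R x := fun j k => by
  have := hf.1.comp_neg.mul_step (zero_notMem_tsupport_comp_neg hf.2) (L j k) (R j k)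
  simp only [← pw_apply] at this
  exact this

theorem neg_inMat (S : Mat) (x : ℝ) :
    -inMat S x = pw (-chargeMat) (-(S * chargeMat * star S)) x := by
  rw [inMat, pw, pw]; split_ifs <;> rfl

theorem IsOffTest.isSymbol_model {u v : ℝ → ℂ} (hu : IsOffTest u) (hv : IsOffTest v) (S : Mat) :
    IsSymbol fun x => u (-x) • outMat S x - v (-x) • inMat S x := fun j k =>
  (hu.isSymbol _ _ j k).sub (hv.isSymbol _ _ j k)

/-- Second quantizability of smeared currents. -/
theorem exists_tame_pw (L R : Mat) (μL μR : ℝ) {δ : ℝ} (hδ : 0 < δ) (hδ1 : δ ≤ 1) :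
    ∃ C, 0 ≤ C ∧ ∀ {ι : Type*} {b : HilbertBasis ι ℂ H} (hb : Adapted (fermiSea μL μR) b)
      {f : ℝ → ℂ} (_ : IsOffTest f) {B ε : ℝ}, 0 < ε → ε ≤ 1 → C2Bound f B ε →
      (fermi hb).Tame (mulOp fun x => f (-x) • pw L R x) (C * B * ε ^ (-δ)) := by
  obtain ⟨C, hC0, hC⟩ := exists_tame_bound μL μR hδ hδ1
  obtain ⟨-, K, hK⟩ := BddSym.const L
  obtain ⟨-, K', hK'⟩ := BddSym.const R
  have h0 : 0 ≤ K := (norm_nonneg _).trans (hK 0 0 0)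
  refine ⟨C * max K K', mul_nonneg hC0 (h0.trans (le_max_left _ _)),
    @fun ι b hb f hf B ε hε hε1 h => ?_⟩
  have := hC hb (hf.isSymbol L R) (B := max K K' * B) hε hε1 fun j k => by
    have := C2Bound.mul_step hf.1.comp_neg (zero_notMem_tsupport_comp_neg hf.2) h.comp_neg
      ((hK 0 j k).trans (le_max_left K K')) ((hK' 0 j k).trans (le_max_right K K'))
    simp only [← pw_apply] at this
    exact this
  simpa only [← mul_assoc] using this

theorem currentOut_eq_pw (S : Mat) (f : ℝ → ℂ) : currentOut S f =
    mulOp fun x => f (-x) • pw (star S * chargeMat * S) chargeMat x := rfl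

theorem currentIn_eq_pw (S : Mat) (f : ℝ → ℂ) : currentIn S f =
    mulOp fun x => f (-x) • pw (-chargeMat) (-(S * chargeMat * star S)) x := by
  simp only [currentIn_eq, neg_inMat]

theorem deriv_model {w : ℝ → ℂ} (hw : IsOffTest w) (S : Mat) (j k : Fin 2) (x : ℝ) :
    deriv (fun x => (w (-x) • outMat S x - w (-x) • inMat S x) j k) x =
      -deriv w (-x) * (outMat S x - inMat S x) j k := by
  have e : ∀ x, (w (-x) • outMat S x - w (-x) • inMat S x) j k =
      w (-x) * step ((star S * chargeMat * S - chargeMat) j k)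
        ((chargeMat - S * chargeMat * star S) j k) x := fun x => by
    rw [← smul_sub, ← pw_apply, Matrix.smul_apply, smul_eq_mul]
    congr 2
    rw [outMat, inMat, pw, pw, pw]; split_ifs <;> rfl
  have h1 := hw.1.comp_neg
  simp only [e]
  rw [deriv_mul_step (h1.1.differentiable (by simp)) (zero_notMem_tsupport_comp_neg hw.2),
    deriv_comp_neg, ← pw_apply]
  congr 2
  rw [outMat, inMat, pw, pw, pw]; split_ifs <;> rfl

/-- Commuting regularized charges have no Schwinger term. -/
theorem schwinger_model_eq_zero {μL μR : ℝ} {ι : Type*} {b : HilbertBasis ι ℂ H}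
    (hb : Adapted (fermiSea μL μR) b) {S : Mat} (hS : S ∈ Matrix.unitaryGroup (Fin 2) ℂ)
    {u v w : ℝ → ℂ} (hu : IsOffTest u) (hv : IsOffTest v) (hw : IsOffTest w) (α : ℂ)
    (hc : ∀ x ≠ 0, Commute (α • chargeMat + (u (-x) • outMat S x - v (-x) • inMat S x))
      (modelMat S w w x)) (hi : ∫ y, deriv w y * (u y + v y) = 0) :
    (fermi hb).schwinger (mulOp fun x => u (-x) • outMat S x - v (-x) • inMat S x)
      (mulOp fun x => w (-x) • outMat S x - w (-x) • inMat S x) = 0 := by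
  refine schwinger_symbol_eq_zero (hu.isSymbol_model hv S) (hw.isSymbol_model hw S) hb ?_ ?_
  · have h0 : ∀ᵐ x : ℝ, x ≠ 0 := by simp [ae_iff]
    filter_upwards [h0] with x hx k
    have h1 := congrArg (fun M : Mat => M k k) (hc x hx).eq
    have h2 := chargeMat_comm_diag (u (-x) • outMat S x - v (-x) • inMat S x) k
    have h3 := chargeMat_comm_diag (w (-x) • outMat S x - w (-x) • inMat S x) k
    simp only [modelMat, add_mul, mul_add, Matrix.add_apply, smul_mul_assoc, mul_smul_comm,
      Matrix.smul_apply, smul_eq_mul] at h1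
    -- Only the diagonal of the commutator is needed; the terms with the charge matrix cancel there.
    -- Here α = 1 serves the mixed charge and α = 0 the increments.
    linear_combination h1 + h2 - α * h3
  · have e : ∀ x, ∑ j, ∑ k, (u (-x) • outMat S x - v (-x) • inMat S x) k j *
        deriv (fun x => (w (-x) • outMat S x - w (-x) • inMat S x) j k) x =
        -(1 - (star S * chargeMat * S * chargeMat).trace) *
          (deriv w (-x) * (u (-x) + v (-x))) := fun x => by
      have h1 := trace_model hS x (u (-x)) (v (-x))
      rw [Matrix.trace] at h1
      simp only [Matrix.diag_apply, Matrix.mul_apply] at h1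
      rw [Finset.sum_comm] at h1
      simp only [deriv_model hw]
      calc _ = -deriv w (-x) * ∑ j, ∑ k, (u (-x) • outMat S x - v (-x) • inMat S x) k j *
            (outMat S x - inMat S x) j k := by
            simp only [Finset.mul_sum]
            exact Finset.sum_congr rfl fun j _ => Finset.sum_congr rfl fun k _ => by ring
        _ = _ := by rw [h1]; ring
    simp only [e]
    rw [integral_const_mul, integral_neg_eq_self fun x => deriv w x * (u x + v x), hi, mul_zero]

/-! ### The charge at time `t` -/

theorem shift_ae (t : ℝ) (f : H) : (shift t f : ℝ → Lead) =ᵐ[volume] fun x => f (x - t) :=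
  Lp.coeFn_compMeasurePreserving f (measurePreserving_sub_right volume t)

theorem shift_adjoint_comp (t : ℝ) (A : H →L[ℂ] H) : (shift t).adjoint ∘L (shift t ∘L A) = A := by
  have h : (shift t).adjoint ∘L shift t = 1 :=
    (ContinuousLinearMap.norm_map_iff_adjoint_comp_self _).1 fun x =>
      (Lp.compMeasurePreservingₗᵢ ℂ (fun x : ℝ => x - t)
        (measurePreserving_sub_right volume t)).norm_map x
  rw [← ContinuousLinearMap.comp_assoc, h]
  rfl

theorem mulOp_comp_shift {m : ℝ → Mat} (hm : BddSym m) (t : ℝ) :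
    mulOp m ∘L shift t = shift t ∘L mulOp fun x => m (x + t) := by
  have hm' : BddSym fun x => m (x + t) := by
    obtain ⟨h1, C, h2⟩ := hm
    exact ⟨fun j k => (h1 j k).comp (measurable_add_const t), C, fun x => h2 _⟩
  refine ContinuousLinearMap.ext fun f => Lp.ext ?_
  have h1 := (measurePreserving_sub_right volume t).quasiMeasurePreserving.ae (hm'.ae f)
  filter_upwards [hm.ae (shift t f), shift_ae t f, shift_ae t (mulOp (fun x => m (x + t)) f), h1]
    with x h1 h2 h3 h4
  change (mulOp m (shift t f) : ℝ → Lead) x = _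
  change _ = (shift t (mulOp (fun x => m (x + t)) f) : ℝ → Lead) x
  rw [h1, h2, h3, h4, sub_add_cancel]

/-- The matrix of the propagator. -/
def propMat (S : Mat) (t x : ℝ) : Mat :=
  if 0 < x ∧ x < t then S else if t < x ∧ x < 0 then star S else 1

theorem bddSym_propMat (S : Mat) (t : ℝ) : BddSym (propMat S t) :=
  (BddSym.const S).piecewise measurableSet_Ioo
    ((BddSym.const (star S)).piecewise measurableSet_Ioo (BddSym.const 1))

theorem bddMeas_interval (t : ℝ) : BddMeas (interval t) := by
  refine ⟨(Measurable.ite measurableSet_Iio measurable_const measurable_const).sub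
    (Measurable.ite measurableSet_Iio measurable_const measurable_const), 2, fun s => ?_⟩
  rw [interval]
  split_ifs <;> norm_num

/-- Conjugation by the shift moves the propagator matrix from x to x + t. The identity is then
checked in four cases, according to the signs of x and x + t; the two exceptional points have
measure zero. -/
theorem chargeAt_eq (S : Mat) (t : ℝ) : chargeAt S t =
    charge + (currentOut S (interval t) + currentIn S (interval t)) := by
  have hp := bddSym_propMat S t
  have hq : BddSym fun x => star (propMat S t x) * (chargeMat * propMat S t x) :=
    hp.star.mul ((BddSym.const _).mul hp)
  have e : chargeAt S t =
      mulOp fun x => star (propMat S t (x + t)) * (chargeMat * propMat S t (x + t)) := by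
    rw [chargeAt, propagator, ContinuousLinearMap.adjoint_comp]
    change ((shift t).adjoint ∘L (mulOp (propMat S t)).adjoint) ∘L
      (mulOp fun _ => chargeMat) ∘L (mulOp (propMat S t) ∘L shift t) = _
    rw [mulOp_adjoint hp, ← ContinuousLinearMap.comp_assoc (mulOp fun _ => chargeMat),
      mulOp_comp (BddSym.const _) hp, ContinuousLinearMap.comp_assoc,
      ← ContinuousLinearMap.comp_assoc (mulOp fun x => star (propMat S t x)), mulOp_comp hp.star ((BddSym.const _).mul hp),
      mulOp_comp_shift hq, shift_adjoint_comp]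
  rw [e, ← add_assoc, charge_add_currents S (bddMeas_interval t) (bddMeas_interval t)]
  refine mulOp_congr ?_ (bddSym_model S (bddMeas_interval t) (bddMeas_interval t)) ?_
  · obtain ⟨h1, C, h2⟩ := hq
    exact ⟨fun j k => (h1 j k).comp (measurable_add_const t), C, fun x => h2 _⟩
  · have h0 : ∀ᵐ x : ℝ, x ≠ 0 := by simp [ae_iff]
    have h1 : ∀ᵐ x : ℝ, x ≠ -t := by simp [ae_iff]
    filter_upwards [h0, h1] with x hx hxt
    simp only [modelMat, propMat, outMat, inMat, pw, interval, lt_add_iff_pos_left, add_lt_iff_neg_right]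
    rcases hx.lt_or_gt with h | h <;> rcases hxt.lt_or_gt with h' | h'
    · rw [if_neg (by intro h2; linarith [h2.1]), if_neg (by intro h2; linarith [h2.1]),
        if_pos h, if_pos h, if_neg (by linarith), if_neg (by linarith)]
      simp
    · rw [if_pos ⟨by linarith, h⟩, if_pos h, if_pos h, if_pos (by linarith), if_neg (by linarith)]
      simp [mul_assoc]
    · rw [if_neg (by intro h2; linarith [h2.2]), if_pos ⟨h, by linarith⟩, if_neg h.not_gt,
        if_neg h.not_gt, if_neg (by linarith), if_pos (by linarith)]
      simp [mul_assoc]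
    · rw [if_neg (by intro h2; linarith [h2.2]), if_neg (by intro h2; linarith [h2.2]),
        if_neg h.not_gt, if_neg h.not_gt, if_pos (by linarith), if_pos (by linarith)]
      simp

/-! ### Strong continuity and smearing of the sharp currents -/

theorem interval_eq (t y : ℝ) : interval t y = (if y < t then 1 else 0) - step 1 0 y := rfl

/-- Sharp time intervals. -/
def stepFamily_interval {ε : ℝ} (hε : 0 < ε) : StepFamily Set.univ ε interval where
  χ _ := 1
  g t y := if y < t then 1 else 0
  eq t y := by rw [interval_eq, one_mul]
  one _ _ := rfl
  early t y h := if_pos (by linarith)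
  late t y h := if_neg (by linarith)

theorem tendsto_of_enorm_sq {α : Type*} {l : Filter α} {E : Type*} [NormedAddCommGroup E]
    {f : α → E} {a : E} (h : Tendsto (fun x => ‖f x - a‖ₑ ^ 2) l (𝓝 0)) : Tendsto f l (𝓝 a) := by
  rw [tendsto_iff_norm_sub_tendsto_zero]
  have h1 := ((ENNReal.tendsto_toReal ENNReal.zero_ne_top).comp h).sqrt
  simpa [Function.comp_def, Real.sqrt_sq] using h1

/-- Dominated convergence: off the single point x = -t₀ the indicator is eventually constant in t.
This strong continuity is why the sharp charge needs no regularization. -/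
theorem continuous_mulOp_interval {N : ℝ → Mat} (hN : BddSym N) (v : H) :
    Continuous fun t => mulOp (fun x => interval t (-x) • N x) v := by
  refine continuous_iff_continuousAt.2 fun t₀ => tendsto_of_enorm_sq ?_
  have hb : ∀ t, BddSym fun x => interval t (-x) • N x := fun t => (bddMeas_interval t).bddSym hN
  have e : ∀ t, ‖mulOp (fun x => interval t (-x) • N x) v -
      mulOp (fun x => interval t₀ (-x) • N x) v‖ₑ ^ 2 = ∫⁻ x,
      ‖(interval t (-x) - interval t₀ (-x)) • (mulOp N v : ℝ → Lead) x‖ₑ ^ 2 := fun t => by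
    rw [enorm_H_sq]
    refine lintegral_congr_ae ?_
    filter_upwards [Lp.coeFn_sub (mulOp (fun x => interval t (-x) • N x) v)
      (mulOp (fun x => interval t₀ (-x) • N x) v), (hb t).ae v, (hb t₀).ae v, hN.ae v]
      with x h1 h2 h3 h4
    rw [h1, Pi.sub_apply, h2, h3, h4, matAct_smul, matAct_smul, smul_apply, smul_apply, sub_smul]
  simp only [e]
  have hm : ∀ t, AEMeasurable (fun x : ℝ => ‖(interval t (-x) - interval t₀ (-x)) •
      (mulOp N v : ℝ → Lead) x‖ₑ ^ 2) := fun t => by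
    have h1 : Measurable fun x : ℝ => interval t (-x) - interval t₀ (-x) :=
      ((bddMeas_interval t).1.comp measurable_neg).sub ((bddMeas_interval t₀).1.comp measurable_neg)
    exact (h1.aestronglyMeasurable.smul (Lp.aestronglyMeasurable (mulOp N v))).enorm.pow_const 2
  have h0 : ∫⁻ _ : ℝ, (0 : ℝ≥0∞) = 0 := lintegral_zero
  rw [← h0]
  refine tendsto_lintegral_filter_of_dominated_convergence'
    (fun x => 4 * ‖(mulOp N v : ℝ → Lead) x‖ₑ ^ 2) (Eventually.of_forall hm)
    (Eventually.of_forall fun t => Eventually.of_forall fun x => ?_) ?_ ?_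
  · rw [enorm_smul, mul_pow]
    gcongr
    have : ‖interval t (-x) - interval t₀ (-x)‖ₑ ≤ 2 := by
      rw [← ofReal_norm, ← ENNReal.ofReal_ofNat]
      refine ENNReal.ofReal_le_ofReal ?_
      simp only [interval_eq, sub_sub_sub_cancel_right]
      split_ifs <;> norm_num
    calc _ ≤ (2 : ℝ≥0∞) ^ 2 := by gcongr
      _ = 4 := by norm_num
  · rw [lintegral_const_mul' _ _ (by norm_num), ← enorm_H_sq]
    exact ENNReal.mul_ne_top (by norm_num) (by simp)
  · have h1 : ∀ᵐ x : ℝ, x ≠ -t₀ := by simp [ae_iff]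
    filter_upwards [h1] with x hx
    refine tendsto_const_nhds.congr' ?_
    have h2 : ∀ᶠ t in 𝓝 t₀, interval t (-x) = interval t₀ (-x) := by
      rcases hx.lt_or_gt with h | h
      · filter_upwards [Iio_mem_nhds (show t₀ < -x by linarith)] with t ht
        have ht : t < -x := ht
        rw [interval, interval, if_neg (by linarith), if_neg (c := -x < t₀) (by linarith)]
      · filter_upwards [Ioi_mem_nhds (show -x < t₀ by linarith)] with t ht
        have ht : -x < t := ht
        rw [interval, interval, if_pos ht, if_pos (c := -x < t₀) (by linarith)]
    filter_upwards [h2] with t ht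
    rw [ht, sub_self, zero_smul]
    simp

theorem integral_deriv_mul_interval {φ : ℝ → ℂ} (hφ : IsTest φ) (s : ℝ) :
    ∫ t, -deriv φ t * interval t s = φ s := by
  have h1 : ∫ t, deriv φ t = 0 := integral_eq_zero_of_hasDerivAt_of_integrable
    (fun t => (hφ.1.differentiable (by simp) t).hasDerivAt) hφ.deriv.integrable hφ.integrable
  have h2 : ∫ t, (Set.Ioi s).indicator (deriv φ) t = -φ s := by
    rw [integral_indicator measurableSet_Ioi]
    exact hφ.2.integral_Ioi_deriv_eq (hφ.1.of_le (by simp)) s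
  have e : ∀ t, -deriv φ t * interval t s =
      step 1 0 s * deriv φ t - (Set.Ioi s).indicator (deriv φ) t := fun t => by
    rw [interval_eq, Set.indicator_apply]
    simp only [Set.mem_Ioi]
    split_ifs <;> ring
  simp only [e]
  rw [integral_sub (hφ.deriv.integrable.const_mul _)
    (hφ.deriv.integrable.indicator measurableSet_Ioi), integral_const_mul, h1, h2]
  ring

theorem measurable_interval : Measurable fun z : ℝ × ℝ => interval z.1 z.2 :=
  (Measurable.ite (measurableSet_lt measurable_snd measurable_fst) measurable_const
    measurable_const).sub (Measurable.ite (measurableSet_lt measurable_snd measurable_const)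
    measurable_const measurable_const)

theorem integral_deriv_smul_mulOp_interval {N : ℝ → Mat} (hN : BddSym N) {φ : ℝ → ℂ}
    (hφ : IsTest φ) (v : H) :
    ∫ t, (-deriv φ t) • mulOp (fun x => interval t (-x) • N x) v =
      mulOp (fun x => φ (-x) • N x) v := by
  have hi : Integrable fun t => (-deriv φ t) • mulOp (fun x => interval t (-x) • N x) v :=
    (hφ.deriv.1.continuous.neg.smul (continuous_mulOp_interval hN v)).integrable_of_hasCompactSupport
      hφ.deriv.2.neg.smul_right
  refine ext_inner_left ℂ fun w => ?_
  rw [← integral_inner hi]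
  simp only [inner_smul_right]
  exact (integral_inner_mulOp hN hφ.deriv.integrable.neg measurable_interval (C := 2)
    (fun t x => by rw [interval]; split_ifs <;> norm_num) hφ.bddMeas
    (integral_deriv_mul_interval hφ) w v).2

/-! ### First quantization -/

section Top

variable (E : Type*) [NormedAddCommGroup E] [NormedSpace ℂ E]

/-- The trivial filtration. -/
def topFilt : Filtered E where
  space _ := ⊤
  proj _ := ContinuousLinearMap.id ℂ E
  mono _ _ _ := le_rfl
  proj_mem _ _ := trivial
  proj_eq _ _ _ := rfl

variable {E}

theorem mem_topFilt_union (v : E) : v ∈ (topFilt E).union :=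
  Filtered.space_le_union 0 (show v ∈ (topFilt E).space 0 from trivial)

/-- A bounded operator on the whole space. -/
def topOp (A : E →L[ℂ] E) : (topFilt E).Op :=
  (A.toLinearMap ∘ₗ (topFilt E).union.subtype).codRestrict _ fun _ => mem_topFilt_union _

theorem topOp_coe (A : E →L[ℂ] E) (v : (topFilt E).union) : (topOp A v : E) = A v := rfl

theorem topOp_commute {A B : E →L[ℂ] E} (h : Commute A B) : Commute (topOp A) (topOp B) :=
  LinearMap.ext fun v => Subtype.ext (congrArg (fun T : E →L[ℂ] E => T v) h.eq)

theorem opBound_topOp {A : E →L[ℂ] E} {C : ℝ} (h : ‖A‖ ≤ C) (N M : ℕ) :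
    Filtered.OpBound (topOp A) N M C := fun v _ =>
  ⟨trivial, (A.le_opNorm (v : E)).trans (mul_le_mul_of_nonneg_right h (norm_nonneg _))⟩

end Top

theorem exists_norm_mulOp_interval_le {N : ℝ → Mat} (hN : BddSym N) :
    ∃ C, ∀ t, ‖mulOp fun x => interval t (-x) • N x‖ ≤ C := by
  obtain ⟨-, K, hK⟩ := id hN
  have h0 : 0 ≤ K := (norm_nonneg _).trans (hK 0 0 0)
  refine ⟨4 * (2 * K), fun t => norm_mulOp_le ((bddMeas_interval t).bddSym hN) (by positivity)
    fun x j k => ?_⟩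
  rw [Matrix.smul_apply, norm_smul]
  gcongr
  · rw [interval]; split_ifs <;> norm_num
  · exact hK x j k

/-- The first quantized charge, which needs no regularization. -/
def sharpCharge (S : Mat) : RegularizedCharge (topFilt H) Set.univ where
  rest := topOp charge
  -- The scale ε is ignored, so the limit theorem is applied to a constant family and yields an
  -- identity.
  out _ t := topOp (currentOut S (interval t))
  inc _ t := topOp (currentIn S (interval t))
  continuous_out _ _ v := continuous_mulOp_interval (bddSym_outMat S) v
  continuous_inc _ _ v := by
    simp only [topOp_coe, currentIn_eq]
    exact continuous_mulOp_interval (bddSym_inMat S).neg v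
  bound N δ hδ := by
    obtain ⟨C, hC⟩ := exists_norm_mulOp_interval_le (bddSym_outMat S)
    obtain ⟨C', hC'⟩ := exists_norm_mulOp_interval_le (bddSym_inMat S).neg
    have h0 : 0 ≤ C := (norm_nonneg _).trans (hC 0)
    have h0' : 0 ≤ C' := (norm_nonneg _).trans (hC' 0)
    refine ⟨‖charge‖ + C + C', fun ε hε t => ?_⟩
    have hn := norm_nonneg charge
    have h1 := RegularizedCharge.one_le_rpow_min hε hδ
    have h2 : ‖charge‖ + C + C' ≤ (‖charge‖ + C + C') * (min ε 1) ^ (-δ) :=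
      le_mul_of_one_le_right (by positivity) h1
    refine ⟨opBound_topOp (by linarith) _ _, opBound_topOp ?_ _ _, opBound_topOp ?_ _ _⟩
    · exact (hC t).trans (by linarith)
    · rw [currentIn_eq]
      exact (hC' t).trans (by linarith)
  commute_out ε hε p q s hpq hU hs := topOp_commute
    ((stepFamily_interval hε).commute_currentOut S bddMeas_interval hpq hU hs)
  commute_inc ε hε p q s hpq hU hs := topOp_commute
    ((stepFamily_interval hε).commute_currentIn S bddMeas_interval hpq hU hs)
  commute_mid ε hε p q s _ hU hs hs' := topOp_commute
    ((stepFamily_interval hε).commute_charge S bddMeas_interval hε hU hs hs')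

theorem isSmeared_topOp {φ : ℝ → ℂ} {Y : ℝ → H →L[ℂ] H} {J : H →L[ℂ] H}
    (h : ∀ v, ∫ t, (-deriv φ t) • Y t v = J v) :
    IsSmeared (F := topFilt H) (fun _ t => topOp (Y t)) φ (topOp J) := by
  refine ⟨fun _ => topOp J, fun ε _ w => h w, fun N => ⟨‖J‖, norm_nonneg _,
    opBound_topOp le_rfl _ _, fun ε hε _ v _ => ?_⟩⟩
  refine ⟨trivial, ?_⟩
  rw [sub_self]
  simp only [LinearMap.zero_apply, ZeroMemClass.coe_zero, norm_zero]
  positivity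

theorem prod_filter_perm {R : Type*} [Monoid R] {k : ℕ} (J : Fin k → R)
    (hJ : ∀ i j, Commute (J i) (J j)) (p : Fin k → Bool) (e e' : Equiv.Perm (Fin k)) :
    (((List.ofFn e).filter p).map J).prod = (((List.ofFn e').filter p).map J).prod := by
  have h : (List.ofFn e).Perm (List.ofFn e') :=
    (e.ofFn_comp_perm id).trans (e'.ofFn_comp_perm id).symm
  refine ((h.filter p).map J).prod_eq' ?_
  rw [List.pairwise_map]
  exact List.pairwise_of_forall fun i j => hJ i j

theorem mulOp_smul_commute {N : ℝ → Mat} (hN : BddSym N) {u v : ℝ → ℂ} (hu : BddMeas u)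
    (hv : BddMeas v) :
    Commute (mulOp fun x => u (-x) • N x) (mulOp fun x => v (-x) • N x) :=
  mulOp_commute (hu.bddSym hN) (hv.bddSym hN) fun _ _ =>
    ((Commute.refl _).smul_left _).smul_right _

/-- The limit theorem for the ε-independent sharp charge gives an equality. Smeared currents of the
same type commute, being scalar functions times one matrix function, so all orders agree and the
average is trivial. -/
theorem first_quantization (S : Mat) (k : ℕ) (φ : Fin k → ℝ → ℂ) (hφ : ∀ i, IsTest (φ i))
    (ψ : H) :
    Integrable (starIntegrand (fun s v => chargeAt S s v) φ ψ) ∧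
    ∀ e : Finset (Fin k) → Equiv.Perm (Fin k),
      starOrdered (fun s v => chargeAt S s v) φ ψ =
        ∑ A : Finset (Fin k),
          inOutTerm (fun i v => currentOut S (φ i) v) (fun i v => currentIn S (φ i) v)
            A (e A) ψ := by
  set X := (sharpCharge S).charge 1 with hX
  set v : (topFilt H).union := ⟨ψ, mem_topFilt_union ψ⟩ with hv
  have hXc : ∀ ε, (sharpCharge S).charge ε = X := fun ε => rfl
  have e1 : ∀ i, ∀ s ∈ tsupport (φ i), ∀ w : (topFilt H).union, chargeAt S s w = X s w :=
    fun i s _ w => by rw [chargeAt_eq, ← add_assoc]; rfl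
  have e2 := starIntegrand_eq (Y := fun s v => chargeAt S s v) e1 v
  have e2' : starIntegrand (fun s v => chargeAt S s v) φ ψ = _ := e2
  refine ⟨?_, fun e => ?_⟩
  · rw [e2']
    exact integrable_weight_smul hφ
      (((sharpCharge S).stronglyContinuous_charge one_pos).continuous_timeProd v)
  set Jp : Fin k → (topFilt H).Op := fun i => topOp (currentOut S (φ i)) with hJp
  set Jm : Fin k → (topFilt H).Op := fun i => topOp (currentIn S (φ i)) with hJm
  have hp : ∀ i j, Commute (Jp i) (Jp j) := fun i j => topOp_commute
    (mulOp_smul_commute (bddSym_outMat S) (hφ i).bddMeas (hφ j).bddMeas)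
  have hm : ∀ i j, Commute (Jm i) (Jm j) := fun i j => topOp_commute (by
    rw [currentIn_eq, currentIn_eq]
    exact mulOp_smul_commute (bddSym_inMat S).neg (hφ i).bddMeas (hφ j).bddMeas)
  have h1 := tendsto_starVec_sym (sharpCharge S) isOpen_univ φ
    (fun i => ⟨hφ i, Set.subset_univ _⟩) (Jp := Jp) (Jm := Jm) (fun i => ⟨
      isSmeared_topOp fun v => integral_deriv_smul_mulOp_interval (bddSym_outMat S) (hφ i) v,
      isSmeared_topOp fun v => by
        simp only [currentIn_eq]
        exact integral_deriv_smul_mulOp_interval (bddSym_inMat S).neg (hφ i) v⟩) v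
  simp only [hXc] at h1
  have h2 := tendsto_nhds_unique tendsto_const_nhds h1
  have h3 : ∀ (e' : Equiv.Perm (Fin k)) A, outProd Jp A (List.ofFn e') * inProd Jm A (List.ofFn e') =
      outProd Jp A (List.ofFn (e A)) * inProd Jm A (List.ofFn (e A)) := fun e' A => by
    rw [outProd, inProd, prod_filter_perm Jp hp _ e' (e A), prod_filter_perm Jm hm _ e' (e A)]
    rfl
  have h4 : ((k.factorial : ℂ)) ≠ 0 := by exact_mod_cast k.factorial_ne_zero
  have h5 : starOrdered (fun s v => chargeAt S s v) φ ψ = starVec X φ v := by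
    rw [starOrdered, e2']; rfl
  rw [h5, h2]
  simp only [h3]
  rw [Finset.sum_const, Finset.card_univ, Fintype.card_perm, Fintype.card_fin,
    ← Nat.cast_smul_eq_nsmul ℂ, inv_smul_smul₀ h4]
  exact Finset.sum_congr rfl fun A _ =>
    (inOutTerm_eq (Yp := fun i v => currentOut S (φ i) v) (Ym := fun i v => currentIn S (φ i) v)
      (Jp := Jp) (Jm := Jm) (fun _ _ => rfl) (fun _ _ => rfl) A (e A) v).symm

/-! ### Antiderivatives off the scatterer -/

/-- Integrate from 1 on the right half-line and from -1 on the left. Nothing is required at 0, where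
c may be singular. -/
theorem exists_antiderivative {c : ℝ → ℂ} (hc : ContinuousOn c {0}ᶜ) :
    ∃ F : ℝ → ℂ, ∀ t ≠ 0, HasDerivAt F (c t) t := by
  have key : ∀ {a t : ℝ}, 0 < a * t → HasDerivAt (fun u => ∫ x in a..u, c x) (c t) t :=
    fun {a t} h => by
      have ht : t ≠ 0 := fun h0 => by simp [h0] at h
      have hu : Set.uIcc a t ⊆ {0}ᶜ := fun x hx => by
        rintro rfl
        rcases Set.mem_uIcc.1 hx with h1 | h1 <;> nlinarith [h1.1, h1.2]
      have hcont : ContinuousAt c t := hc.continuousAt (isOpen_compl_singleton.mem_nhds ht)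
      refine intervalIntegral.integral_hasDerivAt_right
        (hc.mono hu).intervalIntegrable ?_ hcont
      exact ContinuousOn.stronglyMeasurableAtFilter isOpen_compl_singleton hc t ht
  refine ⟨fun t => if 0 < t then ∫ x in (1 : ℝ)..t, c x else ∫ x in (-1 : ℝ)..t, c x,
    fun t ht => ?_⟩
  rcases ht.lt_or_gt with h | h
  · refine (key (a := -1) (by linarith)).congr_of_eventuallyEq ?_
    filter_upwards [Iio_mem_nhds h] with u hu
    rw [if_neg (not_lt.2 (le_of_lt hu))]
  · refine (key (a := 1) (by linarith)).congr_of_eventuallyEq ?_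
    filter_upwards [Ioi_mem_nhds h] with u hu
    rw [if_pos (Set.mem_Ioi.1 hu)]

theorem IsOffTest.continuous_mul {f g : ℝ → ℂ} (hf : IsOffTest f) (hg : ContinuousOn g {0}ᶜ) :
    Continuous fun t => f t * g t := by
  refine continuous_iff_continuousAt.2 fun t => ?_
  by_cases ht : t = 0
  · subst ht
    have : (fun t => f t * g t) =ᶠ[𝓝 0] fun _ => 0 := by
      filter_upwards [notMem_tsupport_iff_eventuallyEq.1 hf.2] with y hy
      rw [hy, Pi.zero_apply, zero_mul]
    exact (continuousAt_congr this).2 continuousAt_const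
  · exact hf.1.1.continuous.continuousAt.mul (hg.continuousAt (isOpen_compl_singleton.mem_nhds ht))

theorem IsOffTest.deriv {f : ℝ → ℂ} (hf : IsOffTest f) : IsOffTest (deriv f) :=
  ⟨hf.1.deriv, fun h => hf.2 (tsupport_deriv_subset h)⟩

theorem IsOffTest.integrable_mul {f g : ℝ → ℂ} (hf : IsOffTest f) (hg : ContinuousOn g {0}ᶜ) :
    Integrable fun t => f t * g t :=
  (hf.continuous_mul hg).integrable_of_hasCompactSupport hf.1.2.mul_right

theorem IsOffTest.integral_deriv_mul {φ F c : ℝ → ℂ} (hφ : IsOffTest φ)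
    (hF : ∀ t ≠ 0, HasDerivAt F (c t) t) (hc : ContinuousOn c {0}ᶜ) :
    ∫ t, -_root_.deriv φ t * F t = ∫ t, φ t * c t := by
  have hFc : ContinuousOn F {0}ᶜ := fun t ht => (hF t ht).continuousAt.continuousWithinAt
  have h1 : ∀ t, HasDerivAt (fun t => φ t * F t) (_root_.deriv φ t * F t + φ t * c t) t := fun t => by
    by_cases ht : t = 0
    · subst ht
      have h0 := notMem_tsupport_iff_eventuallyEq.1 hφ.2
      rw [h0.deriv_eq, h0.eq_of_nhds]
      have : (fun t => φ t * F t) =ᶠ[𝓝 0] fun _ => 0 := by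
        filter_upwards [h0] with y hy
        rw [hy, Pi.zero_apply, zero_mul]
      refine ((hasDerivAt_const (0 : ℝ) (0 : ℂ)).congr_of_eventuallyEq this).congr_deriv ?_
      have hz : _root_.deriv (0 : ℝ → ℂ) 0 = 0 := by
        rw [show (0 : ℝ → ℂ) = fun _ => 0 from rfl, deriv_const]
      rw [hz]; simp
    · exact (hφ.1.1.differentiable (by simp) t).hasDerivAt.mul (hF t ht)
  have i1 := hφ.deriv.integrable_mul hFc
  have i2 := hφ.integrable_mul hc
  have h2 := integral_eq_zero_of_hasDerivAt_of_integrable h1 (i1.add i2)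
    (hφ.integrable_mul hFc)
  rw [integral_add i1 i2] at h2
  simp only [neg_mul]
  rw [integral_neg]
  linear_combination -h2

/-! ### Second quantized currents -/

/-- Smooth time intervals. -/
def stepFamily_smooth (χ : ℝ → ℝ) {G : ℝ → ℝ} (hG : IsSmoothStep G) {ε : ℝ} (hε : 0 < ε) :
    StepFamily (interior {s | χ s = 1}) ε (smoothInterval χ G ε) where
  χ s := χ s
  g t y := G ((t - y) / ε)
  eq t y := rfl
  one y hy := by
    have h : y ∈ {s | χ s = 1} := interior_subset hy
    rw [show χ y = 1 from h, Complex.ofReal_one]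
  early t y h := by rw [hG.2.2 _ (by rw [le_div_iff₀ hε]; linarith), Complex.ofReal_one]
  late t y h := by
    rw [hG.2.1 _ (by rw [div_le_iff₀ hε]; linarith), Complex.ofReal_zero]

section

variable {χ G : ℝ → ℝ} (hχ : IsTest χ) (h0 : 0 ∉ tsupport χ) (hG : IsSmoothStep G)
include hχ h0 hG

theorem isOffTest_smoothInterval (ε t : ℝ) : IsOffTest (smoothInterval χ G ε t) :=
  ⟨isTest_smoothInterval hχ h0 hG ε t, zero_notMem_tsupport_smoothInterval h0 ε t⟩

omit hχ hG in
theorem zero_notMem_interior : (0 : ℝ) ∉ interior {s | χ s = 1} := fun h => by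
  have h1 : (0 : ℝ) ∈ {s | χ s = 1} := interior_subset h
  replace h1 : χ 0 = 1 := h1
  rw [image_eq_zero_of_notMem_tsupport h0] at h1
  exact zero_ne_one h1

variable {μL μR : ℝ} {ι : Type*} [LinearOrder ι] {b : HilbertBasis ι ℂ H}
  (hb : Adapted (fermiSea μL μR) b)

omit [LinearOrder ι] in
omit hχ h0 hG in
theorem IsOffTest.exists_tame {f : ℝ → ℂ} (hf : IsOffTest f) (L R : Mat) :
    ∃ c, (fermi hb).Tame (mulOp fun x => f (-x) • pw L R x) c :=
  (hf.isSymbol L R).exists_tame hb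

omit [LinearOrder ι] in
theorem exists_tame_smoothInterval (L R : Mat) {δ : ℝ} (hδ : 0 < δ) : ∃ C, 0 ≤ C ∧
    ∀ ε > (0 : ℝ), ∀ t, (fermi hb).Tame
      (mulOp fun x => smoothInterval χ G ε t (-x) • pw L R x) (C * (min ε 1) ^ (-δ)) := by
  obtain ⟨C, hC0, hC⟩ := exists_tame_pw L R μL μR (δ := min δ 1) (by positivity) (min_le_right _ _)
  obtain ⟨B, hB0, hB⟩ := exists_c2Bound_smoothInterval hχ h0 hG
  refine ⟨C * B, by positivity, fun ε hε t => ?_⟩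
  refine (hC hb (isOffTest_smoothInterval hχ h0 hG ε t) (by positivity) (min_le_right _ _)
    (hB ε hε t)).mono ?_
  gcongr C * B * ?_
  exact Real.rpow_le_rpow_of_exponent_ge (by positivity) (min_le_right _ _)
    (neg_le_neg (min_le_left _ _))

omit hχ h0 hG in
theorem hatOp_sub {s : Sea ι} {A B : H →L[ℂ] H} {c c' : ℝ} (hA : s.Tame A c) (hB : s.Tame B c') :
    s.hatOp (A - B) = s.hatOp A - s.hatOp B := by
  have h := hA.add (hB.smul (-1))
  rw [neg_one_smul, ← sub_eq_add_neg] at h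
  rw [eq_sub_iff_add_eq, ← Sea.hatOp_add h hB, sub_add_cancel]

omit hχ h0 hG in
theorem hatOp_pw_sub {u v : ℝ → ℂ} (hu : IsOffTest u) (hv : IsOffTest v) (L R : Mat) :
    (fermi hb).hatOp (mulOp fun x => (u (-x) - v (-x)) • pw L R x) =
      (fermi hb).hatOp (mulOp fun x => u (-x) • pw L R x) -
        (fermi hb).hatOp (mulOp fun x => v (-x) • pw L R x) := by
  obtain ⟨c, hc⟩ := hu.exists_tame hb L R
  obtain ⟨c', hc'⟩ := hv.exists_tame hb L R
  rw [← hatOp_sub hc hc', mulOp_smul_sub (BddSym.pw L R) hu.1.bddMeas hv.1.bddMeas]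

/-- At fixed ε the symbol is Lipschitz in t in the norms of `C2Bound`, and second quantization is
bounded on levels by these norms. -/
theorem continuous_hatOp_smoothInterval (L R : Mat) {ε : ℝ} (hε : 0 < ε)
    (v : (fockFilt ι).union) : Continuous fun t =>
      ((fermi hb).hatOp (mulOp fun x => smoothInterval χ G ε t (-x) • pw L R x) v : Fock ι) := by
  obtain ⟨C, hC0, hC⟩ := exists_tame_pw L R μL μR one_pos le_rfl
  obtain ⟨B, hB0, hB⟩ := exists_c2Bound_smoothInterval_sub hχ hG hε
  obtain ⟨N, hN⟩ := Filtered.exists_mem_space v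
  have hf := isOffTest_smoothInterval hχ h0 hG ε
  refine (LipschitzWith.of_dist_le_mul (K := Real.toNNReal (4 * (N + 2) * (C * B) * ‖(v : Fock ι)‖))
    fun t t' => ?_).continuous
  rw [Real.coe_toNNReal _ (by positivity), dist_eq_norm, Real.dist_eq]
  have h1 := ((hC hb ((hf t).sub (hf t')) one_pos le_rfl (hB t t')).opBound N v hN).2
  rw [hatOp_pw_sub hb (hf t) (hf t')] at h1
  refine le_trans (le_of_eq ?_) (h1.trans (le_of_eq ?_))
  · rfl
  · rw [Real.one_rpow]; ring

/-- Smearing the smoothed intervals gives the symbol χ times the mollified φ. As χ = 1 on the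
support of φ, it differs from φ by O(ε) in the norms of `C2Bound` at scale 1, hence so do the second
quantized operators on every level. -/
theorem exists_smeared_hatOp (L R : Mat) {φ : ℝ → ℂ} (hφ : IsOffTest φ)
    (hφχ : ∀ s ∈ tsupport φ, χ s = 1) :
    IsSmeared (fun ε t => (fermi hb).hatOp (mulOp fun x => smoothInterval χ G ε t (-x) • pw L R x))
      φ ((fermi hb).hatOp (mulOp fun x => φ (-x) • pw L R x)) := by
  have h0' := zero_notMem_tsupport_ofReal h0
  have hm : ∀ ε, IsOffTest fun s => (χ s : ℂ) * mollify G ε φ s := fun ε => by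
    refine ⟨hχ.ofReal.mul_left (contDiff_mollify hG hφ.1 ε), ?_⟩
    rw [notMem_tsupport_iff_eventuallyEq] at h0' ⊢
    filter_upwards [h0'] with s hs
    simp only [hs, Pi.zero_apply, zero_mul]
  have hχφ : ∀ s, (χ s : ℂ) * φ s = φ s := fun s => by
    by_cases hs : s ∈ tsupport φ
    · rw [hφχ s hs, Complex.ofReal_one, one_mul]
    · rw [image_eq_zero_of_notMem_tsupport hs, mul_zero]
  refine ⟨fun ε => (fermi hb).hatOp (mulOp fun x => ((χ (-x) : ℂ) * mollify G ε φ (-x)) • pw L R x),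
    fun ε hε w => ?_, fun N => ?_⟩
  · obtain ⟨C, -, hC⟩ := exists_tame_smoothInterval hχ h0 hG hb L R one_pos
    obtain ⟨B, -, hB⟩ := exists_c2Bound_smoothInterval hχ h0 hG
    obtain ⟨c', hc'⟩ := (hm ε).exists_tame hb L R
    have hmeas : Measurable fun z : ℝ × ℝ => smoothInterval χ G ε z.1 z.2 := by
      have h1 : Measurable fun z : ℝ × ℝ => (χ z.2 : ℂ) :=
        (hχ.ofReal.1.continuous.comp continuous_snd).measurable
      have h2 : Measurable fun z : ℝ × ℝ => (G ((z.1 - z.2) / ε) : ℂ) :=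
        (hG.contDiff_ofReal.continuous.comp
          ((continuous_fst.sub continuous_snd).div_const ε)).measurable
      exact h1.mul (h2.sub (Measurable.ite (measurableSet_lt measurable_snd measurable_const)
        measurable_const measurable_const))
    have key := fun i j => integral_inner_mulOp (BddSym.pw L R) hφ.1.deriv.integrable.neg hmeas
      (C := B) (fun t x => (hB ε hε t).sup x) (hm ε).1.bddMeas
      (integral_deriv_mul_smoothInterval hG hφ.1 hε) (b i) (b j)
    exact Sea.integral_hatOp (hC ε hε) hc' hφ.1.deriv.integrable.neg
      (continuous_hatOp_smoothInterval hχ h0 hG hb L R hε) (fun i j => (key i j).1)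
      (fun i j => (key i j).2) w
  · obtain ⟨C, hC0, hC⟩ := exists_tame_pw L R μL μR one_pos le_rfl
    obtain ⟨B, hB0, hB⟩ := exists_c2Bound_mollify_sub hG hχ hφ.1
    obtain ⟨c, hc⟩ := hφ.exists_tame hb L R
    have hc0 := hc.nonneg
    refine ⟨4 * (N + 2) * c + 4 * (N + 2) * (C * B), by positivity,
      (hc.opBound N).mono le_rfl (le_add_of_nonneg_right (by positivity)), fun ε hε hε1 => ?_⟩
    have h1 : C2Bound (fun s => (χ s : ℂ) * mollify G ε φ s - φ s) (B * ε) 1 := by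
      have := hB ε hε
      simp only [mul_sub, hχφ] at this
      exact this
    have h2 := (hC hb ((hm ε).sub hφ) one_pos le_rfl h1).opBound N
    rw [hatOp_pw_sub hb (hm ε) hφ] at h2
    refine h2.mono le_rfl ?_
    rw [Real.one_rpow, add_mul]
    have : 0 ≤ 4 * (N + 2) * c * ε := by positivity
    linarith

end

/-! ### Scalar shifts -/

section Shift

variable {E : Type*} [NormedAddCommGroup E] [NormedSpace ℂ E] {F : Filtered E}

theorem IsSmeared.add_smul_one [CompleteSpace E] {Y : ℝ → ℝ → F.Op} {φ : ℝ → ℂ} {J : F.Op}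
    (h : IsSmeared Y φ J) (hφ : IsTest φ) (hY : ∀ ε > (0 : ℝ), ∀ w : F.union,
      Continuous fun t => (Y ε t w : E)) {κ : ℝ → ℂ} (hκ : Continuous κ) {z : ℂ}
    (hz : ∫ t, -deriv φ t * κ t = z) :
    IsSmeared (fun ε t => Y ε t + κ t • 1) φ (J + z • 1) := by
  obtain ⟨Jε, h1, h2⟩ := h
  refine ⟨fun ε => Jε ε + z • 1, fun ε hε w => ?_, fun N => ?_⟩
  · have i1 : Integrable fun t => (-deriv φ t) • (Y ε t w : E) :=
      (hφ.deriv.1.continuous.neg.smul (hY ε hε w)).integrable_of_hasCompactSupport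
        hφ.deriv.2.neg.smul_right
    have i2 : Integrable fun t => -deriv φ t * κ t :=
      (hφ.deriv.1.continuous.neg.mul hκ).integrable_of_hasCompactSupport hφ.deriv.2.neg.mul_right
    have e : ∀ t, (-deriv φ t) • ((Y ε t + κ t • (1 : F.Op)) w : E) =
        (-deriv φ t) • (Y ε t w : E) + (-deriv φ t * κ t) • (w : E) := fun t => by
      simp [mul_smul]
    simp only [e]
    rw [integral_add i1 (i2.smul_const _), integral_smul_const, hz, h1 ε hε]
    simp
  · obtain ⟨C, hC, h3, h4⟩ := h2 N
    refine ⟨C + ‖z‖ * 1, by positivity,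
      h3.add (((Filtered.OpBound.one N).smul z).mono (by omega) le_rfl), fun ε hε hε1 => ?_⟩
    rw [add_sub_add_right_eq_sub]
    exact (h4 ε hε hε1).mono le_rfl (by gcongr; simp)

theorem commute_add_smul_one {a b : F.Op} (h : Commute a b) (z w : ℂ) :
    Commute (a + z • 1) (b + w • 1) :=
  (h.add_right ((Commute.one_right a).smul_right w)).add_left
    (((Commute.one_left b).smul_left z).add_right (((Commute.refl 1).smul_left z).smul_right w))

end Shift

/-! ### Commutation of second quantized charges -/

theorem currentOut_add_currentIn (S : Mat) {u v : ℝ → ℂ} (hu : BddMeas u) (hv : BddMeas v) :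
    currentOut S u + currentIn S v =
      mulOp fun x => u (-x) • outMat S x - v (-x) • inMat S x := by
  rw [currentOut_eq, currentIn_eq, ← mulOp_add (hu.bddSym (bddSym_outMat S))
    (hv.bddSym (bddSym_inMat S).neg)]
  simp only [smul_neg, sub_eq_add_neg]

theorem currentOut_sub_eq (S : Mat) {u v : ℝ → ℂ} (hu : BddMeas u) (hv : BddMeas v) :
    currentOut S u - currentOut S v =
      mulOp fun x => (u (-x) - v (-x)) • outMat S x - (0 : ℂ) • inMat S x := by
  simp only [currentOut_sub S hu hv, zero_smul, sub_zero]

theorem currentIn_sub_eq (S : Mat) {u v : ℝ → ℂ} (hu : BddMeas u) (hv : BddMeas v) :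
    currentIn S u - currentIn S v =
      mulOp fun x => (0 : ℂ) • outMat S x - (u (-x) - v (-x)) • inMat S x := by
  simp only [currentIn_sub S hu hv, zero_smul, zero_sub, smul_neg]

section

variable {μL μR : ℝ} {ι : Type*} {b : HilbertBasis ι ℂ H}
  (hb : Adapted (fermiSea μL μR) b)

theorem IsOffTest.exists_tame_currentOut {u : ℝ → ℂ} (hu : IsOffTest u) (S : Mat) :
    ∃ c, (fermi hb).Tame (currentOut S u) c := by
  rw [currentOut_eq_pw]; exact hu.exists_tame hb _ _

theorem IsOffTest.exists_tame_currentIn {u : ℝ → ℂ} (hu : IsOffTest u) (S : Mat) :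
    ∃ c, (fermi hb).Tame (currentIn S u) c := by
  rw [currentIn_eq_pw]; exact hu.exists_tame hb _ _

theorem exists_tame_charge_add {u v : ℝ → ℂ} (hu : IsOffTest u) (hv : IsOffTest v) (S : Mat) :
    ∃ c, (fermi hb).Tame (charge + currentOut S u + currentIn S v) c := by
  obtain ⟨c₀, -, h0⟩ := exists_tame_charge μL μR
  obtain ⟨c₁, h1⟩ := hu.exists_tame_currentOut hb S
  obtain ⟨c₂, h2⟩ := hv.exists_tame_currentIn hb S
  exact ⟨_, ((h0 hb).add h1).add h2⟩

variable [LinearOrder ι]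

theorem hatOp_charge_add {u v : ℝ → ℂ} (hu : IsOffTest u) (hv : IsOffTest v) (S : Mat) :
    (fermi hb).hatOp (charge + currentOut S u + currentIn S v) =
      (fermi hb).hatOp charge + (fermi hb).hatOp (currentOut S u) +
        (fermi hb).hatOp (currentIn S v) := by
  obtain ⟨c₀, -, h0⟩ := exists_tame_charge μL μR
  obtain ⟨c₁, h1⟩ := hu.exists_tame_currentOut hb S
  obtain ⟨c₂, h2⟩ := hv.exists_tame_currentIn hb S
  rw [Sea.hatOp_add ((h0 hb).add h1) h2, Sea.hatOp_add (h0 hb) h1]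

variable {S : Mat} (hS : S ∈ Matrix.unitaryGroup (Fin 2) ℂ) {U : Set ℝ} (h0 : 0 ∉ U) {ε : ℝ}
  {f : ℝ → ℝ → ℂ} (F : StepFamily U ε f) (hf : ∀ t, IsOffTest (f t))
include hS h0 F hf

/-- The one-particle operators commute pointwise. The Schwinger integral vanishes because the
interval at time s is locally constant where the increment lives. -/
theorem commute_hatOp_currentOut {p q s : ℝ} (hpq : p < q) (hU : Set.Icc (p - ε) (q + ε) ⊆ U)
    (hs : q + 2 * ε ≤ s) :
    Commute ((fermi hb).hatOp (currentOut S (f q)) - (fermi hb).hatOp (currentOut S (f p)))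
      ((fermi hb).hatOp charge + (fermi hb).hatOp (currentOut S (f s)) +
        (fermi hb).hatOp (currentIn S (f s))) := by
  have hm := fun t => (hf t).1.bddMeas
  obtain ⟨c, hc⟩ := (hf q).exists_tame_currentOut hb S
  obtain ⟨c', hc'⟩ := (hf p).exists_tame_currentOut hb S
  obtain ⟨d, hd⟩ := exists_tame_charge_add hb (hf s) (hf s) S
  obtain ⟨e, he⟩ := ((hf q).sub (hf p)).exists_tame_currentOut hb S
  rw [currentOut_eq, ← currentOut_sub S (hm q) (hm p)] at he
  rw [← hatOp_sub hc hc', ← hatOp_charge_add hb (hf s) (hf s)]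
  refine Sea.commute_hatOp he hd (F.commute_currentOut S hm hpq hU hs).eq ?_
  have key := schwinger_model_eq_zero hb hS ((hf q).sub (hf p)) IsOffTest.zero (hf s) 0
    (fun x hx => by
      rw [zero_smul, zero_add, zero_smul, sub_zero]
      exact F.commute_out hpq hU hs hx)
    (by simp only [add_zero, F.deriv_mul_sub_eq_zero_of_le h0 hpq hU hs, integral_zero])
  rw [add_assoc, schwinger_charge_add_right, currentOut_sub_eq S (hm q) (hm p),
    currentOut_add_currentIn S (hm s) (hm s)]
  exact key

theorem commute_hatOp_currentIn {p q s : ℝ} (hpq : p < q) (hU : Set.Icc (p - ε) (q + ε) ⊆ U)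
    (hs : s ≤ p - 2 * ε) :
    Commute ((fermi hb).hatOp (currentIn S (f q)) - (fermi hb).hatOp (currentIn S (f p)))
      ((fermi hb).hatOp charge + (fermi hb).hatOp (currentOut S (f s)) +
        (fermi hb).hatOp (currentIn S (f s))) := by
  have hm := fun t => (hf t).1.bddMeas
  obtain ⟨c, hc⟩ := (hf q).exists_tame_currentIn hb S
  obtain ⟨c', hc'⟩ := (hf p).exists_tame_currentIn hb S
  obtain ⟨d, hd⟩ := exists_tame_charge_add hb (hf s) (hf s) S
  obtain ⟨e, he⟩ := ((hf q).sub (hf p)).exists_tame_currentIn hb S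
  rw [currentIn_eq, ← currentIn_sub S (hm q) (hm p)] at he
  rw [← hatOp_sub hc hc', ← hatOp_charge_add hb (hf s) (hf s)]
  refine Sea.commute_hatOp he hd (F.commute_currentIn S hm hpq hU hs).eq ?_
  have key := schwinger_model_eq_zero hb hS IsOffTest.zero ((hf q).sub (hf p)) (hf s) 0
    (fun x hx => by
      rw [zero_smul, zero_add, zero_smul, zero_sub]
      exact (F.commute_inc hpq hU hs hx).neg_left)
    (by simp only [zero_add, F.deriv_mul_sub_eq_zero_of_ge h0 hpq hU hs, integral_zero])
  rw [add_assoc, schwinger_charge_add_right, currentIn_sub_eq S (hm q) (hm p),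
    currentOut_add_currentIn S (hm s) (hm s)]
  exact key

/-- The bare charge commutes with ρ and drops out of the Schwinger term. The rest is the integral of
a total derivative. -/
theorem commute_hatOp_charge (hε : 0 < ε) {p q s : ℝ} (hU : Set.Icc (p - ε) (q + ε) ⊆ U)
    (hs : p + 2 * ε ≤ s) (hs' : s ≤ q - 2 * ε) :
    Commute ((fermi hb).hatOp charge + (fermi hb).hatOp (currentOut S (f p)) +
        (fermi hb).hatOp (currentIn S (f q)))
      ((fermi hb).hatOp charge + (fermi hb).hatOp (currentOut S (f s)) +
        (fermi hb).hatOp (currentIn S (f s))) := by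
  have hm := fun t => (hf t).1.bddMeas
  obtain ⟨c, hc⟩ := exists_tame_charge_add hb (hf p) (hf q) S
  obtain ⟨d, hd⟩ := exists_tame_charge_add hb (hf s) (hf s) S
  rw [← hatOp_charge_add hb (hf p) (hf q), ← hatOp_charge_add hb (hf s) (hf s)]
  refine Sea.commute_hatOp hc hd (F.commute_charge S hm hε hU hs hs').eq ?_
  rw [add_assoc, add_assoc, schwinger_charge_add_left, schwinger_charge_add_right,
    currentOut_add_currentIn S (hm p) (hm q), currentOut_add_currentIn S (hm s) (hm s)]
  refine schwinger_model_eq_zero hb hS (hf p) (hf q) (hf s) 1 (fun x hx => ?_)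
    (F.integral_deriv_mul_add (fun t => (hf t).1) hε h0 hU hs hs')
  rw [one_smul]
  exact F.commute_mid hε hU hs hs' hx

end

/-! ### The second quantized regularized charge -/

section

variable {χ G : ℝ → ℝ} (hχ : IsTest χ) (h0 : 0 ∉ tsupport χ) (hG : IsSmoothStep G)
  {μL μR : ℝ} {ι : Type*} [LinearOrder ι] {b : HilbertBasis ι ℂ H}
  (hb : Adapted (fermiSea μL μR) b)
include hχ h0 hG

theorem exists_opBound_smoothInterval (L R : Mat) (N : ℕ) {δ : ℝ} (hδ : 0 < δ) {κ : ℝ → ℂ}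
    {K : ℝ} (hκ : ∀ t, ‖κ t‖ ≤ K) : ∃ C, 0 ≤ C ∧ ∀ ε > (0 : ℝ), ∀ t, Filtered.OpBound
      ((fermi hb).hatOp (mulOp fun x => smoothInterval χ G ε t (-x) • pw L R x) + κ t • 1)
      N (N + 2) (C * (min ε 1) ^ (-δ)) := by
  obtain ⟨C, hC0, hC⟩ := exists_tame_smoothInterval hχ h0 hG hb L R hδ
  have hK : 0 ≤ K := (norm_nonneg _).trans (hκ 0)
  refine ⟨4 * (N + 2) * C + K, by positivity, fun ε hε t => ?_⟩
  have h1 := RegularizedCharge.one_le_rpow_min hε hδ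
  refine (((hC ε hε t).opBound N).add
    (((Filtered.OpBound.one N).smul (κ t)).mono (by omega) le_rfl)).mono le_rfl ?_
  have h2 := mul_le_mul (hκ t) h1 zero_le_one hK
  nlinarith [hκ t]

end

theorem IsOffTest.ofReal {χ : ℝ → ℝ} (hχ : IsTest χ) (h0 : 0 ∉ tsupport χ) :
    IsOffTest fun s => (χ s : ℂ) := ⟨hχ.ofReal, zero_notMem_tsupport_ofReal h0⟩

theorem IsOffTest.exists_bound_mul {f g : ℝ → ℂ} (hf : IsOffTest f) (hg : ContinuousOn g {0}ᶜ) :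
    ∃ K, ∀ t, ‖f t * g t‖ ≤ K :=
  hf.1.2.mul_right.exists_bound_of_continuous (hf.continuous_mul hg)

section

variable {χ G : ℝ → ℝ} (hχ : IsTest χ) (h0 : 0 ∉ tsupport χ) (hG : IsSmoothStep G)
  {μL μR : ℝ} {ι : Type*} [LinearOrder ι] {b : HilbertBasis ι ℂ H}
  (hb : Adapted (fermiSea μL μR) b) {S : Mat} (hS : S ∈ Matrix.unitaryGroup (Fin 2) ℂ)
  {κ κ' : ℝ → ℂ} (hκ : ContinuousOn κ {0}ᶜ) (hκ' : ContinuousOn κ' {0}ᶜ)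

/-- The second quantized regularized charge, shifted by `χ (κ + κ')`. -/
def hatCharge : RegularizedCharge (fockFilt ι) (interior {s | χ s = 1}) where
  rest := (fermi hb).hatOp charge
  -- The factor χ makes the scalar continuous across t = 0, where κ may be singular. It is invisible
  -- to the test functions, on whose supports χ = 1.
  out ε t := (fermi hb).hatOp (currentOut S (smoothInterval χ G ε t)) + ((χ t : ℂ) * κ t) • 1
  inc ε t := (fermi hb).hatOp (currentIn S (smoothInterval χ G ε t)) + ((χ t : ℂ) * κ' t) • 1
  continuous_out ε hε v := by
    simp only [currentOut_eq_pw]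
    exact (continuous_hatOp_smoothInterval hχ h0 hG hb _ _ hε v).add
      (((IsOffTest.ofReal hχ h0).continuous_mul hκ).smul continuous_const)
  continuous_inc ε hε v := by
    simp only [currentIn_eq_pw]
    exact (continuous_hatOp_smoothInterval hχ h0 hG hb _ _ hε v).add
      (((IsOffTest.ofReal hχ h0).continuous_mul hκ').smul continuous_const)
  bound N δ hδ := by
    obtain ⟨K, hK⟩ := (IsOffTest.ofReal hχ h0).exists_bound_mul hκ
    obtain ⟨K', hK'⟩ := (IsOffTest.ofReal hχ h0).exists_bound_mul hκ'
    obtain ⟨c, hc0, hc⟩ := exists_tame_charge μL μR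
    obtain ⟨C, hC0, hC⟩ := exists_opBound_smoothInterval hχ h0 hG hb
      (star S * chargeMat * S) chargeMat N hδ hK
    obtain ⟨C', hC0', hC'⟩ := exists_opBound_smoothInterval hχ h0 hG hb
      (-chargeMat) (-(S * chargeMat * star S)) N hδ hK'
    refine ⟨4 * (N + 2) * c + C + C', fun ε hε t => ⟨((hc hb).opBound N).mono le_rfl ?_,
      (hC ε hε t).mono le_rfl ?_, ?_⟩⟩
    · refine le_trans ?_ (le_mul_of_one_le_right (by positivity)
        (RegularizedCharge.one_le_rpow_min hε hδ))
      linarith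
    · gcongr
      have : 0 ≤ 4 * (N + 2) * c := by positivity
      linarith
    · rw [currentIn_eq_pw]
      refine (hC' ε hε t).mono le_rfl ?_
      gcongr
      have : 0 ≤ 4 * (N + 2) * c := by positivity
      linarith
  commute_out ε hε p q s hpq hU hs := by
    have := commute_add_smul_one (commute_hatOp_currentOut hb hS (zero_notMem_interior h0)
      (stepFamily_smooth χ hG hε) (isOffTest_smoothInterval hχ h0 hG ε) hpq hU hs)
      ((χ q : ℂ) * κ q - (χ p : ℂ) * κ p) ((χ s : ℂ) * κ s + (χ s : ℂ) * κ' s)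
    -- The normalizing scalars are multiples of the identity and do not affect commutation.
    convert this using 1 <;> module
  commute_inc ε hε p q s hpq hU hs := by
    have := commute_add_smul_one (commute_hatOp_currentIn hb hS (zero_notMem_interior h0)
      (stepFamily_smooth χ hG hε) (isOffTest_smoothInterval hχ h0 hG ε) hpq hU hs)
      ((χ q : ℂ) * κ' q - (χ p : ℂ) * κ' p) ((χ s : ℂ) * κ s + (χ s : ℂ) * κ' s)
    convert this using 1 <;> module
  commute_mid ε hε p q s _ hU hs hs' := by
    have := commute_add_smul_one (commute_hatOp_charge hb hS (zero_notMem_interior h0)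
      (stepFamily_smooth χ hG hε) (isOffTest_smoothInterval hχ h0 hG ε) hε hU hs hs')
      ((χ p : ℂ) * κ p + (χ q : ℂ) * κ' q) ((χ s : ℂ) * κ s + (χ s : ℂ) * κ' s)
    convert this using 1 <;> module

include hχ h0 hG in
theorem exists_smeared_hatOp_add (L R : Mat) {φ c : ℝ → ℂ} (hφ : IsOffTest φ)
    (hφχ : ∀ s ∈ tsupport φ, χ s = 1) (hκc : ∀ t ≠ 0, HasDerivAt κ (c t) t)
    (hc : ContinuousOn c {0}ᶜ) :
    IsSmeared (fun ε t => (fermi hb).hatOp (mulOp fun x =>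
        smoothInterval χ G ε t (-x) • pw L R x) + ((χ t : ℂ) * κ t) • 1)
      φ ((fermi hb).hatOp (mulOp fun x => φ (-x) • pw L R x) + (∫ t, φ t * c t) • 1) := by
  have hκ : ContinuousOn κ {0}ᶜ := fun t ht => (hκc t ht).continuousAt.continuousWithinAt
  refine (exists_smeared_hatOp hχ h0 hG hb L R hφ hφχ).add_smul_one hφ.1
    (fun ε hε => continuous_hatOp_smoothInterval hχ h0 hG hb L R hε)
    ((IsOffTest.ofReal hχ h0).continuous_mul hκ) ?_
  rw [← hφ.integral_deriv_mul hκc hc]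
  refine integral_congr_ae (Eventually.of_forall fun t => ?_)
  by_cases ht : t ∈ tsupport φ
  · simp only [hφχ t ht, Complex.ofReal_one, one_mul]
  · simp only [deriv_eq_zero_of_notMem_tsupport ht, neg_zero, zero_mul]

include hb in
theorem hat_implementable {A : H →L[ℂ] H} (hA : Implementable (fermiSea μL μR) b A) {Ψ : Fock ι}
    (hΨ : FiniteExcitation Ψ) :
    (∀ Δ, Summable (hatTerm (fermiSea μL μR) b A Ψ Δ)) ∧
      Memℓp (hatCoeff (fermiSea μL μR) b A Ψ) 2 ∧
      FiniteExcitation (hat (fermiSea μL μR) b A Ψ) := by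
  have h := (fermi hb).implementable_iff.1 hA
  obtain ⟨N, hN⟩ := id hΨ
  exact ⟨fun Δ => (Sea.summable_hatTerm (s := fermi hb) h hN (sqSum_fock_ne_top Ψ) Δ),
    (fermi hb).memlp_hatCoeff h hΨ, N + 2, (fermi hb).hat_mem_space h hN⟩

omit [LinearOrder ι] in
include hb in
theorem implementable_of_tame {A : H →L[ℂ] H} (h : ∃ c, (fermi hb).Tame A c) :
    Implementable (fermiSea μL μR) b A :=
  (fermi hb).implementable_iff.2 h.choose_spec.ne_top

omit [LinearOrder ι] in
include hχ h0 hG in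
theorem exists_tame_regCharge (S : Mat) (ε t : ℝ) :
    ∃ c, (fermi hb).Tame (regCharge S χ G ε t) c := by
  rw [regCharge, ← add_assoc]
  exact exists_tame_charge_add hb (isOffTest_smoothInterval hχ h0 hG ε t)
    (isOffTest_smoothInterval hχ h0 hG ε t) S

theorem hatCharge_charge {ε t : ℝ} (ht : χ t = 1) (w : (fockFilt ι).union) :
    hat (fermiSea μL μR) b (regCharge S χ G ε t) w + (κ t + κ' t) • (w : Fock ι) =
      ((hatCharge hχ h0 hG hb hS hκ hκ').charge ε t w : Fock ι) := by
  have hf := isOffTest_smoothInterval hχ h0 hG ε t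
  obtain ⟨c, hc⟩ := exists_tame_regCharge hχ h0 hG hb S ε t
  have h1 := Sea.hatOp_coe hc.ne_top w
  have h2 := hatOp_charge_add hb hf hf S
  rw [regCharge, ← add_assoc, h2] at h1
  change hat (fermi hb).ρ (fermi hb).b _ _ + _ = _
  rw [regCharge, ← add_assoc, ← h1]
  simp only [RegularizedCharge.charge, hatCharge, ht, Complex.ofReal_one, one_mul,
    LinearMap.add_apply, LinearMap.smul_apply, Submodule.coe_add, Submodule.coe_smul,
    Module.End.one_apply]
  module

end

/-! ### Second quantization of the current correlators -/

/-- On the supports of the test functions the normalized charge coincides with `hatCharge`, so the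
abstract limit theorem applies. Its smeared parts are the currents with the prescribed scalar
normalization. -/
theorem second_quantization {χ G : ℝ → ℝ} (hχ : IsTest χ) (h0 : 0 ∉ tsupport χ)
    (hG : IsSmoothStep G) {μL μR : ℝ} {ι : Type*} [LinearOrder ι] {b : HilbertBasis ι ℂ H}
    (hb : Adapted (fermiSea μL μR) b) {S : Mat} (hS : S ∈ Matrix.unitaryGroup (Fin 2) ℂ)
    {k : ℕ} (φ : Fin k → ℝ → ℂ) (hφ : ∀ i, IsOffTest (φ i))
    (hφχ : ∀ i, tsupport (φ i) ⊆ interior {s | χ s = 1}) {cOut cIn C : ℝ → ℂ}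
    (hcOut : ContinuousOn cOut {0}ᶜ) (hcIn : ContinuousOn cIn {0}ᶜ)
    (hC : ∀ t ≠ 0, HasDerivAt C (cOut t + cIn t) t) {Ψ : Fock ι} (hΨ : FiniteExcitation Ψ) :
    (∀ ε > 0, Integrable (starIntegrand
      (fun s v => hat (fermiSea μL μR) b (regCharge S χ G ε s) v + C s • v) φ Ψ)) ∧
    Tendsto
      (fun ε : ℝ => starOrdered
        (fun s v => hat (fermiSea μL μR) b (regCharge S χ G ε s) v + C s • v) φ Ψ)
      (𝓝[>] 0)
      (𝓝 ((k.factorial : ℂ)⁻¹ • ∑ e : Equiv.Perm (Fin k), ∑ A : Finset (Fin k),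
        inOutTerm
          (fun i v => hat (fermiSea μL μR) b (currentOut S (φ i)) v
            + (∫ t, φ i t * cOut t) • v)
          (fun i v => hat (fermiSea μL μR) b (currentIn S (φ i)) v
            + (∫ t, φ i t * cIn t) • v)
          A e Ψ)) := by
  obtain ⟨κ, hκ⟩ := exists_antiderivative hcOut
  -- The scalar C is split into an outgoing and an incoming antiderivative. Defining the second as a
  -- remainder makes them add up to C exactly, whatever integration constants occur on the two
  -- half-lines.
  set κ' : ℝ → ℂ := fun t => C t - κ t with hκ'_def
  have hκ' : ∀ t ≠ 0, HasDerivAt κ' (cIn t) t := fun t ht =>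
    ((hC t ht).sub (hκ t ht)).congr_deriv (by ring)
  have hκc : ContinuousOn κ {0}ᶜ := fun t ht => (hκ t ht).continuousAt.continuousWithinAt
  have hκc' : ContinuousOn κ' {0}ᶜ := fun t ht => (hκ' t ht).continuousAt.continuousWithinAt
  have hone : ∀ i, ∀ s ∈ tsupport (φ i), χ s = 1 := fun i s hs => by
    have h : s ∈ {s | χ s = 1} := interior_subset (hφχ i hs)
    exact h
  set Q := hatCharge hχ h0 hG hb hS hκc hκc'
  set v : (fockFilt ι).union := ⟨Ψ, finiteExcitation_iff.1 hΨ⟩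
  have e1 : ∀ ε, ∀ i, ∀ s ∈ tsupport (φ i), ∀ w : (fockFilt ι).union,
      hat (fermiSea μL μR) b (regCharge S χ G ε s) w + C s • (w : Fock ι) = Q.charge ε s w :=
    fun ε i s hs w => by
      rw [← hatCharge_charge hχ h0 hG hb hS hκc hκc' (hone i s hs) w, hκ'_def, add_sub_cancel]
  have e2 : ∀ ε, starIntegrand
      (fun s v => hat (fermiSea μL μR) b (regCharge S χ G ε s) v + C s • v) φ Ψ = _ :=
    fun ε => starIntegrand_eq (e1 ε) v
  refine ⟨fun ε hε => ?_, ?_⟩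
  · rw [e2]
    exact integrable_weight_smul (fun i => (hφ i).1)
      ((Q.stronglyContinuous_charge hε).continuous_timeProd v)
  set Jp : Fin k → (fockFilt ι).Op := fun i =>
    (fermi hb).hatOp (currentOut S (φ i)) + (∫ t, φ i t * cOut t) • 1
  set Jm : Fin k → (fockFilt ι).Op := fun i =>
    (fermi hb).hatOp (currentIn S (φ i)) + (∫ t, φ i t * cIn t) • 1
  have hJp : ∀ i, ∀ w : (fockFilt ι).union, hat (fermiSea μL μR) b (currentOut S (φ i)) w +
      (∫ t, φ i t * cOut t) • (w : Fock ι) = Jp i w := fun i w => by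
    obtain ⟨c, hc⟩ := IsOffTest.exists_tame_currentOut hb (hφ i) S
    exact congrArg (· + _) (Sea.hatOp_coe hc.ne_top w).symm
  have hJm : ∀ i, ∀ w : (fockFilt ι).union, hat (fermiSea μL μR) b (currentIn S (φ i)) w +
      (∫ t, φ i t * cIn t) • (w : Fock ι) = Jm i w := fun i w => by
    obtain ⟨c, hc⟩ := IsOffTest.exists_tame_currentIn hb (hφ i) S
    exact congrArg (· + _) (Sea.hatOp_coe hc.ne_top w).symm
  have h1 := tendsto_starVec_sym Q isOpen_interior φ (fun i => ⟨(hφ i).1, hφχ i⟩)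
    (Jp := Jp) (Jm := Jm) (fun i => ⟨
      exists_smeared_hatOp_add hχ h0 hG hb _ _ (hφ i) (hone i) hκ hcOut, by
      have := exists_smeared_hatOp_add hχ h0 hG hb (-chargeMat) (-(S * chargeMat * star S))
        (hφ i) (hone i) hκ' hcIn
      simp only [← currentIn_eq_pw] at this
      exact this⟩) v
  have h2 : ∀ ε, starOrdered
      (fun s v => hat (fermiSea μL μR) b (regCharge S χ G ε s) v + C s • v) φ Ψ =
        starVec (Q.charge ε) φ v := fun ε => by rw [starOrdered, e2]; rfl
  simp only [h2]
  convert h1 using 6 with e _ A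
  exact inOutTerm_eq hJp hJm A e v

end ScatteringModel

end

open ScatteringModel in
theorem mainTheorem4
    (S : Mat) (hS : S ∈ Matrix.unitaryGroup (Fin 2) ℂ) :
    -- first quantization
    ((∀ t : ℝ, chargeAt S t = charge + (currentOut S (interval t) + currentIn S (interval t))) ∧
      ∀ (k : ℕ) (φ : Fin k → ℝ → ℂ), (∀ i, IsTest (φ i)) → ∀ ψ : H,
        Integrable (starIntegrand (fun s v => chargeAt S s v) φ ψ) ∧
        ∀ e : Finset (Fin k) → Equiv.Perm (Fin k),
          starOrdered (fun s v => chargeAt S s v) φ ψ =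
            ∑ A : Finset (Fin k),
              inOutTerm (fun i v => currentOut S (φ i) v) (fun i v => currentIn S (φ i) v)
                A (e A) ψ) ∧
    -- second quantization
    (∀ (μL μR : ℝ) (ι : Type*) [LinearOrder ι] (b : HilbertBasis ι ℂ H),
      Adapted (fermiSea μL μR) b →
      -- operators satisfying the Hilbert-Schmidt criterion act on vectors of finite excitation
      (∀ A : H →L[ℂ] H, Implementable (fermiSea μL μR) b A →
        ∀ Ψ : Fock ι, FiniteExcitation Ψ →
          (∀ Δ, Summable (hatTerm (fermiSea μL μR) b A Ψ Δ)) ∧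
          Memℓp (hatCoeff (fermiSea μL μR) b A Ψ) 2 ∧
          FiniteExcitation (hat (fermiSea μL μR) b A Ψ)) ∧
      ∀ (k : ℕ) (φ : Fin k → ℝ → ℂ) (χ G : ℝ → ℝ) (cOut cIn C : ℝ → ℂ),
        (∀ i, IsTest (φ i) ∧ 0 ∉ tsupport (φ i)) →
        IsTest χ → 0 ∉ tsupport χ → (∀ i, tsupport (φ i) ⊆ interior {s | χ s = 1}) →
        IsSmoothStep G →
        ContinuousOn cOut {0}ᶜ → ContinuousOn cIn {0}ᶜ →
        (∀ t ≠ 0, HasDerivAt C (cOut t + cIn t) t) →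
        (∀ i, Implementable (fermiSea μL μR) b (currentOut S (φ i)) ∧
          Implementable (fermiSea μL μR) b (currentIn S (φ i))) ∧
        (∀ ε > 0, ∀ t, Implementable (fermiSea μL μR) b (regCharge S χ G ε t)) ∧
        ∀ Ψ : Fock ι, FiniteExcitation Ψ →
          (∀ ε > 0, Integrable (starIntegrand
            (fun s v => hat (fermiSea μL μR) b (regCharge S χ G ε s) v + C s • v) φ Ψ)) ∧
          Tendsto
            (fun ε : ℝ => starOrdered
              (fun s v => hat (fermiSea μL μR) b (regCharge S χ G ε s) v + C s • v) φ Ψ)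
            (𝓝[>] 0)
            (𝓝 ((k.factorial : ℂ)⁻¹ • ∑ e : Equiv.Perm (Fin k), ∑ A : Finset (Fin k),
              inOutTerm
                (fun i v => hat (fermiSea μL μR) b (currentOut S (φ i)) v
                  + (∫ t, φ i t * cOut t) • v)
                (fun i v => hat (fermiSea μL μR) b (currentIn S (φ i)) v
                  + (∫ t, φ i t * cIn t) • v)
                A e Ψ))) := by
  refine ⟨⟨chargeAt_eq S, first_quantization S⟩, fun μL μR ι _ b hb =>
    ⟨fun A hA Ψ hΨ => hat_implementable hb hA hΨ, ?_⟩⟩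
  intro k φ χ G cOut cIn C hφ hχ h0 hφχ hG hcOut hcIn hC
  exact ⟨fun i => ⟨implementable_of_tame hb (IsOffTest.exists_tame_currentOut hb (hφ i) S),
      implementable_of_tame hb (IsOffTest.exists_tame_currentIn hb (hφ i) S)⟩,
    fun ε _ t => implementable_of_tame hb (exists_tame_regCharge hχ h0 hG hb S ε t),
    fun Ψ hΨ => second_quantization hχ h0 hG hb hS φ hφ hφχ hcOut hcIn hC hΨ⟩
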